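/- Let $p$ be an odd prime, $F$ a $p$-adic field (a nonarchimedean local field of characteristic $0$ with residue characteristic $p$) with ring of integers $\mathcal O$, residue field $\mathfrak k$ of order $q=p^f$, normalized valuation $v$ and a fixed uniformizer $\varpi$. Let $E$ be an algebraically closed field of characteristic $p$ with a fixed embedding $\mathfrak k\hookrightarrow E$. Let $(a,b)\in\mu_2=\{\pm1\}$ be the quadratic Hilbert symbol of $F$, that is, the quadratic residue symbol of the reduction of $(-1)^{v(a)v(b)}b^{v(a)}a^{-v(b)}$. For a matrix $g$ with lower row $(c,d)$ put $X(g)=c$ if $c\ne0$ and $X(g)=d$ otherwise. Let $\widetilde{GL}_2(F)=GL_2(F)\times\mu_2$ with multiplication $(g,\zeta)(g',\zeta')=(gg',\zeta\zeta'\Delta(g,g'))$, where $$\Delta(g,g')=\Big(\tfrac{X(gg')}{X(g)},\tfrac{X(gg')}{X(g')}\Big)\Big(\det g,\tfrac{X(gg')}{X(g)}\Big),$$ and let $\widetilde G$ be the preimage of $SL_2(F)$, the metaplectic cover of $SL_2(F)$. It is a topological group in which $g\mapsto(g,1)$ is a homeomorphism from a small open subgroup of $SL_2(F)$ onto an open subgroup.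 A representation $\rho$ of $\widetilde G$ over $E$ is smooth if the stabilizer of every vector is open, genuine if $\rho(g,\zeta)=\zeta\rho(g,1)$, and a smooth representation is admissible if the invariants of every open subgroup are finite-dimensional. Smooth and genuine representations of the preimage $\widetilde T$ of the diagonal torus are defined in the same way. Let $\widetilde K$ be the preimage of $K=SL_2(\mathcal O)$, and let $\widetilde K'=\tilde\alpha\widetilde K\tilde\alpha^{-1}$, where $\tilde\alpha\in\widetilde{GL}_2(F)$ lifts $\mathrm{diag}(1,\varpi)$. For $k\in K$ with lower row $(c,d)$ let $\theta(k)=(c,d)$ if $c$ is a nonzero nonunit, and $\theta(k)=1$ otherwise; then $k\mapsto(k,\theta(k))$ is a homomorphism $K\to\widetilde K$. For $\vec r=(r_0,\dots,r_{f-1})\in\{0,\dots,p-1\}^f$ let $\sigma_{\vec r}=\bigotimes_{i=0}^{f-1}(\mathrm{Sym}^{r_i}E^2)^{\mathrm{Frob}^i}$ be the corresponding representation of $SL_2(\mathfrak k)$, on the space $V_{\vec r}$, and let $\tilde\sigma_{\vec r}(k,\zeta)=\zeta\,\theta(k)\,\sigma_{\vec r}(k\bmod\varpi)$ on $\widetilde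 K$. Let $\tilde h(\varpi)=(\mathrm{diag}(\varpi,\varpi^{-1}),(-1,\varpi))$. Let $\varphi:\widetilde G\to\mathrm{End}_E(V_{\vec r})$ be the function with $\varphi(k_1gk_2)=\tilde\sigma_{\vec r}(k_1)\varphi(g)\tilde\sigma_{\vec r}(k_2)$ for $k_1,k_2\in\widetilde K$, supported on $\widetilde K\tilde h(\varpi)^{-1}\widetilde K$, whose value at $\tilde h(\varpi)^{-1}$ is the projection of $V_{\vec r}$ onto its highest weight line along the other weight spaces, and let $\mathcal T$ be the endomorphism $(\mathcal Tf)(g)=\sum_{\widetilde Kx\in\widetilde K\backslash\widetilde G}\varphi(gx^{-1})f(x)$ of the compact induction $\mathrm{ind}_{\widetilde K}^{\widetilde G}\tilde\sigma_{\vec r}$. For $\lambda\in E$ put $\pi(\vec r,\lambda)=\mathrm{ind}_{\widetilde K}^{\widetilde G}\tilde\sigma_{\vec r}/(\mathcal T-\lambda)$, and let $\pi'(\vec r,\lambda)$ be the module obtained in the same way from $\widetilde K'$ and the conjugates of $\tilde\sigma_{\vec r}$ and $\varphi$ by $\tilde\alpha$. A pair $(\vec r,\lambda)$ is a parameter of $\rho$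 with respect to $\widetilde K$ (resp. $\widetilde K'$) if $\rho$ is isomorphic to a quotient of $\pi(\vec r,\lambda)$ (resp. $\pi'(\vec r,\lambda)$). It is supersingular if $\lambda=0$ and nonsupersingular if $\lambda\neq0$. For a smooth genuine representation $\tau$ of $\widetilde T$, let $\mathrm{Ind}(\tau)$ be the smooth (unnormalized) induction to $\widetilde G$ of the inflation of $\tau$ to the preimage $\widetilde{\overline B}=\widetilde T\,\overline U^*$ of the lower triangular Borel subgroup, where $\overline U^*$ is the group of the elements $(\bar u,1)$ with $\bar u$ lower unipotent. A genuine principal series representation is a representation isomorphic to $\mathrm{Ind}(\chi)$ for a smooth genuine character $\chi:\widetilde T\to E^\times$. A smooth genuine irreducible admissible representation of $\widetilde G$ is supercuspidal if it is not isomorphic to a subquotient of $\mathrm{Ind}(\tau)$ for any irreducible smooth genuine representation $\tau$ of $\widetilde T$. **Theorem.** Every smooth, genuine, irreducible, admissible $E$-representation of $\widetilde G$ has a parameter with respect to $\widetilde K$ and a parameter with respect to $\widetilde K'$, and it belongs to exactly one of the following two classes: 1. those all of whose parameters (with respect to $\widetilde K$ and with respect to $\widetilde K'$) are nonsupersingular;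 2. those all of whose parameters (with respect to $\widetilde K$ and with respect to $\widetilde K'$) are supersingular. The representations in the first class are exactly the genuine principal series representations of $\widetilde G$ (in particular, all of these are irreducible and admissible). Every representation in the second class is supercuspidal. -/

import Mathlib

set_option linter.unusedSectionVars false

open scoped ValuativeRel MatrixGroups Topology

noncomputable section

namespace Metaplectic

section Symbol

variable {F : Type*} [Field F] [ValuativeRel F] [TopologicalSpace F] [IsNonarchimedeanLocalField F]

/-- The normalized additive valuation of `F` (with junk value `0` at `0`). -/
def ord (x : F) : ℤ :=
  -WithZero.log (IsNonarchimedeanLocalField.valueGroupWithZeroIsoInt F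
    (ValuativeRel.valuation F x))

/-- Reduction to the residue field (with junk value `0` off the ring of integers). -/
def res (x : F) : 𝓀[F] :=
  open Classical in
  if h : ValuativeRel.valuation F x ≤ 1 then IsLocalRing.residue 𝒪[F] ⟨x, h⟩ else 0

/-- The tame unit `(-1)^{v(a)v(b)} b^{v(a)} / a^{v(b)}`. -/
def tameUnit (a b : F) : F :=
  (-1) ^ (ord a * ord b) * b ^ ord a * a ^ (-ord b)

/-- The (tame) quadratic Hilbert symbol of `F`, for residue characteristic different from `2`:
the quadratic residue symbol of the reduction of the tame unit.  It is used only for nonzero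
`a` and `b`. -/
def hilb (a b : F) : ℤˣ :=
  open Classical in
  if IsSquare (res (tameUnit a b)) then 1 else -1

lemma iso_val_ne {x : F} (hx : x ≠ 0) : IsNonarchimedeanLocalField.valueGroupWithZeroIsoInt F
    (ValuativeRel.valuation F x) ≠ 0 := by
  simpa using hx

lemma ord_mul {x y : F} (hx : x ≠ 0) (hy : y ≠ 0) : ord (x * y) = ord x + ord y := by
  unfold ord
  rw [map_mul, map_mul, WithZero.log_mul (iso_val_ne hx) (iso_val_ne hy)]
  ring

lemma ord_one : ord (1 : F) = 0 := by simp [ord]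

lemma ord_neg (x : F) : ord (-x) = ord x := by simp [ord, Valuation.map_neg]

lemma ord_inv (x : F) : ord x⁻¹ = -ord x := by
  simp [ord, map_inv₀]

lemma ord_zpow (x : F) (n : ℤ) : ord (x ^ n) = n * ord x := by
  simp [ord, map_zpow₀]

lemma val_le_val {x y : F} (hx : x ≠ 0) (hy : y ≠ 0) :
    ValuativeRel.valuation F x ≤ ValuativeRel.valuation F y ↔ ord y ≤ ord x := by
  unfold ord
  rw [neg_le_neg_iff, WithZero.log_le_log (iso_val_ne hx) (iso_val_ne hy)]
  exact (map_le_map_iff (IsNonarchimedeanLocalField.valueGroupWithZeroIsoInt F)).symm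

lemma val_le_one {x : F} (hx : x ≠ 0) : ValuativeRel.valuation F x ≤ 1 ↔ 0 ≤ ord x := by
  have := val_le_val hx (one_ne_zero (α := F))
  rwa [map_one, ord_one] at this

lemma one_le_val {x : F} (hx : x ≠ 0) : 1 ≤ ValuativeRel.valuation F x ↔ ord x ≤ 0 := by
  have := val_le_val (one_ne_zero (α := F)) hx
  rwa [map_one, ord_one] at this

lemma val_eq_one {x : F} (hx : x ≠ 0) : ValuativeRel.valuation F x = 1 ↔ ord x = 0 := by
  rw [le_antisymm_iff, val_le_one hx, one_le_val hx]; omega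

lemma val_lt_one {x : F} (hx : x ≠ 0) : ValuativeRel.valuation F x < 1 ↔ 0 < ord x := by
  rw [← not_le, one_le_val hx]; omega

lemma res_of_le {x : F} (h : ValuativeRel.valuation F x ≤ 1) :
    res x = IsLocalRing.residue 𝒪[F] ⟨x, h⟩ := by
  simp [res, h]

lemma res_mul {x y : F} (hx : ValuativeRel.valuation F x ≤ 1)
    (hy : ValuativeRel.valuation F y ≤ 1) : res (x * y) = res x * res y := by
  have hxy : ValuativeRel.valuation F (x * y) ≤ 1 := by rw [map_mul]; exact mul_le_one' hx hy
  rw [res_of_le hx, res_of_le hy, res_of_le hxy, ← map_mul]; rfl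

lemma res_add {x y : F} (hx : ValuativeRel.valuation F x ≤ 1)
    (hy : ValuativeRel.valuation F y ≤ 1) : res (x + y) = res x + res y := by
  have hxy : ValuativeRel.valuation F (x + y) ≤ 1 :=
    (Valuation.map_add _ _ _).trans (max_le hx hy)
  rw [res_of_le hx, res_of_le hy, res_of_le hxy, ← map_add]; rfl

lemma res_one : res (1 : F) = 1 := by
  rw [res_of_le (by simp), ← map_one (IsLocalRing.residue 𝒪[F])]; rfl

lemma res_zero : res (0 : F) = 0 := by
  rw [res_of_le (by simp), ← map_zero (IsLocalRing.residue 𝒪[F])]; rfl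

lemma res_eq_zero {x : F} (hx : ValuativeRel.valuation F x ≤ 1) :
    res x = 0 ↔ ValuativeRel.valuation F x < 1 := by
  rw [res_of_le hx, IsLocalRing.residue_eq_zero_iff, IsLocalRing.mem_maximalIdeal, mem_nonunits_iff,
    (Valuation.integer.integers (ValuativeRel.valuation F)).isUnit_iff_valuation_eq_one, lt_iff_le_and_ne]
  exact ⟨fun h => ⟨hx, h⟩, fun h => h.2⟩

lemma tameUnit_ne {a b : F} (ha : a ≠ 0) (hb : b ≠ 0) : tameUnit a b ≠ 0 := by
  unfold tameUnit
  have h1 : (-1 : F) ≠ 0 := by simp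
  exact mul_ne_zero (mul_ne_zero (zpow_ne_zero _ h1) (zpow_ne_zero _ hb)) (zpow_ne_zero _ ha)

lemma ord_tameUnit {a b : F} (ha : a ≠ 0) (hb : b ≠ 0) : ord (tameUnit a b) = 0 := by
  unfold tameUnit
  have h1 : (-1 : F) ≠ 0 := by simp
  rw [ord_mul (mul_ne_zero (zpow_ne_zero _ h1) (zpow_ne_zero _ hb)) (zpow_ne_zero _ ha),
    ord_mul (zpow_ne_zero _ h1) (zpow_ne_zero _ hb), ord_zpow, ord_zpow, ord_zpow, ord_neg, ord_one]
  ring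

/-- The quadratic residue sign of a unit of the ring of integers. -/
def rsign (x : F) : ℤˣ :=
  open Classical in
  if IsSquare (res x) then 1 else -1

lemma hilb_eq (a b : F) : hilb a b = rsign (tameUnit a b) := rfl

lemma rsign_one : rsign (1 : F) = 1 := by simp [rsign, res_one]

lemma res_ne_zero {x : F} (hx : x ≠ 0) (hx' : ord x = 0) : res x ≠ 0 := by
  have h1 := (val_eq_one hx).2 hx'
  rw [Ne, res_eq_zero h1.le, h1]; simp

lemma rsign_mul {x y : F} (hx : x ≠ 0) (hx' : ord x = 0) (hy : y ≠ 0) (hy' : ord y = 0) :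
    rsign (x * y) = rsign x * rsign y := by
  classical
  have := Fintype.ofFinite 𝓀[F]
  have h1 := (val_eq_one hx).2 hx'
  have h2 := (val_eq_one hy).2 hy'
  have h3 := res_ne_zero hx hx'
  have h4 := res_ne_zero hy hy'
  have key := map_mul (quadraticChar 𝓀[F]) (res x) (res y)
  unfold rsign
  rw [res_mul h1.le h2.le]
  simp only [quadraticChar_apply, quadraticCharFun, h3, h4, mul_eq_zero, or_self, if_false] at key
  split_ifs at key ⊢ <;> simp_all

lemma int_units_sq (u : ℤˣ) : u * u = 1 := by
  rcases Int.units_eq_one_or u with h | h <;> simp [h]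

lemma rsign_inv {x : F} (hx : x ≠ 0) (hx' : ord x = 0) : rsign x⁻¹ = rsign x := by
  have h := rsign_mul hx hx' (inv_ne_zero hx) (by rw [ord_inv, hx', neg_zero])
  rw [mul_inv_cancel₀ hx, rsign_one] at h
  calc rsign x⁻¹ = rsign x * rsign x * rsign x⁻¹ := by rw [int_units_sq, one_mul]
    _ = rsign x := by rw [mul_assoc, ← h, mul_one]

lemma rsign_of_res_one {x : F} (h : res x = 1) : rsign x = 1 := by
  simp [rsign, h]

lemma tameUnit_mul_left {a a' b : F} (ha : a ≠ 0) (ha' : a' ≠ 0) (hb : b ≠ 0) :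
    tameUnit (a * a') b = tameUnit a b * tameUnit a' b := by
  unfold tameUnit
  have h1 : (-1 : F) ≠ 0 := by simp
  rw [ord_mul ha ha', add_mul, zpow_add₀ h1, zpow_add₀ hb, mul_zpow]
  ring

lemma tameUnit_symm (a b : F) : tameUnit b a = (tameUnit a b)⁻¹ := by
  unfold tameUnit
  have h : ((-1 : F) ^ (ord a * ord b))⁻¹ = (-1) ^ (ord a * ord b) := by
    rw [← inv_zpow]; simp
  rw [mul_inv, mul_inv, h, zpow_neg, zpow_neg, inv_inv, mul_comm (ord b)]
  ring_nf

lemma hilb_mul_left {a a' b : F} (ha : a ≠ 0) (ha' : a' ≠ 0) (hb : b ≠ 0) :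
    hilb (a * a') b = hilb a b * hilb a' b := by
  rw [hilb_eq, tameUnit_mul_left ha ha' hb, rsign_mul (tameUnit_ne ha hb) (ord_tameUnit ha hb)
    (tameUnit_ne ha' hb) (ord_tameUnit ha' hb)]
  rfl

lemma hilb_symm {a b : F} (ha : a ≠ 0) (hb : b ≠ 0) : hilb b a = hilb a b := by
  rw [hilb_eq, tameUnit_symm, rsign_inv (tameUnit_ne ha hb) (ord_tameUnit ha hb)]
  rfl

lemma hilb_mul_right {a b b' : F} (ha : a ≠ 0) (hb : b ≠ 0) (hb' : b' ≠ 0) :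
    hilb a (b * b') = hilb a b * hilb a b' := by
  rw [hilb_symm (mul_ne_zero hb hb') ha, hilb_mul_left hb hb' ha, hilb_symm ha hb, hilb_symm ha hb']

lemma hilb_one_left {b : F} : hilb 1 b = 1 := by
  have : tameUnit 1 b = 1 := by simp [tameUnit, ord_one]
  rw [hilb_eq, this, rsign_one]

lemma hilb_one_right {b : F} : hilb b 1 = 1 := by
  have : tameUnit b 1 = 1 := by simp [tameUnit, ord_one]
  rw [hilb_eq, this, rsign_one]

lemma hilb_inv_left {a b : F} (ha : a ≠ 0) (hb : b ≠ 0) : hilb a⁻¹ b = hilb a b := by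
  have h := hilb_mul_left ha (inv_ne_zero ha) hb
  rw [mul_inv_cancel₀ ha, hilb_one_left] at h
  calc hilb a⁻¹ b = hilb a b * hilb a b * hilb a⁻¹ b := by rw [int_units_sq, one_mul]
    _ = hilb a b := by rw [mul_assoc, ← h, mul_one]

lemma hilb_inv_right {a b : F} (ha : a ≠ 0) (hb : b ≠ 0) : hilb a b⁻¹ = hilb a b := by
  rw [hilb_symm (inv_ne_zero hb) ha, hilb_inv_left hb ha, hilb_symm ha hb]

lemma hilb_div_left {a b c : F} (ha : a ≠ 0) (hb : b ≠ 0) (hc : c ≠ 0) :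
    hilb (a / b) c = hilb a c * hilb b c := by
  rw [div_eq_mul_inv, hilb_mul_left ha (inv_ne_zero hb) hc, hilb_inv_left hb hc]

lemma hilb_div_right {a b c : F} (ha : a ≠ 0) (hb : b ≠ 0) (hc : c ≠ 0) :
    hilb c (a / b) = hilb c a * hilb c b := by
  rw [div_eq_mul_inv, hilb_mul_right hc ha (inv_ne_zero hb), hilb_inv_right hc hb]

lemma hilb_neg_self {a : F} (ha : a ≠ 0) : hilb (-a) a = 1 := by
  have : tameUnit (-a) a = 1 := by
    unfold tameUnit
    rw [ord_neg, neg_eq_neg_one_mul a, mul_zpow]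
    have h1 : (-1 : F) ≠ 0 := by simp
    have h2 : (-1 : F) ^ (ord a * ord a) * (-1) ^ (-ord a) = 1 := by
      rw [← zpow_add₀ h1]
      apply Even.neg_one_zpow
      have : ord a * ord a + -ord a = ord a * (ord a - 1) := by ring
      rw [this]
      rcases Int.even_or_odd (ord a) with h | h
      · exact h.mul_right _
      · exact (h.sub_odd odd_one).mul_left _
    have h3 : a ^ ord a * a ^ (-ord a) = 1 := by rw [← zpow_add₀ ha]; simp
    calc _ = ((-1 : F) ^ (ord a * ord a) * (-1) ^ (-ord a)) * (a ^ ord a * a ^ (-ord a)) := by ring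
      _ = 1 := by rw [h2, h3, one_mul]
  rw [hilb_eq, this, rsign_one]

lemma hilb_self {a : F} (ha : a ≠ 0) : hilb a a = hilb (-1) a := by
  have h1 : (-1 : F) ≠ 0 := by simp
  have h := hilb_neg_self ha
  rw [neg_eq_neg_one_mul, hilb_mul_left h1 ha ha] at h
  calc hilb a a = hilb (-1) a * hilb (-1) a * hilb a a := by rw [int_units_sq, one_mul]
    _ = _ := by rw [mul_assoc, h, mul_one]

lemma hilb_of_res_one {a u : F} (hu : u ≠ 0) (hu' : res u = 1) : hilb a u = 1 := by
  have hv : ValuativeRel.valuation F u ≤ 1 := by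
    by_contra h
    simp [res, h] at hu'
  have ho : ord u = 0 := by
    rw [← val_eq_one hu]
    refine le_antisymm hv (not_lt.1 fun h => ?_)
    rw [← res_eq_zero hv, hu'] at h
    simp at h
  have hk : ∀ n : ℕ, res (u ^ n) = 1 := by
    intro n
    induction n with
    | zero => simp [res_one]
    | succ n ih =>
      rw [pow_succ, res_mul _ hv, ih, hu', one_mul]
      rw [map_pow]; exact pow_le_one' hv _
  have h1 : ∀ n : ℕ, rsign (u ^ n) = 1 := fun n => rsign_of_res_one (hk n)
  have ht : tameUnit a u = u ^ ord a := by simp [tameUnit, ho]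
  rw [hilb_eq, ht]
  obtain ⟨n, hn | hn⟩ := Int.eq_nat_or_neg (ord a)
  · rw [hn, zpow_natCast, h1]
  · rw [hn, zpow_neg, zpow_natCast, rsign_inv (pow_ne_zero _ hu), h1]
    rw [← zpow_natCast, ord_zpow, ho, mul_zero]

lemma hilb_of_res_one_left {a u : F} (ha : a ≠ 0) (hu : u ≠ 0) (hu' : res u = 1) :
    hilb u a = 1 := by
  rw [hilb_symm ha hu, hilb_of_res_one hu hu']

lemma hilb_units {a b : F} (ha : ord a = 0) (hb : ord b = 0) : hilb a b = 1 := by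
  have : tameUnit a b = 1 := by simp [tameUnit, ha, hb]
  rw [hilb_eq, this, rsign_one]

lemma hilb_steinberg {a b : F} (ha : a ≠ 0) (hb : b ≠ 0) (h : a + b = 1) : hilb a b = 1 := by
  have hpos : ∀ {a b : F}, a ≠ 0 → b ≠ 0 → a + b = 1 → 0 < ord a → hilb a b = 1 := by
    intro a b ha hb h hp
    have hv := (val_lt_one ha).2 hp
    refine hilb_of_res_one hb ?_
    have : b = 1 + -a := by rw [← h]; ring
    rw [this, res_add (by simp) (by rw [Valuation.map_neg]; exact hv.le), res_one,
      (res_eq_zero (by rw [Valuation.map_neg]; exact hv.le)).2 (by rwa [Valuation.map_neg]), add_zero]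
  have hneg : ∀ {a b : F}, a ≠ 0 → b ≠ 0 → a + b = 1 → ord a < 0 → hilb a b = 1 := by
    intro a b ha hb h hn
    have h1 : (-1 : F) ≠ 0 := by simp
    -- `a⁻¹ + (-b/a) = 1`
    have e : a⁻¹ + -(b / a) = 1 → hilb a⁻¹ (-(b / a)) = 1 := fun e =>
      hpos (inv_ne_zero ha) (neg_ne_zero.2 (div_ne_zero hb ha)) e (by rw [ord_inv]; omega)
    have e' : a⁻¹ + -(b / a) = 1 := by
      have : b = 1 - a := by rw [← h]; ring
      rw [this]; field_simp; ring
    have := e e'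
    rw [hilb_inv_left ha (neg_ne_zero.2 (div_ne_zero hb ha)), neg_eq_neg_one_mul,
      hilb_mul_right ha h1 (div_ne_zero hb ha), hilb_div_right hb ha ha, hilb_self ha,
      hilb_symm ha h1] at this
    have h2 := int_units_sq (hilb a (-1))
    calc hilb a b = hilb a (-1) * hilb a (-1) * hilb a b := by rw [h2, one_mul]
      _ = hilb a (-1) * (hilb a b * hilb a (-1)) := by rw [mul_assoc, mul_comm (hilb a b)]
      _ = 1 := this
  rcases lt_trichotomy (ord a) 0 with h1 | h1 | h1
  · exact hneg ha hb h h1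
  · rcases lt_trichotomy (ord b) 0 with h2 | h2 | h2
    · rw [hilb_symm hb ha]; exact hneg hb ha (by rw [add_comm, h]) h2
    · exact hilb_units h1 h2
    · rw [hilb_symm hb ha]; exact hpos hb ha (by rw [add_comm, h]) h2
  · exact hpos ha hb h h1

end Symbol

section GLCover

variable {F : Type*} [Field F] [ValuativeRel F] [TopologicalSpace F] [IsNonarchimedeanLocalField F]

/-- The lower left entry of an invertible `2 × 2` matrix if it is nonzero, otherwise the lower
right entry. -/
def X (g : GL (Fin 2) F) : F :=
  open Classical in
  if (g : Matrix (Fin 2) (Fin 2) F) 1 0 = 0 then (g : Matrix (Fin 2) (Fin 2) F) 1 1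
  else (g : Matrix (Fin 2) (Fin 2) F) 1 0

/-- Kubota's `2`-cocycle on `GL₂(F)`. -/
def cocycle (g h : GL (Fin 2) F) : ℤˣ :=
  hilb (X (g * h) / X g) (X (g * h) / X h) *
    hilb (g : Matrix (Fin 2) (Fin 2) F).det (X (g * h) / X g)

lemma det_ne (g : GL (Fin 2) F) : (g : Matrix (Fin 2) (Fin 2) F).det ≠ 0 := by
  have := (Matrix.GeneralLinearGroup.det g).ne_zero
  simpa using this

lemma X_ne (g : GL (Fin 2) F) : X g ≠ 0 := by
  have h := det_ne g
  rw [Matrix.det_fin_two] at h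
  unfold X
  split_ifs with h1
  · intro h2; rw [h1, h2] at h; simp at h
  · exact h1

lemma X_one : X (1 : GL (Fin 2) F) = 1 := by simp [X]

lemma cocycle_one_left (g : GL (Fin 2) F) : cocycle 1 g = 1 := by
  simp [cocycle, X_one, hilb_one_left, hilb_one_right, div_self (X_ne g)]

lemma cocycle_one_right (g : GL (Fin 2) F) : cocycle g 1 = 1 := by
  simp [cocycle, X_one, hilb_one_left, hilb_one_right, div_self (X_ne g)]

/-- The symbol written additively. -/
def H (a b : F) : ZMod 2 := if hilb a b = 1 then 0 else 1

lemma H_eq_zero {a b : F} : H a b = 0 ↔ hilb a b = 1 := by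
  unfold H; split_ifs with h <;> simp [h]

/-- Signs written additively. -/
def sgnAdd (u : ℤˣ) : ZMod 2 := if u = 1 then 0 else 1

lemma sgnAdd_mul (u v : ℤˣ) : sgnAdd (u * v) = sgnAdd u + sgnAdd v := by
  rcases Int.units_eq_one_or u with h | h <;> rcases Int.units_eq_one_or v with h' | h' <;>
    subst h <;> subst h' <;> decide

lemma sgnAdd_inj {u v : ℤˣ} : sgnAdd u = sgnAdd v ↔ u = v := by
  rcases Int.units_eq_one_or u with h | h <;> rcases Int.units_eq_one_or v with h' | h' <;>
    subst h <;> subst h' <;> decide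

lemma H_def (a b : F) : sgnAdd (hilb a b) = H a b := rfl

lemma H_mul_left {a a' b : F} (ha : a ≠ 0) (ha' : a' ≠ 0) (hb : b ≠ 0) :
    H (a * a') b = H a b + H a' b := by
  rw [← H_def, hilb_mul_left ha ha' hb, sgnAdd_mul]; rfl

lemma H_mul_right {a b b' : F} (ha : a ≠ 0) (hb : b ≠ 0) (hb' : b' ≠ 0) :
    H a (b * b') = H a b + H a b' := by
  rw [← H_def, hilb_mul_right ha hb hb', sgnAdd_mul]; rfl

lemma H_div_left {a a' b : F} (ha : a ≠ 0) (ha' : a' ≠ 0) (hb : b ≠ 0) :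
    H (a / a') b = H a b + H a' b := by
  rw [← H_def, hilb_div_left ha ha' hb, sgnAdd_mul]; rfl

lemma H_div_right {a b b' : F} (ha : a ≠ 0) (hb : b ≠ 0) (hb' : b' ≠ 0) :
    H a (b / b') = H a b + H a b' := by
  rw [← H_def, hilb_div_right hb hb' ha, sgnAdd_mul]; rfl

lemma H_symm {a b : F} (ha : a ≠ 0) (hb : b ≠ 0) : H a b = H b a := by
  unfold H; rw [hilb_symm hb ha]

lemma two_zero : (2 : ZMod 2) = 0 := by decide

/-- The cocycle identity in terms of the values of `X`. -/
lemma cocycle_aux {x1 x2 x3 x12 x23 x123 d1 d2 : F} (h1 : x1 ≠ 0) (h2 : x2 ≠ 0) (h3 : x3 ≠ 0)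
    (h12 : x12 ≠ 0) (h23 : x23 ≠ 0) (h123 : x123 ≠ 0) (hd1 : d1 ≠ 0) (hd2 : d2 ≠ 0)
    (key : hilb (d2 * (x1 * x3) * (x12 * x23)) ((x12 * x23) * (x2 * x123)) = 1) :
    hilb (x12 / x1) (x12 / x2) * hilb d1 (x12 / x1) *
      (hilb (x123 / x12) (x123 / x3) * hilb (d1 * d2) (x123 / x12)) =
    hilb (x123 / x1) (x123 / x23) * hilb d1 (x123 / x1) *
      (hilb (x23 / x2) (x23 / x3) * hilb d2 (x23 / x2)) := by
  rw [← H_eq_zero] at key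
  rw [← sgnAdd_inj]
  simp only [sgnAdd_mul, H_def]
  simp only [H_mul_left, H_mul_right, H_div_left, H_div_right, ne_eq, mul_eq_zero, div_eq_zero_iff,
    h1, h2, h3, h12, h23, h123, hd1, hd2, or_self, not_false_eq_true] at key ⊢
  rw [H_symm h3 h123, H_symm h3 h2, H_symm h3 h12, H_symm h3 h23, H_symm h23 h123, H_symm h23 h12,
    H_symm h23 h2, H_symm h12 h2] at key
  rw [H_symm h12 h2]
  grind

lemma X_eq_of_ne {g : GL (Fin 2) F} (h : (g : Matrix (Fin 2) (Fin 2) F) 1 0 ≠ 0) :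
    X g = (g : Matrix (Fin 2) (Fin 2) F) 1 0 := by simp [X, h]

lemma X_eq_of_eq {g : GL (Fin 2) F} (h : (g : Matrix (Fin 2) (Fin 2) F) 1 0 = 0) :
    X g = (g : Matrix (Fin 2) (Fin 2) F) 1 1 := by simp [X, h]

lemma hilb_mul_self_right {a b : F} (ha : a ≠ 0) (hb : b ≠ 0) : hilb a (b * b) = 1 := by
  rw [hilb_mul_right ha hb hb, int_units_sq]

lemma hilb_mul_self_left {a b : F} (ha : a ≠ 0) (hb : b ≠ 0) : hilb (b * b) a = 1 := by
  rw [hilb_mul_left hb hb ha, int_units_sq]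

lemma hilb_neg_self' {a : F} (ha : a ≠ 0) : hilb a (-a) = 1 := by
  rw [hilb_symm (neg_ne_zero.2 ha) ha, hilb_neg_self ha]

lemma key_of_eq {A B C : F} (hA : A ≠ 0) (hC : C ≠ 0) (h : A = B) :
    hilb (C * A) (A * B) = 1 := by
  subst h; exact hilb_mul_self_right (mul_ne_zero hC hA) hA

lemma key_of_eq2 {A B C : F} (hA : A ≠ 0) (hB : B ≠ 0) (h : A = C) :
    hilb (C * A) (A * B) = 1 := by
  subst h; exact hilb_mul_self_left (mul_ne_zero hA hB) hA

lemma key_of_eq3 {A B C : F} (hA : A ≠ 0) (hB : B ≠ 0) (h : B = -C) :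
    hilb (C * A) (A * B) = 1 := by
  have : C = -B := by rw [h]; ring
  rw [this]
  have : -B * A = -(A * B) := by ring
  rw [this]
  exact hilb_neg_self (mul_ne_zero hA hB)

lemma key_of_sub {A B C : F} (hA : A ≠ 0) (hB : B ≠ 0) (hC : C ≠ 0) (h : A - B = C) :
    hilb (C * A) (A * B) = 1 := by
  have h1 : hilb (C / A) (B / A) = 1 :=
    hilb_steinberg (div_ne_zero hC hA) (div_ne_zero hB hA) (by rw [← h]; field_simp; ring)
  rw [← H_eq_zero] at h1 ⊢
  simp only [H_mul_left, H_mul_right, H_div_left, H_div_right, ne_eq, mul_eq_zero, div_eq_zero_iff,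
    hA, hB, hC, or_self, not_false_eq_true] at h1 ⊢
  grind

/-- `X` as a function of the lower row. -/
def xRow (c e : F) : F :=
  open Classical in if c = 0 then e else c

lemma xRow_zero (e : F) : xRow 0 e = e := by simp [xRow]

lemma xRow_ne {c : F} (h : c ≠ 0) (e : F) : xRow c e = c := by simp [xRow, h]

lemma xRow_mul {u : F} (h : u ≠ 0) (c e : F) : xRow (u * c) (u * e) = u * xRow c e := by
  by_cases hc : c = 0 <;> simp [xRow, h, hc]

lemma X_eq_xRow (g : GL (Fin 2) F) : X g = xRow ((g : Matrix (Fin 2) (Fin 2) F) 1 0)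
    ((g : Matrix (Fin 2) (Fin 2) F) 1 1) := rfl

lemma cocycle_key (g1 g2 g3 : GL (Fin 2) F) :
    hilb ((g2 : Matrix (Fin 2) (Fin 2) F).det * (X g1 * X g3) * (X (g1 * g2) * X (g2 * g3)))
      ((X (g1 * g2) * X (g2 * g3)) * (X g2 * X (g1 * g2 * g3))) = 1 := by
  have hd1 := det_ne g1
  have hd2 := det_ne g2
  have hd3 := det_ne g3
  have hx1 := X_ne g1
  have hx2 := X_ne g2
  have hx3 := X_ne g3
  have hx12 := X_ne (g1 * g2)
  have hx23 := X_ne (g2 * g3)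
  have hx123 := X_ne (g1 * g2 * g3)
  have hA : X (g1 * g2) * X (g2 * g3) ≠ 0 := mul_ne_zero hx12 hx23
  have hB : X g2 * X (g1 * g2 * g3) ≠ 0 := mul_ne_zero hx2 hx123
  have hC : (g2 : Matrix (Fin 2) (Fin 2) F).det * (X g1 * X g3) ≠ 0 :=
    mul_ne_zero hd2 (mul_ne_zero hx1 hx3)
  simp only [X_eq_xRow, Units.val_mul, Matrix.mul_apply, Fin.sum_univ_two,
    Matrix.det_fin_two] at *
  generalize (g1 : Matrix (Fin 2) (Fin 2) F) 0 0 = a1 at *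
  generalize (g1 : Matrix (Fin 2) (Fin 2) F) 0 1 = b1 at *
  generalize (g1 : Matrix (Fin 2) (Fin 2) F) 1 0 = c1 at *
  generalize (g1 : Matrix (Fin 2) (Fin 2) F) 1 1 = e1 at *
  generalize (g2 : Matrix (Fin 2) (Fin 2) F) 0 0 = a2 at *
  generalize (g2 : Matrix (Fin 2) (Fin 2) F) 0 1 = b2 at *
  generalize (g2 : Matrix (Fin 2) (Fin 2) F) 1 0 = c2 at *
  generalize (g2 : Matrix (Fin 2) (Fin 2) F) 1 1 = e2 at *
  generalize (g3 : Matrix (Fin 2) (Fin 2) F) 0 0 = a3 at *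
  generalize (g3 : Matrix (Fin 2) (Fin 2) F) 0 1 = b3 at *
  generalize (g3 : Matrix (Fin 2) (Fin 2) F) 1 0 = c3 at *
  generalize (g3 : Matrix (Fin 2) (Fin 2) F) 1 1 = e3 at *
  clear g1 g2 g3
  by_cases h1 : c1 = 0
  · apply key_of_eq hA hC
    subst h1
    have he1 : e1 ≠ 0 := by rintro rfl; simp at hd1
    have r1 : xRow (0 * a2 + e1 * c2) (0 * b2 + e1 * e2) = e1 * xRow c2 e2 := by
      rw [← xRow_mul he1]; ring_nf
    have r2 : xRow ((0 * a2 + e1 * c2) * a3 + (0 * b2 + e1 * e2) * c3)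
        ((0 * a2 + e1 * c2) * b3 + (0 * b2 + e1 * e2) * e3) =
        e1 * xRow (c2 * a3 + e2 * c3) (c2 * b3 + e2 * e3) := by
      rw [← xRow_mul he1]; ring_nf
    rw [r1, r2]; ring
  by_cases h3 : c3 = 0
  · subst h3
    have he3 : e3 ≠ 0 := by rintro rfl; simp at hd3
    have ha3 : a3 ≠ 0 := by rintro rfl; simp at hd3
    simp only [mul_zero, add_zero, xRow_zero] at *
    by_cases h2 : c2 = 0
    · subst h2
      have he2 : e2 ≠ 0 := by rintro rfl; simp at hd2
      have ha2 : a2 ≠ 0 := by rintro rfl; simp at hd2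
      simp only [mul_zero, add_zero, xRow_zero, zero_mul, zero_add, sub_zero] at *
      apply key_of_eq2 hA hB
      rw [xRow_ne (mul_ne_zero h1 ha2), xRow_ne h1]; ring
    · by_cases h12 : c1 * a2 + e1 * c2 = 0
      · rw [h12, xRow_zero] at hx12
        simp only [h12, xRow_zero, zero_mul, zero_add, xRow_ne h1, xRow_ne h2,
          xRow_ne (mul_ne_zero h2 ha3)]
        have e : (a2 * e2 - b2 * c2) * (c1 * e3) * ((c1 * b2 + e1 * e2) * (c2 * a3)) =
            -(a3 * e3) * ((c1 * (a2 * e2 - b2 * c2)) * (c1 * (a2 * e2 - b2 * c2))) := by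
          have : (c1 * b2 + e1 * e2) * c2 = - (c1 * (a2 * e2 - b2 * c2)) := by
            linear_combination e2 * h12
          linear_combination (a2 * e2 - b2 * c2) * c1 * e3 * a3 * this
        have e' : (c1 * b2 + e1 * e2) * (c2 * a3) * (c2 * ((c1 * b2 + e1 * e2) * e3)) =
            (a3 * e3) * ((c2 * (c1 * b2 + e1 * e2)) * (c2 * (c1 * b2 + e1 * e2))) := by ring
        rw [e, e']
        have hae := mul_ne_zero ha3 he3
        have hy := mul_ne_zero h2 hx12
        have hz := mul_ne_zero h1 hd2
        rw [hilb_mul_right (mul_ne_zero (neg_ne_zero.2 hae) (mul_ne_zero hz hz)) hae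
          (mul_ne_zero hy hy), hilb_mul_self_right (mul_ne_zero (neg_ne_zero.2 hae)
          (mul_ne_zero hz hz)) hy, hilb_mul_left (neg_ne_zero.2 hae) (mul_ne_zero hz hz) hae,
          hilb_mul_self_left hae hz, hilb_neg_self hae]
        simp
      · apply key_of_eq hA hC
        rw [xRow_ne h12, xRow_ne (mul_ne_zero h12 ha3), xRow_ne h2, xRow_ne (mul_ne_zero h2 ha3)]
        ring
  by_cases h2 : c2 = 0
  · subst h2
    have he2 : e2 ≠ 0 := by rintro rfl; simp at hd2
    have ha2 : a2 ≠ 0 := by rintro rfl; simp at hd2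
    simp only [mul_zero, add_zero, xRow_zero, zero_mul, zero_add, sub_zero] at *
    apply key_of_eq2 hA hB
    rw [xRow_ne (mul_ne_zero h1 ha2), xRow_ne h1, xRow_ne h3, xRow_ne (mul_ne_zero he2 h3)]; ring
  rw [xRow_ne h1, xRow_ne h3] at hC
  rw [xRow_ne h2] at hB
  rw [xRow_ne h1, xRow_ne h2, xRow_ne h3]
  by_cases h12 : c1 * a2 + e1 * c2 = 0
  · simp only [h12, xRow_zero, zero_mul, zero_add] at hA hB hx12 ⊢
    apply key_of_eq3 hA hB
    rw [xRow_ne (mul_ne_zero hx12 h3)]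
    linear_combination c3 * e2 * h12
  by_cases h23 : c2 * a3 + e2 * c3 = 0
  · rw [h23] at hA ⊢
    rw [xRow_zero] at hA ⊢
    apply key_of_eq3 hA hB
    have hc : (c1 * a2 + e1 * c2) * a3 + (c1 * b2 + e1 * e2) * c3 = c1 * (a2 * a3 + b2 * c3) := by
      linear_combination e1 * h23
    have hn : a2 * a3 + b2 * c3 ≠ 0 := by
      intro h
      apply mul_ne_zero hd2 h3
      linear_combination a2 * h23 - c2 * h
    rw [hc, xRow_ne (mul_ne_zero h1 hn)]
    linear_combination c1 * a2 * h23
  rw [xRow_ne h12, xRow_ne h23] at hA ⊢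
  by_cases h123 : (c1 * a2 + e1 * c2) * a3 + (c1 * b2 + e1 * e2) * c3 = 0
  · apply key_of_eq2 hA hB
    linear_combination c2 * h123
  · apply key_of_sub hA hB hC
    rw [xRow_ne h123]
    ring

lemma cocycle_assoc (g1 g2 g3 : GL (Fin 2) F) :
    cocycle g1 g2 * cocycle (g1 * g2) g3 = cocycle g1 (g2 * g3) * cocycle g2 g3 := by
  unfold cocycle
  rw [Units.val_mul, Matrix.det_mul, ← mul_assoc g1]
  exact cocycle_aux (X_ne _) (X_ne _) (X_ne _) (X_ne _) (X_ne _) (X_ne _) (det_ne _) (det_ne _)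
    (cocycle_key g1 g2 g3)

variable (F) in
/-- The twofold metaplectic cover of `GL₂(F)`: pairs `(g, ζ)` with multiplication
`(g, ζ)(g', ζ') = (g g', ζ ζ' Δ(g, g'))`. -/
@[ext]
structure GLCover where
  /-- the underlying matrix -/
  mat : GL (Fin 2) F
  /-- the sign -/
  sgn : ℤˣ

instance : Mul (GLCover F) := ⟨fun x y => ⟨x.mat * y.mat, x.sgn * y.sgn * cocycle x.mat y.mat⟩⟩

instance : One (GLCover F) := ⟨⟨1, 1⟩⟩

instance : Inv (GLCover F) := ⟨fun x => ⟨x.mat⁻¹, x.sgn * cocycle x.mat⁻¹ x.mat⟩⟩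

lemma GLCover.mul_def (x y : GLCover F) :
    x * y = ⟨x.mat * y.mat, x.sgn * y.sgn * cocycle x.mat y.mat⟩ := rfl

lemma GLCover.one_def : (1 : GLCover F) = ⟨1, 1⟩ := rfl

lemma GLCover.inv_def (x : GLCover F) :
    x⁻¹ = ⟨x.mat⁻¹, x.sgn * cocycle x.mat⁻¹ x.mat⟩ := rfl

instance : Group (GLCover F) :=
  Group.ofLeftAxioms
    (fun x y z => by
      simp only [GLCover.mul_def]
      refine GLCover.ext (mul_assoc _ _ _) ?_
      have := cocycle_assoc x.mat y.mat z.mat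
      calc x.sgn * y.sgn * cocycle x.mat y.mat * z.sgn * cocycle (x.mat * y.mat) z.mat
          = x.sgn * y.sgn * z.sgn * (cocycle x.mat y.mat * cocycle (x.mat * y.mat) z.mat) := by
            rw [mul_assoc _ _ z.sgn, mul_comm _ z.sgn]; simp only [mul_assoc]
        _ = _ := by
            rw [this, mul_comm (cocycle x.mat (y.mat * z.mat))]; simp only [mul_assoc])
    (fun x => by simp [GLCover.mul_def, GLCover.one_def, cocycle_one_left])
    (fun x => by
      simp only [GLCover.mul_def, GLCover.inv_def, GLCover.one_def, inv_mul_cancel]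
      refine GLCover.ext rfl ?_
      change x.sgn * cocycle x.mat⁻¹ x.mat * x.sgn * cocycle x.mat⁻¹ x.mat = 1
      rw [mul_assoc, int_units_sq])

/-- The projection of the cover of `GL₂(F)` onto `GL₂(F)`. -/
def GLCover.proj : GLCover F →* GL (Fin 2) F where
  toFun := GLCover.mat
  map_one' := rfl
  map_mul' _ _ := rfl

variable (F) in
/-- The metaplectic cover `G̃` of `SL₂(F)`: the preimage of `SL₂(F)` in the cover of `GL₂(F)`. -/
abbrev Mp : Subgroup (GLCover F) :=
  (Matrix.GeneralLinearGroup.det.comp GLCover.proj).ker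

/-- The element `(g, ζ)` of the metaplectic cover. -/
def mk (g : SL(2, F)) (ζ : ℤˣ) : Mp F :=
  ⟨⟨g, ζ⟩, by
    rw [MonoidHom.mem_ker]
    ext
    simp [GLCover.proj]⟩

end GLCover

section Maximal

variable {F : Type*} [Field F] [ValuativeRel F] [TopologicalSpace F] [IsNonarchimedeanLocalField F]

/-- The topology of the metaplectic cover: the section `k ↦ (k, 1)` is a homomorphism on a small
open subgroup of `SL₂(F)`, and the cover carries the group topology for which this section is a
local homeomorphism at the identity. -/
instance : TopologicalSpace (Mp F) where
  IsOpen U := ∀ x ∈ U, ∀ᶠ k in 𝓝 (1 : SL(2, F)), x * mk k 1 ∈ U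
  isOpen_univ := by simp
  isOpen_inter U V hU hV x hx := (hU x hx.1).and (hV x hx.2)
  isOpen_sUnion S hS x := by
    rintro ⟨U, hU, hx⟩
    exact (hS U hU x hx).mono fun k hk => ⟨U, hU, hk⟩

/-- The sign of Kubota's splitting of the cover over `SL₂(O)`. -/
def theta (g : GL (Fin 2) F) : ℤˣ :=
  open Classical in
  if (g : Matrix (Fin 2) (Fin 2) F) 1 0 ≠ 0 ∧
      ValuativeRel.valuation F ((g : Matrix (Fin 2) (Fin 2) F) 1 0) < 1 then
    hilb ((g : Matrix (Fin 2) (Fin 2) F) 1 0) ((g : Matrix (Fin 2) (Fin 2) F) 1 1)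
  else 1

/-- Membership in `SL₂(O)`. -/
def IsK (g : GL (Fin 2) F) : Prop :=
  (g : Matrix (Fin 2) (Fin 2) F).det = 1 ∧
    ∀ i j, ValuativeRel.valuation F ((g : Matrix (Fin 2) (Fin 2) F) i j) ≤ 1

lemma IsK.mul {g h : GL (Fin 2) F} (hg : IsK g) (hh : IsK h) : IsK (g * h) := by
  refine ⟨by rw [Units.val_mul, Matrix.det_mul, hg.1, hh.1, one_mul], fun i j => ?_⟩
  rw [Units.val_mul, Matrix.mul_apply]
  refine Valuation.map_sum_le _ fun k _ => ?_
  rw [map_mul]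
  exact mul_le_one' (hg.2 i k) (hh.2 k j)

lemma IsK.one : IsK (1 : GL (Fin 2) F) := by
  refine ⟨by simp, fun i j => ?_⟩
  rw [Units.val_one, Matrix.one_apply]
  split_ifs <;> simp

lemma IsK.inv {g : GL (Fin 2) F} (hg : IsK g) : IsK g⁻¹ := by
  have h : ((g⁻¹ : GL (Fin 2) F) : Matrix (Fin 2) (Fin 2) F) =
      Matrix.adjugate (g : Matrix (Fin 2) (Fin 2) F) := by
    rw [Matrix.coe_units_inv, Matrix.inv_def, hg.1]; simp
  refine ⟨by rw [h, Matrix.det_adjugate, hg.1]; simp, fun i j => ?_⟩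
  rw [h, Matrix.adjugate_fin_two]
  fin_cases i <;> fin_cases j <;> simp [Valuation.map_neg, hg.2]

/-- An element of `SL₂(F)` with given entries, in `GL₂(F)`. -/
def gl (a b c d : F) (h : a * d - b * c = 1) : GL (Fin 2) F :=
  Matrix.GeneralLinearGroup.mkOfDetNeZero !![a, b; c, d] (by
    rw [Matrix.det_fin_two_of, h]; exact one_ne_zero)

lemma gl_val (a b c d : F) (h : a * d - b * c = 1) :
    (gl a b c d h : Matrix (Fin 2) (Fin 2) F) = !![a, b; c, d] := rfl

lemma gl_eq {g : GL (Fin 2) F} (hg : (g : Matrix (Fin 2) (Fin 2) F).det = 1) :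
    ∃ a b c d h, g = gl a b c d h := by
  refine ⟨(g : Matrix (Fin 2) (Fin 2) F) 0 0, (g : Matrix (Fin 2) (Fin 2) F) 0 1,
    (g : Matrix (Fin 2) (Fin 2) F) 1 0, (g : Matrix (Fin 2) (Fin 2) F) 1 1, ?_, ?_⟩
  · rw [← hg, Matrix.det_fin_two]
  · apply Units.ext
    rw [gl_val]
    ext i j; fin_cases i <;> fin_cases j <;> rfl

lemma gl_congr {a b c d a' b' c' d' : F} {h : a * d - b * c = 1} {h' : a' * d' - b' * c' = 1}
    (ha : a = a') (hb : b = b') (hc : c = c') (hd : d = d') : gl a b c d h = gl a' b' c' d' h' := by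
  subst ha hb hc hd; rfl

lemma gl_mul {a b c d a' b' c' d' : F} (h : a * d - b * c = 1) (h' : a' * d' - b' * c' = 1) :
    gl a b c d h * gl a' b' c' d' h' =
      gl (a * a' + b * c') (a * b' + b * d') (c * a' + d * c') (c * b' + d * d')
        (by linear_combination (a' * d' - b' * c') * h + h') := by
  apply Units.ext
  rw [Units.val_mul, gl_val, gl_val, gl_val, Matrix.mul_fin_two]

lemma gl_isK {a b c d : F} {h : a * d - b * c = 1} : IsK (gl a b c d h) ↔
    ValuativeRel.valuation F a ≤ 1 ∧ ValuativeRel.valuation F b ≤ 1 ∧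
    ValuativeRel.valuation F c ≤ 1 ∧ ValuativeRel.valuation F d ≤ 1 := by
  unfold IsK
  rw [gl_val, Matrix.det_fin_two_of, h]
  constructor
  · rintro ⟨-, h⟩
    exact ⟨h 0 0, h 0 1, h 1 0, h 1 1⟩
  · rintro ⟨h1, h2, h3, h4⟩
    refine ⟨rfl, fun i j => ?_⟩
    fin_cases i <;> fin_cases j <;> assumption

lemma X_gl {a b c d : F} {h : a * d - b * c = 1} : X (gl a b c d h) = xRow c d := rfl

lemma theta_gl_zero {a b d : F} {h : a * d - b * 0 = 1} : theta (gl a b 0 d h) = 1 := by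
  simp [theta, gl_val]

lemma theta_gl_unit {a b c d : F} {h : a * d - b * c = 1} (hc : ValuativeRel.valuation F c = 1) :
    theta (gl a b c d h) = 1 := by
  simp [theta, gl_val, hc]

lemma theta_gl_nonunit {a b c d : F} {h : a * d - b * c = 1} (hc : c ≠ 0)
    (hc' : ValuativeRel.valuation F c < 1) : theta (gl a b c d h) = hilb c d := by
  simp [theta, gl_val, hc, hc']

lemma cocycle_gl {a b c d : F} (h : a * d - b * c = 1) (g : GL (Fin 2) F) :
    cocycle (gl a b c d h) g =
      hilb (X (gl a b c d h * g) / X (gl a b c d h)) (X (gl a b c d h * g) / X g) := by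
  unfold cocycle
  rw [gl_val, Matrix.det_fin_two_of, h, hilb_one_left, mul_one]

/-- The compatibility of `theta` with left multiplication by `k`. -/
def Good (k : GL (Fin 2) F) : Prop :=
  ∀ y, IsK y → cocycle k y * theta (k * y) = theta k * theta y

lemma Good.mul {k k' : GL (Fin 2) F} (hk' : IsK k') (h : Good k) (h' : Good k') :
    Good (k * k') := by
  intro y hy
  have h1 := h (k' * y) (hk'.mul hy)
  have h2 := h' y hy
  have h3 := h k' hk'
  have h4 := cocycle_assoc k k' y
  rw [← sgnAdd_inj] at *
  simp only [sgnAdd_mul, ← mul_assoc] at *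
  grind

lemma good_u {x : F} (h : (1 : F) * 1 - x * 0 = 1) : Good (gl 1 x 0 1 h) := by
  intro y hy
  obtain ⟨a, b, c, d, hd, rfl⟩ := gl_eq hy.1
  have e : gl 1 x 0 1 h * gl a b c d hd = gl (a + x * c) (b + x * d) c d
      (by linear_combination hd) := by
    rw [gl_mul]; apply gl_congr <;> ring
  rw [cocycle_gl, e, theta_gl_zero]
  simp only [X_gl, xRow_zero]
  rw [div_self (X_gl (h := hd) ▸ X_ne (gl a b c d hd)), hilb_one_right]
  rfl

lemma val_ne {x : F} (h : ValuativeRel.valuation F x = 1) : x ≠ 0 := by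
  rintro rfl; simp at h

lemma ord_of_val {x : F} (h : ValuativeRel.valuation F x = 1) : ord x = 0 :=
  (val_eq_one (val_ne h)).1 h

lemma hilb_val {x y : F} (h : ValuativeRel.valuation F x = 1)
    (h' : ValuativeRel.valuation F y = 1) : hilb x y = 1 :=
  hilb_units (ord_of_val h) (ord_of_val h')

lemma val_inv_one {x : F} (h : ValuativeRel.valuation F x = 1) :
    ValuativeRel.valuation F x⁻¹ = 1 := by rw [map_inv₀, h, inv_one]

/-- If `a d - b c = 1` with `c` a nonunit and all entries integral, then `a d` is `1` modulo the
maximal ideal. -/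
lemma res_ad {a b c d : F} (h : a * d - b * c = 1) (hb : ValuativeRel.valuation F b ≤ 1)
    (hc : ValuativeRel.valuation F c < 1) : res (a * d) = 1 := by
  have hbc : ValuativeRel.valuation F (b * c) < 1 := by
    rw [map_mul]; exact (mul_le_of_le_one_left' hb).trans_lt hc
  have : a * d = 1 + b * c := by linear_combination h
  rw [this, res_add (by simp) hbc.le, (res_eq_zero hbc.le).2 hbc, res_one, add_zero]

lemma val_of_res {x : F} (h : res x = 1) : ValuativeRel.valuation F x = 1 := by
  have hv : ValuativeRel.valuation F x ≤ 1 := by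
    by_contra h'
    simp [res, h'] at h
  refine le_antisymm hv (not_lt.1 fun h' => ?_)
  rw [← res_eq_zero hv, h] at h'
  simp at h'

lemma val_both {a d : F} (h : ValuativeRel.valuation F (a * d) = 1)
    (ha : ValuativeRel.valuation F a ≤ 1) (hd : ValuativeRel.valuation F d ≤ 1) :
    ValuativeRel.valuation F a = 1 ∧ ValuativeRel.valuation F d = 1 := by
  rw [map_mul] at h
  constructor
  · exact le_antisymm ha (h ▸ mul_le_of_le_one_right' hd)
  · exact le_antisymm hd (h ▸ mul_le_of_le_one_left' ha)

lemma good_h {t : F} (ht : ValuativeRel.valuation F t = 1) (h : t * t⁻¹ - 0 * 0 = 1) :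
    Good (gl t 0 0 t⁻¹ h) := by
  intro y hy
  obtain ⟨a, b, c, d, hd, rfl⟩ := gl_eq hy.1
  obtain ⟨ha1, hb1, hc1, hd1⟩ := gl_isK.1 hy
  have ht0 := val_ne ht
  have hti := val_inv_one ht
  have e : gl t 0 0 t⁻¹ h * gl a b c d hd = gl (t * a) (t * b) (t⁻¹ * c) (t⁻¹ * d)
      (by field_simp; linear_combination hd) := by
    rw [gl_mul]; apply gl_congr <;> ring
  have hX := X_gl (h := hd) ▸ X_ne (gl a b c d hd)
  rw [cocycle_gl, e, theta_gl_zero]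
  simp only [X_gl, xRow_zero, xRow_mul (inv_ne_zero ht0)]
  rw [mul_div_cancel_left₀ _ (inv_ne_zero ht0), mul_div_cancel_right₀ _ hX, one_mul]
  by_cases hc : c = 0
  · subst hc
    simp only [xRow_zero, mul_zero, theta_gl_zero]
    rw [hilb_val (val_both (a := a) (by rw [show a * d = 1 by linear_combination hd, map_one])
      ha1 hd1).2 hti, mul_one]
  rw [xRow_ne hc]
  rcases eq_or_lt_of_le hc1 with hu | hu
  · rw [hilb_val hu hti, theta_gl_unit hu, theta_gl_unit (by rw [map_mul, hti, hu, one_mul]),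
      mul_one]
  · have had := val_both (val_of_res (res_ad hd hb1 hu)) ha1 hd1
    have hd0 := val_ne had.2
    have hi0 := inv_ne_zero ht0
    rw [theta_gl_nonunit hc hu, theta_gl_nonunit (mul_ne_zero hi0 hc) (by
      rw [map_mul, hti, one_mul]; exact hu), hilb_mul_left hi0 hc (mul_ne_zero hi0 hd0),
      hilb_mul_right hi0 hi0 hd0, hilb_mul_right hc hi0 hd0, hilb_val hti hti, hilb_val hti had.2,
      one_mul, one_mul, ← mul_assoc, int_units_sq, one_mul]

lemma good_w (h : (0 : F) * 0 - 1 * (-1) = 1) : Good (gl 0 1 (-1) 0 h) := by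
  intro y hy
  obtain ⟨a, b, c, d, hd, rfl⟩ := gl_eq hy.1
  obtain ⟨ha1, hb1, hc1, hd1⟩ := gl_isK.1 hy
  have hn : (-1 : F) ≠ 0 := by simp
  have hnv : ValuativeRel.valuation F (-1 : F) = 1 := by simp
  have e : gl 0 1 (-1) 0 h * gl a b c d hd = gl c d (-a) (-b)
      (by linear_combination hd) := by
    rw [gl_mul]; apply gl_congr <;> ring
  have hX := X_gl (h := hd) ▸ X_ne (gl a b c d hd)
  rw [cocycle_gl, e, theta_gl_unit (c := -1) hnv, one_mul]
  simp only [X_gl, xRow_ne hn]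
  have hav : ValuativeRel.valuation F (-a) = ValuativeRel.valuation F a := Valuation.map_neg _ _
  have hbv : ValuativeRel.valuation F (-b) = ValuativeRel.valuation F b := Valuation.map_neg _ _
  have hxa : -a / -1 = a := by ring
  by_cases hc : c = 0
  · subst hc
    obtain ⟨hau, hdu⟩ := val_both (a := a) (d := d)
      (by rw [show a * d = 1 by linear_combination hd, map_one]) ha1 hd1
    have ha0 := val_ne hau
    have hna0 : -a ≠ 0 := neg_ne_zero.2 ha0
    rw [theta_gl_zero, theta_gl_unit (hav.trans hau), xRow_ne hna0, xRow_zero, mul_one]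
    apply hilb_val
    · rw [hxa, hau]
    · rw [map_div₀, hav, hau, hdu, div_one]
  rw [xRow_ne hc]
  rcases eq_or_lt_of_le hc1 with hu | hu
  · rw [theta_gl_unit hu]
    by_cases ha : a = 0
    · subst ha
      have hbu : ValuativeRel.valuation F b = 1 := by
        have : b * c = -1 := by linear_combination -hd
        have h2 := congrArg (ValuativeRel.valuation F) this
        rwa [map_mul, hu, mul_one, hnv] at h2
      simp only [neg_zero, xRow_zero, theta_gl_zero, mul_one]
      apply hilb_val
      · rw [map_div₀, hbv, hbu, hnv, div_one]
      · rw [map_div₀, hbv, hbu, hu, div_one]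
    have hna : -a ≠ 0 := neg_ne_zero.2 ha
    rw [xRow_ne hna, hxa]
    rcases eq_or_lt_of_le ha1 with hau | hau
    · rw [theta_gl_unit (hav.trans hau), mul_one]
      apply hilb_val hau
      rw [map_div₀, hav, hau, hu, div_one]
    · have hr : res ((-b) * c) = 1 := by
        have := res_ad (a := -b) (b := -d) (c := a) (d := c) (by linear_combination hd)
          (by rwa [Valuation.map_neg]) hau
        exact this
      have hbc := val_both (val_of_res hr) (by rwa [Valuation.map_neg]) hc1
      have hb0 : -b ≠ 0 := val_ne hbc.1
      rw [theta_gl_nonunit hna (by rwa [hav])]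
      have h1 := hilb_of_res_one (a := -a) (mul_ne_zero hb0 hc) hr
      rw [hilb_mul_right hna hb0 hc] at h1
      rw [hilb_div_right hna hc ha, hilb_neg_self' ha, one_mul]
      have h2 : hilb (-a) c = hilb a c := by
        rw [neg_eq_neg_one_mul, hilb_mul_left hn ha hc, hilb_val hnv hu, one_mul]
      rw [h2, mul_comm] at h1
      exact h1
  · have hr := res_ad hd hb1 hu
    obtain ⟨hau, hdu⟩ := val_both (val_of_res hr) ha1 hd1
    have ha0 := val_ne hau
    have hd0 := val_ne hdu
    have hna : -a ≠ 0 := neg_ne_zero.2 ha0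
    rw [xRow_ne hna, hxa, theta_gl_unit (hav.trans hau), theta_gl_nonunit hc hu, mul_one,
      hilb_div_right hna hc ha0, hilb_neg_self' ha0, one_mul]
    have h1 := hilb_of_res_one (a := c) (mul_ne_zero ha0 hd0) hr
    rw [hilb_mul_right hc ha0 hd0, hilb_symm ha0 hc] at h1
    rw [← sgnAdd_inj] at *
    simp only [sgnAdd_mul] at *
    have h5 : sgnAdd 1 = 0 := by decide
    grind

lemma good_of_unit {a b c d : F} {h : a * d - b * c = 1} (hk : IsK (gl a b c d h))
    (hc : ValuativeRel.valuation F c = 1) : Good (gl a b c d h) := by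
  obtain ⟨ha1, hb1, hc1, hd1⟩ := gl_isK.1 hk
  have hc0 := val_ne hc
  have hn : ValuativeRel.valuation F (-c) = 1 := by rw [Valuation.map_neg, hc]
  have e : gl a b c d h = gl 1 (a / c) 0 1 (by ring) * (gl 0 1 (-1) 0 (by ring) *
      (gl (-c) 0 0 (-c)⁻¹ (by field_simp; ring) * gl 1 (d / c) 0 1 (by ring))) := by
    simp only [gl_mul]
    apply gl_congr
    · field_simp; ring
    · field_simp; linear_combination (-c) * h
    · ring
    · field_simp; ring
  have k1 : ∀ {x : F}, ValuativeRel.valuation F x ≤ 1 → ∀ h, IsK (gl 1 (x / c) 0 1 h) := by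
    intro x hx h
    exact gl_isK.2 ⟨by simp, by rw [map_div₀, hc, div_one]; exact hx, by simp, by simp⟩
  have k2 : ∀ h, IsK (gl (-c) 0 0 (-c)⁻¹ h) := fun h =>
    gl_isK.2 ⟨hn.le, by simp, by simp, (val_inv_one hn).le⟩
  have k3 : ∀ h, IsK (gl (0 : F) 1 (-1) 0 h) := fun h =>
    gl_isK.2 ⟨by simp, by simp, by simp, by simp⟩
  rw [e]
  exact (good_u _).mul ((k3 _).mul ((k2 _).mul (k1 hd1 _))) ((good_w _).mul ((k2 _).mul (k1 hd1 _))
    ((good_h hn _).mul (k1 hd1 _) (good_u _)))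

lemma good_of_isK {g : GL (Fin 2) F} (hk : IsK g) : Good g := by
  obtain ⟨a, b, c, d, h, rfl⟩ := gl_eq hk.1
  obtain ⟨ha1, hb1, hc1, hd1⟩ := gl_isK.1 hk
  rcases eq_or_lt_of_le hc1 with hu | hu
  · exact good_of_unit hk hu
  · have hau := (val_both (val_of_res (res_ad h hb1 hu)) ha1 hd1).1
    have e : gl a b c d h = gl 0 (-1) 1 0 (by ring) * gl c d (-a) (-b) (by linear_combination h) := by
      simp only [gl_mul]
      apply gl_congr <;> ring
    have k1 : IsK (gl c d (-a) (-b) (by linear_combination h)) := by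
      apply gl_isK.2
      simp only [Valuation.map_neg]
      exact ⟨hc1, hd1, ha1, hb1⟩
    have k2 : ∀ h, IsK (gl (0 : F) (-1) 1 0 h) := fun h =>
      gl_isK.2 ⟨by simp, by simp, by simp, by simp⟩
    rw [e]
    exact (good_of_unit (k2 _) (by simp)).mul k1 (good_of_unit k1 (by rwa [Valuation.map_neg]))

lemma theta_mul {g h : GL (Fin 2) F} (hg : IsK g) (hh : IsK h) :
    cocycle g h * theta (g * h) = theta g * theta h := good_of_isK hg h hh

variable (F) in
/-- The preimage `K̃` of `SL₂(O)` in the metaplectic cover. -/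
def Kt : Subgroup (Mp F) where
  carrier := {x | IsK x.1.mat}
  mul_mem' hx hy := IsK.mul hx hy
  one_mem' := IsK.one
  inv_mem' hx := IsK.inv hx

variable (F) in
/-- The genuine character `(k, ζ) ↦ ζ θ(k)` of `K̃`, given by the splitting over `SL₂(O)`. -/
def kSign : Kt F →* ℤˣ where
  toFun x := x.1.1.sgn * theta x.1.1.mat
  map_one' := by
    have h1 : theta (1 : GL (Fin 2) F) = 1 := by simp [theta]
    change 1 * theta 1 = 1
    rw [h1, one_mul]
  map_mul' x y := by
    have h := theta_mul x.2 y.2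
    change x.1.1.sgn * y.1.1.sgn * cocycle x.1.1.mat y.1.1.mat * theta (x.1.1.mat * y.1.1.mat) = _
    rw [mul_assoc, h]
    simp only [mul_assoc, mul_left_comm]

variable (F) in
/-- The reduction map from `K̃` to `SL₂` of the residue field. -/
def reduction : Kt F →* SL(2, 𝓀[F]) where
  toFun x := ⟨(x.1.1.mat : Matrix (Fin 2) (Fin 2) F).map res, by
    obtain ⟨hd, hx⟩ : IsK x.1.1.mat := x.2
    rw [Matrix.det_fin_two] at hd ⊢
    have h1 : ∀ i j k l, ValuativeRel.valuation F ((x.1.1.mat : Matrix (Fin 2) (Fin 2) F) i j *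
        (x.1.1.mat : Matrix (Fin 2) (Fin 2) F) k l) ≤ 1 := fun i j k l => by
      rw [map_mul]; exact mul_le_one' (hx i j) (hx k l)
    have hs : (x.1.1.mat : Matrix (Fin 2) (Fin 2) F) 0 0 * (x.1.1.mat : Matrix (Fin 2) (Fin 2) F) 1 1
        = 1 + (x.1.1.mat : Matrix (Fin 2) (Fin 2) F) 0 1 *
          (x.1.1.mat : Matrix (Fin 2) (Fin 2) F) 1 0 := by linear_combination hd
    have h2 := congrArg res hs
    rw [res_add (by simp) (h1 _ _ _ _), res_mul (hx _ _) (hx _ _), res_mul (hx _ _) (hx _ _),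
      res_one] at h2
    simp only [Matrix.map_apply]
    linear_combination h2⟩
  map_one' := by
    ext i j
    change res ((1 : Matrix (Fin 2) (Fin 2) F) i j) = (1 : Matrix (Fin 2) (Fin 2) 𝓀[F]) i j
    rw [Matrix.one_apply, Matrix.one_apply]
    split_ifs
    · exact res_one
    · exact res_zero
  map_mul' x y := by
    ext i j
    obtain ⟨-, hx⟩ : IsK x.1.1.mat := x.2
    obtain ⟨-, hy⟩ : IsK y.1.1.mat := y.2
    have h1 : ∀ i j k l, ValuativeRel.valuation F ((x.1.1.mat : Matrix (Fin 2) (Fin 2) F) i j *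
        (y.1.1.mat : Matrix (Fin 2) (Fin 2) F) k l) ≤ 1 := fun i j k l => by
      rw [map_mul]; exact mul_le_one' (hx i j) (hy k l)
    change res (((x.1.1.mat * y.1.1.mat : GL (Fin 2) F) : Matrix (Fin 2) (Fin 2) F) i j) =
      ((x.1.1.mat : Matrix (Fin 2) (Fin 2) F).map res *
        (y.1.1.mat : Matrix (Fin 2) (Fin 2) F).map res) i j
    rw [Units.val_mul, Matrix.mul_apply, Matrix.mul_apply, Fin.sum_univ_two, Fin.sum_univ_two,
      res_add (h1 _ _ _ _) (h1 _ _ _ _), res_mul (hx _ _) (hy _ _), res_mul (hx _ _) (hy _ _)]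
    rfl

end Maximal

open scoped TensorProduct

section Weights

variable {E : Type*} [Field E]

/-- The space `Sym^n(E²)`, as binary forms of degree `n` in the standard basis `X 0, X 1`
of `E²`. -/
abbrev Forms (E : Type*) [Field E] (n : ℕ) : Submodule E (MvPolynomial (Fin 2) E) :=
  MvPolynomial.homogeneousSubmodule (Fin 2) E n

/-- The algebra map extending the action of a matrix on `E²`. -/
def substHom (g : SL(2, E)) : MvPolynomial (Fin 2) E →ₐ[E] MvPolynomial (Fin 2) E :=
  MvPolynomial.aeval fun j => ∑ i, MvPolynomial.C (g.1 i j) * MvPolynomial.X i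

lemma substHom_X (g : SL(2, E)) (j : Fin 2) : substHom g (MvPolynomial.X j) =
    ∑ i, MvPolynomial.C (g.1 i j) * MvPolynomial.X i := by
  simp [substHom]

lemma substHom_one : substHom (1 : SL(2, E)) = AlgHom.id E _ := by
  ext j : 1
  rw [substHom_X]
  fin_cases j <;> simp [Fin.sum_univ_two]

lemma substHom_mul (g h : SL(2, E)) : substHom (g * h) = (substHom g).comp (substHom h) := by
  ext j : 1
  rw [AlgHom.comp_apply, substHom_X, substHom_X]
  simp only [Fin.sum_univ_two, map_add, map_mul, substHom_X]
  have hC : ∀ c : E, substHom g (MvPolynomial.C c) = MvPolynomial.C c := fun c => by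
    simp [substHom]
  have hm : ∀ i j, (g * h).1 i j = g.1 i 0 * h.1 0 j + g.1 i 1 * h.1 1 j := fun i j => by
    change (g.1 * h.1) i j = _
    rw [Matrix.mul_apply, Fin.sum_univ_two]
  rw [hC, hC, hm, hm]
  simp only [map_add, map_mul]
  ring

lemma substHom_mem {n : ℕ} (g : SL(2, E)) {P : MvPolynomial (Fin 2) E} (hP : P ∈ Forms E n) :
    substHom g P ∈ Forms E n := by
  rw [MvPolynomial.mem_homogeneousSubmodule] at hP ⊢
  have := hP.aeval (fun j => ∑ i, MvPolynomial.C (g.1 i j) * MvPolynomial.X i) (n := 1) fun j =>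
    MvPolynomial.IsHomogeneous.sum _ _ _ fun i _ => (MvPolynomial.isHomogeneous_X E i).C_mul _
  rwa [one_mul] at this

/-- The representation `Sym^n(E²)` of `SL₂(E)`. -/
def symRep (n : ℕ) : Representation E SL(2, E) (Forms E n) where
  toFun g := (substHom g).toLinearMap.restrict fun _ => substHom_mem g
  map_one' := by
    ext P : 2
    change substHom 1 P.1 = P.1
    rw [substHom_one]; rfl
  map_mul' g h := by
    ext P : 2
    change substHom (g * h) P.1 = substHom g (substHom h P.1)
    rw [substHom_mul]; rfl

/-- The highest weight vector of `Sym^n(E²)`. -/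
def topForm (n : ℕ) : Forms E n :=
  ⟨MvPolynomial.X 0 ^ n, by
    rw [MvPolynomial.mem_homogeneousSubmodule]
    simpa using (MvPolynomial.isHomogeneous_X E (0 : Fin 2)).pow n⟩

/-- The projection of `Sym^n(E²)` onto its highest weight line, spanned by `X 0 ^ n`, along the
span of the other monomials. -/
def topProj (n : ℕ) : Forms E n →ₗ[E] Forms E n where
  toFun P := P.1.eval ![1, 0] • topForm n
  map_add' P Q := by rw [← add_smul]; simp
  map_smul' c P := by rw [RingHom.id_apply, ← mul_smul]; simp [MvPolynomial.smul_eval]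

lemma symRep_coe {n : ℕ} (g : SL(2, E)) (P : Forms E n) : (symRep n g P).1 = substHom g P.1 := rfl

lemma topProj_coe {n : ℕ} (P : Forms E n) :
    (topProj n P).1 = P.1.eval ![1, 0] • MvPolynomial.X 0 ^ n := rfl

lemma eval_scale {n : ℕ} {P : MvPolynomial (Fin 2) E} (hP : P.IsHomogeneous n) (a : E)
    (v : Fin 2 → E) : P.eval (fun i => a * v i) = a ^ n * P.eval v := by
  rw [MvPolynomial.eval_eq', MvPolynomial.eval_eq', Finset.mul_sum]
  refine Finset.sum_congr rfl fun d hd => ?_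
  have hdn : d.degree = n := by
    by_contra hne
    exact (MvPolynomial.mem_support_iff.1 hd) (hP.coeff_eq_zero hne)
  rw [← hdn, Finsupp.degree_eq_sum]
  simp only [mul_pow, Finset.prod_mul_distrib, Finset.prod_pow_eq_pow_sum]
  ring

lemma topProj_equiv (n : ℕ) {g h : SL(2, E)} (hg : g.1 1 0 = 0) (hh : h.1 0 1 = 0)
    (hgh : g.1 0 0 = h.1 0 0) : symRep n g ∘ₗ topProj n = topProj n ∘ₗ symRep n h := by
  refine LinearMap.ext fun P => Subtype.ext ?_
  rw [LinearMap.comp_apply, LinearMap.comp_apply, symRep_coe, topProj_coe, topProj_coe, symRep_coe]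
  have hP : P.1.IsHomogeneous n := P.2
  have h1 : (substHom h P.1).eval ![1, 0] = (h.1 0 0) ^ n * P.1.eval ![1, 0] := by
    rw [← eval_scale hP]
    have : (MvPolynomial.aeval ![(1 : E), 0]).comp (substHom h) =
        MvPolynomial.aeval (fun i => h.1 0 0 * (![1, 0] : Fin 2 → E) i) := by
      ext j : 1
      rw [AlgHom.comp_apply, substHom_X]
      fin_cases j <;> simp [Fin.sum_univ_two, hh]
    exact DFunLike.congr_fun this P.1
  have h2 : substHom g (P.1.eval ![1, 0] • MvPolynomial.X 0 ^ n) =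
      P.1.eval ![1, 0] • (substHom g (MvPolynomial.X 0)) ^ n := by
    rw [map_smul, map_pow]
  rw [h1, h2, substHom_X, Fin.sum_univ_two, hg, hgh, mul_comm (h.1 0 0 ^ n), mul_smul]
  simp [mul_pow, MvPolynomial.smul_eq_C_mul]


/-- The underlying space `⨂_{i < f} Sym^{r_i}(E²)` of a weight. -/
def WtSpace (E : Type*) [Field E] {p f : ℕ} (r : Fin f → Fin p) : Type _ :=
  ⨂[E] i : Fin f, Forms E (r i : ℕ)

instance {p f : ℕ} (r : Fin f → Fin p) : AddCommGroup (WtSpace E r) :=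
  inferInstanceAs (AddCommGroup (⨂[E] i : Fin f, Forms E (r i : ℕ)))

instance {p f : ℕ} (r : Fin f → Fin p) : Module E (WtSpace E r) :=
  inferInstanceAs (Module E (⨂[E] i : Fin f, Forms E (r i : ℕ)))

/-- The tensor product of linear endomorphisms of the factors of `WtSpace`. -/
def wtMap {p f : ℕ} {r : Fin f → Fin p} (u : ∀ i, Module.End E (Forms E (r i : ℕ))) :
    Module.End E (WtSpace E r) :=
  PiTensorProduct.map (R := E) (s := fun i => Forms E (r i : ℕ))
    (t := fun i => Forms E (r i : ℕ)) u

lemma wtMap_one {p f : ℕ} {r : Fin f → Fin p} :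
    wtMap (fun i => (1 : Module.End E (Forms E (r i : ℕ)))) = 1 :=
  PiTensorProduct.map_one

lemma wtMap_mul {p f : ℕ} {r : Fin f → Fin p} (u v : ∀ i, Module.End E (Forms E (r i : ℕ))) :
    wtMap (fun i => u i * v i) = wtMap u * wtMap v :=
  PiTensorProduct.map_mul u v

variable {k : Type*} [Field k] (ι : k →+* E) (p : ℕ) [ExpChar E p] {f : ℕ} (r : Fin f → Fin p)

/-- The `i`-th Frobenius twist `SL₂(k) → SL₂(E)` of the embedding `ι`. -/
def twist (i : ℕ) : SL(2, k) →* SL(2, E) :=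
  Matrix.SpecialLinearGroup.map ((iterateFrobenius E p i).comp ι)

/-- The weight `⨂_{i < f} (Sym^{r_i}(E²))^{Frob^i}` of `SL₂(k)`. -/
def weight : Representation E SL(2, k) (WtSpace E r) where
  toFun g := wtMap fun i => symRep (r i : ℕ) (twist ι p i g)
  map_one' := by
    simp only [map_one]
    exact wtMap_one
  map_mul' g h := by
    simp only [map_mul]
    exact wtMap_mul _ _

/-- The projection of a weight onto its highest weight line along the other weight spaces.  Its
kernel is the kernel of the map to the coinvariants of the lower unipotent subgroup, its image is
the line of invariants of the upper unipotent subgroup, and it is the identity on this line. -/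
def wtProj {p f : ℕ} (r : Fin f → Fin p) : WtSpace E r →ₗ[E] WtSpace E r :=
  wtMap fun i => topProj (r i : ℕ)

lemma twist_apply (i : ℕ) (g : SL(2, k)) (a b : Fin 2) :
    (twist (E := E) ι p i g).1 a b = (ι (g.1 a b)) ^ p ^ i := by
  simp [twist, iterateFrobenius_def]

lemma wtProj_equiv {g h : SL(2, k)} (hg : g.1 1 0 = 0) (hh : h.1 0 1 = 0)
    (hgh : g.1 0 0 = h.1 0 0) :
    weight ι p r g ∘ₗ wtProj r = wtProj r ∘ₗ weight ι p r h := by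
  change wtMap _ * wtMap _ = wtMap _ * wtMap _
  rw [← wtMap_mul, ← wtMap_mul]
  have hp := expChar_ne_zero E p
  congr 1
  funext i
  refine topProj_equiv _ ?_ ?_ ?_
  · rw [twist_apply, hg, map_zero, zero_pow (pow_ne_zero _ hp)]
  · rw [twist_apply, hh, map_zero, zero_pow (pow_ne_zero _ hp)]
  · rw [twist_apply, twist_apply, hgh]

end Weights

section Hecke

variable {E : Type*} [Field E] {G : Type*} [Group G] {H : Subgroup G} {V : Type*}
  [AddCommGroup V] [Module E V] (σ : Representation E H V)

/-- A subset of `G` is finite modulo `H` if it is contained in a finite union of cosets `H s`. -/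
def FiniteMod (H : Subgroup G) (S : Set G) : Prop :=
  ∃ T : Finset G, ∀ g ∈ S, ∃ s ∈ T, g * s⁻¹ ∈ H

lemma FiniteMod.mono {S S' : Set G} (h : FiniteMod H S') (hS : S ⊆ S') : FiniteMod H S := by
  obtain ⟨T, hT⟩ := h
  exact ⟨T, fun g hg => hT g (hS hg)⟩

lemma FiniteMod.union {S S' : Set G} (h : FiniteMod H S) (h' : FiniteMod H S') :
    FiniteMod H (S ∪ S') := by
  classical
  obtain ⟨T, hT⟩ := h
  obtain ⟨T', hT'⟩ := h'
  refine ⟨T ∪ T', fun g hg => ?_⟩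
  rcases hg with hg | hg
  · obtain ⟨s, hs, h⟩ := hT g hg
    exact ⟨s, Finset.mem_union_left _ hs, h⟩
  · obtain ⟨s, hs, h⟩ := hT' g hg
    exact ⟨s, Finset.mem_union_right _ hs, h⟩

lemma FiniteMod.translate {S : Set G} (h : FiniteMod H S) (x : G) :
    FiniteMod H {g | g * x ∈ S} := by
  classical
  obtain ⟨T, hT⟩ := h
  refine ⟨T.image (· * x⁻¹), fun g hg => ?_⟩
  obtain ⟨s, hs, h⟩ := hT _ hg
  refine ⟨s * x⁻¹, Finset.mem_image_of_mem _ hs, ?_⟩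
  rwa [mul_inv_rev, inv_inv, ← mul_assoc]

/-- The space of the compact induction `ind_H^G σ`, for an open subgroup `H` and a smooth `σ`:
functions `f : G → V` with `f (h g) = σ(h) f(g)` and support finite modulo `H`. -/
def cIndSpace : Submodule E (G → V) where
  carrier := {f | (∀ (h : H) (g : G), f (h * g) = σ h (f g)) ∧ FiniteMod H {g | f g ≠ 0}}
  zero_mem' := ⟨fun h g => by simp, ∅, fun g hg => absurd rfl hg⟩
  add_mem' {f f'} hf hf' := by
    refine ⟨fun h g => by simp [hf.1, hf'.1], (hf.2.union hf'.2).mono fun g hg => ?_⟩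
    by_contra hn
    simp only [Set.mem_union, Set.mem_ofPred_eq, not_or, not_not] at hn
    exact hg (by simp [hn.1, hn.2])
  smul_mem' c f hf := by
    refine ⟨fun h g => by simp [hf.1], hf.2.mono fun g hg hn => hg (by simp [hn])⟩

/-- The compact induction `ind_H^G σ`, with `G` acting by right translation. -/
def cInd : Representation E G (cIndSpace σ) where
  toFun x :=
    { toFun := fun f => ⟨fun g => f.1 (g * x), fun h g => by
        change f.1 (h * g * x) = _
        rw [mul_assoc]; exact f.2.1 h _,
        f.2.2.translate x⟩
      map_add' := fun _ _ => rfl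
      map_smul' := fun _ _ => rfl }
  map_one' := by
    refine LinearMap.ext fun f => Subtype.ext (funext fun g => ?_)
    change f.1 (g * 1) = f.1 g
    rw [mul_one]
  map_mul' x y := by
    refine LinearMap.ext fun f => Subtype.ext (funext fun g => ?_)
    change f.1 (g * (x * y)) = f.1 (g * x * y)
    rw [mul_assoc]

lemma cInd_apply (x : G) (f : cIndSpace σ) (g : G) : (cInd σ x f).1 g = f.1 (g * x) := rfl

/-- An element of the Hecke algebra of `(H, σ)`: a function `φ : G → End(V)` with
`φ (h g h') = σ(h) φ(g) σ(h')` and support finite modulo `H`. -/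
structure HeckeFunction where
  /-- the underlying function -/
  toFun : G → V →ₗ[E] V
  left_equiv : ∀ (h : H) (g : G), toFun (h * g) = σ h ∘ₗ toFun g
  right_equiv : ∀ (h : H) (g : G), toFun (g * h) = toFun g ∘ₗ σ h
  finite : FiniteMod H {g | toFun g ≠ 0}

variable {σ} (φ : HeckeFunction σ)

/-- The convolution `(φ * f)(g) = ∑_{H x ∈ H \ G} φ (g x⁻¹) (f x)`. -/
def HeckeFunction.conv (f : G → V) (g : G) : V :=
  ∑ᶠ c : Quotient (QuotientGroup.rightRel H), φ.toFun (g * c.out⁻¹) (f c.out)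

lemma HeckeFunction.term_eq (f : cIndSpace σ) (g x : G) :
    φ.toFun (g * (Quotient.mk (QuotientGroup.rightRel H) x).out⁻¹)
      (f.1 (Quotient.mk (QuotientGroup.rightRel H) x).out) = φ.toFun (g * x⁻¹) (f.1 x) := by
  have h : QuotientGroup.rightRel H (Quotient.mk (QuotientGroup.rightRel H) x).out x :=
    Quotient.exact (Quotient.out_eq _)
  rw [QuotientGroup.rightRel_apply] at h
  generalize (Quotient.mk (QuotientGroup.rightRel H) x).out = y at h ⊢
  obtain ⟨k, hk⟩ : ∃ k : H, (k : G) = x * y⁻¹ := ⟨⟨_, h⟩, rfl⟩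
  have hx : x = k * y := by rw [hk]; group
  have h1 : g * y⁻¹ = g * x⁻¹ * k := by rw [hx]; group
  rw [h1, φ.right_equiv, hx, f.2.1]
  rfl

lemma HeckeFunction.finite_support (f : cIndSpace σ) (g : G) :
    (Function.support fun c : Quotient (QuotientGroup.rightRel H) =>
      φ.toFun (g * c.out⁻¹) (f.1 c.out)).Finite := by
  obtain ⟨T, hT⟩ := f.2.2
  refine (T.finite_toSet.image (Quotient.mk (QuotientGroup.rightRel H))).subset fun c hc => ?_
  have hf : f.1 c.out ≠ 0 := fun h0 => hc (by simp [h0])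
  obtain ⟨s, hs, h⟩ := hT _ hf
  refine ⟨s, hs, ?_⟩
  rw [← Quotient.out_eq c]
  exact Quotient.sound (QuotientGroup.rightRel_apply.2 h)

lemma HeckeFunction.conv_mem (f : cIndSpace σ) : φ.conv f.1 ∈ cIndSpace σ := by
  classical
  constructor
  · intro h g
    unfold HeckeFunction.conv
    rw [map_finsum _ (φ.finite_support f g)]
    refine finsum_congr fun c => ?_
    rw [mul_assoc, φ.left_equiv]; rfl
  · obtain ⟨T, hT⟩ := f.2.2
    obtain ⟨T', hT'⟩ := φ.finite
    refine ⟨(T' ×ˢ T).image fun s => s.1 * s.2, fun g hg => ?_⟩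
    obtain ⟨c, hc⟩ : ∃ c : Quotient (QuotientGroup.rightRel H),
        φ.toFun (g * c.out⁻¹) (f.1 c.out) ≠ 0 := by
      by_contra hn
      push Not at hn
      exact hg (finsum_eq_zero_of_forall_eq_zero hn)
    have hf : f.1 c.out ≠ 0 := fun h0 => hc (by simp [h0])
    obtain ⟨s, hs, h⟩ := hT _ hf
    have hcs : c = Quotient.mk (QuotientGroup.rightRel H) s := by
      rw [← Quotient.out_eq c]
      exact Quotient.sound (QuotientGroup.rightRel_apply.2 (by
        have := H.inv_mem h
        rwa [mul_inv_rev, inv_inv] at this))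
    rw [hcs, φ.term_eq] at hc
    have hφ : φ.toFun (g * s⁻¹) ≠ 0 := fun h0 => hc (by simp [h0])
    obtain ⟨s', hs', h'⟩ := hT' _ hφ
    refine ⟨s' * s, Finset.mem_image.2 ⟨(s', s), Finset.mem_product.2 ⟨hs', hs⟩, rfl⟩, ?_⟩
    rwa [mul_inv_rev, ← mul_assoc]

/-- The Hecke operator on `ind_H^G σ` given by `φ`. -/
def HeckeFunction.op : cIndSpace σ →ₗ[E] cIndSpace σ where
  toFun f := ⟨φ.conv f.1, φ.conv_mem f⟩
  map_add' f f' := by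
    refine Subtype.ext (funext fun g => ?_)
    change φ.conv (f.1 + f'.1) g = φ.conv f.1 g + φ.conv f'.1 g
    unfold HeckeFunction.conv
    rw [← finsum_add_distrib (φ.finite_support f g) (φ.finite_support f' g)]
    exact finsum_congr fun c => by simp
  map_smul' a f := by
    refine Subtype.ext (funext fun g => ?_)
    change φ.conv (a • f.1) g = a • φ.conv f.1 g
    unfold HeckeFunction.conv
    rw [smul_finsum]
    exact finsum_congr fun c => by simp

lemma HeckeFunction.op_comm (x : G) (f : cIndSpace σ) :
    φ.op (cInd σ x f) = cInd σ x (φ.op f) := by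
  refine Subtype.ext (funext fun g => ?_)
  rw [cInd_apply]
  change φ.conv (cInd σ x f).1 g = φ.conv f.1 (g * x)
  unfold HeckeFunction.conv
  have hwd : ∀ (y : G) (a b : G), QuotientGroup.rightRel H a b →
      QuotientGroup.rightRel H (a * y) (b * y) := fun y a b h => by
    rw [QuotientGroup.rightRel_apply] at h ⊢
    simpa using h
  let e : Quotient (QuotientGroup.rightRel H) ≃ Quotient (QuotientGroup.rightRel H) :=
    { toFun := Quotient.map (· * x) (fun a b h => hwd x a b h)
      invFun := Quotient.map (· * x⁻¹) (fun a b h => hwd x⁻¹ a b h)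
      left_inv := fun c => by
        induction c using Quotient.inductionOn with
        | h a => simp
      right_inv := fun c => by
        induction c using Quotient.inductionOn with
        | h a => simp }
  rw [← finsum_comp_equiv e (f := fun c => φ.toFun (g * x * c.out⁻¹) (f.1 c.out))]
  refine finsum_congr fun c => ?_
  induction c using Quotient.inductionOn with
  | h a =>
    rw [φ.term_eq (cInd σ x f)]
    change _ = φ.toFun (g * x * (Quotient.mk (QuotientGroup.rightRel H) (a * x)).out⁻¹)
      (f.1 (Quotient.mk (QuotientGroup.rightRel H) (a * x)).out)
    rw [φ.term_eq f, cInd_apply]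
    congr 2
    group

/-- The image of `T - a`, where `T` is the Hecke operator given by `φ`. -/
def HeckeFunction.image (a : E) : Submodule E (cIndSpace σ) :=
  LinearMap.range (φ.op - a • LinearMap.id)

lemma HeckeFunction.image_le (a : E) (x : G) :
    φ.image a ≤ (φ.image a).comap (cInd σ x) := by
  rintro _ ⟨f, rfl⟩
  refine ⟨cInd σ x f, ?_⟩
  simp [φ.op_comm]

/-- The representation `ind_H^G σ / (T - a)`, where `T` is the Hecke operator given by `φ`. -/
def HeckeFunction.cokernel (a : E) : Representation E G (cIndSpace σ ⧸ φ.image a) :=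
  (cInd σ).quotient (φ.image a) (φ.image_le a)

/-- The function supported on the double coset `H t H` with `φ (h t h') = σ(h) A σ(h')`. -/
def doubleCosetFun (σ : Representation E H V) (t : G) (A : V →ₗ[E] V) (g : G) : V →ₗ[E] V :=
  open Classical in
  if h : ∃ k : H × H, g = k.1 * t * k.2 then σ h.choose.1 ∘ₗ A ∘ₗ σ h.choose.2 else 0

lemma doubleCosetFun_apply {t : G} {A : V →ₗ[E] V}
    (hA : ∀ k k' : H, (k : G) * t = t * k' → σ k ∘ₗ A = A ∘ₗ σ k') (k k' : H) :
    doubleCosetFun σ t A (k * t * k') = σ k ∘ₗ A ∘ₗ σ k' := by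
  have h : ∃ l : H × H, (k : G) * t * k' = l.1 * t * l.2 := ⟨(k, k'), rfl⟩
  rw [doubleCosetFun, dif_pos h]
  have hl := h.choose_spec
  generalize h.choose = l at hl ⊢
  have h1 : ((l.1⁻¹ * k : H) : G) * t = t * ((l.2 * k'⁻¹ : H) : G) := by
    push_cast
    calc (l.1 : G)⁻¹ * k * t = (l.1 : G)⁻¹ * (k * t * k') * (k' : G)⁻¹ := by group
      _ = t * (l.2 * (k' : G)⁻¹) := by rw [hl]; group
  have h2 := hA _ _ h1
  have e1 : σ k = σ l.1 ∘ₗ σ (l.1⁻¹ * k) := by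
    rw [← Module.End.mul_eq_comp, ← map_mul, mul_inv_cancel_left]
  have e2 : σ l.2 = σ (l.2 * k'⁻¹) ∘ₗ σ k' := by
    rw [← Module.End.mul_eq_comp, ← map_mul, inv_mul_cancel_right]
  rw [e1, e2, LinearMap.comp_assoc, ← LinearMap.comp_assoc (σ k') A, h2]
  rfl

/-- The Hecke function supported on the double coset `H t H` with value `A` at `t`. -/
def doubleCoset (σ : Representation E H V) (t : G) (A : V →ₗ[E] V)
    (hA : ∀ k k' : H, (k : G) * t = t * k' → σ k ∘ₗ A = A ∘ₗ σ k')
    (hfin : FiniteMod H {g | ∃ k : H, g = t * k}) : HeckeFunction σ where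
  toFun := doubleCosetFun σ t A
  left_equiv h g := by
    by_cases hg : ∃ k : H × H, g = k.1 * t * k.2
    · obtain ⟨⟨k, k'⟩, rfl⟩ := hg
      have e : (h : G) * (k * t * k') = (h * k : H) * t * k' := by push_cast; group
      rw [e, doubleCosetFun_apply hA, doubleCosetFun_apply hA, map_mul]
      rfl
    · have hg' : ¬ ∃ k : H × H, (h : G) * g = k.1 * t * k.2 := by
        rintro ⟨⟨k, k'⟩, hk⟩
        refine hg ⟨(h⁻¹ * k, k'), ?_⟩
        push_cast
        rw [mul_assoc, mul_assoc, ← mul_assoc (k : G), ← hk, inv_mul_cancel_left]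
      rw [doubleCosetFun, doubleCosetFun, dif_neg hg, dif_neg hg', LinearMap.comp_zero]
  right_equiv h g := by
    by_cases hg : ∃ k : H × H, g = k.1 * t * k.2
    · obtain ⟨⟨k, k'⟩, rfl⟩ := hg
      have e : (k * t * k' : G) * h = k * t * (k' * h : H) := by push_cast; group
      rw [e, doubleCosetFun_apply hA, doubleCosetFun_apply hA, map_mul]
      rfl
    · have hg' : ¬ ∃ k : H × H, g * (h : G) = k.1 * t * k.2 := by
        rintro ⟨⟨k, k'⟩, hk⟩
        refine hg ⟨(k, k' * h⁻¹), ?_⟩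
        push_cast
        rw [← mul_assoc, ← hk, mul_inv_cancel_right]
      rw [doubleCosetFun, doubleCosetFun, dif_neg hg, dif_neg hg', LinearMap.zero_comp]
  finite := by
    obtain ⟨T, hT⟩ := hfin
    refine ⟨T, fun g hg => ?_⟩
    by_cases h : ∃ k : H × H, g = k.1 * t * k.2
    · obtain ⟨⟨k, k'⟩, rfl⟩ := h
      obtain ⟨s, hs, h⟩ := hT (t * k') ⟨k', rfl⟩
      refine ⟨s, hs, ?_⟩
      have := H.mul_mem k.2 h
      simpa [mul_assoc] using this
    · exact absurd (by rw [doubleCosetFun, dif_neg h]) hg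

variable (c : G ≃* G)

/-- The transport of a representation of `H` to the image of `H` under an automorphism of `G`:
`h' ↦ σ (c⁻¹ h')`. -/
def transport (σ : Representation E H V) : Representation E (H.map c.toMonoidHom) V :=
  σ.comp (c.subgroupMap H).symm.toMonoidHom

lemma transport_apply (h : H.map c.toMonoidHom) :
    transport c σ h = σ ⟨c.symm h, by
      obtain ⟨k, hk, h'⟩ := h.2
      rw [← h']
      simpa using hk⟩ := by
  unfold transport
  change σ ((c.subgroupMap H).symm h) = _
  congr 1

/-- The transport of a Hecke function along an automorphism of `G`. -/
def HeckeFunction.transport : HeckeFunction (transport c σ) where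
  toFun g := φ.toFun (c.symm g)
  left_equiv h g := by
    rw [transport_apply, map_mul, ← φ.left_equiv]
  right_equiv h g := by
    rw [transport_apply, map_mul, ← φ.right_equiv]
  finite := by
    classical
    obtain ⟨T, hT⟩ := φ.finite
    refine ⟨T.image c, fun g hg => ?_⟩
    obtain ⟨s, hs, h⟩ := hT _ hg
    refine ⟨c s, Finset.mem_image_of_mem _ hs, c.symm g * s⁻¹, h, ?_⟩
    simp

end Hecke

section Weyl

variable {F : Type*} [Field F] [ValuativeRel F] [TopologicalSpace F] [IsNonarchimedeanLocalField F]

variable (F) in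
/-- The uniformizers of `F`. -/
abbrev Uniformizer : Type _ := {x : 𝒪[F] // Irreducible x}

/-- A uniformizer as an element of `F`. -/
def Uniformizer.val (ϖ : Uniformizer F) : F := (ϖ.1 : F)

lemma Uniformizer.ne_zero (ϖ : Uniformizer F) : ϖ.val ≠ 0 := by
  intro h
  exact ϖ.2.ne_zero (Subtype.ext h)

lemma Uniformizer.val_lt (ϖ : Uniformizer F) : ValuativeRel.valuation F ϖ.val < 1 := by
  have h := ϖ.2.not_isUnit
  rw [(Valuation.integer.integers (ValuativeRel.valuation F)).isUnit_iff_valuation_eq_one] at h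
  exact lt_of_le_of_ne ϖ.1.2 h

/-- The diagonal matrix with entries `x, x⁻¹`. -/
def hMat (x : Fˣ) : SL(2, F) :=
  ⟨!![(x : F), 0; 0, (x : F)⁻¹], by simp [Matrix.det_fin_two_of]⟩

/-- The preferred lift `h̃(x) = (diag(x, x⁻¹), (-1, x))` to the metaplectic cover. -/
def hTilde (x : Fˣ) : Mp F := mk (hMat x) (hilb (-1) (x : F))

/-- The unit of `F` given by a uniformizer. -/
def Uniformizer.unit (ϖ : Uniformizer F) : Fˣ := Units.mk0 ϖ.val ϖ.ne_zero

lemma hMat_gl (x : Fˣ) : ((hMat x : SL(2, F)) : GL (Fin 2) F) =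
    gl (x : F) 0 0 (x : F)⁻¹ (by simp) := by
  apply Units.ext
  rw [gl_val]
  rfl

lemma gl_inj {a b c d a' b' c' d' : F} {h : a * d - b * c = 1} {h' : a' * d' - b' * c' = 1}
    (e : gl a b c d h = gl a' b' c' d' h') : a = a' ∧ b = b' ∧ c = c' ∧ d = d' := by
  have e1 := congrArg (fun g : GL (Fin 2) F => (g : Matrix (Fin 2) (Fin 2) F)) e
  simp only [gl_val] at e1
  exact ⟨congrFun (congrFun e1 0) 0, congrFun (congrFun e1 0) 1, congrFun (congrFun e1 1) 0,
    congrFun (congrFun e1 1) 1⟩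

/-- The sign computation behind the existence of the Hecke operator. -/
lemma sign_aux {x : F} (hx : x ≠ 0) (hx1 : ValuativeRel.valuation F x < 1)
    {a b c d b' c' : F} {h : a * d - b * c = 1} {h' : a * d - b' * c' = 1}
    (hk : IsK (gl a b c d h)) (hk' : IsK (gl a b' c' d h')) (hc : c = x * x * c')
    (h0 : x * x⁻¹ - 0 * 0 = 1) :
    cocycle (gl x 0 0 x⁻¹ h0) (gl a b c d h) * theta (gl a b c d h) =
      cocycle (gl a b' c' d h') (gl x 0 0 x⁻¹ h0) * theta (gl a b' c' d h') := by
  obtain ⟨ha1, hb1, hc1, hd1⟩ := gl_isK.1 hk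
  obtain ⟨-, -, hc1', -⟩ := gl_isK.1 hk'
  have hxi := inv_ne_zero hx
  have hX := X_gl (h := h) ▸ X_ne (gl a b c d h)
  have hX' := X_gl (h := h') ▸ X_ne (gl a b' c' d h')
  have hxx : x * x ≠ 0 := mul_ne_zero hx hx
  rw [cocycle_gl, cocycle_gl, gl_mul, gl_mul]
  simp only [X_gl, xRow_zero, mul_zero, zero_mul, add_zero, zero_add]
  rw [xRow_mul hxi, mul_div_cancel_left₀ _ hxi, mul_div_cancel_right₀ _ hX]
  by_cases h0' : c' = 0
  · subst h0'
    have hc0 : c = 0 := by rw [hc, mul_zero]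
    subst hc0
    have hd0 : d ≠ 0 := by simpa [xRow_zero] using hX
    simp only [zero_mul, xRow_zero, theta_gl_zero]
    rw [mul_div_cancel_left₀ _ hd0, mul_div_cancel_right₀ _ hxi, hilb_symm hd0 hxi]
  · have hc0 : c ≠ 0 := by rw [hc]; exact mul_ne_zero hxx h0'
    have hcl : ValuativeRel.valuation F c < 1 := by
      rw [hc, map_mul, map_mul]
      exact (mul_le_of_le_one_right' hc1').trans_lt ((mul_le_of_le_one_right' hx1.le).trans_lt hx1)
    have hd := (val_both (val_of_res (res_ad h hb1 hcl)) ha1 hd1).2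
    have hd0 := val_ne hd
    have hcx : c' * x ≠ 0 := mul_ne_zero h0' hx
    rw [xRow_ne hc0, xRow_ne h0', xRow_ne hcx, mul_div_cancel_left₀ _ h0', div_inv_eq_mul,
      theta_gl_nonunit hc0 hcl]
    have ht : theta (gl a b' c' d h') = hilb c' d := by
      rcases eq_or_lt_of_le hc1' with hu | hu
      · rw [theta_gl_unit hu, hilb_val hu hd]
      · rw [theta_gl_nonunit h0' hu]
    rw [ht, hc, mul_assoc c', mul_comm (x * x) c', hilb_mul_left h0' hxx hxi,
      hilb_mul_left h0' hxx hd0, hilb_mul_self_left hxi hx, hilb_mul_self_left hd0 hx,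
      hilb_mul_right hx h0' hxx, hilb_mul_self_right hx hx, hilb_inv_right h0' hx,
      hilb_symm hx h0', mul_one, mul_one]

lemma comm_entries {x : Fˣ} {k k' : Kt F} (e : hTilde x * k = k' * hTilde x) :
    ∃ a b c d b' c' : F, ∃ h h', k.1.1.mat = gl a b c d h ∧ k'.1.1.mat = gl a b' c' d h' ∧
      c = x * x * c' ∧ b' = x * x * b := by
  have hx : (x : F) ≠ 0 := x.ne_zero
  obtain ⟨a, b, c, d, h, e1⟩ := gl_eq (IsK.inv (IsK.inv k.2)).1
  obtain ⟨a', b', c', d', h', e2⟩ := gl_eq (IsK.inv (IsK.inv k'.2)).1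
  rw [inv_inv] at e1 e2
  have e3 : ((hMat x : SL(2, F)) : GL (Fin 2) F) * k.1.1.mat =
      k'.1.1.mat * ((hMat x : SL(2, F)) : GL (Fin 2) F) :=
    congrArg (fun y : Mp F => y.1.mat) e
  rw [e1, e2, hMat_gl, gl_mul, gl_mul] at e3
  obtain ⟨h1, h2, h3, h4⟩ := gl_inj e3
  have ha : a' = a := by
    apply mul_right_cancel₀ hx; linear_combination -h1
  have hd : d' = d := by
    apply mul_right_cancel₀ (inv_ne_zero hx); linear_combination -h4
  subst ha hd
  refine ⟨a', b, c, d', b', c', h, h', e1, e2, ?_, ?_⟩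
  · field_simp at h3; linear_combination h3
  · field_simp at h2; linear_combination -h2

lemma comm_sign {ϖ : Uniformizer F} {k k' : Kt F}
    (e : hTilde ϖ.unit * k = k' * hTilde ϖ.unit) : kSign F k = kSign F k' := by
  obtain ⟨a, b, c, d, b', c', h, h', e1, e2, hc, hb⟩ := comm_entries e
  have hk : IsK (gl a b c d h) := e1 ▸ k.2
  have hk' : IsK (gl a b' c' d h') := e2 ▸ k'.2
  have key := sign_aux ϖ.ne_zero ϖ.val_lt hk hk' hc (by rw [mul_inv_cancel₀ ϖ.ne_zero]; ring)
  have e3 : hilb (-1) ϖ.val * k.1.1.sgn *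
      cocycle ((hMat ϖ.unit : SL(2, F)) : GL (Fin 2) F) k.1.1.mat =
      k'.1.1.sgn * hilb (-1) ϖ.val * cocycle k'.1.1.mat ((hMat ϖ.unit : SL(2, F)) : GL (Fin 2) F) :=
    congrArg (fun y : Mp F => y.1.sgn) e
  rw [hMat_gl, e1, e2] at e3
  change k.1.1.sgn * theta k.1.1.mat = k'.1.1.sgn * theta k'.1.1.mat
  rw [e1, e2]
  change hilb (-1) ϖ.val * k.1.1.sgn * cocycle (gl ϖ.val 0 0 (ϖ.val)⁻¹ _) (gl a b c d h) =
      k'.1.1.sgn * hilb (-1) ϖ.val * cocycle (gl a b' c' d h') (gl ϖ.val 0 0 (ϖ.val)⁻¹ _) at e3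
  rw [← sgnAdd_inj] at *
  simp only [sgnAdd_mul] at *
  grind

lemma comm_reduction {ϖ : Uniformizer F} {k k' : Kt F}
    (e : hTilde ϖ.unit * k = k' * hTilde ϖ.unit) :
    (reduction F k).1 1 0 = 0 ∧ (reduction F k').1 0 1 = 0 ∧
      (reduction F k).1 0 0 = (reduction F k').1 0 0 := by
  obtain ⟨a, b, c, d, b', c', h, h', e1, e2, hc, hb⟩ := comm_entries e
  have hk : IsK (gl a b c d h) := e1 ▸ k.2
  have hk' : IsK (gl a b' c' d h') := e2 ▸ k'.2
  obtain ⟨ha1, hb1, hc1, hd1⟩ := gl_isK.1 hk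
  obtain ⟨-, -, hc1', -⟩ := gl_isK.1 hk'
  have hz : ∀ y : F, ValuativeRel.valuation F y ≤ 1 → res (ϖ.val * ϖ.val * y) = 0 := fun y hy => by
    have : ValuativeRel.valuation F (ϖ.val * ϖ.val * y) < 1 := by
      rw [map_mul, map_mul]
      exact (mul_le_of_le_one_right' hy).trans_lt
        ((mul_le_of_le_one_right' ϖ.val_lt.le).trans_lt ϖ.val_lt)
    exact (res_eq_zero this.le).2 this
  refine ⟨?_, ?_, ?_⟩
  · change res ((k.1.1.mat : Matrix (Fin 2) (Fin 2) F) 1 0) = 0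
    rw [e1]
    change res c = 0
    rw [hc]; exact hz _ hc1'
  · change res ((k'.1.1.mat : Matrix (Fin 2) (Fin 2) F) 0 1) = 0
    rw [e2]
    change res b' = 0
    rw [hb]; exact hz _ hb1
  · change res ((k.1.1.mat : Matrix (Fin 2) (Fin 2) F) 0 0) =
      res ((k'.1.1.mat : Matrix (Fin 2) (Fin 2) F) 0 0)
    rw [e1, e2]; rfl

lemma finite_quot (ϖ : Uniformizer F) : Finite (𝒪[F] ⧸ Ideal.span {ϖ.1 * ϖ.1}) := by
  have h1 : 𝓂[F] = Ideal.span {ϖ.1} := ϖ.2.maximalIdeal_eq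
  have h2 : Ideal.span {ϖ.1 * ϖ.1} = 𝓂[F] ^ 2 := by
    rw [h1, Ideal.span_singleton_pow, pow_two]
  rw [h2]
  have : Finite (𝒪[F] ⧸ 𝓂[F]) := inferInstanceAs (Finite 𝓀[F])
  exact Ideal.finite_quotient_pow (h1 ▸ ⟨{ϖ.1}, by simp⟩) 2

/-- An entry of an element of `K̃` as an integer of `F`. -/
def ktEntry (k : Kt F) (i j : Fin 2) : 𝒪[F] :=
  ⟨(k.1.1.mat : Matrix (Fin 2) (Fin 2) F) i j, k.2.2 i j⟩

lemma finite_doubleCoset (ϖ : Uniformizer F) :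
    FiniteMod (Kt F) {g | ∃ k : Kt F, g = (hTilde ϖ.unit)⁻¹ * k} := by
  classical
  have := finite_quot ϖ
  let κ : Kt F → (𝒪[F] ⧸ Ideal.span {ϖ.1 * ϖ.1}) × (𝒪[F] ⧸ Ideal.span {ϖ.1 * ϖ.1}) := fun k =>
    (Ideal.Quotient.mk _ (ktEntry k 0 0), Ideal.Quotient.mk _ (ktEntry k 0 1))
  have hfin : (Set.range κ).Finite := Set.toFinite _
  choose s hs using fun y : Set.range κ => y.2
  have : Fintype (Set.range κ) := hfin.fintype
  refine ⟨Finset.univ.image fun y => (hTilde ϖ.unit)⁻¹ * (s y : Mp F), ?_⟩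
  rintro g ⟨k, rfl⟩
  refine ⟨_, Finset.mem_image_of_mem _ (Finset.mem_univ ⟨κ k, k, rfl⟩), ?_⟩
  have hk0 := hs ⟨κ k, k, rfl⟩
  generalize s ⟨κ k, k, rfl⟩ = k0 at hk0 ⊢
  obtain ⟨h1, h2⟩ := Prod.ext_iff.1 hk0
  simp only [κ] at h1 h2
  rw [Ideal.Quotient.eq, Ideal.mem_span_singleton] at h1 h2
  obtain ⟨u, hu⟩ := h1
  obtain ⟨v, hv⟩ := h2
  obtain ⟨a, b, c, d, h, e1⟩ := gl_eq (IsK.inv (IsK.inv k.2)).1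
  obtain ⟨a', b', c', d', h', e2⟩ := gl_eq (IsK.inv (IsK.inv k0.2)).1
  rw [inv_inv] at e1 e2
  have hk : IsK (gl a b c d h) := e1 ▸ k.2
  have hk' : IsK (gl a' b' c' d' h') := e2 ▸ k0.2
  obtain ⟨ha1, hb1, hc1, hd1⟩ := gl_isK.1 hk
  obtain ⟨ha1', hb1', hc1', hd1'⟩ := gl_isK.1 hk'
  have hu' : a' - a = ϖ.val * ϖ.val * u := by
    have := congrArg (fun y : 𝒪[F] => (y : F)) hu
    change (k0.1.1.mat : Matrix (Fin 2) (Fin 2) F) 0 0 - (k.1.1.mat : Matrix (Fin 2) (Fin 2) F) 0 0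
      = ϖ.val * ϖ.val * u at this
    rwa [e1, e2] at this
  have hv' : b' - b = ϖ.val * ϖ.val * v := by
    have := congrArg (fun y : 𝒪[F] => (y : F)) hv
    change (k0.1.1.mat : Matrix (Fin 2) (Fin 2) F) 0 1 - (k.1.1.mat : Matrix (Fin 2) (Fin 2) F) 0 1
      = ϖ.val * ϖ.val * v at this
    rwa [e1, e2] at this
  have hx := ϖ.ne_zero
  have inv_gl : ∀ {a b c d : F} (h : a * d - b * c = 1),
      (gl a b c d h)⁻¹ = gl d (-b) (-c) a (by linear_combination h) := by
    intro a b c d h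
    rw [inv_eq_iff_mul_eq_one, gl_mul]
    apply Units.ext
    rw [gl_val, Units.val_one, Matrix.one_fin_two]
    congr 1
    ext i j
    fin_cases i <;> fin_cases j <;> simp
    · linear_combination h
    · ring
    · ring
    · linear_combination h
  change IsK (((hMat ϖ.unit : SL(2, F)) : GL (Fin 2) F)⁻¹ * k.1.1.mat *
    (((hMat ϖ.unit : SL(2, F)) : GL (Fin 2) F)⁻¹ * k0.1.1.mat)⁻¹)
  rw [mul_inv_rev, inv_inv, hMat_gl, e1, e2]
  change IsK ((gl ϖ.val 0 0 (ϖ.val)⁻¹ _)⁻¹ * gl a b c d h * ((gl a' b' c' d' h')⁻¹ *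
    gl ϖ.val 0 0 (ϖ.val)⁻¹ _))
  have fin : gl (a * d' - b * c') (b * u - a * v) (ϖ.val * ϖ.val * (c * d' - d * c'))
      (d * a' - c * b') (by
        apply mul_left_cancel₀ hx
        linear_combination ϖ.val * h * (a' * d' - b' * c') + ϖ.val * h' +
          ϖ.val * (c * d' - d * c') * (b * hu' - a * hv')) =
      (gl ϖ.val 0 0 (ϖ.val)⁻¹ (by rw [mul_inv_cancel₀ hx]; ring))⁻¹ * gl a b c d h *
      ((gl a' b' c' d' h')⁻¹ * gl ϖ.val 0 0 (ϖ.val)⁻¹ (by rw [mul_inv_cancel₀ hx]; ring)) := by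
    rw [inv_gl, inv_gl, gl_mul, gl_mul, gl_mul]
    apply gl_congr
    · field_simp; ring
    · field_simp; linear_combination a * hv' - b * hu'
    · ring
    · field_simp; ring
  rw [← fin, gl_isK]
  have hm : ∀ {y z : F}, ValuativeRel.valuation F y ≤ 1 → ValuativeRel.valuation F z ≤ 1 →
      ValuativeRel.valuation F (y * z) ≤ 1 := fun hy hz => by
    rw [map_mul]; exact mul_le_one' hy hz
  have hsub : ∀ {y z : F}, ValuativeRel.valuation F y ≤ 1 → ValuativeRel.valuation F z ≤ 1 →
      ValuativeRel.valuation F (y - z) ≤ 1 := fun hy hz =>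
    (Valuation.map_sub _ _ _).trans (max_le hy hz)
  exact ⟨hsub (hm ha1 hd1') (hm hb1 hc1'), hsub (hm hb1 u.2) (hm ha1 v.2),
    hm (hm ϖ.val_lt.le ϖ.val_lt.le) (hsub (hm hc1 hd1') (hm hd1 hc1')),
    hsub (hm hd1 ha1') (hm hc1 hb1')⟩

variable {E : Type*} [Field E] (ι : 𝓀[F] →+* E) (p : ℕ) [ExpChar E p] {f : ℕ} (r : Fin f → Fin p)

/-- The weight `σ̃_r` of `K̃`: the genuine representation `(k, ζ) ↦ ζ θ(k) σ_r(k mod ϖ)`. -/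
def genWeight : Representation E (Kt F) (WtSpace E r) where
  toFun k := ((kSign F k : ℤ) : E) • weight ι p r (reduction F k)
  map_one' := by simp
  map_mul' x y := by
    rw [map_mul, map_mul, map_mul, Units.val_mul, Int.cast_mul, smul_mul_smul_comm]

/-- The generator of the genuine spherical Hecke algebra of `σ̃_r`: it is supported on
`K̃ h̃(ϖ)⁻¹ K̃` and its value at `h̃(ϖ)⁻¹` is the projection onto the highest weight line. -/
def heckeGen (ϖ : Uniformizer F) : HeckeFunction (genWeight ι p r) :=
  doubleCoset (genWeight ι p r) (hTilde ϖ.unit)⁻¹ (wtProj r) (fun k k' e => by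
    have e' : hTilde ϖ.unit * k = k' * hTilde ϖ.unit := by
      have h1 := congrArg (fun y => hTilde ϖ.unit * y * hTilde ϖ.unit) e
      simpa [mul_assoc] using h1
    obtain ⟨h1, h2, h3⟩ := comm_reduction e'
    have h4 := wtProj_equiv ι p r h1 h2 h3
    change (((kSign F k : ℤ) : E) • weight ι p r (reduction F k)) ∘ₗ wtProj r =
      wtProj r ∘ₗ (((kSign F k' : ℤ) : E) • weight ι p r (reduction F k'))
    rw [comm_sign e', LinearMap.smul_comp, LinearMap.comp_smul, h4]) (finite_doubleCoset ϖ)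

/-- The element `(diag(1, ϖ), 1)` of the cover of `GL₂(F)`. -/
def alphaTilde (ϖ : Uniformizer F) : GLCover F :=
  ⟨Matrix.GeneralLinearGroup.mkOfDetNeZero !![1, 0; 0, ϖ.val] (by
    simpa [Matrix.det_fin_two_of] using ϖ.ne_zero), 1⟩

/-- Conjugation by `α̃` on the metaplectic cover. -/
def conjAlpha (ϖ : Uniformizer F) : Mp F ≃* Mp F :=
  MulAut.conjNormal (alphaTilde ϖ)

end Weyl

section Topology

variable {F : Type*} [Field F] [ValuativeRel F] [TopologicalSpace F] [IsNonarchimedeanLocalField F]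

/-- The image in `SL₂(F)` of an element of the metaplectic cover. -/
def toSL (x : Mp F) : SL(2, F) :=
  ⟨(x.1.mat : Matrix (Fin 2) (Fin 2) F), by
    have h := x.2
    rw [MonoidHom.mem_ker] at h
    have h2 := congrArg (fun u : Fˣ => (u : F)) h
    simpa [GLCover.proj] using h2⟩

lemma toSL_coe (x : Mp F) : ((toSL x : SL(2, F)) : GL (Fin 2) F) = x.1.mat :=
  Units.ext rfl

lemma toSL_mul (x y : Mp F) : toSL (x * y) = toSL x * toSL y := rfl

lemma toSL_mk (g : SL(2, F)) (ζ : ℤˣ) : toSL (mk g ζ) = g := rfl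

lemma mp_ext {x y : Mp F} (h : toSL x = toSL y) (h' : x.1.sgn = y.1.sgn) : x = y := by
  refine Subtype.ext (GLCover.ext ?_ h')
  rw [← toSL_coe, ← toSL_coe, h]

/-- Conjugation by `x` preserves the section `k ↦ (k, 1)` near the identity. -/
def ConjGood (x : Mp F) : Prop :=
  ∀ᶠ k in 𝓝 (1 : SL(2, F)), x * mk k 1 = mk (toSL x * k * (toSL x)⁻¹) 1 * x

lemma tendsto_conj (g : SL(2, F)) :
    Filter.Tendsto (fun k => g * k * g⁻¹) (𝓝 (1 : SL(2, F))) (𝓝 1) := by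
  have h : Continuous fun k : SL(2, F) => g * k * g⁻¹ := by fun_prop
  have h1 := h.tendsto 1
  simpa using h1

lemma ConjGood.mul {x y : Mp F} (hx : ConjGood x) (hy : ConjGood y) : ConjGood (x * y) := by
  have h1 := (tendsto_conj (toSL y)).eventually hx
  filter_upwards [h1, hy] with k h1 h2
  rw [mul_assoc, h2, ← mul_assoc, h1, toSL_mul, mul_inv_rev]
  simp only [mul_assoc]

lemma conjGood_of (x : Mp F) (h : ∀ᶠ k : SL(2, F) in 𝓝 (1 : SL(2, F)),
    cocycle x.1.mat (k : GL (Fin 2) F) = cocycle ((toSL x * k * (toSL x)⁻¹ : SL(2, F)) : GL (Fin 2) F) x.1.mat) :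
    ConjGood x := by
  filter_upwards [h] with k hk
  refine mp_ext ?_ ?_
  · rw [toSL_mul, toSL_mul]
    change toSL x * k = toSL x * k * (toSL x)⁻¹ * toSL x
    group
  · change x.1.sgn * 1 * cocycle x.1.mat k = 1 * x.1.sgn * cocycle _ x.1.mat
    rw [hk, one_mul, mul_one]
    rfl

/-- Explicit elements of `SL₂(F)`. -/
def sl (a b c d : F) (h : a * d - b * c = 1) : SL(2, F) :=
  ⟨!![a, b; c, d], by rw [Matrix.det_fin_two_of, h]⟩

lemma sl_coe (a b c d : F) (h : a * d - b * c = 1) :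
    ((sl a b c d h : SL(2, F)) : GL (Fin 2) F) = gl a b c d h := Units.ext rfl

lemma sl_eq (g : SL(2, F)) : ∃ a b c d h, g = sl a b c d h := by
  refine ⟨g.1 0 0, g.1 0 1, g.1 1 0, g.1 1 1, ?_, ?_⟩
  · rw [← Matrix.det_fin_two]; exact g.2
  · ext i j; fin_cases i <;> fin_cases j <;> rfl

lemma sl_congr {a b c d a' b' c' d' : F} {h : a * d - b * c = 1} {h' : a' * d' - b' * c' = 1}
    (ha : a = a') (hb : b = b') (hc : c = c') (hd : d = d') : sl a b c d h = sl a' b' c' d' h' := by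
  subst ha hb hc hd; rfl

lemma sl_mul {a b c d a' b' c' d' : F} (h : a * d - b * c = 1) (h' : a' * d' - b' * c' = 1) :
    sl a b c d h * sl a' b' c' d' h' =
      sl (a * a' + b * c') (a * b' + b * d') (c * a' + d * c') (c * b' + d * d')
        (by linear_combination (a' * d' - b' * c') * h + h') := by
  apply Subtype.ext
  change !![a, b; c, d] * !![a', b'; c', d'] = _
  rw [Matrix.mul_fin_two]; rfl

lemma sl_inv {a b c d : F} (h : a * d - b * c = 1) :
    (sl a b c d h)⁻¹ = sl d (-b) (-c) a (by linear_combination h) := by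
  rw [inv_eq_iff_mul_eq_one, sl_mul]
  apply Subtype.ext
  change !![_, _; _, _] = (1 : Matrix (Fin 2) (Fin 2) F)
  rw [Matrix.one_fin_two]
  congr 1
  ext i j
  fin_cases i <;> fin_cases j <;> simp
  · linear_combination h
  · ring
  · ring
  · linear_combination h

lemma conjGood_u {x : F} (h : (1 : F) * 1 - x * 0 = 1) : ConjGood (mk (sl 1 x 0 1 h) 1) := by
  refine conjGood_of _ (Filter.Eventually.of_forall fun k => ?_)
  obtain ⟨a, b, c, d, hk, rfl⟩ := sl_eq k
  change cocycle ((sl 1 x 0 1 h : SL(2, F)) : GL (Fin 2) F) _ =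
    cocycle ((sl 1 x 0 1 h * sl a b c d hk * (sl 1 x 0 1 h)⁻¹ : SL(2, F)) : GL (Fin 2) F)
      ((sl 1 x 0 1 h : SL(2, F)) : GL (Fin 2) F)
  have hX := X_gl (h := hk) ▸ X_ne (gl a b c d hk)
  have e : sl 1 x 0 1 h * sl a b c d hk * (sl 1 x 0 1 h)⁻¹ =
      sl (a + x * c) (b + x * d - (a + x * c) * x) c (d - c * x) (by linear_combination hk) := by
    rw [sl_inv, sl_mul, sl_mul]
    apply sl_congr <;> ring
  rw [e, sl_coe, sl_coe, sl_coe, cocycle_gl, cocycle_gl, gl_mul, gl_mul]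
  simp only [X_gl, xRow_zero, zero_mul, zero_add, one_mul, mul_one, mul_zero, add_zero]
  have e1 : c * x + (d - c * x) = d := by ring
  have e2 : xRow c (d - c * x) = xRow c d := by
    by_cases hc : c = 0
    · subst hc; simp
    · rw [xRow_ne hc, xRow_ne hc]
  rw [e1, e2, div_self hX, hilb_one_right, hilb_one_left]

lemma conjGood_h {t : F} (ht : t ≠ 0) (h : t * t⁻¹ - 0 * 0 = 1) :
    ConjGood (mk (sl t 0 0 t⁻¹ h) 1) := by
  refine conjGood_of _ (Filter.Eventually.of_forall fun k => ?_)
  obtain ⟨a, b, c, d, hk, rfl⟩ := sl_eq k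
  change cocycle ((sl t 0 0 t⁻¹ h : SL(2, F)) : GL (Fin 2) F) _ =
    cocycle ((sl t 0 0 t⁻¹ h * sl a b c d hk * (sl t 0 0 t⁻¹ h)⁻¹ : SL(2, F)) : GL (Fin 2) F)
      ((sl t 0 0 t⁻¹ h : SL(2, F)) : GL (Fin 2) F)
  have hX := X_gl (h := hk) ▸ X_ne (gl a b c d hk)
  have hti := inv_ne_zero ht
  have e : sl t 0 0 t⁻¹ h * sl a b c d hk * (sl t 0 0 t⁻¹ h)⁻¹ =
      sl a (t * t * b) (t⁻¹ * t⁻¹ * c) d (by field_simp; linear_combination hk) := by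
    rw [sl_inv, sl_mul, sl_mul]
    apply sl_congr <;> field_simp <;> ring
  rw [e, sl_coe, sl_coe, sl_coe, cocycle_gl, cocycle_gl, gl_mul, gl_mul]
  simp only [X_gl, xRow_zero, zero_mul, zero_add, mul_zero, add_zero]
  have e1 : xRow (t⁻¹ * t⁻¹ * c * t) (d * t⁻¹) = t⁻¹ * xRow c d := by
    rw [← xRow_mul hti]
    congr 1
    · field_simp
    · ring
  rw [e1, xRow_mul hti, mul_div_cancel_left₀ _ hti, mul_div_cancel_right₀ _ hX]
  by_cases hc : c = 0
  · subst hc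
    have hd : d ≠ 0 := by simpa [xRow_zero] using hX
    rw [mul_zero, xRow_zero, mul_div_cancel_right₀ _ hd, hilb_symm hti hd]
  · rw [xRow_ne hc, xRow_ne (mul_ne_zero (mul_ne_zero hti hti) hc)]
    have e2 : t⁻¹ * c / (t⁻¹ * t⁻¹ * c) = t := by field_simp
    rw [e2, hilb_inv_right hc ht, hilb_symm hc ht]

lemma conjGood_w (h : (0 : F) * 0 - 1 * (-1) = 1) : ConjGood (mk (sl 0 1 (-1) 0 h) 1) := by
  refine conjGood_of _ ?_
  have hcont : Continuous fun k : SL(2, F) => k.1 0 0 := by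
    exact (continuous_apply_apply 0 0).comp continuous_subtype_val
  have hnear : ∀ᶠ k in 𝓝 (1 : SL(2, F)), res (k.1 0 0) = 1 := by
    have h1 : {y : F | ValuativeRel.valuation F (y - 1) < 1} ∈ 𝓝 (1 : F) := by
      rw [IsValuativeTopology.mem_nhds_iff]
      refine ⟨1, ?_⟩
      rintro _ ⟨z, hz, rfl⟩
      simpa using hz
    have h2 := hcont.tendsto 1
    have h3 : (1 : SL(2, F)).1 0 0 = 1 := rfl
    rw [h3] at h2
    filter_upwards [h2 h1] with k hk
    have hk' : ValuativeRel.valuation F (k.1 0 0 - 1) < 1 := hk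
    have e : k.1 0 0 = 1 + (k.1 0 0 - 1) := by ring
    rw [e, res_add (by simp) hk'.le, (res_eq_zero hk'.le).2 hk', res_one, add_zero]
  filter_upwards [hnear] with k hk1
  obtain ⟨a, b, c, d, hk, rfl⟩ := sl_eq k
  have ha : res a = 1 := hk1
  have ha0 : a ≠ 0 := val_ne (val_of_res ha)
  have hna : -a ≠ 0 := neg_ne_zero.2 ha0
  have hn : (-1 : F) ≠ 0 := by simp
  change cocycle ((sl 0 1 (-1) 0 h : SL(2, F)) : GL (Fin 2) F) _ =
    cocycle ((sl 0 1 (-1) 0 h * sl a b c d hk * (sl 0 1 (-1) 0 h)⁻¹ : SL(2, F)) : GL (Fin 2) F)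
      ((sl 0 1 (-1) 0 h : SL(2, F)) : GL (Fin 2) F)
  have hX := X_gl (h := hk) ▸ X_ne (gl a b c d hk)
  have e : sl 0 1 (-1) 0 h * sl a b c d hk * (sl 0 1 (-1) 0 h)⁻¹ =
      sl d (-c) (-b) a (by linear_combination hk) := by
    rw [sl_inv, sl_mul, sl_mul]
    apply sl_congr <;> ring
  rw [e, sl_coe, sl_coe, sl_coe, cocycle_gl, cocycle_gl, gl_mul, gl_mul]
  simp only [X_gl, zero_mul, zero_add, mul_zero, add_zero, mul_one, mul_neg, neg_mul, one_mul]
  rw [xRow_ne hna, xRow_ne hn]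
  have e1 : -a / -1 = a := by ring
  rw [e1, hilb_of_res_one_left (div_ne_zero hna hX) ha0 ha, hilb_of_res_one ha0 ha]

lemma conjGood_central (ζ : ℤˣ) : ConjGood (mk (1 : SL(2, F)) ζ) := by
  refine conjGood_of _ (Filter.Eventually.of_forall fun k => ?_)
  have h : ((1 : SL(2, F)) : GL (Fin 2) F) = 1 := Units.ext rfl
  change cocycle ((1 : SL(2, F)) : GL (Fin 2) F) _ = cocycle _ ((1 : SL(2, F)) : GL (Fin 2) F)
  rw [h, cocycle_one_left, cocycle_one_right]

lemma eq_mul_central {x y : Mp F} (h : toSL x = toSL y) :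
    x = y * mk 1 (x.1.sgn * y.1.sgn) := by
  refine mp_ext ?_ ?_
  · rw [toSL_mul, h]
    change toSL y = toSL y * 1
    rw [mul_one]
  · have h1 : ((1 : SL(2, F)) : GL (Fin 2) F) = 1 := Units.ext rfl
    change x.1.sgn = y.1.sgn * (x.1.sgn * y.1.sgn) *
      cocycle y.1.mat ((1 : SL(2, F)) : GL (Fin 2) F)
    rw [h1, cocycle_one_right, mul_one, mul_comm x.1.sgn, ← mul_assoc, int_units_sq, one_mul]

lemma ConjGood.of_toSL {x y : Mp F} (hy : ConjGood y) (h : toSL x = toSL y) : ConjGood x := by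
  rw [eq_mul_central h]
  exact hy.mul (conjGood_central _)

lemma conjGood (x : Mp F) : ConjGood x := by
  obtain ⟨a, b, c, d, h, e⟩ := sl_eq (toSL x)
  by_cases hc : c = 0
  · subst hc
    have ha : a ≠ 0 := by rintro rfl; simp at h
    have hd : d = a⁻¹ := by field_simp; linear_combination h
    refine ((conjGood_h ha (by rw [mul_inv_cancel₀ ha]; ring)).mul
      (conjGood_u (x := b / a) (by ring))).of_toSL ?_
    rw [e, toSL_mul, toSL_mk, toSL_mk, sl_mul]
    apply sl_congr
    · ring
    · field_simp; ring
    · ring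
    · rw [hd]; ring
  · have hn : -c ≠ 0 := neg_ne_zero.2 hc
    refine ((conjGood_u (x := a / c) (by ring)).mul ((conjGood_w (by ring)).mul
      ((conjGood_h hn (by rw [mul_inv_cancel₀ hn]; ring)).mul
        (conjGood_u (x := d / c) (by ring))))).of_toSL ?_
    simp only [e, toSL_mul, toSL_mk, sl_mul]
    apply sl_congr
    · field_simp; ring
    · field_simp; linear_combination (-c) * h
    · ring
    · field_simp; ring

lemma isOpen_iff_mp {U : Set (Mp F)} :
    IsOpen U ↔ ∀ x ∈ U, ∀ᶠ k in 𝓝 (1 : SL(2, F)), x * mk k 1 ∈ U := Iff.rfl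

lemma isOpen_conj {U : Set (Mp F)} (hU : IsOpen U) (x : Mp F) :
    IsOpen {y | x⁻¹ * y * x ∈ U} := by
  rw [isOpen_iff_mp] at hU ⊢
  intro y hy
  have h1 := (tendsto_conj (toSL x⁻¹)).eventually (hU _ hy)
  filter_upwards [h1, conjGood x⁻¹] with k h1 h2
  have h3 : x⁻¹ * (y * mk k 1) * x =
      x⁻¹ * y * x * mk (toSL x⁻¹ * k * (toSL x⁻¹)⁻¹) 1 := by
    have : mk (toSL x⁻¹ * k * (toSL x⁻¹)⁻¹) 1 = x⁻¹ * mk k 1 * x := by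
      rw [h2, inv_mul_cancel_right]
    rw [this]; group
  change x⁻¹ * (y * mk k 1) * x ∈ U
  rw [h3]
  exact h1

/-- The conjugate `x U x⁻¹` of an open subgroup. -/
def conjOpen (U : OpenSubgroup (Mp F)) (x : Mp F) : OpenSubgroup (Mp F) where
  carrier := {y | x⁻¹ * y * x ∈ U}
  mul_mem' {a b} ha hb := by
    have := U.mul_mem ha hb
    have e : x⁻¹ * a * x * (x⁻¹ * b * x) = x⁻¹ * (a * b) * x := by group
    rw [e] at this
    exact this
  one_mem' := by
    have e : x⁻¹ * 1 * x = 1 := by group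
    change x⁻¹ * 1 * x ∈ U
    rw [e]; exact U.one_mem
  inv_mem' {a} ha := by
    have := U.inv_mem ha
    have e : (x⁻¹ * a * x)⁻¹ = x⁻¹ * a⁻¹ * x := by group
    rw [e] at this
    exact this
  isOpen' := isOpen_conj U.isOpen x

end Topology

section Reps

/-- A representation of a topological group is smooth if all stabilizers of vectors are open. -/
def IsSmooth {E G V : Type*} [Field E] [Group G] [TopologicalSpace G] [AddCommGroup V] [Module E V]
    (ρ : Representation E G V) : Prop :=
  ∀ v, IsOpen {g | ρ g v = v}

/-- A representation `ρ` is a quotient of a representation `π`. -/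
def IsQuotientOf {E G V W : Type*} [Field E] [Group G] [AddCommGroup V] [Module E V]
    [AddCommGroup W] [Module E W] (ρ : Representation E G V) (π : Representation E G W) : Prop :=
  ∃ q : Representation.IntertwiningMap π ρ, Function.Surjective q

/-- A representation `ρ` is a subquotient of a representation `π`. -/
def IsSubquotientOf {E G V W : Type*} [Field E] [Group G] [AddCommGroup V] [Module E V]
    [AddCommGroup W] [Module E W] (ρ : Representation E G V) (π : Representation E G W) : Prop :=
  ∃ N : Subrepresentation π, IsQuotientOf ρ N.toRepresentation

variable {F : Type*} [Field F] [ValuativeRel F] [TopologicalSpace F] [IsNonarchimedeanLocalField F]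
variable {E : Type*} [Field E] {V : Type*} [AddCommGroup V] [Module E V]

/-- A representation of the metaplectic cover is genuine if `ρ(g, ζ) = ζ ρ(g, 1)`. -/
def IsGenuine (ρ : Representation E (Mp F) V) : Prop :=
  ∀ (g : SL(2, F)) (ζ : ℤˣ) (v : V), ρ (mk g ζ) v = ((ζ : ℤ) : E) • ρ (mk g 1) v

/-- A representation is admissible if the invariants of every open subgroup are
finite-dimensional (it is used together with smoothness). -/
def IsAdmissible (ρ : Representation E (Mp F) V) : Prop :=
  ∀ U : OpenSubgroup (Mp F),
    FiniteDimensional E (Representation.invariants (ρ.comp U.toSubgroup.subtype))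

variable (F) in
/-- The preimage `T̃` of the diagonal torus in the metaplectic cover. -/
def Torus : Subgroup (Mp F) where
  carrier := {x | (toSL x).1 0 1 = 0 ∧ (toSL x).1 1 0 = 0}
  mul_mem' {x y} hx hy := by
    have h : ∀ i j, (toSL (x * y)).1 i j =
        (toSL x).1 i 0 * (toSL y).1 0 j + (toSL x).1 i 1 * (toSL y).1 1 j := fun i j => by
      change ((toSL x).1 * (toSL y).1) i j = _
      rw [Matrix.mul_apply, Fin.sum_univ_two]
    constructor
    · rw [h, hx.1, hy.1, mul_zero, zero_mul, add_zero]
    · rw [h, hx.2, hy.2, mul_zero, zero_mul, add_zero]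
  one_mem' := ⟨rfl, rfl⟩
  inv_mem' {x} hx := by
    obtain ⟨a, b, c, d, h, e⟩ := sl_eq (toSL x)
    have e2 : toSL x⁻¹ = (toSL x)⁻¹ := by
      rw [eq_inv_iff_mul_eq_one, ← toSL_mul, inv_mul_cancel]
      rfl
    have hb : b = 0 := by have := hx.1; rw [e] at this; exact this
    have hc : c = 0 := by have := hx.2; rw [e] at this; exact this
    change (toSL x⁻¹).1 0 1 = 0 ∧ (toSL x⁻¹).1 1 0 = 0
    rw [e2, e, sl_inv]
    exact ⟨by change -b = 0; rw [hb, neg_zero], by change -c = 0; rw [hc, neg_zero]⟩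

/-- A representation of `T̃` is genuine if `τ(t, ζ) = ζ τ(t, 1)`. -/
def IsGenuineTorus (τ : Representation E (Torus F) V) : Prop :=
  ∀ (t : SL(2, F)) (ζ : ℤˣ) (h : mk t ζ ∈ Torus F) (h' : mk t 1 ∈ Torus F) (v : V),
    τ ⟨mk t ζ, h⟩ v = ((ζ : ℤ) : E) • τ ⟨mk t 1, h'⟩ v

/-- The lift `(ū(x), 1)` of a lower unipotent matrix; these elements form the subgroup `Ū*`. -/
def lowerUnip (x : F) : Mp F := mk (sl 1 0 x 1 (by ring)) 1

variable (τ : Representation E (Torus F) V)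

/-- The space of the smooth parabolic induction to the metaplectic cover of the inflation of `τ`
to the preimage `T̃ Ū*` of the lower triangular Borel subgroup. -/
def parIndSpace : Submodule E (Mp F → V) where
  carrier := {f | (∀ (t : Torus F) (g : Mp F), f (t * g) = τ t (f g)) ∧
    (∀ (x : F) (g : Mp F), f (lowerUnip x * g) = f g) ∧
    ∃ U : OpenSubgroup (Mp F), ∀ u ∈ U, ∀ g, f (g * u) = f g}
  zero_mem' := ⟨fun t g => by simp, fun x g => rfl, ⊤, fun u _ g => rfl⟩
  add_mem' {f f'} hf hf' := by
    obtain ⟨h1, h2, U, hU⟩ := hf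
    obtain ⟨h1', h2', U', hU'⟩ := hf'
    refine ⟨fun t g => by simp [h1, h1'], fun x g => by simp [h2, h2'], U ⊓ U', fun u hu g => ?_⟩
    simp only [Pi.add_apply]
    rw [hU u hu.1, hU' u hu.2]
  smul_mem' c f hf := by
    obtain ⟨h1, h2, U, hU⟩ := hf
    exact ⟨fun t g => by simp [h1], fun x g => by simp [h2], U, fun u hu g => by simp [hU u hu]⟩

/-- The smooth (unnormalized) parabolic induction of `τ`, with the metaplectic cover acting by
right translation. -/
def parInd : Representation E (Mp F) (parIndSpace τ) where
  toFun x :=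
    { toFun := fun f => ⟨fun g => f.1 (g * x), by
        obtain ⟨h1, h2, U, hU⟩ := f.2
        refine ⟨fun t g => ?_, fun y g => ?_, conjOpen U x, fun u hu g => ?_⟩
        · change f.1 (t * g * x) = _
          rw [mul_assoc]; exact h1 t _
        · change f.1 (lowerUnip y * g * x) = _
          rw [mul_assoc]; exact h2 y _
        · change f.1 (g * u * x) = f.1 (g * x)
          have e : g * u * x = g * x * (x⁻¹ * u * x) := by group
          rw [e]; exact hU _ hu _⟩
      map_add' := fun _ _ => rfl
      map_smul' := fun _ _ => rfl }
  map_one' := by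
    refine LinearMap.ext fun f => Subtype.ext (funext fun g => ?_)
    change f.1 (g * 1) = f.1 g
    rw [mul_one]
  map_mul' x y := by
    refine LinearMap.ext fun f => Subtype.ext (funext fun g => ?_)
    change f.1 (g * (x * y)) = f.1 (g * x * y)
    rw [mul_assoc]

/-- A character of `T̃` as a one-dimensional representation. -/
def charRep (χ : Torus F →* Eˣ) : Representation E (Torus F) E where
  toFun t := (χ t : E) • LinearMap.id
  map_one' := by simp; rfl
  map_mul' s t := by
    refine LinearMap.ext fun v => ?_
    simp
    ring

/-- The genuine principal series representations: the representations isomorphic to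
`Ind_{B̃}^{G̃} χ` for a smooth genuine character `χ` of `T̃`. -/
def IsGenuinePrincipalSeries (ρ : Representation E (Mp F) V) : Prop :=
  ∃ χ : Torus F →* Eˣ, IsSmooth (charRep χ) ∧ IsGenuineTorus (charRep χ) ∧
    Nonempty (Representation.Equiv ρ (parInd (charRep χ)))

/-- A representation of the metaplectic cover is supercuspidal if it is smooth, genuine,
irreducible and admissible, and is not a subquotient of the parabolic induction of an irreducible
smooth genuine representation of `T̃`. -/
def IsSupercuspidal.{u, e, v, w} {F : Type u} [Field F] [ValuativeRel F] [TopologicalSpace F]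
    [IsNonarchimedeanLocalField F] {E : Type e} [Field E] {V : Type v} [AddCommGroup V]
    [Module E V] (ρ : Representation E (Mp F) V) : Prop :=
  IsSmooth ρ ∧ IsGenuine ρ ∧ ρ.IsIrreducible ∧ IsAdmissible ρ ∧
    ∀ (W : Type w) [AddCommGroup W] [Module E W] (τ : Representation E (Torus F) W),
      IsSmooth τ → IsGenuineTorus τ → τ.IsIrreducible → ¬ IsSubquotientOf ρ (parInd τ)

variable (ι : 𝓀[F] →+* E) (p : ℕ) [ExpChar E p] {f : ℕ} (ϖ : Uniformizer F)

/-- The pair `(r, a)` is a parameter of `ρ` with respect to `K̃`: `ρ` is a quotient of the cokernel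
module `π(r, a) = ind_{K̃}^{G̃} σ̃_r / (T - a)`. -/
def IsParameter (ρ : Representation E (Mp F) V) (r : Fin f → Fin p) (a : E) : Prop :=
  IsQuotientOf ρ ((heckeGen ι p r ϖ).cokernel a)

/-- The pair `(r, a)` is a parameter of `ρ` with respect to `K̃' = α̃ K̃ α̃⁻¹`: `ρ` is a quotient of
the cokernel module `π'(r, a)`, formed from the conjugates by `α̃` of the weight `σ̃_r` and of the
Hecke operator `T`. -/
def IsParameterConj (ρ : Representation E (Mp F) V) (r : Fin f → Fin p) (a : E) : Prop :=
  IsQuotientOf ρ (((heckeGen ι p r ϖ).transport (conjAlpha ϖ)).cokernel a)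

/-- All parameters of `ρ`, with respect to `K̃` and to `K̃'`, are nonsupersingular. -/
def OnlyNonsupersingular (f : ℕ) (ρ : Representation E (Mp F) V) : Prop :=
  ∀ (r : Fin f → Fin p) (a : E), IsParameter ι p ϖ ρ r a ∨ IsParameterConj ι p ϖ ρ r a → a ≠ 0

/-- All parameters of `ρ`, with respect to `K̃` and to `K̃'`, are supersingular. -/
def OnlySupersingular (f : ℕ) (ρ : Representation E (Mp F) V) : Prop :=
  ∀ (r : Fin f → Fin p) (a : E), IsParameter ι p ϖ ρ r a ∨ IsParameterConj ι p ϖ ρ r a → a = 0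

end Reps

end Metaplectic

end

universe u e v w

open Metaplectic

/-!
Write `v₊` for the highest weight vector of a weight `σ`, `u(x)` and `ū(x)` for the lifts of the
upper and lower unipotent matrices, `w` for the lift of the Weyl element, and `h = h̃(ϖ)`.

*Parameters exist.* The kernel of the reduction map on `K̃` is a pro-`p` group, so by smoothness it
fixes a nonzero vector, and by admissibility only a finite-dimensional space of vectors. After
removing the genuine sign, `SL₂` of the residue field acts on this space, and every such
representation contains a weight (`exists_weight_map`): its matrix coefficients against an
eigenfunctional of the upper triangular subgroup are compared with those of a weight. The Hecke
operator has an eigenvector in the finite-dimensional space of equivariant maps `σ → ρ`, so by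
Frobenius reciprocity `ρ` has a parameter (`exists_isParameter`).

*Nonzero eigenvalues give principal series.* A parameter yields an equivariant map `Φ : σ → ρ` which
satisfies the Hecke eigenvalue equation (`exists_isEigenMap`). On `v₊` this equation reads
`U_p Φ(v₊) = λ Φ(v₊)` with `U_p = ∑ u(x) h`, where `x` runs over `𝒪 / ϖ²`, except that for the
trivial weight a second sum occurs. If `λ ≠ 0` then `Φ(v₊)`, or `U_p Φ(v₊)` for the trivial weight,
is a nonzero *ordinary vector*: an eigenvector of `U_p` and of the integral part of the torus, fixed
by `u(𝒪)` (`IsEigenMap.exists_isOrdinary`). That `U_p Φ(v₊)` is nonzero rests on the genuineness of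
`ρ`: no nonzero vector is fixed by all `u(x)`, since its stabilizer would contain two lifts of the
same torus element (`eq_zero_of_upperUnip_fixed`). The translates of an ordinary vector by the
`u(x) hⁿ`, together with its translate by `w`, span a subrepresentation (`IsOrdinary.ordSub_stable`).
A principal series `Ind χ` is generated by such a vector, the function supported on the open cell
whose restriction to the upper unipotent elements is the characteristic function of `𝒪`. For an
ordinary vector `v` of `ρ` with the character `χ`, the subrepresentation of `Ind χ × ρ` generated by
the pair of both vectors is the graph of a map from `Ind χ` to `ρ`, because a combination of
translates of the first vector vanishes only if it is formally zero. As `ρ` and `Ind χ` are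
irreducible, this map is an isomorphism (`IsOrdinary.nonempty_equiv`).

*Principal series.* The representation `Ind χ` is irreducible (`isIrreducible_parInd`): by
genuineness a nonzero subrepresentation contains a nonzero function vanishing at `w`, and a finite
`p`-group of upper unipotent elements fixes a nonzero vector in the span of its translates, which is
a multiple of a translate of the ordinary vector. The Hecke eigenvalues of `Ind χ` are nonzero, by evaluating the eigenvalue equation at `1` or at `w` (`IsEigenMap.ne_zero_of_parInd`).

*The second maximal compact subgroup.* Conjugation by `α̃` preserves the torus and the lower
unipotent subgroup (`isBorelAut_conjAlpha`), so twisting by it preserves principal series and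
exchanges parameters for `K̃'` with parameters for `K̃`. Hence an arbitrary parameter of an
irreducible representation is nonsupersingular exactly for the principal series
(`ne_zero_iff_isGenuinePrincipalSeries`).

*Supercuspidality.* An irreducible smooth genuine representation of the torus is a character
(`exists_char_equiv`): the torus is commutative, and some nonzero polynomial in each of its elements
kills a nonzero vector. So the irreducible subquotients of the `Ind τ` are principal series.
-/

set_option linter.unusedSectionVars false

open scoped ValuativeRel MatrixGroups Topology

noncomputable section

namespace Metaplectic

/-! ### Relations in the metaplectic cover -/

section Relations

variable {F : Type*} [Field F] [ValuativeRel F] [TopologicalSpace F] [IsNonarchimedeanLocalField F]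

lemma mk_mul_mk (g g' : SL(2, F)) (ζ ζ' : ℤˣ) :
    mk g ζ * mk g' ζ' = mk (g * g') (ζ * ζ' * cocycle (g : GL (Fin 2) F) (g' : GL (Fin 2) F)) :=
  mp_ext rfl rfl

lemma mk_sl_mul {a b c d a' b' c' d' : F} (h : a * d - b * c = 1) (h' : a' * d' - b' * c' = 1)
    (ζ ζ' : ℤˣ) : mk (sl a b c d h) ζ * mk (sl a' b' c' d' h') ζ' =
      mk (sl (a * a' + b * c') (a * b' + b * d') (c * a' + d * c') (c * b' + d * d')
        (by linear_combination (a' * d' - b' * c') * h + h'))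
        (ζ * ζ' * hilb (xRow (c * a' + d * c') (c * b' + d * d') / xRow c d)
          (xRow (c * a' + d * c') (c * b' + d * d') / xRow c' d')) := by
  rw [mk_mul_mk, sl_coe, sl_coe, cocycle_gl, gl_mul, sl_mul]
  rfl

lemma mk_sl_congr {a b c d a' b' c' d' : F} {h : a * d - b * c = 1} {h' : a' * d' - b' * c' = 1}
    {ζ ζ' : ℤˣ} (ha : a = a') (hb : b = b') (hc : c = c') (hd : d = d') (hζ : ζ = ζ') :
    mk (sl a b c d h) ζ = mk (sl a' b' c' d' h') ζ' := by
  subst ha hb hc hd hζ; rfl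

lemma mk_toSL (x : Mp F) : mk (toSL x) x.1.sgn = x := mp_ext rfl rfl

lemma exists_mk_sl (x : Mp F) : ∃ a b c d, ∃ h : a * d - b * c = 1, ∃ ζ,
    x = mk (sl a b c d h) ζ := by
  obtain ⟨a, b, c, d, h, e⟩ := sl_eq (toSL x)
  exact ⟨a, b, c, d, h, x.1.sgn, by rw [← e, mk_toSL]⟩

/-- The lift `(u(x), 1)` of an upper unipotent matrix. -/
def upperUnip (x : F) : Mp F := mk (sl 1 x 0 1 (by ring)) 1

/-- The element `(diag(x, x⁻¹), ζ)` of the torus. -/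
def tor (x : Fˣ) (ζ : ℤˣ) : Mp F := mk (hMat x) ζ

variable (F) in
/-- The lift of the Weyl element with lower row `(-1, 0)`. -/
def weyl : Mp F := mk (sl 0 1 (-1) 0 (by ring)) 1

lemma tor_eq (x : Fˣ) (ζ : ℤˣ) : tor x ζ = mk (sl (x : F) 0 0 (x : F)⁻¹ (by simp)) ζ := rfl

lemma hTilde_eq (x : Fˣ) : hTilde x = tor x (hilb (-1) (x : F)) := rfl

lemma upperUnip_add (x y : F) : upperUnip (x + y) = upperUnip x * upperUnip y := by
  unfold upperUnip
  rw [mk_sl_mul]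
  apply mk_sl_congr <;> simp [xRow_zero, hilb_one_left]
  ring

lemma upperUnip_zero : upperUnip (0 : F) = 1 := by
  have := upperUnip_add (0 : F) 0
  rwa [add_zero, left_eq_mul] at this

lemma upperUnip_neg (x : F) : upperUnip (-x) = (upperUnip x)⁻¹ := by
  rw [eq_inv_iff_mul_eq_one, ← upperUnip_add, neg_add_cancel, upperUnip_zero]

lemma lowerUnip_add (x y : F) : lowerUnip (x + y) = lowerUnip x * lowerUnip y := by
  unfold lowerUnip
  rw [mk_sl_mul]
  refine mk_sl_congr (by ring) (by ring) (by ring) (by ring) ?_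
  simp only [mul_one, one_mul, mul_zero, zero_add]
  by_cases hx : x = 0
  · subst hx
    by_cases hy : y = 0
    · subst hy; simp [xRow_zero, hilb_one_left]
    · simp [xRow_ne hy, xRow_zero, hy, hilb_one_right]
  by_cases hy : y = 0
  · subst hy
    simp [xRow_ne hx, xRow_zero, hx, hilb_one_left]
  by_cases hxy : x + y = 0
  · have hy' : y = -x := by linear_combination hxy
    rw [hxy, xRow_zero, xRow_ne hx, xRow_ne hy, hy', one_div, one_div, hilb_inv_left hx (by simpa using hx),
      hilb_inv_right hx (neg_ne_zero.2 hx), hilb_neg_self' hx]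
  · rw [xRow_ne hx, xRow_ne hy, xRow_ne hxy]
    have h1 := hilb_steinberg (div_ne_zero hx hxy) (div_ne_zero hy hxy) (by field_simp)
    have e1 : (x + y) / x = (x / (x + y))⁻¹ := by rw [inv_div]
    have e2 : (x + y) / y = (y / (x + y))⁻¹ := by rw [inv_div]
    rw [e1, e2, hilb_inv_left (div_ne_zero hx hxy) (inv_ne_zero (div_ne_zero hy hxy)),
      hilb_inv_right (div_ne_zero hx hxy) (div_ne_zero hy hxy), h1]

lemma lowerUnip_zero : lowerUnip (0 : F) = 1 := by
  have := lowerUnip_add (0 : F) 0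
  rwa [add_zero, left_eq_mul] at this

lemma lowerUnip_neg (x : F) : lowerUnip (-x) = (lowerUnip x)⁻¹ := by
  rw [eq_inv_iff_mul_eq_one, ← lowerUnip_add, neg_add_cancel, lowerUnip_zero]

lemma tor_mul_tor (x y : Fˣ) (ζ ξ : ℤˣ) :
    tor x ζ * tor y ξ = tor (x * y) (ζ * ξ * hilb (x : F) (y : F)) := by
  have hx := x.ne_zero
  have hy := y.ne_zero
  rw [tor_eq, tor_eq, tor_eq, mk_sl_mul]
  refine mk_sl_congr (by simp) (by simp) (by simp) (by simp [mul_comm]) ?_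
  simp only [mul_zero, zero_mul, add_zero, zero_add, xRow_zero]
  rw [mul_div_cancel_left₀ _ (inv_ne_zero hx), mul_div_cancel_right₀ _ (inv_ne_zero hy),
    hilb_inv_left hy (inv_ne_zero hx), hilb_inv_right hy hx, hilb_symm hx hy]

lemma tor_comm (x y : Fˣ) (ζ ξ : ℤˣ) : tor x ζ * tor y ξ = tor y ξ * tor x ζ := by
  rw [tor_mul_tor, tor_mul_tor, mul_comm x y, mul_comm ζ ξ, hilb_symm x.ne_zero y.ne_zero]

lemma tor_one_one : tor (1 : Fˣ) 1 = 1 := by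
  refine mp_ext ?_ rfl
  ext i j
  fin_cases i <;> fin_cases j <;> simp [tor, hMat] <;> rfl

lemma tor_one (ζ : ℤˣ) : tor (1 : Fˣ) ζ = mk 1 ζ := by
  refine mp_ext ?_ rfl
  change hMat 1 = 1
  ext i j
  fin_cases i <;> fin_cases j <;> simp [hMat]

lemma mk_eq_mul_central (g : SL(2, F)) (ζ : ℤˣ) : mk g ζ = mk g 1 * mk 1 ζ := by
  have h1 : ((1 : SL(2, F)) : GL (Fin 2) F) = 1 := Units.ext rfl
  rw [mk_mul_mk, h1, cocycle_one_right]
  simp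

lemma central_comm (ζ : ℤˣ) (x : Mp F) : mk 1 ζ * x = x * mk 1 ζ := by
  have h1 : ((1 : SL(2, F)) : GL (Fin 2) F) = 1 := Units.ext rfl
  rw [← mk_toSL x, mk_mul_mk, mk_mul_mk, h1, cocycle_one_right, cocycle_one_left]
  simp [mul_comm]

lemma weyl_mul_upperUnip (x : F) : weyl F * upperUnip x = lowerUnip (-x) * weyl F := by
  have h1 : (-1 : F) ≠ 0 := by simp
  unfold upperUnip lowerUnip weyl
  rw [mk_sl_mul, mk_sl_mul]
  refine mk_sl_congr (by ring) (by ring) (by ring) (by ring) ?_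
  simp [xRow_ne h1, xRow_zero, hilb_one_left, hilb_one_right]

lemma weyl_mul_lowerUnip (x : F) : weyl F * lowerUnip x = upperUnip (-x) * weyl F := by
  have h1 : (-1 : F) ≠ 0 := by simp
  unfold upperUnip lowerUnip weyl
  rw [mk_sl_mul, mk_sl_mul]
  refine mk_sl_congr (by ring) (by ring) (by ring) (by ring) ?_
  simp [xRow_ne h1, xRow_zero, hilb_one_left, hilb_one_right]

lemma weyl_mul_tor (x : Fˣ) (ζ : ℤˣ) : weyl F * tor x ζ = tor x⁻¹ ζ * weyl F := by
  have h1 : (-1 : F) ≠ 0 := by simp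
  have hx := x.ne_zero
  rw [tor_eq, tor_eq, weyl, mk_sl_mul, mk_sl_mul]
  refine mk_sl_congr (by simp) (by simp) (by simp) (by simp) ?_
  simp only [mul_zero, zero_mul, add_zero, zero_add, xRow_zero, xRow_ne h1, Units.val_inv_eq_inv_val,
    inv_inv, mul_one, one_mul]
  have hx1 : (-1 : F) * x ≠ 0 := mul_ne_zero h1 hx
  rw [xRow_ne hx1, xRow_ne (mul_ne_zero hx h1)]
  have e1 : (-1 : F) * x / -1 = x := by ring
  have e2 : (-1 : F) * x / (x : F)⁻¹ = -1 * (x * x) := by field_simp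
  have e3 : (x : F) * -1 / x = -1 := by field_simp
  have e4 : (x : F) * -1 / -1 = x := by ring
  rw [e1, e2, e3, e4, hilb_mul_right hx h1 (mul_ne_zero hx hx), hilb_mul_self_right hx hx,
    hilb_symm h1 hx, mul_one]

lemma tor_mul_upperUnip (x : Fˣ) (ζ : ℤˣ) (y : F) :
    tor x ζ * upperUnip y = upperUnip (x * x * y) * tor x ζ := by
  have hx := x.ne_zero
  rw [tor_eq, upperUnip, upperUnip, mk_sl_mul, mk_sl_mul]
  refine mk_sl_congr (by ring) (by field_simp; ring) (by ring) (by ring) ?_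
  simp [xRow_zero, hilb_one_left, hilb_one_right, hx]

lemma tor_mul_lowerUnip (x : Fˣ) (ζ : ℤˣ) (y : F) :
    tor x ζ * lowerUnip y = lowerUnip (((x⁻¹ : Fˣ) : F) * ((x⁻¹ : Fˣ) : F) * y) * tor x ζ := by
  have h : tor x⁻¹ ζ * upperUnip (-y) = upperUnip (((x⁻¹ : Fˣ) : F) * ((x⁻¹ : Fˣ) : F) * -y) * tor x⁻¹ ζ :=
    tor_mul_upperUnip _ _ _
  have h2 := congrArg (fun g => weyl F * g) h
  simp only [← mul_assoc, weyl_mul_tor, weyl_mul_upperUnip, inv_inv] at h2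
  rw [mul_assoc _ (weyl F), mul_assoc _ (weyl F), weyl_mul_tor, weyl_mul_upperUnip, ← mul_assoc,
    ← mul_assoc, inv_inv, mul_left_inj, neg_neg, mul_neg, neg_neg] at h2
  exact h2

lemma weyl_mul_weyl : weyl F * weyl F = tor (-1) 1 := by
  have h1 : (-1 : F) ≠ 0 := by simp
  rw [tor_eq, weyl, mk_sl_mul]
  refine mk_sl_congr (by simp) (by simp) (by simp) (by simp) ?_
  simp [xRow_ne h1, xRow_zero, hilb_one_left]

/-- The rank one relation: for `x ≠ 0` the element `u(x)` lies in the double coset of the Weyl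
element with respect to the lower triangular Borel subgroup. -/
lemma upperUnip_eq (x : Fˣ) : upperUnip (x : F) =
    lowerUnip ((x⁻¹ : Fˣ) : F) * hTilde x * weyl F * lowerUnip ((x⁻¹ : Fˣ) : F) := by
  have h1 : (-1 : F) ≠ 0 := by simp
  have hx := x.ne_zero
  have hxi := inv_ne_zero hx
  have hh : hTilde x * weyl F = mk (sl 0 (x : F) (-(x : F)⁻¹) 0 (by field_simp; ring)) 1 := by
    rw [hTilde_eq, tor_eq, weyl, mk_sl_mul]
    refine mk_sl_congr (by simp) (by simp) (by simp) (by simp) ?_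
    have hm : (x : F)⁻¹ * -1 ≠ 0 := mul_ne_zero hxi h1
    simp only [mul_zero, add_zero, zero_add, xRow_zero, xRow_ne h1, xRow_ne hm, mul_one]
    have e3 : (x : F)⁻¹ * -1 / (x : F)⁻¹ = -1 := by field_simp
    have e4 : (x : F)⁻¹ * -1 / -1 = (x : F)⁻¹ := by ring
    rw [e3, e4, hilb_inv_right h1 hx, int_units_sq]
  have hm : -(x : F)⁻¹ ≠ 0 := neg_ne_zero.2 hxi
  rw [mul_assoc (lowerUnip _), hh, lowerUnip, mk_sl_mul, mk_sl_mul, upperUnip]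
  simp only [Units.val_inv_eq_inv_val]
  refine mk_sl_congr ?_ (by simp) (by simp [hx]) (by simp [hx]) ?_
  · simp [hx]
  · simp only [mul_zero, add_zero, zero_add, mul_one, one_mul]
    have e : (x : F)⁻¹ * x = 1 := inv_mul_cancel₀ hx
    simp only [e, xRow_ne hxi, xRow_ne hm]
    rw [div_self hm, hilb_one_right, one_mul, one_mul, neg_add_cancel, xRow_zero, one_div, one_div, inv_inv,
      ← neg_inv, inv_inv, hilb_neg_self hx]

lemma hTilde_mul (x y : Fˣ) :
    hTilde x * hTilde y = hTilde (x * y) * mk 1 (hilb (x : F) (y : F)) := by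
  have h1 : (-1 : F) ≠ 0 := by simp
  rw [← tor_one, hTilde_eq, hTilde_eq, hTilde_eq, tor_mul_tor, tor_mul_tor, Units.val_mul,
    hilb_mul_right h1 x.ne_zero y.ne_zero, Units.val_one, hilb_one_right, mul_one, mul_one]

/-- Elements with nonzero upper left entry lie in the big cell of the lower triangular Borel. -/
lemma exists_eq_lower_tor_upper {x : Mp F} (a : Fˣ) (ha : (toSL x).1 0 0 = a) :
    ∃ ζ, x = lowerUnip ((toSL x).1 1 0 / a) * tor a ζ * upperUnip ((toSL x).1 0 1 / a) := by
  have e : toSL x = toSL (lowerUnip ((toSL x).1 1 0 / a) * tor a 1 *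
      upperUnip ((toSL x).1 0 1 / a)) := by
    obtain ⟨a', b, c, d, h, e⟩ := sl_eq (toSL x)
    rw [e] at ha ⊢
    change a' = a at ha
    subst ha
    change sl (a : F) b c d h = toSL (lowerUnip (c / a)) * sl (a : F) 0 0 (a : F)⁻¹ (by simp) *
      toSL (upperUnip (b / a))
    have hx := a.ne_zero
    rw [lowerUnip, upperUnip, toSL_mk, toSL_mk, sl_mul, sl_mul]
    apply sl_congr
    · ring
    · field_simp; ring
    · field_simp; ring
    · field_simp; linear_combination h
  refine ⟨x.1.sgn * (lowerUnip ((toSL x).1 1 0 / a) * tor a 1 *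
      upperUnip ((toSL x).1 0 1 / a)).1.sgn, (eq_mul_central e).trans ?_⟩
  generalize x.1.sgn * (lowerUnip ((toSL x).1 1 0 / a) * tor a 1 *
      upperUnip ((toSL x).1 0 1 / a)).1.sgn = ζ
  rw [mul_assoc, ← central_comm, ← mul_assoc, mul_assoc _ (tor a 1), tor, tor, ← mk_eq_mul_central]

lemma exists_eq_lower_tor_weyl {x : Mp F} (ha : (toSL x).1 0 0 = 0) :
    ∃ y a ζ, x = lowerUnip y * tor a ζ * weyl F := by
  obtain ⟨a', b, c, d, h, e⟩ := sl_eq (toSL x)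
  have ha' : a' = 0 := by rw [e] at ha; exact ha
  subst ha'
  have hb : b ≠ 0 := by rintro rfl; simp at h
  have e : toSL x = toSL (lowerUnip (d / b) * tor (Units.mk0 b hb) 1 * weyl F) := by
    rw [e]
    change sl 0 b c d h = toSL (lowerUnip (d / b)) * sl b 0 0 (b : F)⁻¹ (by simp [hb]) *
      toSL (weyl F)
    rw [lowerUnip, weyl, toSL_mk, toSL_mk, sl_mul, sl_mul]
    apply sl_congr
    · ring
    · ring
    · field_simp; linear_combination -h
    · field_simp; ring
  refine ⟨d / b, Units.mk0 b hb, x.1.sgn *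
    (lowerUnip (d / b) * tor (Units.mk0 b hb) 1 * weyl F).1.sgn, (eq_mul_central e).trans ?_⟩
  generalize x.1.sgn * (lowerUnip (d / b) * tor (Units.mk0 b hb) 1 * weyl F).1.sgn = ζ
  rw [mul_assoc, ← central_comm, ← mul_assoc, mul_assoc _ (tor _ 1), tor, tor, ← mk_eq_mul_central]

lemma lowerUnip_eq_weyl (x : F) : lowerUnip x = weyl F * upperUnip (-x) * (weyl F)⁻¹ := by
  rw [weyl_mul_upperUnip, neg_neg, mul_inv_cancel_right]

lemma tor_inv (x : Fˣ) (ζ : ℤˣ) : ∃ ξ, (tor x ζ)⁻¹ = tor x⁻¹ ξ := by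
  refine ⟨ζ * hilb (x : F) ((x⁻¹ : Fˣ) : F), ?_⟩
  rw [inv_eq_iff_mul_eq_one, tor_mul_tor, mul_inv_cancel, ← mul_assoc, int_units_sq, one_mul,
    int_units_sq, tor_one_one]

/-- The metaplectic cover is generated by the torus, the upper unipotent elements and the Weyl
element. -/
lemma submonoid_eq_top (S : Submonoid (Mp F)) (hu : ∀ x, upperUnip x ∈ S)
    (ht : ∀ x ζ, tor x ζ ∈ S) (hw : weyl F ∈ S) (g : Mp F) : g ∈ S := by
  have hwi : (weyl F)⁻¹ ∈ S := by
    obtain ⟨ξ, hξ⟩ := tor_inv (-1 : Fˣ) 1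
    have : (weyl F)⁻¹ = weyl F * (tor (-1) 1)⁻¹ := by
      rw [← weyl_mul_weyl]; group
    rw [this, hξ]
    exact S.mul_mem hw (ht _ _)
  have hl : ∀ x, lowerUnip x ∈ S := fun x => by
    rw [lowerUnip_eq_weyl]
    exact S.mul_mem (S.mul_mem hw (hu _)) hwi
  by_cases ha : (toSL g).1 0 0 = 0
  · obtain ⟨y, a, ζ, rfl⟩ := exists_eq_lower_tor_weyl ha
    exact S.mul_mem (S.mul_mem (hl _) (ht _ _)) hw
  · obtain ⟨ζ, h⟩ := exists_eq_lower_tor_upper (Units.mk0 _ ha) rfl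
    rw [h]
    exact S.mul_mem (S.mul_mem (hl _) (ht _ _)) (hu _)

end Relations

/-! ### Fractional ideals and congruence subgroups -/

section Balls

variable {F : Type*} [Field F] [ValuativeRel F] [TopologicalSpace F] [IsNonarchimedeanLocalField F]

lemma le_ord_add {x y : F} {n : ℤ} (hx : n ≤ ord x) (hy : n ≤ ord y) (hxy : x + y ≠ 0) :
    n ≤ ord (x + y) := by
  by_cases hx0 : x = 0
  · subst hx0; rwa [zero_add]
  by_cases hy0 : y = 0
  · subst hy0; rwa [add_zero]
  rcases le_total (ValuativeRel.valuation F x) (ValuativeRel.valuation F y) with h | h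
  · have := (Valuation.map_add (ValuativeRel.valuation F) x y).trans (max_le h le_rfl)
    exact hy.trans ((val_le_val hxy hy0).1 this)
  · have := (Valuation.map_add (ValuativeRel.valuation F) x y).trans (max_le le_rfl h)
    exact hx.trans ((val_le_val hxy hx0).1 this)

variable (F) in
/-- The fractional ideal of the elements of valuation at least `n`. -/
def ball (n : ℤ) : AddSubgroup F where
  carrier := {x | x = 0 ∨ n ≤ ord x}
  zero_mem' := Or.inl rfl
  add_mem' {x y} hx hy := by
    by_cases hxy : x + y = 0
    · exact Or.inl hxy
    rcases hx with rfl | hx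
    · simpa using hy
    rcases hy with rfl | hy
    · simpa using Or.inr hx
    exact Or.inr (le_ord_add hx hy hxy)
  neg_mem' {x} hx := by
    rcases hx with rfl | hx
    · exact Or.inl (by simp)
    · exact Or.inr (by rwa [ord_neg])

lemma mem_ball {n : ℤ} {x : F} : x ∈ ball F n ↔ x = 0 ∨ n ≤ ord x := Iff.rfl

lemma mem_ball_of_ne {n : ℤ} {x : F} (hx : x ≠ 0) : x ∈ ball F n ↔ n ≤ ord x := by
  simp [mem_ball, hx]

lemma not_mem_ball {n : ℤ} {x : F} : x ∉ ball F n ↔ x ≠ 0 ∧ ord x < n := by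
  rw [mem_ball, not_or, not_le]

lemma ball_anti {m n : ℤ} (h : m ≤ n) : ball F n ≤ ball F m := by
  rintro x (hx | hx)
  · exact Or.inl hx
  · exact Or.inr (h.trans hx)

lemma mem_ball_zero {x : F} : x ∈ ball F 0 ↔ ValuativeRel.valuation F x ≤ 1 := by
  by_cases hx : x = 0
  · subst hx; simp
  · rw [mem_ball_of_ne hx, val_le_one hx]

lemma mem_ball_one {x : F} : x ∈ ball F 1 ↔ ValuativeRel.valuation F x < 1 := by
  by_cases hx : x = 0
  · subst hx; simp
  · rw [mem_ball_of_ne hx, val_lt_one hx]; rfl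

lemma mul_mem_ball {m n : ℤ} {x y : F} (hx : x ∈ ball F m) (hy : y ∈ ball F n) :
    x * y ∈ ball F (m + n) := by
  by_cases hx0 : x = 0
  · subst hx0; simp
  by_cases hy0 : y = 0
  · subst hy0; simp
  rw [mem_ball_of_ne hx0] at hx
  rw [mem_ball_of_ne hy0] at hy
  rw [mem_ball_of_ne (mul_ne_zero hx0 hy0), ord_mul hx0 hy0]
  omega

lemma mul_mem_ball_iff {n : ℤ} {x y : F} (hx : x ≠ 0) :
    x * y ∈ ball F n ↔ y ∈ ball F (n - ord x) := by
  by_cases hy0 : y = 0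
  · subst hy0; simp
  rw [mem_ball_of_ne hy0, mem_ball_of_ne (mul_ne_zero hx hy0), ord_mul hx hy0]
  omega

lemma one_mem_ball : (1 : F) ∈ ball F 0 := Or.inr (by rw [ord_one])

lemma mul_mem_ball_zero {n : ℤ} {x y : F} (hx : x ∈ ball F 0) (hy : y ∈ ball F n) :
    x * y ∈ ball F n := by
  simpa using mul_mem_ball hx hy

lemma ord_pos_unique {a : F} (h : a - 1 ∈ ball F 1) : a ≠ 0 ∧ ord a = 0 ∧ res a = 1 := by
  rw [mem_ball_one] at h
  have e : a = (a - 1) + 1 := by ring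
  have hr : res a = 1 := by
    rw [e, res_add h.le (by simp), (res_eq_zero h.le).2 h, res_one, zero_add]
  exact ⟨val_ne (val_of_res hr), ord_of_val (val_of_res hr), hr⟩

lemma exists_mem_ball (x : F) : ∃ n : ℤ, x ∈ ball F n := ⟨ord x, Or.inr le_rfl⟩

lemma ord_uniformizer (ϖ : Uniformizer F) : ord ϖ.val = 1 := by
  have h0 : 0 < ord ϖ.val := (val_lt_one ϖ.ne_zero).1 ϖ.val_lt
  obtain ⟨y, hy⟩ : ∃ y : F, ord y = 1 := by
    obtain ⟨y, hy⟩ := ValuativeRel.valuation_surjective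
      ((IsNonarchimedeanLocalField.valueGroupWithZeroIsoInt F).symm (WithZero.exp (-1)))
    refine ⟨y, ?_⟩
    unfold ord
    rw [hy]
    simp
  have hy0 : y ≠ 0 := by
    rintro rfl
    simp [ord] at hy
  have hy1 : ValuativeRel.valuation F y < 1 := (val_lt_one hy0).2 (by omega)
  have hm : (⟨y, hy1.le⟩ : 𝒪[F]) ∈ 𝓂[F] := by
    rw [IsLocalRing.mem_maximalIdeal, mem_nonunits_iff,
      (Valuation.integer.integers (ValuativeRel.valuation F)).isUnit_iff_valuation_eq_one]
    exact hy1.ne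
  rw [ϖ.2.maximalIdeal_eq, Ideal.mem_span_singleton] at hm
  obtain ⟨z, hz⟩ := hm
  have hz' : y = ϖ.val * z := congrArg (fun t : 𝒪[F] => (t : F)) hz
  have hz0 : (z : F) ≠ 0 := by
    intro h; rw [h, mul_zero] at hz'; exact hy0 hz'
  have h2 : 0 ≤ ord (z : F) := (val_le_one hz0).1 z.2
  rw [hz', ord_mul ϖ.ne_zero hz0] at hy
  omega

lemma ord_uniformizer_zpow (ϖ : Uniformizer F) (n : ℤ) : ord (ϖ.val ^ n) = n := by
  rw [ord_zpow, ord_uniformizer, mul_one]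

lemma zpow_mul_mem_ball (ϖ : Uniformizer F) {k n : ℤ} {x : F} :
    ϖ.val ^ k * x ∈ ball F n ↔ x ∈ ball F (n - k) := by
  rw [mul_mem_ball_iff (zpow_ne_zero _ ϖ.ne_zero), ord_uniformizer_zpow]

lemma ball_mem_nhds (ϖ : Uniformizer F) (n : ℤ) : (ball F n : Set F) ∈ 𝓝 (0 : F) := by
  rw [IsValuativeTopology.mem_nhds_zero_iff]
  refine ⟨Units.mk0 (ValuativeRel.valuation F (ϖ.val ^ n))
    ((Valuation.ne_zero_iff _).2 (zpow_ne_zero _ ϖ.ne_zero)), fun x hx => ?_⟩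
  by_cases hx0 : x = 0
  · exact Or.inl hx0
  · have := (val_le_val hx0 (zpow_ne_zero n ϖ.ne_zero)).1 (le_of_lt hx)
    rw [ord_uniformizer_zpow] at this
    exact Or.inr this

lemma exists_ball_subset {U : Set F} (hU : U ∈ 𝓝 (0 : F)) : ∃ n : ℕ, (ball F n : Set F) ⊆ U := by
  rw [IsValuativeTopology.mem_nhds_zero_iff] at hU
  obtain ⟨γ, hγ⟩ := hU
  obtain ⟨y, hy⟩ := ValuativeRel.valuation_surjective γ.1
  have hy0 : y ≠ 0 := by
    rintro rfl
    rw [map_zero] at hy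
    exact γ.ne_zero hy.symm
  refine ⟨(ord y + 1).toNat, fun x hx => hγ ?_⟩
  change ValuativeRel.valuation F x < γ.1
  rw [← hy]
  rcases hx with rfl | hx
  · rw [map_zero]; exact (Valuation.pos_iff _).2 hy0
  · by_cases hx0 : x = 0
    · subst hx0; rw [map_zero]; exact (Valuation.pos_iff _).2 hy0
    rw [← not_le, val_le_val hy0 hx0]
    omega

/-- The condition that a matrix is congruent to the identity modulo the `n`-th power of the
maximal ideal. -/
def IsCong (n : ℤ) (k : SL(2, F)) : Prop :=
  k.1 0 0 - 1 ∈ ball F n ∧ k.1 0 1 ∈ ball F n ∧ k.1 1 0 ∈ ball F n ∧ k.1 1 1 - 1 ∈ ball F n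

lemma IsCong.mono {m n : ℤ} (h : m ≤ n) {k : SL(2, F)} (hk : IsCong n k) : IsCong m k :=
  ⟨ball_anti h hk.1, ball_anti h hk.2.1, ball_anti h hk.2.2.1, ball_anti h hk.2.2.2⟩

lemma eventually_isCong (ϖ : Uniformizer F) (n : ℤ) : ∀ᶠ k in 𝓝 (1 : SL(2, F)), IsCong n k := by
  have hc : ∀ i j, Continuous fun k : SL(2, F) => k.1 i j := fun i j =>
    (continuous_apply_apply i j).comp continuous_subtype_val
  have h0 : ∀ i j, ∀ᶠ k in 𝓝 (1 : SL(2, F)), k.1 i j - (1 : SL(2, F)).1 i j ∈ ball F n :=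
    fun i j => by
      have h : Filter.Tendsto (fun k : SL(2, F) => k.1 i j - (1 : SL(2, F)).1 i j) (𝓝 1)
          (𝓝 ((1 : SL(2, F)).1 i j - (1 : SL(2, F)).1 i j)) :=
        ((hc i j).sub (continuous_const (y := (1 : SL(2, F)).1 i j))).tendsto 1
      rw [sub_self] at h
      exact h (ball_mem_nhds ϖ n)
  filter_upwards [h0 0 0, h0 0 1, h0 1 0, h0 1 1] with k h1 h2 h3 h4
  refine ⟨h1, ?_, ?_, h4⟩
  · change k.1 0 1 - 0 ∈ _ at h2
    rwa [sub_zero] at h2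
  · change k.1 1 0 - 0 ∈ _ at h3
    rwa [sub_zero] at h3

lemma exists_forall_sub_mem_ball {M₀ : Fin 2 → Fin 2 → F} {t : Set (Fin 2 → Fin 2 → F)}
    (ht : t ∈ 𝓝 M₀) :
    ∃ n : ℕ, ∀ M : Fin 2 → Fin 2 → F, (∀ i j, M i j - M₀ i j ∈ ball F n) → M ∈ t := by
  rw [nhds_pi, Filter.mem_pi] at ht
  obtain ⟨I, -, s, hs, hst⟩ := ht
  have hrow : ∀ i, ∃ n : ℕ, ∀ r : Fin 2 → F, (∀ j, r j - M₀ i j ∈ ball F n) → r ∈ s i := by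
    intro i
    have h := hs i
    rw [nhds_pi, Filter.mem_pi] at h
    obtain ⟨J, -, w, hw, hws⟩ := h
    have h2 : ∀ j, ∃ n : ℕ, ∀ y, y - M₀ i j ∈ ball F n → y ∈ w j := by
      intro j
      have h3 : (fun z => z + M₀ i j) ⁻¹' w j ∈ 𝓝 (0 : F) := by
        refine (continuous_id.add continuous_const).tendsto 0 ?_
        simpa using hw j
      obtain ⟨n, hn⟩ := exists_ball_subset h3
      refine ⟨n, fun y hy => ?_⟩
      have := hn hy
      simpa using this
    choose n hn using h2
    refine ⟨max (n 0) (n 1), fun r hr => hws fun j _ => hn j _ (ball_anti ?_ (hr j))⟩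
    fin_cases j <;> simp
  choose n hn using hrow
  refine ⟨max (n 0) (n 1), fun M hM => hst fun i _ => hn i _ fun j => ball_anti ?_ (hM i j)⟩
  fin_cases i <;> simp

lemma exists_isCong {U : Set SL(2, F)} (hU : U ∈ 𝓝 (1 : SL(2, F))) :
    ∃ n : ℕ, 0 < n ∧ ∀ k, IsCong n k → k ∈ U := by
  have h1 : 𝓝 (1 : SL(2, F)) = Filter.comap (fun k : SL(2, F) => k.1)
      (𝓝 ((1 : SL(2, F)).1 : Matrix (Fin 2) (Fin 2) F)) := nhds_induced _ _
  rw [h1] at hU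
  obtain ⟨t, ht, htU⟩ := Filter.mem_comap.1 hU
  obtain ⟨n, hn⟩ := exists_forall_sub_mem_ball ht
  refine ⟨n + 1, by omega, fun k hk => htU (hn k.1 fun i j => ?_)⟩
  obtain ⟨h1, h2, h3, h4⟩ := hk.mono (show (n : ℤ) ≤ ((n + 1 : ℕ) : ℤ) by omega)
  fin_cases i <;> fin_cases j
  · exact h1
  · change k.1 0 1 - 0 ∈ _
    rwa [sub_zero]
  · change k.1 1 0 - 0 ∈ _
    rwa [sub_zero]
  · exact h4

/-- A subgroup of the metaplectic cover is open if and only if it contains the section over a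
principal congruence subgroup. -/
lemma isOpen_subgroup_iff (ϖ : Uniformizer F) (S : Subgroup (Mp F)) :
    IsOpen (S : Set (Mp F)) ↔ ∃ n : ℕ, 0 < n ∧ ∀ k : SL(2, F), IsCong n k → mk k 1 ∈ S := by
  rw [isOpen_iff_mp]
  constructor
  · intro h
    have h1 := h 1 S.one_mem
    obtain ⟨n, hn, h2⟩ := exists_isCong h1
    refine ⟨n, hn, fun k hk => ?_⟩
    have : (1 : Mp F) * mk k 1 ∈ S := h2 k hk
    rwa [one_mul] at this
  · rintro ⟨n, -, hn⟩ x hx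
    filter_upwards [eventually_isCong ϖ n] with k hk
    exact S.mul_mem hx (hn k hk)

lemma isCong_upperUnip {n : ℤ} {x : F} (hx : x ∈ ball F n) :
    IsCong n (toSL (upperUnip x)) := by
  refine ⟨?_, hx, (ball F n).zero_mem, ?_⟩
  · change (1 : F) - 1 ∈ _
    simp
  · change (1 : F) - 1 ∈ _
    simp

lemma isCong_lowerUnip {n : ℤ} {x : F} (hx : x ∈ ball F n) :
    IsCong n (toSL (lowerUnip x)) := by
  refine ⟨?_, (ball F n).zero_mem, hx, ?_⟩
  · change (1 : F) - 1 ∈ _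
    simp
  · change (1 : F) - 1 ∈ _
    simp

lemma inv_sub_one_mem_ball {n : ℤ} {a : F} (ha0 : ord a = 0) (hane : a ≠ 0)
    (ha : a - 1 ∈ ball F n) : a⁻¹ - 1 ∈ ball F n := by
  have e : a⁻¹ - 1 = -a⁻¹ * (a - 1) := by field_simp; ring
  rw [e]
  exact mul_mem_ball_zero (Or.inr (by rw [ord_neg, ord_inv, ha0, neg_zero])) ha

lemma isCong_hMat {n : ℤ} {a : Fˣ} (ha0 : ord (a : F) = 0) (ha : (a : F) - 1 ∈ ball F n) :
    IsCong n (hMat a) :=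
  ⟨ha, (ball F n).zero_mem, (ball F n).zero_mem, inv_sub_one_mem_ball ha0 a.ne_zero ha⟩

/-- The Iwahori factorization of the section over a congruence subgroup. -/
lemma mk_eq_of_isCong {n : ℤ} (hn : 0 < n) {k : SL(2, F)} (hk : IsCong n k) :
    ∃ (a : Fˣ) (b c : F), (a : F) - 1 ∈ ball F n ∧ b ∈ ball F n ∧ c ∈ ball F n ∧
      mk k 1 = lowerUnip c * tor a 1 * upperUnip b := by
  obtain ⟨a', b, c, d, h, rfl⟩ := sl_eq k
  obtain ⟨h1, h2, h3, h4⟩ := hk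
  change a' - 1 ∈ _ at h1
  change b ∈ _ at h2
  change c ∈ _ at h3
  obtain ⟨ha, hao, har⟩ := ord_pos_unique (ball_anti (show (1 : ℤ) ≤ n by omega) h1)
  obtain ⟨a, rfl⟩ : ∃ a : Fˣ, (a : F) = a' := ⟨Units.mk0 a' ha, rfl⟩
  have hi : ((a : F)⁻¹) ∈ ball F 0 := Or.inr (by rw [ord_inv, hao, neg_zero])
  refine ⟨a, (a : F)⁻¹ * b, (a : F)⁻¹ * c, h1, mul_mem_ball_zero hi h2,
    mul_mem_ball_zero hi h3, ?_⟩
  rw [tor_eq, lowerUnip, upperUnip, mk_sl_mul, mk_sl_mul]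
  refine mk_sl_congr ?_ ?_ ?_ ?_ ?_
  · ring
  · field_simp; ring
  · field_simp; ring
  · field_simp; linear_combination h
  · simp only [mul_zero, zero_add, add_zero, xRow_zero, mul_one, one_mul]
    by_cases hc : c = 0
    · subst hc
      simp [xRow_zero, hilb_one_right, ha, hilb_one_left]
    · have hc1 : (a : F)⁻¹ * c ≠ 0 := mul_ne_zero (inv_ne_zero ha) hc
      have hc2 : (a : F)⁻¹ * c * a ≠ 0 := mul_ne_zero hc1 ha
      rw [xRow_ne hc1, xRow_ne hc2, xRow_ne hc2, div_self hc2, hilb_one_left, mul_one,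
        mul_div_cancel_left₀ _ hc1, hilb_of_res_one_left _ ha har]
      exact div_ne_zero hc2 (inv_ne_zero ha)

/-- A subgroup of the metaplectic cover is open if it contains small elements of the two root
subgroups and of the torus. -/
lemma isOpen_of_generators (ϖ : Uniformizer F) (S : Subgroup (Mp F)) {n : ℤ} (hn : 0 < n)
    (hu : ∀ x ∈ ball F n, upperUnip x ∈ S) (hl : ∀ x ∈ ball F n, lowerUnip x ∈ S)
    (ht : ∀ a : Fˣ, (a : F) - 1 ∈ ball F n → tor a 1 ∈ S) : IsOpen (S : Set (Mp F)) := by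
  rw [isOpen_subgroup_iff ϖ]
  refine ⟨n.toNat, by omega, fun k hk => ?_⟩
  obtain ⟨a, b, c, ha, hb, hc, e⟩ := mk_eq_of_isCong hn (hk.mono (by omega))
  rw [e]
  exact S.mul_mem (S.mul_mem (hl c hc) (ht a ha)) (hu b hb)

end Balls

/-! ### Fixed vectors of `p`-groups -/

section FixedVectors

/-- A group acting on a vector space in characteristic `p` through a finite `p`-group on the orbit
of a nonzero vector has a nonzero fixed vector in the span of this orbit. -/
lemma exists_fixed_vector {E V P : Type*} [Field E] [AddCommGroup V] [Module E V] [Group P]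
    (p : ℕ) [Fact p.Prime] [CharP E p] (ρ : Representation E P V) {v : V} (hv : v ≠ 0)
    (hfin : (Set.range fun g => ρ g v).Finite)
    (hp : ∀ g, ∃ k : ℕ, ∀ h, ρ (g ^ p ^ k) (ρ h v) = ρ h v) :
    ∃ w ∈ Submodule.span E (Set.range fun g => ρ g v), w ≠ 0 ∧ ∀ g, ρ g w = w := by
  -- the additive group generated by the orbit is finite of exponent `p`, so the fixed points of the
  -- `p`-group on it are counted modulo `p`; `0` is one of them
  let M : AddSubgroup V := AddSubgroup.closure (Set.range fun g => ρ g v)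
  have hpV : ∀ x : V, p • x = 0 := fun x => by
    rw [← Nat.cast_smul_eq_nsmul E, CharP.cast_eq_zero, zero_smul]
  have hfg : AddGroup.FG M := by
    rw [AddGroup.fg_iff_addSubgroup_fg]
    exact ⟨hfin.toFinset, by simp [M]⟩
  have hMf : Finite M := AddCommGroup.finite_of_fg_isAddTorsion M fun x =>
    isOfFinAddOrder_iff_nsmul_eq_zero.2 ⟨p, (Fact.out : p.Prime).pos, Subtype.ext (hpV x)⟩
  have hstab : ∀ g, ∀ x ∈ M, ρ g x ∈ M := by
    intro g x hx
    induction hx using AddSubgroup.closure_induction with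
    | mem x hx =>
      obtain ⟨h, rfl⟩ := hx
      refine AddSubgroup.subset_closure ⟨g * h, ?_⟩
      simp [map_mul]
    | zero => rw [map_zero]; exact M.zero_mem
    | add x y _ _ hx hy => rw [map_add]; exact M.add_mem hx hy
    | neg x _ hx => rw [map_neg]; exact M.neg_mem hx
  let φ : P →* Equiv.Perm M := MonoidHom.toHomPerm
    { toFun := fun g x => ⟨ρ g x.1, hstab g x.1 x.2⟩
      map_one' := by
        funext x
        exact Subtype.ext (congrArg (fun u : Module.End E V => u x.1) (map_one ρ))
      map_mul' := fun g h => by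
        funext x
        exact Subtype.ext (congrArg (fun u : Module.End E V => u x.1) (map_mul ρ g h)) }
  have hφ : ∀ g (x : M), (φ g x : V) = ρ g x.1 := fun g x => rfl
  have hP : IsPGroup p φ.range := by
    rintro ⟨_, g, rfl⟩
    obtain ⟨k, hk⟩ := hp g
    refine ⟨k, Subtype.ext ?_⟩
    change φ g ^ p ^ k = 1
    rw [← map_pow]
    ext ⟨x, hx⟩
    rw [hφ]
    change ρ (g ^ p ^ k) x = x
    induction hx using AddSubgroup.closure_induction with
    | mem x hx =>
      obtain ⟨h, rfl⟩ := hx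
      exact hk h
    | zero => rw [map_zero]
    | add x y _ _ hx hy => rw [map_add, hx, hy]
    | neg x _ hx => rw [map_neg, hx]
  have hvM : v ∈ M := AddSubgroup.subset_closure ⟨1, by simp⟩
  have hdvd : p ∣ Nat.card M := by
    have h1 : addOrderOf (⟨v, hvM⟩ : M) = p :=
      addOrderOf_eq_prime (Subtype.ext (hpV v)) (fun h => hv (congrArg Subtype.val h))
    rw [← h1]
    exact addOrderOf_dvd_natCard _
  obtain ⟨b, hb, hb0⟩ := hP.exists_fixed_point_of_prime_dvd_card_of_fixed_point M hdvd
    (a := (0 : M)) (by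
      rintro ⟨_, g, rfl⟩
      exact Subtype.ext (map_zero (ρ g)))
  refine ⟨b.1, ?_, fun h => hb0 (Subtype.ext h.symm), fun g => ?_⟩
  · have hle : M ≤ (Submodule.span E (Set.range fun g => ρ g v)).toAddSubgroup :=
      (AddSubgroup.closure_le _).2 Submodule.subset_span
    exact hle b.2
  · exact congrArg Subtype.val (hb ⟨φ g, g, rfl⟩)

end FixedVectors

/-! ### Smooth genuine representations -/

section Genuine

variable {F : Type*} [Field F] [ValuativeRel F] [TopologicalSpace F] [IsNonarchimedeanLocalField F]
variable {E : Type*} [Field E] {V : Type*} [AddCommGroup V] [Module E V]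

/-- The stabilizer of a vector. -/
def stab {G : Type*} [Group G] (ρ : Representation E G V) (v : V) : Subgroup G where
  carrier := {g | ρ g v = v}
  mul_mem' {g h} hg hh := by
    change ρ (g * h) v = v
    rw [map_mul, Module.End.mul_apply, show ρ h v = v from hh, show ρ g v = v from hg]
  one_mem' := by
    change ρ 1 v = v
    rw [map_one]; rfl
  inv_mem' {g} hg := by
    change ρ g⁻¹ v = v
    conv_lhs => rw [← show ρ g v = v from hg]
    rw [← Module.End.mul_apply, ← map_mul, inv_mul_cancel, map_one]; rfl

lemma mem_stab {G : Type*} [Group G] {ρ : Representation E G V} {v : V} {g : G} :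
    g ∈ stab ρ v ↔ ρ g v = v := Iff.rfl

lemma rep_mul {G : Type*} [Monoid G] (ρ : Representation E G V) (g h : G) (v : V) :
    ρ (g * h) v = ρ g (ρ h v) := by
  rw [map_mul, Module.End.mul_apply]

lemma IsSmooth.exists_isCong {ρ : Representation E (Mp F) V} (h : IsSmooth ρ) (ϖ : Uniformizer F)
    (v : V) : ∃ n : ℕ, 0 < n ∧ ∀ k : SL(2, F), IsCong n k → ρ (mk k 1) v = v :=
  (isOpen_subgroup_iff ϖ (stab ρ v)).1 (h v)

lemma isSmooth_of_isCong {ρ : Representation E (Mp F) V} (ϖ : Uniformizer F)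
    (h : ∀ v, ∃ n : ℕ, 0 < n ∧ ∀ k : SL(2, F), IsCong n k → ρ (mk k 1) v = v) : IsSmooth ρ :=
  fun v => (isOpen_subgroup_iff ϖ (stab ρ v)).2 (h v)

lemma IsSmooth.lowerUnip {ρ : Representation E (Mp F) V} (h : IsSmooth ρ) (ϖ : Uniformizer F)
    (v : V) : ∃ n : ℕ, ∀ x ∈ ball F n, ρ (lowerUnip x) v = v := by
  obtain ⟨n, -, hn⟩ := h.exists_isCong ϖ v
  exact ⟨n, fun x hx => hn _ (isCong_lowerUnip hx)⟩

lemma mk_one_one : mk (1 : SL(2, F)) 1 = 1 := by rw [← tor_one, tor_one_one]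

lemma central_mul (ζ ξ : ℤˣ) : mk (1 : SL(2, F)) ζ * mk 1 ξ = mk 1 (ζ * ξ) := by
  rw [← tor_one, ← tor_one, ← tor_one, tor_mul_tor, Units.val_one, hilb_one_left, mul_one, mul_one]

lemma IsGenuine.central {ρ : Representation E (Mp F) V} (h : IsGenuine ρ) (ζ : ℤˣ) (v : V) :
    ρ (mk 1 ζ) v = ((ζ : ℤ) : E) • v := by
  rw [h 1 ζ v, mk_one_one, map_one]; rfl

lemma isGenuine_of_central {ρ : Representation E (Mp F) V}
    (h : ∀ ζ v, ρ (mk 1 ζ) v = ((ζ : ℤ) : E) • v) : IsGenuine ρ := fun g ζ v => by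
  rw [mk_eq_mul_central, ← central_comm, rep_mul, h]

lemma hilb_unit_uniformizer (ϖ : Uniformizer F) {a : F} (ha : a ≠ 0) (ha0 : ord a = 0) :
    hilb a ϖ.val = rsign a := by
  rw [hilb_eq]
  have : tameUnit a ϖ.val = a⁻¹ := by
    simp [tameUnit, ha0, ord_uniformizer]
  rw [this, rsign_inv ha ha0]

lemma exists_res_eq (y : 𝓀[F]) : ∃ a : F, a ∈ ball F 0 ∧ res a = y := by
  obtain ⟨x, hx⟩ := IsLocalRing.residue_surjective (R := 𝒪[F]) y
  refine ⟨x, mem_ball_zero.2 x.2, ?_⟩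
  rw [res_of_le x.2, ← hx]

lemma unit_of_res_ne_zero {a : F} (ha : a ∈ ball F 0) (h : res a ≠ 0) : a ≠ 0 ∧ ord a = 0 := by
  have ha0 : a ≠ 0 := by rintro rfl; exact h res_zero
  refine ⟨ha0, ?_⟩
  rw [mem_ball_zero] at ha
  rw [Ne, res_eq_zero ha, val_lt_one ha0] at h
  rw [val_le_one ha0] at ha
  omega

/-- In odd residue characteristic there is a unit which is not a square modulo the maximal
ideal. -/
lemma exists_nonsquare_unit (h2 : ringChar 𝓀[F] ≠ 2) :
    ∃ a : Fˣ, ord (a : F) = 0 ∧ rsign (a : F) = -1 := by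
  obtain ⟨y, hy⟩ := FiniteField.exists_nonsquare h2
  obtain ⟨a, ha, rfl⟩ := exists_res_eq y
  have h0 : res a ≠ 0 := by
    intro h; rw [h] at hy; exact hy (IsSquare.zero)
  obtain ⟨h1, h2⟩ := unit_of_res_ne_zero ha h0
  exact ⟨Units.mk0 a h1, h2, by simp [rsign, hy]⟩

lemma uniformizer_unit_val (ϖ : Uniformizer F) : (ϖ.unit : F) = ϖ.val := rfl

/-- A vector in a smooth genuine representation which is fixed by all upper unipotent elements
vanishes: its stabilizer contains two lifts of the same torus element. -/
lemma eq_zero_of_upperUnip_fixed {ρ : Representation E (Mp F) V} (hs : IsSmooth ρ)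
    (hg : IsGenuine ρ) (ϖ : Uniformizer F) (h2 : ringChar 𝓀[F] ≠ 2) (hE : (2 : E) ≠ 0) {v : V}
    (hv : ∀ x, ρ (upperUnip x) v = v) : v = 0 := by
  obtain ⟨n, hn⟩ := hs.lowerUnip ϖ v
  obtain ⟨ε, hε0, hε⟩ := exists_nonsquare_unit h2
  -- `h̃(x) w` fixes `v` for all `x` of sufficiently negative valuation
  have hw : ∀ x : Fˣ, ord (x : F) ≤ -n → hTilde x * weyl F ∈ stab ρ v := by
    intro x hx
    have hx' : lowerUnip ((x⁻¹ : Fˣ) : F) ∈ stab ρ v := by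
      refine hn _ (Or.inr ?_)
      rw [Units.val_inv_eq_inv_val, ord_inv]; omega
    have h1 : upperUnip (x : F) ∈ stab ρ v := hv x
    have e : hTilde x * weyl F = (lowerUnip ((x⁻¹ : Fˣ) : F))⁻¹ * upperUnip (x : F) *
        (lowerUnip ((x⁻¹ : Fˣ) : F))⁻¹ := by
      rw [upperUnip_eq]; group
    rw [e]
    exact Subgroup.mul_mem _ (Subgroup.mul_mem _ (Subgroup.inv_mem _ hx') h1)
      (Subgroup.inv_mem _ hx')
  -- `h̃(εx) w (h̃(x) w)⁻¹` is a lift of `diag(ε, ε⁻¹)` whose sign depends on the parity of the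
  -- valuation of `x`
  have key : ∀ x : Fˣ, ord (x : F) ≤ -n → hTilde ε * mk 1 (hilb (ε : F) (x : F)) ∈ stab ρ v := by
    intro x hx
    have hεx : ord ((ε * x : Fˣ) : F) ≤ -n := by
      rw [Units.val_mul, ord_mul ε.ne_zero x.ne_zero, hε0]; omega
    have h3 := Subgroup.mul_mem _ (hw _ hεx) (Subgroup.inv_mem _ (hw _ hx))
    have e : hTilde (ε * x) * weyl F * (hTilde x * weyl F)⁻¹ = hTilde ε * mk 1 (hilb (ε : F) (x : F)) := by
      have h4 := hTilde_mul ε x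
      have h5 : hTilde (ε * x) = hTilde ε * hTilde x * mk 1 (hilb (ε : F) (x : F)) := by
        rw [h4, mul_assoc, central_mul, int_units_sq, mk_one_one, mul_one]
      rw [h5, mul_assoc (hTilde ε), ← central_comm]
      group
    rwa [e] at h3
  have hX : ∀ m : ℤ, ord ((ϖ.unit ^ m : Fˣ) : F) = m := fun m => by
    rw [Units.val_zpow_eq_zpow_val, uniformizer_unit_val, ord_uniformizer_zpow]
  have k1 := key (ϖ.unit ^ (-(n : ℤ))) (by rw [hX])
  have k2 := key (ϖ.unit ^ (-(n : ℤ)) * (ϖ.unit)⁻¹) (by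
    rw [Units.val_mul, ord_mul (Units.ne_zero _) (Units.ne_zero _), hX, Units.val_inv_eq_inv_val,
      ord_inv, uniformizer_unit_val, ord_uniformizer]; omega)
  have e : hilb (ε : F) ((ϖ.unit ^ (-(n : ℤ)) * (ϖ.unit)⁻¹ : Fˣ) : F) =
      -hilb (ε : F) ((ϖ.unit ^ (-(n : ℤ)) : Fˣ) : F) := by
    rw [Units.val_mul, hilb_mul_right ε.ne_zero (Units.ne_zero _) (Units.ne_zero _),
      Units.val_inv_eq_inv_val, hilb_inv_right ε.ne_zero (Units.ne_zero _), uniformizer_unit_val,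
      hilb_unit_uniformizer ϖ ε.ne_zero hε0, hε, mul_neg, mul_one]
  rw [e] at k2
  rw [mem_stab, rep_mul, hg.central] at k1 k2
  generalize hilb (ε : F) ((ϖ.unit ^ (-(n : ℤ)) : Fˣ) : F) = ζ at k1 k2
  rw [Units.val_neg, Int.cast_neg, neg_smul, map_neg, k1] at k2
  have h3 : (2 : E) • v = 0 := by
    rw [two_smul]
    nth_rewrite 1 [← k2]
    rw [neg_add_cancel]
  exact (smul_eq_zero.1 h3).resolve_left hE

end Genuine

/-! ### Power sums over a finite field -/

section PowerSums

variable {k E : Type*} [Field k] [Fintype k] [Field E] (ι : k →+* E)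

/-- The power sums over `k` in `E`; with `0 ^ 0 = 1` the sum for `i = 0` is `|k| = 0`. -/
lemma sum_pow_eq (i : ℕ) : ∑ x : k, (ι x) ^ i =
    if 0 < i ∧ Fintype.card k - 1 ∣ i then -1 else 0 := by
  classical
  have h1 : ∑ x : k, (ι x) ^ i = ι (∑ x : k, x ^ i) := by simp [map_sum]
  rw [h1]
  rcases Nat.eq_zero_or_pos i with hi | hi
  · subst hi
    simp
  · have h2 : ∑ x : k, x ^ i = ∑ x : kˣ, (x ^ i : k) := by
      rw [← Finset.sum_filter_add_sum_filter_not Finset.univ (fun x : k => x ≠ 0)]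
      have h3 : ∑ x ∈ Finset.univ.filter (fun x : k => ¬ x ≠ 0), x ^ i = 0 := by
        refine Finset.sum_eq_zero fun x hx => ?_
        have : x = 0 := by simpa using hx
        rw [this, zero_pow hi.ne']
      rw [h3, add_zero]
      refine (Finset.sum_bij (fun (x : kˣ) _ => (x : k)) ?_ ?_ ?_ ?_).symm
      · intro x _; simp
      · intro x _ y _ h; exact Units.ext h
      · intro x hx
        exact ⟨Units.mk0 x (by simpa using hx), Finset.mem_univ _, rfl⟩
      · intro x _; simp
    rw [h2, FiniteField.sum_pow_units]
    simp only [hi, true_and]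
    split_ifs <;> simp

end PowerSums

/-! ### Weights and their highest weight vectors -/

section Weights

open MvPolynomial

variable {E : Type*} [Field E]

/-- The monomial `X₀ ^ (n - j) X₁ ^ j` of `Sym^n(E²)`. -/
def symMono (n : ℕ) (j : Fin (n + 1)) : Forms E n :=
  ⟨MvPolynomial.X 0 ^ (n - (j : ℕ)) * MvPolynomial.X 1 ^ (j : ℕ), by
    rw [mem_homogeneousSubmodule]
    have h := ((isHomogeneous_X E (0 : Fin 2)).pow (n - (j : ℕ))).mul
      ((isHomogeneous_X E (1 : Fin 2)).pow (j : ℕ))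
    have e : 1 * (n - (j : ℕ)) + 1 * (j : ℕ) = n := by omega
    rwa [e] at h⟩

lemma symMono_zero (n : ℕ) : symMono n 0 = topForm (E := E) n := by
  refine Subtype.ext ?_
  simp [symMono, topForm]

lemma symRep_topForm (n : ℕ) (g : SL(2, E)) : symRep n g (topForm n) =
    ∑ j : Fin (n + 1), ((n.choose j : E) * (g.1 0 0) ^ (n - (j : ℕ)) * (g.1 1 0) ^ (j : ℕ)) •
      symMono n j := by
  refine Subtype.ext ?_
  have hs : ((∑ j : Fin (n + 1), ((n.choose j : E) * (g.1 0 0) ^ (n - (j : ℕ)) *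
      (g.1 1 0) ^ (j : ℕ)) • symMono n j : Forms E n) : MvPolynomial (Fin 2) E) =
      ∑ j : Fin (n + 1), ((n.choose j : E) * (g.1 0 0) ^ (n - (j : ℕ)) *
      (g.1 1 0) ^ (j : ℕ)) • (MvPolynomial.X 0 ^ (n - (j : ℕ)) * MvPolynomial.X 1 ^ (j : ℕ)) := by
    rw [Submodule.coe_sum]; rfl
  rw [hs, symRep_coe]
  change substHom g (MvPolynomial.X 0 ^ n) = _
  rw [map_pow, substHom_X, Fin.sum_univ_two, add_comm, add_pow,
    Finset.sum_range (fun m => (C (g.1 1 0) * MvPolynomial.X 1) ^ m * (C (g.1 0 0) * MvPolynomial.X 0) ^ (n - m) *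
      ((n.choose m : ℕ) : MvPolynomial (Fin 2) E))]
  refine Finset.sum_congr rfl fun j _ => ?_
  rw [smul_eq_C_mul, mul_pow, mul_pow]
  simp only [map_mul, map_pow, map_natCast]
  ring

lemma symMono_eq_monomial (n : ℕ) (j : Fin (n + 1)) : (symMono (E := E) n j).1 =
    monomial (Finsupp.single 0 (n - (j : ℕ)) + Finsupp.single 1 (j : ℕ)) 1 := by
  change MvPolynomial.X 0 ^ (n - (j : ℕ)) * MvPolynomial.X 1 ^ (j : ℕ) = _
  rw [X_pow_eq_monomial, X_pow_eq_monomial, monomial_mul, one_mul]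

lemma exists_eq_sum_symMono {n : ℕ} (P : Forms E n) :
    ∃ c : Fin (n + 1) → E, P = ∑ j, c j • symMono n j := by
  refine ⟨fun j => P.1.coeff (Finsupp.single 0 (n - (j : ℕ)) + Finsupp.single 1 (j : ℕ)),
    Subtype.ext ?_⟩
  rw [Submodule.coe_sum]
  simp only [Submodule.coe_smul, symMono_eq_monomial]
  ext d
  rw [coeff_sum]
  simp only [coeff_smul, coeff_monomial, smul_eq_mul, mul_ite, mul_one, mul_zero]
  by_cases hd : d 0 + d 1 = n
  · have hd1 : d 1 < n + 1 := by omega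
    rw [Finset.sum_eq_single ⟨d 1, hd1⟩]
    · have e : Finsupp.single 0 (n - d 1) + Finsupp.single 1 (d 1) = d := by
        ext i
        fin_cases i
        · simp; omega
        · simp
      simp only [e, if_true]
    · intro j _ hj
      rw [if_neg]
      intro h
      apply hj
      have := DFunLike.congr_fun h 1
      simp at this
      exact Fin.ext this
    · intro h; exact absurd (Finset.mem_univ _) h
  · have h0 : P.1.coeff d = 0 := by
      have hP : P.1.IsHomogeneous n := P.2
      refine hP.coeff_eq_zero ?_
      rw [Finsupp.degree_eq_sum, Fin.sum_univ_two]
      exact hd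
    rw [h0]
    refine (Finset.sum_eq_zero fun j _ => ?_).symm
    rw [if_neg]
    rintro rfl
    apply hd
    simp
    omega

variable {p f : ℕ} (r : Fin f → Fin p)

variable {r} in
/-- Pure tensors in the space of a weight. -/
def wtTprod (v : ∀ i, Forms E (r i : ℕ)) : WtSpace E r := PiTensorProduct.tprod E v

lemma wtMap_wtTprod (u : ∀ i, Module.End E (Forms E (r i : ℕ))) (v : ∀ i, Forms E (r i : ℕ)) :
    wtMap u (wtTprod v) = wtTprod fun i => u i (v i) :=
  PiTensorProduct.map_tprod _ _

/-- The index set of the weight vectors of a weight. -/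
abbrev WtIndex : Type := ∀ i, Fin ((r i : ℕ) + 1)

variable {r} in
/-- The weight vectors of a weight. -/
def wtMono (j : WtIndex r) : WtSpace E r := wtTprod fun i => symMono (r i) (j i)

lemma wtTprod_sum (c : ∀ i, Fin ((r i : ℕ) + 1) → E) :
    (wtTprod fun i => ∑ j, c i j • symMono (r i : ℕ) j : WtSpace E r) =
      ∑ j : WtIndex r, (∏ i, c i (j i)) • wtMono j := by
  classical
  refine ((PiTensorProduct.tprod E).map_sum (fun i (j : Fin ((r i : ℕ) + 1)) =>
    c i j • symMono (r i : ℕ) j)).trans ?_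
  refine Finset.sum_congr rfl fun j _ => ?_
  exact (PiTensorProduct.tprod E).map_smul_univ _ _

lemma span_wtMono : Submodule.span E (Set.range (wtMono (E := E) (r := r))) = ⊤ := by
  rw [eq_top_iff]
  have h : Submodule.span E (Set.range (wtTprod (E := E) (r := r))) = ⊤ :=
    PiTensorProduct.span_tprod_eq_top
  rw [← h, Submodule.span_le]
  rintro _ ⟨v, rfl⟩
  choose c hc using fun i => exists_eq_sum_symMono (v i)
  have : v = fun i => ∑ j, c i j • symMono (r i : ℕ) j := funext hc
  rw [this, wtTprod_sum]
  exact Submodule.sum_mem _ fun j _ => Submodule.smul_mem _ _ (Submodule.subset_span ⟨j, rfl⟩)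

instance : FiniteDimensional E (WtSpace E r) :=
  Module.finite_def.2 (Submodule.fg_def.2 ⟨_, Set.finite_range _, span_wtMono r⟩)

/-- The highest weight vector. -/
def topVec : WtSpace E r := wtTprod fun i => topForm (r i : ℕ)

/-- The integer `∑ jᵢ pⁱ`. -/
def wtExp {r : Fin f → Fin p} (j : WtIndex r) : ℕ := ∑ i, (j i : ℕ) * p ^ (i : ℕ)

/-- The integer `∑ rᵢ pⁱ`. The matrix `diag(x, x⁻¹)` acts on the highest weight vector by the power
of `x` with this exponent. -/
def wtTotal (r : Fin f → Fin p) : ℕ := ∑ i, (r i : ℕ) * p ^ (i : ℕ)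

lemma wtTotal_lt : wtTotal r < p ^ f := by
  have := (finFunctionFinEquiv r).2
  rwa [finFunctionFinEquiv_apply] at this

lemma exists_wtTotal_eq {n : ℕ} (hn : n < p ^ f) : ∃ r : Fin f → Fin p, wtTotal r = n :=
  ⟨finFunctionFinEquiv.symm ⟨n, hn⟩, by
    have := congrArg Fin.val (finFunctionFinEquiv.apply_symm_apply (⟨n, hn⟩ : Fin (p ^ f)))
    rwa [finFunctionFinEquiv_apply] at this⟩

variable {r}

/-- The digits of a weight index as a function to `Fin p`. -/
def WtIndex.toFun (j : WtIndex r) (i : Fin f) : Fin p := ⟨j i, by have := (j i).2; have := (r i).2; omega⟩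

lemma wtExp_inj {j j' : WtIndex r} (h : wtExp j = wtExp j') : j = j' := by
  have h1 : finFunctionFinEquiv j.toFun = finFunctionFinEquiv j'.toFun := by
    apply Fin.ext
    rw [finFunctionFinEquiv_apply, finFunctionFinEquiv_apply]
    exact h
  have h2 := finFunctionFinEquiv.injective h1
  funext i
  have h3 := congrFun h2 i
  exact Fin.ext (congrArg (fun x : Fin p => (x : ℕ)) h3)

lemma wtExp_lt (j : WtIndex r) : wtExp j < p ^ f := wtTotal_lt j.toFun

variable {k : Type*} [Field k] (ι : k →+* E) [ExpChar E p]

lemma weight_wtTprod (g : SL(2, k)) (v : ∀ i, Forms E (r i : ℕ)) :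
    weight ι p r g (wtTprod v) = wtTprod fun i => symRep (r i : ℕ) (twist ι p i g) (v i) :=
  wtMap_wtTprod r _ _

/-- The binomial coefficient in front of a weight vector in the translates of the highest weight
vector. -/
def wtBinom (j : WtIndex r) : E := ∏ i, ((r i : ℕ).choose (j i) : E)

lemma weight_topVec (g : SL(2, k)) : weight ι p r g (topVec r) =
    ∑ j : WtIndex r, (wtBinom j * ∏ i : Fin f, ((ι (g.1 0 0) ^ p ^ (i : ℕ)) ^ ((r i : ℕ) - (j i : ℕ)) *
      (ι (g.1 1 0) ^ p ^ (i : ℕ)) ^ (j i : ℕ))) • wtMono j := by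
  rw [topVec, weight_wtTprod]
  simp only [symRep_topForm, twist_apply]
  rw [wtTprod_sum r (fun i j => ((r i : ℕ).choose j : E) *
    (ι (g.1 0 0) ^ p ^ (i : ℕ)) ^ ((r i : ℕ) - (j : ℕ)) * (ι (g.1 1 0) ^ p ^ (i : ℕ)) ^ (j : ℕ))]
  refine Finset.sum_congr rfl fun j _ => ?_
  rw [wtBinom, ← Finset.prod_mul_distrib]
  simp only [mul_assoc]

lemma wtBinom_ne_zero [CharP E p] [Fact p.Prime] (j : WtIndex r) : (wtBinom j : E) ≠ 0 := by
  refine Finset.prod_ne_zero_iff.2 fun i _ => ?_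
  rw [Ne, CharP.cast_eq_zero_iff E p]
  intro h
  have h1 : (r i : ℕ).choose (j i) ∣ (r i : ℕ).factorial := by
    have := Nat.choose_mul_factorial_mul_factorial (Nat.lt_succ_iff.1 (j i).2)
    exact ⟨_, by rw [← this, mul_assoc]⟩
  have h2 := (Nat.Prime.dvd_factorial (Fact.out : p.Prime)).1 (h.trans h1)
  have := (r i).2
  omega

/-- The lower unipotent matrices. -/
def slLow (x : k) : SL(2, k) := ⟨!![1, 0; x, 1], by simp [Matrix.det_fin_two_of]⟩

lemma prod_pow_wtExp (y : E) (j : WtIndex r) :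
    ∏ i : Fin f, (y ^ p ^ (i : ℕ)) ^ (j i : ℕ) = y ^ wtExp j := by
  rw [wtExp, ← Finset.prod_pow_eq_pow_sum]
  refine Finset.prod_congr rfl fun i _ => ?_
  rw [← pow_mul, Nat.mul_comm]

lemma weight_low_topVec (x : k) : weight ι p r (slLow x) (topVec r) =
    ∑ j : WtIndex r, (wtBinom j * ι x ^ wtExp j) • wtMono j := by
  rw [weight_topVec]
  refine Finset.sum_congr rfl fun j _ => ?_
  have h0 : (slLow x).1 0 0 = 1 := rfl
  have h1 : (slLow x).1 1 0 = x := rfl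
  rw [h0, h1, ← prod_pow_wtExp]
  simp

lemma wtMono_zero : wtMono (fun _ => 0) = topVec (E := E) r := by
  unfold wtMono topVec
  congr 1
  funext i
  exact symMono_zero _

lemma wtExp_zero : wtExp (r := r) (fun _ => 0) = 0 := by simp [wtExp]

/-- Every weight vector other than the highest one is a combination of translates of the highest
weight vector by lower unipotent matrices, with coefficients of sum zero. -/
lemma exists_wtMono_eq_sum [Fintype k] [CharP E p] [Fact p.Prime] (hk : Fintype.card k = p ^ f)
    {j : WtIndex r} (hj : j ≠ fun _ => 0) :
    ∃ c : k → E, ∑ x, c x = 0 ∧ wtMono j = ∑ x, c x • weight ι p r (slLow x) (topVec r) := by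
  have hj0 : wtExp j ≠ 0 := fun h => hj (wtExp_inj (h.trans wtExp_zero.symm))
  have hjl := wtExp_lt j
  set q := Fintype.card k with hq
  have hpos : (1 : ℕ) < q := Fintype.one_lt_card
  -- the translates by lower unipotent matrices are polynomials in `x` with distinct exponents
  -- `wtExp j'` between `0` and `q - 1`, whose coefficients are extracted by power sums
  have hsum : ∀ j' : WtIndex r, ∑ x : k, ι x ^ (q - 1 - wtExp j + wtExp j') =
      if j' = j then -1 else 0 := by
    intro j'
    have hl' := wtExp_lt j'
    rw [sum_pow_eq, ← hq]
    congr 1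
    rw [eq_iff_iff]
    constructor
    · rintro ⟨h1, c, hc⟩
      apply wtExp_inj
      have hc1 : c < 2 := by
        by_contra h
        have : (q - 1) * 2 ≤ (q - 1) * c := Nat.mul_le_mul_left _ (by omega)
        omega
      interval_cases c <;> omega
    · rintro rfl
      exact ⟨by omega, ⟨1, by omega⟩⟩
  refine ⟨fun x => -(wtBinom j)⁻¹ * ι x ^ (q - 1 - wtExp j), ?_, ?_⟩
  · rw [← Finset.mul_sum, sum_pow_eq, if_neg, mul_zero]
    rintro ⟨h1, h2⟩
    have := Nat.le_of_dvd h1 h2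
    omega
  · simp only [weight_low_topVec, Finset.smul_sum, smul_smul]
    rw [Finset.sum_comm]
    have h2 : ∀ j' : WtIndex r, ∑ x : k, (-(wtBinom j)⁻¹ * ι x ^ (q - 1 - wtExp j) *
        (wtBinom j' * ι x ^ wtExp j')) • wtMono (E := E) j' =
        if j' = j then wtMono (E := E) j' else 0 := by
      intro j'
      rw [← Finset.sum_smul]
      have : ∀ x : k, (-(wtBinom j)⁻¹ * ι x ^ (q - 1 - wtExp j) *
        (wtBinom j' * ι x ^ wtExp j')) = -(wtBinom j)⁻¹ * wtBinom j' *
          ι x ^ (q - 1 - wtExp j + wtExp j') := fun x => by rw [pow_add]; ring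
      simp only [this]
      rw [← Finset.mul_sum, hsum]
      split_ifs with h
      · subst h
        rw [mul_neg, mul_one, neg_mul, neg_neg, inv_mul_cancel₀ (wtBinom_ne_zero _), one_smul]
      · rw [mul_zero, zero_smul]
    rw [Finset.sum_congr rfl fun j' _ => h2 j']
    simp

/-- The highest weight vector generates a weight under the lower unipotent matrices. -/
lemma eq_top_of_topVec_mem [Fintype k] [CharP E p] [Fact p.Prime] (hk : Fintype.card k = p ^ f)
    (N : Submodule E (WtSpace E r)) (h : topVec r ∈ N)
    (hN : ∀ x : k, ∀ v ∈ N, weight ι p r (slLow x) v ∈ N) : N = ⊤ := by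
  rw [eq_top_iff, ← span_wtMono, Submodule.span_le]
  rintro _ ⟨j, rfl⟩
  by_cases hj : j = fun _ => 0
  · subst hj; rw [wtMono_zero]; exact h
  · obtain ⟨c, -, hc⟩ := exists_wtMono_eq_sum ι hk hj
    rw [hc]
    exact N.sum_mem fun x _ => N.smul_mem _ (hN x _ h)

/-- A linear map which is invariant under the lower unipotent matrices kills the lower weight
vectors. -/
lemma map_wtMono_eq_zero [Fintype k] [CharP E p] [Fact p.Prime] (hk : Fintype.card k = p ^ f)
    {M : Type*} [AddCommGroup M] [Module E M] (ψ : WtSpace E r →ₗ[E] M)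
    (hψ : ∀ (x : k) v, ψ (weight ι p r (slLow x) v) = ψ v) {j : WtIndex r}
    (hj : j ≠ fun _ => 0) : ψ (wtMono j) = 0 := by
  obtain ⟨c, hc0, hc⟩ := exists_wtMono_eq_sum ι hk hj
  rw [hc, map_sum]
  simp only [map_smul, hψ]
  rw [← Finset.sum_smul, hc0, zero_smul]

/-- A linear map which is invariant under the lower unipotent matrices is determined by its value
at the highest weight vector. -/
lemma eq_zero_of_map_topVec [Fintype k] [CharP E p] [Fact p.Prime] (hk : Fintype.card k = p ^ f)
    {M : Type*} [AddCommGroup M] [Module E M] (ψ : WtSpace E r →ₗ[E] M)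
    (hψ : ∀ (x : k) v, ψ (weight ι p r (slLow x) v) = ψ v) (h0 : ψ (topVec r) = 0) : ψ = 0 := by
  refine LinearMap.ext_on_range (span_wtMono r) fun j => ?_
  by_cases hj : j = fun _ => 0
  · subst hj; rw [wtMono_zero, h0]; rfl
  · rw [map_wtMono_eq_zero ι hk ψ hψ hj]; rfl

lemma wtProj_topVec : wtProj r (topVec (E := E) r) = topVec r := by
  rw [wtProj, topVec, wtMap_wtTprod]
  congr 1
  funext i
  refine Subtype.ext ?_
  rw [topProj_coe]
  simp [topForm]

/-- An element whose upper left entry vanishes maps the highest weight vector into the kernel of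
the projection, unless the weight is trivial. -/
lemma wtProj_weight_topVec [Fact p.Prime] (hr : wtTotal r ≠ 0) {g : SL(2, k)} (hg : g.1 0 0 = 0) :
    wtProj r (weight ι p r g (topVec r)) = 0 := by
  obtain ⟨i, hi⟩ : ∃ i, (r i : ℕ) ≠ 0 := by
    by_contra h
    push Not at h
    exact hr (Finset.sum_eq_zero fun i _ => by rw [h i, zero_mul])
  rw [topVec, weight_wtTprod, wtProj, wtMap_wtTprod]
  refine (PiTensorProduct.tprod E).map_coord_zero i ?_
  refine Subtype.ext ?_
  rw [topProj_coe, symRep_coe]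
  change (substHom _ (MvPolynomial.X 0 ^ (r i : ℕ))).eval ![1, 0] • _ = _
  rw [map_pow, substHom_X, Fin.sum_univ_two, twist_apply, hg, map_zero,
    zero_pow (pow_ne_zero _ (Fact.out : p.Prime).ne_zero)]
  simp [hi]

/-- An upper triangular element acts on the highest weight vector by a scalar. -/
lemma weight_topVec_of_upper [Fact p.Prime] {g : SL(2, k)} (hg : g.1 1 0 = 0) :
    weight ι p r g (topVec r) = (ι (g.1 0 0) ^ wtTotal r) • topVec r := by
  rw [weight_topVec, Finset.sum_eq_single fun _ => 0]
  · rw [wtMono_zero]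
    congr 1
    simp only [wtBinom, Fin.val_zero, Nat.choose_zero_right, Nat.cast_one, Finset.prod_const_one,
      one_mul, pow_zero, mul_one, tsub_zero]
    rw [wtTotal, ← Finset.prod_pow_eq_pow_sum]
    refine Finset.prod_congr rfl fun i _ => ?_
    rw [← pow_mul, Nat.mul_comm]
  · intro j _ hj
    obtain ⟨i, hi⟩ : ∃ i, j i ≠ 0 := by
      by_contra h; push Not at h; exact hj (funext h)
    rw [Finset.prod_eq_zero (Finset.mem_univ i), mul_zero, zero_smul]
    rw [hg, map_zero, zero_pow (pow_ne_zero _ (Fact.out : p.Prime).ne_zero), zero_pow, mul_zero]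
    exact fun h => hi (Fin.ext h)
  · intro h; exact absurd (Finset.mem_univ _) h

/-- An element whose upper left entry vanishes maps the highest weight vector to a multiple of
the lowest weight vector. -/
lemma weight_topVec_of_zero [Fact p.Prime] {g : SL(2, k)} (hg : g.1 0 0 = 0) :
    weight ι p r g (topVec r) = (ι (g.1 1 0) ^ wtTotal r) • wtMono fun i => Fin.last (r i : ℕ) := by
  rw [weight_topVec, Finset.sum_eq_single fun i => Fin.last (r i : ℕ)]
  · congr 1
    simp only [wtBinom, Fin.val_last, Nat.choose_self, Nat.cast_one, Finset.prod_const_one,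
      one_mul, tsub_self, pow_zero]
    rw [wtTotal, ← Finset.prod_pow_eq_pow_sum]
    refine Finset.prod_congr rfl fun i _ => ?_
    rw [← pow_mul, Nat.mul_comm]
  · intro j _ hj
    obtain ⟨i, hi⟩ : ∃ i, j i ≠ Fin.last _ := by
      by_contra h; push Not at h; exact hj (funext h)
    rw [Finset.prod_eq_zero (Finset.mem_univ i), mul_zero, zero_smul]
    have h1 : (j i : ℕ) < r i := lt_of_le_of_ne (Nat.lt_succ_iff.1 (j i).2)
      fun h => hi (Fin.ext h)
    rw [hg, map_zero, zero_pow (pow_ne_zero _ (Fact.out : p.Prime).ne_zero), zero_pow, zero_mul]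
    omega
  · intro h; exact absurd (Finset.mem_univ _) h

variable (r) in
/-- The functional giving the coefficient of the lowest weight vector. -/
def lowEval : WtSpace E r →ₗ[E] E :=
  PiTensorProduct.lift ((MultilinearMap.mkPiAlgebra E (Fin f) E).compLinearMap fun i =>
    ((aeval ![(0 : E), 1]).toLinearMap ∘ₗ (Forms E (r i : ℕ)).subtype))

lemma lowEval_wtTprod (v : ∀ i, Forms E (r i : ℕ)) :
    lowEval r (wtTprod v) = ∏ i, (v i).1.eval ![(0 : E), 1] := by
  refine (PiTensorProduct.lift.tprod _).trans ?_
  simp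

lemma lowEval_weight_topVec (g : SL(2, k)) :
    lowEval r (weight ι p r g (topVec r)) = ι (g.1 1 0) ^ wtTotal r := by
  rw [topVec, weight_wtTprod, lowEval_wtTprod, wtTotal, ← Finset.prod_pow_eq_pow_sum]
  refine Finset.prod_congr rfl fun i _ => ?_
  rw [symRep_coe]
  change (substHom _ (MvPolynomial.X 0 ^ (r i : ℕ))).eval ![0, 1] = _
  rw [map_pow, substHom_X, Fin.sum_univ_two, twist_apply, twist_apply]
  simp
  rw [← pow_mul, Nat.mul_comm]

end Weights

/-! ### Representations of `SL₂` over a finite field -/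

section FiniteGroup

variable {k E : Type*} [Field k] [Field E]

/-- The upper unipotent matrices. -/
def slUp (x : k) : SL(2, k) := ⟨!![1, x; 0, 1], by simp [Matrix.det_fin_two_of]⟩

/-- The diagonal matrices. -/
def slDiag (s : kˣ) : SL(2, k) := ⟨!![(s : k), 0; 0, (s⁻¹ : kˣ)], by simp [Matrix.det_fin_two_of]⟩

variable (k) in
/-- The nontrivial element of the Weyl group. -/
def slWeyl : SL(2, k) := ⟨!![0, 1; -1, 0], by simp [Matrix.det_fin_two_of]⟩

lemma slUp_mul (x y : k) : slUp x * slUp y = slUp (x + y) := by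
  refine Subtype.ext ?_
  change !![1, x; 0, 1] * !![1, y; 0, 1] = !![1, x + y; 0, 1]
  rw [Matrix.mul_fin_two]; simp [add_comm]

lemma slDiag_mul (s t : kˣ) : slDiag s * slDiag t = slDiag (s * t) := by
  refine Subtype.ext ?_
  change !![(s : k), 0; 0, (s⁻¹ : kˣ)] * !![(t : k), 0; 0, (t⁻¹ : kˣ)] =
    !![((s * t : kˣ) : k), 0; 0, ((s * t)⁻¹ : kˣ)]
  rw [Matrix.mul_fin_two]; simp [mul_comm]

lemma slDiag_mul_slUp (s : kˣ) (x : k) :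
    slDiag s * slUp x = slUp ((s : k) * s * x) * slDiag s := by
  refine Subtype.ext ?_
  change !![(s : k), 0; 0, (s⁻¹ : kˣ)] * !![1, x; 0, 1] =
    !![1, (s : k) * s * x; 0, 1] * !![(s : k), 0; 0, (s⁻¹ : kˣ)]
  rw [Matrix.mul_fin_two, Matrix.mul_fin_two]
  have := s.mul_inv
  ext i j
  fin_cases i <;> fin_cases j <;> simp
  field_simp

lemma slUp_zero : slUp (0 : k) = 1 := by
  refine Subtype.ext ?_
  change !![1, (0 : k); 0, 1] = 1
  rw [Matrix.one_fin_two]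

lemma slDiag_one : slDiag (1 : kˣ) = 1 := by
  refine Subtype.ext ?_
  change !![((1 : kˣ) : k), 0; 0, ((1 : kˣ)⁻¹ : kˣ)] = 1
  rw [Matrix.one_fin_two]; simp

/-- The Bruhat decomposition on the big cell. -/
lemma eq_slUp_mul_of_ne (γ : SL(2, k)) (c : kˣ) (hc : γ.1 1 0 = c) :
    γ = slUp (γ.1 0 0 * (c⁻¹ : kˣ)) * slDiag (-c⁻¹) * slWeyl k *
      slUp (γ.1 1 1 * (c⁻¹ : kˣ)) := by
  have hd := γ.2
  rw [Matrix.det_fin_two, hc] at hd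
  refine Subtype.ext ?_
  change γ.1 = !![1, γ.1 0 0 * (c⁻¹ : kˣ); 0, 1] * !![((-c⁻¹ : kˣ) : k), 0; 0, ((-c⁻¹)⁻¹ : kˣ)] *
    !![0, 1; -1, 0] * !![1, γ.1 1 1 * (c⁻¹ : kˣ); 0, 1]
  rw [Matrix.mul_fin_two, Matrix.mul_fin_two, Matrix.mul_fin_two]
  have e : ((-c⁻¹)⁻¹ : kˣ) = -c := by simp
  rw [e]
  have h1 : (c : k) * (c⁻¹ : kˣ) = 1 := c.mul_inv
  ext i j
  fin_cases i <;> fin_cases j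
  · simp
  · simp
    field_simp
    linear_combination -hd
  · simp [hc]
  · simp
    field_simp

lemma eq_slUp_mul_of_zero (γ : SL(2, k)) (a : kˣ) (ha : γ.1 0 0 = a) (hc : γ.1 1 0 = 0) :
    γ = slUp (a * γ.1 0 1) * slDiag a := by
  have hd := γ.2
  rw [Matrix.det_fin_two, hc, ha] at hd
  refine Subtype.ext ?_
  change γ.1 = !![1, (a : k) * γ.1 0 1; 0, 1] * !![(a : k), 0; 0, (a⁻¹ : kˣ)]
  rw [Matrix.mul_fin_two]
  have h1 : (a : k) * (a⁻¹ : kˣ) = 1 := a.mul_inv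
  ext i j
  fin_cases i <;> fin_cases j
  · simp [ha]
  · simp
    field_simp
  · simp [hc]
  · simp
    field_simp
    linear_combination hd

variable [Fintype k] (p : ℕ) [Fact p.Prime] [CharP E p] (ι : k →+* E)
variable {W : Type*} [AddCommGroup W] [Module E W]

include p in
/-- Every nonzero representation of `SL₂(k)` in characteristic `p` has a nonzero vector fixed by
the upper unipotent matrices, as these form a finite `p`-group. -/
lemma exists_slUp_fixed [Nontrivial W] [CharP k p] (τ : Representation E SL(2, k) W) :
    ∃ v, v ≠ 0 ∧ ∀ x, τ (slUp x) v = v := by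
  obtain ⟨v, hv⟩ := exists_ne (0 : W)
  let u : Multiplicative k →* SL(2, k) :=
    { toFun := fun x => slUp x.toAdd
      map_one' := slUp_zero
      map_mul' := fun x y => (slUp_mul _ _).symm }
  obtain ⟨w, -, hw, h⟩ := exists_fixed_vector p (τ.comp u) hv (Set.finite_range _) fun g =>
    ⟨1, fun h => by
      have : g ^ p ^ 1 = 1 := by
        rw [pow_one]
        apply Multiplicative.toAdd.injective
        rw [toAdd_pow, toAdd_one, nsmul_eq_mul, CharP.cast_eq_zero, zero_mul]
      rw [this, map_one]; rfl⟩
  exact ⟨w, hw, fun x => h (Multiplicative.ofAdd x)⟩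

/-- An element of `E` whose order divides that of the cyclic group `kˣ` is a power of the image of
a generator. -/
lemma exists_eq_pow_of_pow_eq_one {s : kˣ} (hs : ∀ x : kˣ, x ∈ Subgroup.zpowers s) {c : E}
    (hc : c ^ Nat.card kˣ = 1) : ∃ n : ℕ, c = ι s ^ n := by
  have h1 : orderOf s = Nat.card kˣ := orderOf_eq_card_of_forall_mem_zpowers hs
  have h2 : IsPrimitiveRoot (ι s) (Nat.card kˣ) := by
    rw [← h1]
    have h3 : IsPrimitiveRoot (s : k) (orderOf s) :=
      (IsPrimitiveRoot.orderOf s).map_of_injective (f := Units.coeHom k) Units.val_injective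
    exact h3.map_of_injective ι.injective
  have : NeZero (Nat.card kˣ) := ⟨Nat.card_pos.ne'⟩
  obtain ⟨i, -, hi⟩ := h2.eq_pow_of_pow_eq_one hc
  exact ⟨i, hi.symm⟩

include p in
/-- Every nonzero finite-dimensional representation of `SL₂(k)` has a nonzero functional which is
an eigenvector for the upper triangular subgroup. -/
lemma exists_eigenfunctional [IsAlgClosed E] [Nontrivial W] [FiniteDimensional E W] [CharP k p]
    (τ : Representation E SL(2, k) W) :
    ∃ (ℓ : W →ₗ[E] E) (n : ℕ), ℓ ≠ 0 ∧ (∀ x w, ℓ (τ (slUp x) w) = ℓ w) ∧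
      ∀ (s : kˣ) w, ℓ (τ (slDiag s) w) = ι s ^ n * ℓ w := by
  classical
  -- `S` is the space of the functionals invariant under the upper unipotent matrices; as `kˣ` is
  -- cyclic, it suffices to diagonalize the action of one generator on it
  let S : Submodule E (W →ₗ[E] E) :=
    { carrier := {ℓ | ∀ x w, ℓ (τ (slUp x) w) = ℓ w}
      zero_mem' := fun x w => rfl
      add_mem' := fun {a b} ha hb x w => by simp [ha x w, hb x w]
      smul_mem' := fun c a ha x w => by simp [ha x w] }
  obtain ⟨ℓ0, hℓ0, h0⟩ := exists_slUp_fixed p (W := Module.Dual E W) τ.dual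
  have hS : Nontrivial S := ⟨⟨⟨ℓ0, fun x w => by
    have h1 := LinearMap.congr_fun (h0 (-x)) w
    rw [Representation.dual_apply] at h1
    have h2 : (slUp (-x))⁻¹ = slUp x := by
      rw [inv_eq_iff_mul_eq_one, slUp_mul, neg_add_cancel, slUp_zero]
    rw [h2] at h1
    exact h1⟩, 0, fun h => hℓ0 (congrArg Subtype.val h)⟩⟩
  obtain ⟨s0, hs0⟩ := IsCyclic.exists_generator (α := kˣ)
  let D : S →ₗ[E] S :=
    { toFun := fun ℓ => ⟨ℓ.1 ∘ₗ τ (slDiag s0), fun x w => by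
        change ℓ.1 (τ (slDiag s0) (τ (slUp x) w)) = ℓ.1 (τ (slDiag s0) w)
        rw [← Module.End.mul_apply, ← map_mul, slDiag_mul_slUp, map_mul, Module.End.mul_apply, ℓ.2]⟩
      map_add' := fun _ _ => rfl
      map_smul' := fun _ _ => rfl }
  obtain ⟨c, hc⟩ := Module.End.exists_eigenvalue (K := E) (V := S) D
  obtain ⟨ℓ, hℓ⟩ := hc.exists_hasEigenvector
  have h1 : ∀ w, ℓ.1 (τ (slDiag s0) w) = c * ℓ.1 w := fun w =>
    LinearMap.congr_fun (congrArg Subtype.val hℓ.apply_eq_smul) w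
  have h2 : ∀ (m : ℕ) w, ℓ.1 (τ (slDiag (s0 ^ m)) w) = c ^ m * ℓ.1 w := by
    intro m
    induction m with
    | zero => intro w; simp [slDiag_one]
    | succ m ih =>
      intro w
      rw [pow_succ, ← slDiag_mul, map_mul, Module.End.mul_apply, ih, h1, pow_succ, mul_assoc]
  have hne : ℓ.1 ≠ 0 := fun h => hℓ.2 (Subtype.ext h)
  obtain ⟨w0, hw0⟩ : ∃ w, ℓ.1 w ≠ 0 := by
    by_contra h; push Not at h; exact hne (LinearMap.ext h)
  have h3 : c ^ Nat.card kˣ = 1 := by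
    have h4 := h2 (Nat.card kˣ) w0
    rw [pow_card_eq_one', slDiag_one, map_one, Module.End.one_apply] at h4
    exact mul_right_cancel₀ hw0 (by rw [one_mul]; exact h4.symm)
  obtain ⟨n, hn⟩ := exists_eq_pow_of_pow_eq_one ι hs0 h3
  refine ⟨ℓ.1, n, hne, ℓ.2, fun s w => ?_⟩
  obtain ⟨m, rfl⟩ : ∃ m : ℕ, s0 ^ m = s := by
    obtain ⟨m, hm⟩ := (mem_powers_iff_mem_zpowers (x := s0) (y := s)).2 (hs0 s)
    exact ⟨m, hm⟩
  rw [h2, hn, Units.val_pow_eq_pow_val, map_pow, ← pow_mul, ← pow_mul, Nat.mul_comm]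

lemma map_pow_card_sub_one (s : kˣ) : ι s ^ (Fintype.card k - 1) = 1 := by
  rw [← map_pow, FiniteField.pow_card_sub_one_eq_one _ s.ne_zero, map_one]

include p in
/-- Given an eigenfunctional `ℓ` of the upper triangular subgroup, the matrix coefficients of some
nonzero vector against `ℓ` are proportional to those of the highest weight vector of a weight
against the lowest coordinate, namely `γ ↦ ι(c)^R` where `c` is the lower left entry of `γ`. -/
lemma exists_coefficient [Nontrivial W] {f : ℕ} (hk : Fintype.card k = p ^ f) [CharP k p]
    (τ : Representation E SL(2, k) W) (ℓ : W →ₗ[E] E)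
    (n : ℕ) (hu : ∀ x w, ℓ (τ (slUp x) w) = ℓ w)
    (hd : ∀ (s : kˣ) w, ℓ (τ (slDiag s) w) = ι s ^ n * ℓ w) :
    ∃ (v : W) (R : ℕ) (C : E), v ≠ 0 ∧ R < p ^ f ∧ ∀ γ, ℓ (τ γ v) = C * ι (γ.1 1 0) ^ R := by
  classical
  have hcard : 1 < Fintype.card k := Fintype.one_lt_card
  -- the big cell forces `R ≡ -n` modulo `q - 1`; the representative is chosen positive, so that
  -- `0 ^ R = 0` on the upper triangular subgroup
  obtain ⟨R, hR0, hRq, hR⟩ : ∃ R, 0 < R ∧ R < Fintype.card k ∧ Fintype.card k - 1 ∣ R + n := by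
    refine ⟨Fintype.card k - 1 - n % (Fintype.card k - 1), ?_, ?_, ?_⟩
    · have := Nat.mod_lt n (show 0 < Fintype.card k - 1 by omega); omega
    · omega
    · have h1 := Nat.mod_lt n (show 0 < Fintype.card k - 1 by omega)
      refine ⟨n / (Fintype.card k - 1) + 1, ?_⟩
      have h2 := Nat.div_add_mod n (Fintype.card k - 1)
      rw [mul_add, mul_one]; omega
  have hinv : ∀ s : kˣ, ι ((s⁻¹ : kˣ) : k) ^ n = ι s ^ R := by
    intro s
    obtain ⟨m, hm⟩ := hR
    have h1 : ι s ^ R * ι s ^ n = 1 := by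
      rw [← pow_add, hm, pow_mul, map_pow_card_sub_one, one_pow]
    have h2 : ι ((s⁻¹ : kˣ) : k) ^ n * ι s ^ n = 1 := by
      rw [← mul_pow, ← map_mul, Units.inv_mul, map_one, one_pow]
    exact mul_right_cancel₀ (right_ne_zero_of_mul_eq_one h1) (h2.trans h1.symm)
  -- by the Bruhat decomposition, the coefficients of a vector fixed by the upper unipotent matrices
  -- are determined by `ℓ v` and `ℓ (w v)`
  have hfix : ∀ v, (∀ x, τ (slUp x) v = v) → ∀ γ : SL(2, k), ∀ c : kˣ, γ.1 1 0 = c →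
      ℓ (τ γ v) = (-1) ^ n * ι c ^ R * ℓ (τ (slWeyl k) v) := by
    intro v hv γ c hc
    rw [eq_slUp_mul_of_ne γ c hc, map_mul, map_mul, map_mul, Module.End.mul_apply,
      Module.End.mul_apply, Module.End.mul_apply, hv, hu, hd, ← hinv, Units.val_neg, map_neg,
      neg_pow]
  have hfix0 : ∀ v, ∀ γ : SL(2, k), γ.1 1 0 = 0 → ∃ a : kˣ, ℓ (τ γ v) = ι a ^ n * ℓ v := by
    intro v γ hc
    have h0 : γ.1 0 0 ≠ 0 := by
      intro h
      have := γ.2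
      rw [Matrix.det_fin_two, h, hc] at this
      simp at this
    refine ⟨Units.mk0 _ h0, ?_⟩
    have e := congrArg (fun g => ℓ (τ g v)) (eq_slUp_mul_of_zero γ (Units.mk0 _ h0) rfl hc)
    refine e.trans ?_
    rw [map_mul, Module.End.mul_apply, hu, hd]
  have hgood : ∀ v, (∀ x, τ (slUp x) v = v) → ℓ v = 0 → ∀ γ,
      ℓ (τ γ v) = ((-1) ^ n * ℓ (τ (slWeyl k) v)) * ι (γ.1 1 0) ^ R := by
    intro v hv h0 γ
    by_cases hc : γ.1 1 0 = 0
    · obtain ⟨a, ha⟩ := hfix0 v γ hc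
      rw [ha, h0, hc, map_zero, zero_pow hR0.ne', mul_zero, mul_zero]
    · rw [hfix v hv γ (Units.mk0 _ hc) rfl, Units.val_mk0]; ring
  obtain ⟨v, hv0, hv⟩ := exists_slUp_fixed p τ
  -- `ℓ` kills the sum `v1` of `q` translates; so `v1` has the required coefficients, unless it
  -- vanishes
  set v1 : W := ∑ x : k, τ (slUp x) (τ (slWeyl k) v) with hv1
  have hv1u : ∀ x, τ (slUp x) v1 = v1 := by
    intro x
    rw [hv1, map_sum]
    refine (Finset.sum_congr rfl fun y _ => ?_).trans
      (Equiv.sum_comp (Equiv.addLeft x) fun y => τ (slUp y) (τ (slWeyl k) v))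
    rw [← Module.End.mul_apply, ← map_mul, slUp_mul]; rfl
  have hq0 : ((Fintype.card k : ℕ) : E) = 0 := by
    rw [← map_natCast ι, FiniteField.cast_card_eq_zero, map_zero]
  by_cases h1 : v1 = 0
  · -- evaluating `ℓ` at the translate of `v1 = 0` by the Weyl element
    have h2 : ℓ (τ (slWeyl k) v1) = (-1) ^ n * (ℓ v + ℓ (τ (slWeyl k) v) * ∑ x : k, ι x ^ R) := by
      have h3 : ∀ x : k, ℓ (τ (slWeyl k) (τ (slUp x) (τ (slWeyl k) v))) =
          (-1) ^ n * (ℓ (τ (slWeyl k) v) * ι x ^ R) + if x = 0 then (-1) ^ n * ℓ v else 0 := by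
        intro x
        rw [← Module.End.mul_apply, ← map_mul, ← Module.End.mul_apply, ← map_mul]
        have e10 : (slWeyl k * slUp x * slWeyl k).1 1 0 = x := by
          change (!![(0 : k), 1; -1, 0] * !![1, x; 0, 1] * !![0, 1; -1, 0] : Matrix (Fin 2) (Fin 2) k) 1 0 = x
          rw [Matrix.mul_fin_two, Matrix.mul_fin_two]; simp
        have e00 : (slWeyl k * slUp x * slWeyl k).1 0 0 = ((-1 : kˣ) : k) := by
          change (!![(0 : k), 1; -1, 0] * !![1, x; 0, 1] * !![0, 1; -1, 0] : Matrix (Fin 2) (Fin 2) k) 0 0 = _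
          rw [Matrix.mul_fin_two, Matrix.mul_fin_two]; simp
        by_cases hx : x = 0
        · rw [if_pos hx, eq_slUp_mul_of_zero _ _ e00 (e10.trans hx), map_mul, Module.End.mul_apply,
            hu, hd, hx, map_zero, zero_pow hR0.ne']
          simp
        · rw [if_neg hx, hfix v hv _ (Units.mk0 x hx) e10, Units.val_mk0]
          ring
      rw [hv1, map_sum, map_sum, Finset.sum_congr rfl fun x _ => h3 x, Finset.sum_add_distrib,
        ← Finset.mul_sum, ← Finset.mul_sum]
      simp
      ring
    rw [h1, map_zero, map_zero, sum_pow_eq] at h2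
    have h3 := (mul_eq_zero.1 h2.symm).resolve_left (pow_ne_zero _ (by simp))
    by_cases hdiv : Fintype.card k - 1 ∣ R
    -- here `q - 1` divides `n` and `R`, and all coefficients of `v` equal `ℓ v`: the trivial weight
    · rw [if_pos ⟨hR0, hdiv⟩] at h3
      have hone : ∀ s : kˣ, ι s ^ n = 1 := by
        intro s
        obtain ⟨m, hm⟩ := (Nat.dvd_add_right hdiv).1 hR
        rw [hm, pow_mul, map_pow_card_sub_one, one_pow]
      have hR1 : ∀ s : kˣ, ι s ^ R = 1 := by
        intro s
        obtain ⟨m, hm⟩ := hdiv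
        rw [hm, pow_mul, map_pow_card_sub_one, one_pow]
      have hm1 : (-1 : E) ^ n = 1 := by
        have := hone (-1)
        simpa using this
      refine ⟨v, 0, ℓ v, hv0, by rw [← hk]; omega, fun γ => ?_⟩
      rw [pow_zero, mul_one]
      by_cases hc : γ.1 1 0 = 0
      · obtain ⟨a, ha⟩ := hfix0 v γ hc
        rw [ha, hone, one_mul]
      · rw [hfix v hv γ (Units.mk0 _ hc) rfl, hR1, hm1]
        linear_combination -h3
    · rw [if_neg fun h => hdiv h.2, mul_zero, add_zero] at h3
      exact ⟨v, R, _, hv0, hk ▸ hRq, hgood v hv h3⟩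
  · refine ⟨v1, R, _, h1, hk ▸ hRq, hgood v1 hv1u ?_⟩
    rw [hv1, map_sum]
    simp only [hu]
    rw [Finset.sum_const, Finset.card_univ, ← Nat.cast_smul_eq_nsmul E, hq0, zero_smul]

/-- Every nonzero finite-dimensional representation of `SL₂(k)` receives a nonzero map from a
weight. -/
lemma exists_weight_map [IsAlgClosed E] {f : ℕ} (hk : Fintype.card k = p ^ f) [CharP k p]
    [Nontrivial W] [FiniteDimensional E W] (τ : Representation E SL(2, k) W) :
    ∃ (r : Fin f → Fin p) (Φ : WtSpace E r →ₗ[E] W), Φ ≠ 0 ∧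
      ∀ g v, Φ (weight ι p r g v) = τ g (Φ v) := by
  obtain ⟨d, hd⟩ : ∃ d, Module.finrank E W = d := ⟨_, rfl⟩
  induction d using Nat.strong_induction_on generalizing W with
  | _ d ih =>
    by_cases hirr : ∀ N : Subrepresentation τ, N.toSubmodule = ⊥ ∨ N.toSubmodule = ⊤
    · obtain ⟨ℓ, n, hℓ, hu, hdg⟩ := exists_eigenfunctional p ι τ
      obtain ⟨v, R, C, hv, hR, hvR⟩ := exists_coefficient p ι hk τ ℓ n hu hdg
      obtain ⟨r, hr⟩ := exists_wtTotal_eq hR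
      -- the matrix coefficients against `ℓ` embed `W` into the functions on the group
      let Fm : W →ₗ[E] (SL(2, k) → E) := LinearMap.pi fun γ => ℓ ∘ₗ τ γ
      have hFm : ∀ w γ, Fm w γ = ℓ (τ γ w) := fun _ _ => rfl
      have hinj : LinearMap.ker Fm = ⊥ := by
        refine (hirr ⟨LinearMap.ker Fm, fun g w hw => ?_⟩).resolve_right fun htop => hℓ ?_
        · rw [LinearMap.mem_ker] at hw ⊢
          funext γ
          have := congrFun hw (γ * g)
          rw [hFm, map_mul] at this
          exact this
        · refine LinearMap.ext fun w => ?_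
          have hw : w ∈ LinearMap.ker Fm := by
            change LinearMap.ker Fm = ⊤ at htop
            rw [htop]; trivial
          have := congrFun (LinearMap.mem_ker.1 hw) 1
          rw [hFm, map_one] at this
          exact this
      -- the weight maps to the functions on the group as well, through its lowest coordinate; as the
      -- highest weight vector generates it, its image lies in that of `W`
      let Ψ : WtSpace E r →ₗ[E] (SL(2, k) → E) := LinearMap.pi fun γ => lowEval r ∘ₗ weight ι p r γ
      have hΨ : ∀ P γ, Ψ P γ = lowEval r (weight ι p r γ P) := fun _ _ => rfl
      have hΨtop : ∀ γ, Ψ (topVec r) γ = ι (γ.1 1 0) ^ R := fun γ => by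
        rw [hΨ, lowEval_weight_topVec, hr]
      have hC : C ≠ 0 := by
        rintro rfl
        refine hv ?_
        have : v ∈ LinearMap.ker Fm := LinearMap.mem_ker.2 (funext fun γ => by
          rw [hFm, hvR, zero_mul]; rfl)
        rw [hinj] at this
        exact this
      have hrange : ∀ P, Ψ P ∈ LinearMap.range Fm := by
        have : (LinearMap.range Fm).comap Ψ = ⊤ := by
          refine eq_top_of_topVec_mem ι hk _ ?_ ?_
          · refine ⟨C⁻¹ • v, funext fun γ => ?_⟩
            rw [hFm, map_smul, map_smul, hvR, hΨtop, smul_eq_mul, inv_mul_cancel_left₀ hC]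
          · rintro x P ⟨w, hw⟩
            refine ⟨τ (slLow x) w, funext fun γ => ?_⟩
            have := congrFun hw (γ * slLow x)
            rw [hFm, map_mul, hΨ, map_mul] at this
            exact this
        intro P
        have hP : P ∈ (LinearMap.range Fm).comap Ψ := by rw [this]; trivial
        exact hP
      let e := LinearEquiv.ofInjective Fm (LinearMap.ker_eq_bot.1 hinj)
      let Φ : WtSpace E r →ₗ[E] W := e.symm.toLinearMap ∘ₗ Ψ.codRestrict _ hrange
      have hΦ : ∀ P, Fm (Φ P) = Ψ P := fun P => by
        have h1 : e (Φ P) = ⟨Ψ P, hrange P⟩ := e.apply_symm_apply _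
        exact congrArg Subtype.val h1
      refine ⟨r, Φ, fun h0 => ?_, fun g P => ?_⟩
      · have h1 := congrFun (hΦ (topVec r)) (slWeyl k)
        rw [h0, hΨtop] at h1
        have h2 : (slWeyl k).1 1 0 = -1 := rfl
        rw [h2] at h1
        simp at h1
        exact pow_ne_zero R (by simp) h1.symm
      · apply LinearMap.ker_eq_bot.1 hinj
        funext γ
        have h1 := congrFun (hΦ P) (γ * g)
        rw [hFm, map_mul, hΨ, map_mul] at h1
        rw [hΦ, hΨ, hFm]
        exact h1.symm
    · push Not at hirr
      obtain ⟨N, hN1, hN2⟩ := hirr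
      have hnt : Nontrivial N.toSubmodule := Submodule.nontrivial_iff_ne_bot.2 hN1
      obtain ⟨r, Φ, h0, h⟩ := ih _ (hd ▸ Submodule.finrank_lt hN2)
        N.toRepresentation rfl
      refine ⟨r, N.toSubmodule.subtype ∘ₗ Φ, fun h1 => h0 ?_, fun g v => ?_⟩
      · refine LinearMap.ext fun v => Subtype.ext ?_
        exact LinearMap.congr_fun h1 v
      · exact congrArg Subtype.val (h g v)

end FiniteGroup

/-! ### Powers of the torus element `h̃(ϖ)` -/

section TorusPowers

variable {F : Type*} [Field F] [ValuativeRel F] [TopologicalSpace F] [IsNonarchimedeanLocalField F]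

lemma tor_mem (a : Fˣ) (ζ : ℤˣ) : tor a ζ ∈ Torus F := by
  rw [tor_eq]; exact ⟨rfl, rfl⟩

/-- The elements of `T̃`, as elements of this group. -/
def torT (a : Fˣ) (ζ : ℤˣ) : Torus F := ⟨tor a ζ, tor_mem a ζ⟩

lemma exists_eq_torT (t : Torus F) : ∃ a ζ, t = torT a ζ := by
  obtain ⟨x, hx⟩ := t
  obtain ⟨a, b, c, d, h, ζ, rfl⟩ := exists_mk_sl x
  have hb : b = 0 := hx.1
  have hc : c = 0 := hx.2
  subst hb hc
  have ha : a ≠ 0 := by rintro rfl; simp at h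
  refine ⟨Units.mk0 a ha, ζ, Subtype.ext ?_⟩
  change _ = tor _ _
  rw [tor_eq]
  exact mk_sl_congr rfl rfl rfl (eq_inv_of_mul_eq_one_right (by rw [Units.val_mk0]; linear_combination h)) rfl

lemma torT_mul_torT (x y : Fˣ) (ζ ξ : ℤˣ) :
    torT x ζ * torT y ξ = torT (x * y) (ζ * ξ * hilb (x : F) (y : F)) :=
  Subtype.ext (tor_mul_tor x y ζ ξ)

lemma torus_comm (s t : Torus F) : s * t = t * s := by
  obtain ⟨a, ζ, rfl⟩ := exists_eq_torT s
  obtain ⟨b, ξ, rfl⟩ := exists_eq_torT t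
  exact Subtype.ext (tor_comm a b ζ ξ)

variable (ϖ : Uniformizer F)

/-- The element `h̃(ϖ)` of the metaplectic cover. -/
def hUnif : Mp F := hTilde ϖ.unit

/-- The element `h̃(ϖ)` of `T̃`. -/
def hUnifT : Torus F := ⟨hUnif ϖ, by rw [hUnif, hTilde_eq]; exact tor_mem _ _⟩

lemma coe_hUnifT : (hUnifT ϖ : Mp F) = hUnif ϖ := rfl

lemma hUnif_zpow_eq (k : ℤ) : ∃ ξ, hUnif ϖ ^ k = tor (ϖ.unit ^ k) ξ := by
  have h1 : ∃ ξ, hUnif ϖ = tor ϖ.unit ξ := ⟨_, hTilde_eq _⟩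
  obtain ⟨ξ, h1⟩ := h1
  obtain ⟨ξ', h2⟩ := tor_inv ϖ.unit ξ
  induction k using Int.induction_on with
  | zero => exact ⟨1, by rw [zpow_zero, zpow_zero, tor_one_one]⟩
  | succ n ih =>
    obtain ⟨η, ih⟩ := ih
    exact ⟨_, by rw [zpow_add_one, ih, h1, tor_mul_tor, ← zpow_add_one]⟩
  | pred n ih =>
    obtain ⟨η, ih⟩ := ih
    exact ⟨_, by rw [zpow_sub_one, ih, h1, h2, tor_mul_tor, ← zpow_sub_one]⟩

lemma hUnif_zpow_mul_upperUnip (k : ℤ) (y : F) :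
    hUnif ϖ ^ k * upperUnip y = upperUnip (ϖ.val ^ (2 * k) * y) * hUnif ϖ ^ k := by
  obtain ⟨ξ, h⟩ := hUnif_zpow_eq ϖ k
  rw [h, tor_mul_upperUnip, Units.val_zpow_eq_zpow_val, uniformizer_unit_val,
    ← zpow_add₀ ϖ.ne_zero, two_mul]

lemma hUnif_zpow_mul_lowerUnip (k : ℤ) (y : F) :
    hUnif ϖ ^ k * lowerUnip y = lowerUnip (ϖ.val ^ (-(2 * k)) * y) * hUnif ϖ ^ k := by
  obtain ⟨ξ, h⟩ := hUnif_zpow_eq ϖ k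
  rw [h, tor_mul_lowerUnip, ← zpow_neg, Units.val_zpow_eq_zpow_val, uniformizer_unit_val,
    ← zpow_add₀ ϖ.ne_zero]
  congr 4
  ring

lemma lowerUnip_mul_hUnif_zpow (k : ℤ) (y : F) :
    lowerUnip y * hUnif ϖ ^ k = hUnif ϖ ^ k * lowerUnip (ϖ.val ^ (2 * k) * y) := by
  rw [hUnif_zpow_mul_lowerUnip, ← mul_assoc, ← zpow_add₀ ϖ.ne_zero, neg_add_cancel, zpow_zero,
    one_mul]

lemma upperUnip_mul_hUnif_zpow (k : ℤ) (y : F) :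
    upperUnip y * hUnif ϖ ^ k = hUnif ϖ ^ k * upperUnip (ϖ.val ^ (-(2 * k)) * y) := by
  rw [hUnif_zpow_mul_upperUnip, ← mul_assoc, ← zpow_add₀ ϖ.ne_zero, add_neg_cancel, zpow_zero,
    one_mul]

lemma exists_tor_eq_mul_zpow (a : Fˣ) (ζ : ℤˣ) : ∃ (u : Fˣ) (ξ : ℤˣ) (k : ℤ), ord (u : F) = 0 ∧
    tor a ζ = hUnif ϖ ^ k * tor u ξ := by
  obtain ⟨ξ, h⟩ := hUnif_zpow_eq ϖ (ord (a : F))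
  have hu : ord ((((ϖ.unit ^ ord (a : F))⁻¹ * a : Fˣ)) : F) = 0 := by
    rw [Units.val_mul, ord_mul (Units.ne_zero _) a.ne_zero, ← zpow_neg, Units.val_zpow_eq_zpow_val,
      uniformizer_unit_val, ord_uniformizer_zpow]
    ring
  refine ⟨(ϖ.unit ^ ord (a : F))⁻¹ * a, ξ * ζ * hilb ((ϖ.unit ^ ord (a : F) : Fˣ) : F)
    (((ϖ.unit ^ ord (a : F))⁻¹ * a : Fˣ) : F), ord (a : F), hu, ?_⟩
  rw [h, tor_mul_tor, mul_inv_cancel_left]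
  congr 1
  generalize hilb ((ϖ.unit ^ ord (a : F) : Fˣ) : F) (((ϖ.unit ^ ord (a : F))⁻¹ * a : Fˣ) : F) = s
  calc ζ = (ξ * ξ) * ζ * (s * s) := by rw [int_units_sq, int_units_sq, one_mul, mul_one]
    _ = _ := by simp only [mul_comm, mul_left_comm]

lemma weyl_mul_hUnif_zpow (k : ℤ) : ∃ ζ, weyl F * hUnif ϖ ^ k = mk 1 ζ * hUnif ϖ ^ (-k) * weyl F := by
  obtain ⟨ξ, h⟩ := hUnif_zpow_eq ϖ k
  obtain ⟨ξ', h'⟩ := hUnif_zpow_eq ϖ (-k)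
  refine ⟨ξ * ξ', ?_⟩
  rw [h, h', weyl_mul_tor, ← zpow_neg, ← tor_one, tor_mul_tor, one_mul, Units.val_one,
    hilb_one_left, mul_one, mul_assoc ξ, int_units_sq, mul_one]

/-- For `y ≠ 0` the product of the Weyl element and `u(y)` has an upper triangular times lower
unipotent factorization. -/
lemma weyl_mul_upperUnip_eq (y : Fˣ) : ∃ a ζ, weyl F * upperUnip (y : F) =
    upperUnip (-((y⁻¹ : Fˣ) : F)) * tor a ζ * lowerUnip ((y⁻¹ : Fˣ) : F) := by
  suffices h : ∀ ξ, ∃ a ζ, weyl F * (lowerUnip ((y⁻¹ : Fˣ) : F) * tor y ξ * weyl F *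
      lowerUnip ((y⁻¹ : Fˣ) : F)) =
      upperUnip (-((y⁻¹ : Fˣ) : F)) * tor a ζ * lowerUnip ((y⁻¹ : Fˣ) : F) by
    rw [upperUnip_eq y, hTilde_eq]; exact h _
  intro ξ
  refine ⟨y⁻¹ * (-1), ξ * 1 * hilb ((y⁻¹ : Fˣ) : F) ((-1 : Fˣ) : F), ?_⟩
  rw [← mul_assoc, ← mul_assoc, ← mul_assoc, weyl_mul_lowerUnip,
    mul_assoc (upperUnip _) (weyl F), weyl_mul_tor, mul_assoc (upperUnip _), mul_assoc (tor _ _),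
    weyl_mul_weyl, tor_mul_tor]

end TorusPowers

/-! ### Representatives of quotients of fractional ideals -/

section Representatives

variable {F : Type*} [Field F] [ValuativeRel F] [TopologicalSpace F] [IsNonarchimedeanLocalField F]

/-- A finite set of representatives of `ϖ^m 𝒪` modulo `ϖ^n 𝒪`. -/
structure IsReps (S : Finset F) (m n : ℤ) : Prop where
  mem : ∀ s ∈ S, s ∈ ball F m
  exists_mem : ∀ z ∈ ball F m, ∃ s ∈ S, z - s ∈ ball F n
  inj : ∀ s ∈ S, ∀ t ∈ S, s - t ∈ ball F n → s = t

/-- The quotients of fractional ideals are finite, since the residue field is. -/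
lemma exists_isReps (ϖ : Uniformizer F) (m n : ℤ) : ∃ S : Finset F, IsReps S m n := by
  classical
  obtain ⟨d, hd⟩ : ∃ d : ℕ, n ≤ m + d := ⟨(n - m).toNat, by omega⟩
  have hx : ϖ.val ^ m ≠ 0 := zpow_ne_zero _ ϖ.ne_zero
  have hfin : Finite (𝒪[F] ⧸ Ideal.span {ϖ.1} ^ d) := by
    have h1 : 𝓂[F] = Ideal.span {ϖ.1} := Irreducible.maximalIdeal_eq ϖ.2
    have : Finite (𝒪[F] ⧸ 𝓂[F]) := inferInstanceAs (Finite 𝓀[F])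
    rw [← h1]
    exact Ideal.finite_quotient_pow (h1 ▸ ⟨{ϖ.1}, by simp⟩) d
  have hO : ∀ x : ball F m, ValuativeRel.valuation F (ϖ.val ^ (-m) * x) ≤ 1 := fun x => by
    rw [← mem_ball_zero, zpow_mul_mem_ball]
    exact ball_anti (by omega) x.2
  let κ : ball F m → 𝒪[F] ⧸ Ideal.span {ϖ.1} ^ d := fun x => Ideal.Quotient.mk _ ⟨_, hO x⟩
  have hκ : ∀ x y, κ x = κ y → (x : F) - y ∈ ball F n := by
    intro x y h
    rw [Ideal.Quotient.eq, Ideal.span_singleton_pow, Ideal.mem_span_singleton] at h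
    obtain ⟨z, hz⟩ := h
    have hz' : ϖ.val ^ (-m) * x - ϖ.val ^ (-m) * y = ϖ.val ^ d * z := congrArg Subtype.val hz
    have e : (x : F) - y = ϖ.val ^ (m + d) * z := by
      rw [zpow_add₀ ϖ.ne_zero, zpow_natCast, mul_assoc, ← hz', zpow_neg]
      field_simp
    rw [e, zpow_mul_mem_ball]
    exact ball_anti (by omega) (mem_ball_zero.2 z.2)
  let Q := ball F m ⧸ (ball F n).addSubgroupOf (ball F m)
  have hout : ∀ x : ball F m, (x : F) - (QuotientAddGroup.mk x : Q).out ∈ ball F n := fun x => by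
    have h1 : (QuotientAddGroup.mk (QuotientAddGroup.mk x : Q).out : Q) = QuotientAddGroup.mk x :=
      Quotient.out_eq _
    have h2 := QuotientAddGroup.eq.1 h1
    rw [AddSubgroup.mem_addSubgroupOf] at h2
    have e : (x : F) - (QuotientAddGroup.mk x : Q).out =
        ((-(QuotientAddGroup.mk x : Q).out + x : ball F m) : F) := by push_cast; ring
    rw [e]; exact h2
  have hQ : Finite Q := by
    refine Finite.of_injective (fun q : Q => κ q.out) fun q q' h => ?_
    have h1 := hκ _ _ h
    rw [← Quotient.out_eq q, ← Quotient.out_eq q']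
    refine QuotientAddGroup.eq.2 (AddSubgroup.mem_addSubgroupOf.2 ?_)
    have h2 := (ball F n).neg_mem h1
    have e : ((-q.out + q'.out : ball F m) : F) = -((q.out : F) - q'.out) := by push_cast; ring
    rw [e]; exact h2
  have := Fintype.ofFinite Q
  refine ⟨Finset.univ.image fun q : Q => (q.out : F), ?_, ?_, ?_⟩
  · intro s hs
    obtain ⟨q, -, rfl⟩ := Finset.mem_image.1 hs
    exact q.out.2
  · intro z hz
    exact ⟨_, Finset.mem_image_of_mem _ (Finset.mem_univ (QuotientAddGroup.mk ⟨z, hz⟩ : Q)),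
      hout ⟨z, hz⟩⟩
  · intro s hs t ht h
    obtain ⟨q, -, rfl⟩ := Finset.mem_image.1 hs
    obtain ⟨q', -, rfl⟩ := Finset.mem_image.1 ht
    have : q = q' := by
      rw [← Quotient.out_eq q, ← Quotient.out_eq q']
      refine QuotientAddGroup.eq.2 (AddSubgroup.mem_addSubgroupOf.2 ?_)
      have h2 := (ball F n).neg_mem h
      have e : ((-q.out + q'.out : ball F m) : F) = -((q.out : F) - q'.out) := by push_cast; ring
      rw [e]; exact h2
    rw [this]

lemma IsReps.sum_eq {M : Type*} [AddCommMonoid M] {S S' : Finset F} {m n : ℤ} (hS : IsReps S m n)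
    (hS' : IsReps S' m n) {φ : F → M} (hφ : ∀ x ∈ ball F m, ∀ y, x - y ∈ ball F n → φ x = φ y) :
    ∑ s ∈ S, φ s = ∑ s ∈ S', φ s := by
  choose! i hi hi' using hS'.exists_mem
  refine Finset.sum_bij (fun s _ => i s) (fun s hs => hi s (hS.mem s hs)) ?_ ?_
    fun s hs => hφ _ (hS.mem s hs) _ (hi' s (hS.mem s hs))
  · intro s hs t ht h
    refine hS.inj s hs t ht ?_
    have h1 := (ball F n).sub_mem (hi' s (hS.mem s hs)) (hi' t (hS.mem t ht))
    rw [h] at h1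
    have e : s - i t - (t - i t) = s - t := by ring
    rwa [e] at h1
  · intro t ht
    obtain ⟨s, hs, h⟩ := hS.exists_mem t (hS'.mem t ht)
    refine ⟨s, hs, ?_⟩
    refine hS'.inj _ (hi s (hS.mem s hs)) _ ht ?_
    have h1 := (ball F n).add_mem h (hi' s (hS.mem s hs))
    have e : i s - t = -(t - s + (s - i s)) := by ring
    rw [e]; exact (ball F n).neg_mem h1

lemma IsReps.image_add [DecidableEq F] {S : Finset F} {m n : ℤ} (hS : IsReps S m n) {t : F}
    (ht : t ∈ ball F m) : IsReps (S.image (· + t)) m n := by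
  refine ⟨?_, ?_, ?_⟩
  · intro s hs
    obtain ⟨x, hx, rfl⟩ := Finset.mem_image.1 hs
    exact (ball F m).add_mem (hS.mem x hx) ht
  · intro z hz
    obtain ⟨s, hs, h⟩ := hS.exists_mem (z - t) ((ball F m).sub_mem hz ht)
    refine ⟨s + t, Finset.mem_image_of_mem _ hs, ?_⟩
    have e : z - (s + t) = z - t - s := by ring
    rw [e]; exact h
  · intro s hs s' hs' h
    obtain ⟨x, hx, rfl⟩ := Finset.mem_image.1 hs
    obtain ⟨y, hy, rfl⟩ := Finset.mem_image.1 hs'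
    have e : x + t - (y + t) = x - y := by ring
    rw [e] at h
    rw [hS.inj x hx y hy h]

lemma IsReps.sum_add {M : Type*} [AddCommMonoid M] {S : Finset F} {m n : ℤ} (hS : IsReps S m n)
    {φ : F → M} (hφ : ∀ x ∈ ball F m, ∀ y, x - y ∈ ball F n → φ x = φ y) {t : F}
    (ht : t ∈ ball F m) : ∑ s ∈ S, φ (s + t) = ∑ s ∈ S, φ s := by
  classical
  rw [← (hS.image_add ht).sum_eq hS hφ, Finset.sum_image fun x _ y _ h => add_right_cancel h]

/-- The sum over representatives of a function supported on one class. -/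
lemma IsReps.sum_eq_single {M : Type*} [AddCommMonoid M] {S : Finset F} {m n : ℤ}
    (hS : IsReps S m n) {φ : F → M} {z : F} (hz : z ∈ ball F m)
    (h0 : ∀ s ∈ S, z - s ∉ ball F n → φ s = 0) :
    ∃ s ∈ S, z - s ∈ ball F n ∧ ∑ s ∈ S, φ s = φ s := by
  obtain ⟨s, hs, h⟩ := hS.exists_mem z hz
  refine ⟨s, hs, h, Finset.sum_eq_single_of_mem s hs fun t ht hts => h0 t ht fun h' => hts ?_⟩
  refine hS.inj t ht s hs ?_
  have e : t - s = z - s - (z - t) := by ring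
  rw [e]; exact (ball F n).sub_mem h h'

end Representatives

/-! ### The subrepresentation generated by an ordinary vector -/

section Ordinary

variable {F : Type*} [Field F] [ValuativeRel F] [TopologicalSpace F] [IsNonarchimedeanLocalField F]
variable {E : Type*} [Field E] {V : Type*} [AddCommGroup V] [Module E V]

/-- An ordinary vector for a character `χ` of `T̃`: it is fixed by the integral upper unipotent
elements, the integral part of `T̃` acts on it by `χ`, and it is an eigenvector of the operator
`U_p = ∑_x u(x) h̃(ϖ)`, where `x` runs over `𝒪` modulo `ϖ²`, with eigenvalue `χ(h̃(ϖ))`. -/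
structure IsOrdinary (ϖ : Uniformizer F) (χ : Torus F →* Eˣ) (ρ : Representation E (Mp F) V)
    (v : V) : Prop where
  upper : ∀ x ∈ ball F 0, ρ (upperUnip x) v = v
  units : ∀ (a : Fˣ) ζ, ord (a : F) = 0 → ρ (tor a ζ) v = (χ (torT a ζ) : E) • v
  hecke : ∀ S, IsReps S 0 2 →
    ∑ x ∈ S, ρ (upperUnip x * hUnif ϖ) v = (χ (hUnifT ϖ) : E) • v

variable {ϖ : Uniformizer F} {χ : Torus F →* Eˣ} {ρ : Representation E (Mp F) V} {v : V}

/-- The span of the translates of a vector by the group generated by the upper unipotent elements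
and `h̃(ϖ)`. -/
def ordSpan (ϖ : Uniformizer F) (ρ : Representation E (Mp F) V) (v : V) : Submodule E V :=
  Submodule.span E (Set.range fun q : F × ℤ => ρ (upperUnip q.1 * hUnif ϖ ^ q.2) v)

lemma mem_ordSpan (x : F) (n : ℤ) : ρ (upperUnip x * hUnif ϖ ^ n) v ∈ ordSpan ϖ ρ v :=
  Submodule.subset_span ⟨(x, n), rfl⟩

lemma map_mem_span {W : Type*} [AddCommGroup W] [Module E W] {s : Set V} {N : Submodule E W}
    (T : V →ₗ[E] W) (h : ∀ x ∈ s, T x ∈ N) {x : V} (hx : x ∈ Submodule.span E s) : T x ∈ N := by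
  have : Submodule.span E s ≤ N.comap T := Submodule.span_le.2 h
  exact this hx

/-- The eigenvalue equation rewrites a translate of an ordinary vector as a combination of the
translates at the next level. -/
lemma IsOrdinary.refine_one (h : IsOrdinary ϖ χ ρ v) {S : Finset F} (hS : IsReps S 0 2) (x : F)
    (n : ℤ) : ρ (upperUnip x * hUnif ϖ ^ n) v = ((χ (hUnifT ϖ))⁻¹ : Eˣ).1 •
      ∑ s ∈ S, ρ (upperUnip (x + ϖ.val ^ (2 * n) * s) * hUnif ϖ ^ (n + 1)) v := by
  have h1 : v = ((χ (hUnifT ϖ))⁻¹ : Eˣ).1 • ∑ x ∈ S, ρ (upperUnip x * hUnif ϖ) v := by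
    rw [h.hecke S hS, smul_smul, Units.inv_mul, one_smul]
  conv_lhs => rw [h1, map_smul, map_sum]
  congr 1
  refine Finset.sum_congr rfl fun s _ => ?_
  rw [← rep_mul]
  congr 2
  rw [upperUnip_add, zpow_add_one, mul_assoc, mul_assoc, ← mul_assoc (hUnif ϖ ^ n),
    hUnif_zpow_mul_upperUnip, mul_assoc]

/-- A translate of an ordinary vector at level `n` is a combination of translates at any higher
level, by points of the same ball. -/
lemma IsOrdinary.refine (h : IsOrdinary ϖ χ ρ v) (k : ℕ) : ∀ (x : F) (n : ℤ),
    ρ (upperUnip x * hUnif ϖ ^ n) v ∈ Submodule.span E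
      {w | ∃ y, y - x ∈ ball F (2 * n) ∧ w = ρ (upperUnip y * hUnif ϖ ^ (n + k)) v} := by
  induction k with
  | zero => exact fun x n => Submodule.subset_span ⟨x, by simp, by simp⟩
  | succ k ih =>
    intro x n
    obtain ⟨S, hS⟩ := exists_isReps ϖ 0 2
    rw [h.refine_one hS]
    refine Submodule.smul_mem _ _ (Submodule.sum_mem _ fun s hs => ?_)
    refine Submodule.span_mono ?_ (ih (x + ϖ.val ^ (2 * n) * s) (n + 1))
    rintro w ⟨y, hy, rfl⟩
    refine ⟨y, ?_, ?_⟩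
    · have h1 : ϖ.val ^ (2 * n) * s ∈ ball F (2 * n) := by
        rw [zpow_mul_mem_ball, sub_self]; exact hS.mem s hs
      have h2 := (ball F (2 * n)).add_mem (ball_anti (by omega) hy) h1
      have e : y - x = y - (x + ϖ.val ^ (2 * n) * s) + ϖ.val ^ (2 * n) * s := by ring
      rw [e]; exact h2
    · congr 4; push_cast; ring

lemma IsOrdinary.tor_apply (h : IsOrdinary ϖ χ ρ v) (a : Fˣ) (ζ : ℤˣ) : ∃ (c : E) (k : ℤ),
    ∀ n : ℤ, ρ (tor a ζ * hUnif ϖ ^ n) v = c • ρ (hUnif ϖ ^ (k + n)) v := by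
  obtain ⟨u, ξ, k, hu, e⟩ := exists_tor_eq_mul_zpow ϖ a ζ
  refine ⟨χ (torT u ξ), k, fun n => ?_⟩
  obtain ⟨η, hη⟩ := hUnif_zpow_eq ϖ n
  have h1 : tor a ζ * hUnif ϖ ^ n = hUnif ϖ ^ (k + n) * tor u ξ := by
    rw [e, zpow_add, mul_assoc, mul_assoc, hη, tor_comm]
  rw [h1, rep_mul, h.units u ξ hu, map_smul]

lemma ordSpan_upperUnip {w : V} (hw : w ∈ ordSpan ϖ ρ v) (x : F) :
    ρ (upperUnip x) w ∈ ordSpan ϖ ρ v := by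
  refine map_mem_span (ρ (upperUnip x)) ?_ hw
  rintro _ ⟨⟨y, n⟩, rfl⟩
  rw [← rep_mul, ← mul_assoc, ← upperUnip_add]
  exact mem_ordSpan _ _

lemma IsOrdinary.ordSpan_tor (h : IsOrdinary ϖ χ ρ v) {w : V} (hw : w ∈ ordSpan ϖ ρ v) (a : Fˣ)
    (ζ : ℤˣ) : ρ (tor a ζ) w ∈ ordSpan ϖ ρ v := by
  refine map_mem_span (ρ (tor a ζ)) ?_ hw
  rintro _ ⟨⟨y, n⟩, rfl⟩
  obtain ⟨c, k, hc⟩ := h.tor_apply a ζ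
  rw [← rep_mul, ← mul_assoc, tor_mul_upperUnip, mul_assoc, rep_mul, hc, map_smul, ← rep_mul]
  exact Submodule.smul_mem _ _ (mem_ordSpan _ _)

/-- The Weyl element maps a translate of an ordinary vector by a point outside the ball around `0`
of the same level into `ordSpan`. -/
lemma IsOrdinary.weyl_mem (h : IsOrdinary ϖ χ ρ v) (hs : IsSmooth ρ) {x : F} {n : ℤ}
    (hx : x ∉ ball F (2 * n)) :
    ρ (weyl F * (upperUnip x * hUnif ϖ ^ n)) v ∈ ordSpan ϖ ρ v := by
  obtain ⟨N, hN⟩ := hs.lowerUnip ϖ v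
  obtain ⟨hx0, hxn⟩ := not_mem_ball.1 hx
  -- after a refinement the lower unipotent elements which occur fix the vector
  obtain ⟨k, hk⟩ : ∃ k : ℕ, (N : ℤ) + ord x ≤ 2 * (n + k) :=
    ⟨(N + ord x - 2 * n).toNat, by omega⟩
  rw [rep_mul]
  refine map_mem_span (ρ (weyl F)) ?_ (h.refine k x n)
  rintro _ ⟨y, hy, rfl⟩
  have hy0 : y ≠ 0 := by
    rintro rfl
    rw [zero_sub] at hy
    exact hx (by simpa using (ball F (2 * n)).neg_mem hy)
  have hyo : ord y ≤ ord x := by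
    by_contra hlt
    push Not at hlt
    refine hx ?_
    by_cases hxx : x ∈ ball F (ord x + 1)
    · rw [mem_ball_of_ne hx0] at hxx; omega
    · exfalso
      apply hxx
      have h1 := (ball F (ord x + 1)).sub_mem ((mem_ball_of_ne hy0).2 (by omega))
        (ball_anti (show ord x + 1 ≤ 2 * n by omega) hy)
      have e : y - (y - x) = x := by ring
      rwa [e] at h1
  obtain ⟨a, ζ, e⟩ := weyl_mul_upperUnip_eq (Units.mk0 y hy0)
  rw [Units.val_mk0] at e
  have hfix : ρ (lowerUnip (ϖ.val ^ (2 * (n + k)) * (((Units.mk0 y hy0)⁻¹ : Fˣ) : F))) v = v := by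
    refine hN _ ?_
    rw [zpow_mul_mem_ball, mem_ball_of_ne (Units.ne_zero _)]
    rw [Units.val_inv_eq_inv_val, ord_inv, Units.val_mk0]
    omega
  rw [← rep_mul, ← mul_assoc, e, mul_assoc, lowerUnip_mul_hUnif_zpow, ← mul_assoc,
    rep_mul, hfix, mul_assoc, rep_mul, rep_mul]
  refine ordSpan_upperUnip (h.ordSpan_tor ?_ a ζ) _
  have := mem_ordSpan (ρ := ρ) (v := v) (ϖ := ϖ) 0 (n + k)
  rwa [upperUnip_zero, one_mul] at this

/-- The span of `ordSpan` and of the translate of the vector by the Weyl element. -/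
def ordSub (ϖ : Uniformizer F) (ρ : Representation E (Mp F) V) (v : V) : Submodule E V :=
  ordSpan ϖ ρ v ⊔ Submodule.span E {ρ (weyl F) v}

lemma ordSpan_le_ordSub : ordSpan ϖ ρ v ≤ ordSub ϖ ρ v := le_sup_left

/-- Modulo `ordSpan`, the translates by `w h̃(ϖ)ⁿ` of an ordinary vector are multiples of each
other: of the terms of the eigenvalue equation only the class of `0` escapes
`IsOrdinary.weyl_mem`. -/
lemma IsOrdinary.weyl_sub_mem (h : IsOrdinary ϖ χ ρ v) (hs : IsSmooth ρ) (n : ℤ) :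
    ρ (weyl F * hUnif ϖ ^ n) v - ((χ (hUnifT ϖ))⁻¹ : Eˣ).1 • ρ (weyl F * hUnif ϖ ^ (n + 1)) v ∈
      ordSpan ϖ ρ v := by
  classical
  obtain ⟨S, hS⟩ := exists_isReps ϖ 0 2
  obtain ⟨s, hsS, hs0⟩ := hS.exists_mem 0 (ball F 0).zero_mem
  rw [zero_sub] at hs0
  have e1 := h.refine_one hS 0 n
  rw [upperUnip_zero, one_mul] at e1
  have e2 : ρ (upperUnip (0 + ϖ.val ^ (2 * n) * s) * hUnif ϖ ^ (n + 1)) v =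
      ρ (hUnif ϖ ^ (n + 1)) v := by
    rw [upperUnip_mul_hUnif_zpow, rep_mul, h.upper]
    rw [zero_add, ← mul_assoc, ← zpow_add₀ ϖ.ne_zero, zpow_mul_mem_ball]
    have := (ball F 2).neg_mem hs0
    rw [neg_neg] at this
    exact ball_anti (by omega) this
  rw [rep_mul, e1, ← Finset.add_sum_erase S _ hsS, e2, rep_mul _ _ (hUnif ϖ ^ (n + 1)), map_smul,
    map_add, smul_add, add_sub_cancel_left, map_sum]
  refine Submodule.smul_mem _ _ (Submodule.sum_mem _ fun t ht => ?_)
  rw [← rep_mul]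
  refine h.weyl_mem hs fun hmem => (Finset.mem_erase.1 ht).1 ?_
  rw [zero_add, zpow_mul_mem_ball] at hmem
  refine hS.inj t (Finset.mem_erase.1 ht).2 s hsS ?_
  have h1 := (ball F 2).add_mem (ball_anti (show (2 : ℤ) ≤ 2 * (n + 1) - 2 * n by omega) hmem) hs0
  rwa [← sub_eq_add_neg] at h1

lemma IsOrdinary.weyl_zpow_mem (h : IsOrdinary ϖ χ ρ v) (hs : IsSmooth ρ) (n : ℤ) :
    ρ (weyl F * hUnif ϖ ^ n) v ∈ ordSub ϖ ρ v := by
  have hstep : ∀ n : ℤ, ρ (weyl F * hUnif ϖ ^ n) v ∈ ordSub ϖ ρ v ↔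
      ρ (weyl F * hUnif ϖ ^ (n + 1)) v ∈ ordSub ϖ ρ v := by
    intro n
    have h1 := ordSpan_le_ordSub (h.weyl_sub_mem hs n)
    constructor
    · intro h2
      have h3 := (ordSub ϖ ρ v).sub_mem h2 h1
      rw [sub_sub_cancel] at h3
      have h4 := (ordSub ϖ ρ v).smul_mem (χ (hUnifT ϖ) : E) h3
      rwa [smul_smul, Units.mul_inv, one_smul] at h4
    · intro h2
      have h3 := (ordSub ϖ ρ v).add_mem h1
        ((ordSub ϖ ρ v).smul_mem ((χ (hUnifT ϖ))⁻¹ : Eˣ).1 h2)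
      rwa [sub_add_cancel] at h3
  induction n using Int.induction_on with
  | zero =>
    rw [zpow_zero, mul_one]
    exact Submodule.mem_sup_right (Submodule.mem_span_singleton_self _)
  | succ n ih => exact (hstep _).1 ih
  | pred n ih => exact (hstep _).2 (by rwa [sub_add_cancel])

lemma IsOrdinary.weyl_mem_ordSub (h : IsOrdinary ϖ χ ρ v) (hs : IsSmooth ρ) {w : V}
    (hw : w ∈ ordSpan ϖ ρ v) : ρ (weyl F) w ∈ ordSub ϖ ρ v := by
  refine map_mem_span (ρ (weyl F)) ?_ hw
  rintro _ ⟨⟨x, n⟩, rfl⟩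
  change ρ (weyl F) (ρ (upperUnip x * hUnif ϖ ^ n) v) ∈ _
  rw [← rep_mul]
  by_cases hx : x ∈ ball F (2 * n)
  · rw [upperUnip_mul_hUnif_zpow, ← mul_assoc, rep_mul, h.upper]
    · exact h.weyl_zpow_mem hs n
    · rw [zpow_mul_mem_ball]; exact ball_anti (by omega) hx
  · exact ordSpan_le_ordSub (h.weyl_mem hs hx)

/-- The space `ordSub` of an ordinary vector is stable under the metaplectic cover. -/
lemma IsOrdinary.ordSub_stable (h : IsOrdinary ϖ χ ρ v) (hs : IsSmooth ρ) (g : Mp F) {w : V}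
    (hw : w ∈ ordSub ϖ ρ v) : ρ g w ∈ ordSub ϖ ρ v := by
  let S : Submonoid (Mp F) :=
    { carrier := {g | ∀ w ∈ ordSub ϖ ρ v, ρ g w ∈ ordSub ϖ ρ v}
      one_mem' := fun w hw => by rwa [map_one]
      mul_mem' := fun {a b} ha hb w hw => by rw [rep_mul]; exact ha _ (hb _ hw) }
  have key : ∀ g, (∀ w ∈ ordSpan ϖ ρ v, ρ g w ∈ ordSub ϖ ρ v) → ρ g (ρ (weyl F) v) ∈ ordSub ϖ ρ v →
      g ∈ S := by
    intro g h1 h2 w hw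
    obtain ⟨a, ha, b, hb, rfl⟩ := Submodule.mem_sup.1 hw
    obtain ⟨c, rfl⟩ := Submodule.mem_span_singleton.1 hb
    rw [map_add, map_smul]
    exact Submodule.add_mem _ (h1 a ha) (Submodule.smul_mem _ _ h2)
  have hv : v ∈ ordSpan ϖ ρ v := by
    have := mem_ordSpan (ρ := ρ) (v := v) (ϖ := ϖ) 0 0
    rwa [upperUnip_zero, one_mul, zpow_zero, map_one] at this
  refine submonoid_eq_top S (fun x => ?_) (fun a ζ => ?_) ?_ g w hw
  · refine key _ (fun w hw => ordSpan_le_ordSub (ordSpan_upperUnip hw x)) ?_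
    obtain ⟨N, hN⟩ := hs.lowerUnip ϖ v
    obtain ⟨m, hm⟩ := exists_mem_ball x
    obtain ⟨n, hn⟩ : ∃ n : ℕ, (N : ℤ) ≤ 2 * n + m := ⟨(N - m).toNat, by omega⟩
    -- modulo `ordSpan` the vector may be replaced by a translate fixed by the unipotent element
    have hfix : ρ (upperUnip x) (ρ (weyl F * hUnif ϖ ^ (n : ℤ)) v) = ρ (weyl F * hUnif ϖ ^ (n : ℤ)) v := by
      have e : upperUnip x * (weyl F * hUnif ϖ ^ (n : ℤ)) =
          weyl F * hUnif ϖ ^ (n : ℤ) * lowerUnip (ϖ.val ^ (2 * (n : ℤ)) * (-x)) := by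
        rw [mul_assoc, ← lowerUnip_mul_hUnif_zpow, ← mul_assoc, ← mul_assoc, weyl_mul_lowerUnip,
          neg_neg]
      rw [← rep_mul, e, rep_mul, hN]
      rw [zpow_mul_mem_ball]
      exact ball_anti (by omega) ((ball F m).neg_mem hm)
    have hrep : ∀ n : ℕ, ∃ c : E, ρ (weyl F) v - c • ρ (weyl F * hUnif ϖ ^ (n : ℤ)) v ∈
        ordSpan ϖ ρ v := by
      intro n
      induction n with
      | zero => exact ⟨1, by simp⟩
      | succ n ih =>
        obtain ⟨c, hc⟩ := ih
        refine ⟨c * ((χ (hUnifT ϖ))⁻¹ : Eˣ).1, ?_⟩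
        have h1 := Submodule.add_mem _ hc (Submodule.smul_mem _ c (h.weyl_sub_mem hs n))
        rw [smul_sub, smul_smul, sub_add_sub_cancel] at h1
        exact_mod_cast h1
    obtain ⟨c, hc⟩ := hrep n
    have e : ρ (upperUnip x) (ρ (weyl F) v) = ρ (upperUnip x)
        (ρ (weyl F) v - c • ρ (weyl F * hUnif ϖ ^ (n : ℤ)) v) +
          c • ρ (weyl F * hUnif ϖ ^ (n : ℤ)) v := by
      rw [map_sub, map_smul, hfix, sub_add_cancel]
    rw [e]
    exact Submodule.add_mem _ (ordSpan_le_ordSub (ordSpan_upperUnip hc x))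
      (Submodule.smul_mem _ _ (h.weyl_zpow_mem hs n))
  · refine key _ (fun w hw => ordSpan_le_ordSub (h.ordSpan_tor hw a ζ)) ?_
    have e : tor a ζ * weyl F = weyl F * tor a⁻¹ ζ := by rw [weyl_mul_tor, inv_inv]
    obtain ⟨c, k, hc⟩ := h.tor_apply a⁻¹ ζ
    have h1 := hc 0
    rw [zpow_zero, mul_one, add_zero] at h1
    rw [← rep_mul, e, rep_mul, h1, map_smul, ← rep_mul]
    exact Submodule.smul_mem _ _ (h.weyl_zpow_mem hs k)
  · refine key _ (fun w hw => h.weyl_mem_ordSub hs hw) ?_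
    rw [← rep_mul, weyl_mul_weyl]
    exact ordSpan_le_ordSub (h.ordSpan_tor hv _ _)

end Ordinary

/-! ### A criterion for irreducibility -/

section Irreducible

variable {E G V : Type*} [Field E] [Group G] [AddCommGroup V] [Module E V]
variable {ρ : Representation E G V}

lemma eq_top_of_irreducible (h : ρ.IsIrreducible) (N : Submodule E V)
    (hN : ∀ g, ∀ v ∈ N, ρ g v ∈ N) {v : V} (hv : v ∈ N) (hv0 : v ≠ 0) : N = ⊤ := by
  have := h
  rcases eq_bot_or_eq_top (⟨N, fun g v hv => hN g v hv⟩ : Subrepresentation ρ) with h1 | h1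
  · have h2 : N = ⊥ := congrArg Subrepresentation.toSubmodule h1
    rw [h2] at hv
    exact absurd hv hv0
  · exact congrArg Subrepresentation.toSubmodule h1

/-- Irreducibility from the criterion that every nonzero stable subspace is everything. -/
lemma isIrreducible_of_forall (h0 : ∃ v : V, v ≠ 0)
    (h : ∀ N : Submodule E V, (∀ g, ∀ v ∈ N, ρ g v ∈ N) → (∃ v ∈ N, v ≠ 0) → N = ⊤) :
    ρ.IsIrreducible := by
  obtain ⟨v, hv⟩ := h0
  refine { exists_pair_ne := ⟨⊥, ⊤, fun e => ?_⟩, eq_bot_or_eq_top := fun N => ?_ }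
  · have e1 : (⊥ : Submodule E V) = ⊤ := congrArg Subrepresentation.toSubmodule e
    have : v ∈ (⊥ : Submodule E V) := by rw [e1]; trivial
    exact hv this
  · by_cases hN : ∃ v ∈ N.toSubmodule, v ≠ 0
    · exact Or.inr (Subrepresentation.toSubmodule_injective
        (h _ (fun g v hv => N.apply_mem_toSubmodule g hv) hN))
    · left
      push Not at hN
      exact Subrepresentation.toSubmodule_injective ((Submodule.eq_bot_iff _).2 hN)

end Irreducible

/-! ### Parabolic induction and the ordinary vector of a principal series -/

section PrincipalSeries

variable {F : Type*} [Field F] [ValuativeRel F] [TopologicalSpace F] [IsNonarchimedeanLocalField F]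
variable {E : Type*} [Field E] (ϖ : Uniformizer F) (χ : Torus F →* Eˣ)

section General

variable {W : Type*} [AddCommGroup W] [Module E W] {τ : Representation E (Torus F) W}

lemma parInd_apply (x : Mp F) (f : parIndSpace τ) (g : Mp F) : (parInd τ x f).1 g = f.1 (g * x) :=
  rfl

lemma parInd_torus (f : parIndSpace τ) (t : Torus F) (g : Mp F) : f.1 (t * g) = τ t (f.1 g) :=
  f.2.1 t g

lemma parInd_tor (f : parIndSpace τ) (a : Fˣ) (ζ : ℤˣ) (g : Mp F) :
    f.1 (tor a ζ * g) = τ (torT a ζ) (f.1 g) :=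
  f.2.1 (torT a ζ) g

lemma parInd_lower (f : parIndSpace τ) (x : F) (g : Mp F) : f.1 (lowerUnip x * g) = f.1 g :=
  f.2.2.1 x g

lemma isSmooth_parInd : IsSmooth (parInd τ) := by
  obtain ⟨ϖ⟩ : Nonempty (Uniformizer F) :=
    let ⟨x, hx⟩ := IsDiscreteValuationRing.exists_irreducible 𝒪[F]; ⟨⟨x, hx⟩⟩
  refine isSmooth_of_isCong ϖ fun f => ?_
  obtain ⟨U, hU⟩ := f.2.2.2
  obtain ⟨n, hn, h⟩ := (isOpen_subgroup_iff ϖ U.toSubgroup).1 U.isOpen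
  exact ⟨n, hn, fun k hk => Subtype.ext (funext fun g => hU _ (h k hk) g)⟩

lemma isGenuine_parInd (h : IsGenuineTorus τ) : IsGenuine (parInd τ) := by
  refine isGenuine_of_central fun ζ f => Subtype.ext (funext fun g => ?_)
  change f.1 (g * mk 1 ζ) = ((ζ : ℤ) : E) • f.1 g
  rw [← central_comm, ← tor_one, parInd_tor]
  have h1 : mk (1 : SL(2, F)) ζ ∈ Torus F := ⟨rfl, rfl⟩
  have h2 : mk (1 : SL(2, F)) 1 ∈ Torus F := ⟨rfl, rfl⟩
  have h3 := h 1 ζ h1 h2 (f.1 g)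
  have e1 : torT (1 : Fˣ) ζ = ⟨mk 1 ζ, h1⟩ := Subtype.ext (tor_one ζ)
  have e2 : (⟨mk 1 1, h2⟩ : Torus F) = 1 := Subtype.ext mk_one_one
  rw [e1, h3, e2, map_one]; rfl

/-- The Bruhat decomposition with respect to the lower triangular Borel subgroup. -/
lemma exists_eq_cell (g : Mp F) : ∃ (y : F) (t : Torus F),
    (∃ z, g = lowerUnip y * (t : Mp F) * upperUnip z) ∨ g = lowerUnip y * (t : Mp F) * weyl F := by
  by_cases h : (toSL g).1 0 0 = 0
  · obtain ⟨y, a, ζ, e⟩ := exists_eq_lower_tor_weyl h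
    exact ⟨y, torT a ζ, Or.inr e⟩
  · obtain ⟨ζ, e⟩ := exists_eq_lower_tor_upper (Units.mk0 _ h) rfl
    exact ⟨_, torT _ ζ, Or.inl ⟨_, e⟩⟩

/-- An element of a parabolic induction is determined by its values on the upper unipotent
elements and on the Weyl element. -/
lemma parInd_ext {f f' : parIndSpace τ} (hu : ∀ z, f.1 (upperUnip z) = f'.1 (upperUnip z))
    (hw : f.1 (weyl F) = f'.1 (weyl F)) : f = f' := by
  refine Subtype.ext (funext fun g => ?_)
  obtain ⟨y, t, ⟨z, rfl⟩ | rfl⟩ := exists_eq_cell g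
  · rw [mul_assoc, parInd_lower, parInd_lower, parInd_torus, parInd_torus, hu]
  · rw [mul_assoc, parInd_lower, parInd_lower, parInd_torus, parInd_torus, hw]

end General

lemma lower_torus_upper_eq (y z : F) (t : Torus F) : ∃ (a : Fˣ) (ξ : ℤˣ)
    (h : (a : F) * (y * a * z + (a : F)⁻¹) - a * z * (y * a) = 1),
    lowerUnip y * (t : Mp F) * upperUnip z = mk (sl (a : F) (a * z) (y * a) (y * a * z + (a : F)⁻¹) h) ξ := by
  obtain ⟨a, ζ, rfl⟩ := exists_eq_torT t
  have ha := a.ne_zero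
  have h : (a : F) * (y * a * z + (a : F)⁻¹) - a * z * (y * a) = 1 := by field_simp; ring
  suffices hs : ∀ η, ∃ ξ, mk (sl 1 0 y 1 (by ring)) 1 * mk (sl (a : F) 0 0 (a : F)⁻¹ (by simp)) ζ *
      mk (sl 1 z 0 1 (by ring)) η = mk (sl (a : F) (a * z) (y * a) (y * a * z + (a : F)⁻¹) h) ξ by
    obtain ⟨ξ, hξ⟩ := hs 1
    refine ⟨a, ξ, h, ?_⟩
    rw [← hξ, ← tor_eq]; rfl
  intro η
  rw [mk_sl_mul, mk_sl_mul]
  exact ⟨_, mk_sl_congr (by ring) (by ring) (by ring) (by ring) rfl⟩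

/-- On the open cell the torus part and the upper unipotent part are unique. -/
lemma lower_torus_upper_inj {y z y' z' : F} {t t' : Torus F}
    (h : lowerUnip y * (t : Mp F) * upperUnip z = lowerUnip y' * (t' : Mp F) * upperUnip z') : z = z' ∧ t = t' := by
  obtain ⟨a, ξ, h1, e⟩ := lower_torus_upper_eq y z t
  obtain ⟨a', ξ', h1', e'⟩ := lower_torus_upper_eq y' z' t'
  have h2 : mk (sl _ _ _ _ h1) ξ = mk (sl _ _ _ _ h1') ξ' := by rw [← e, ← e', h]
  have h3 := congrArg toSL h2
  have h00 : (a : F) = a' := congrArg (fun g : SL(2, F) => g.1 0 0) h3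
  have h01 : (a : F) * z = a' * z' := congrArg (fun g : SL(2, F) => g.1 0 1) h3
  have h10 : y * (a : F) = y' * a' := congrArg (fun g : SL(2, F) => g.1 1 0) h3
  rw [← h00] at h01 h10
  have hz : z = z' := mul_left_cancel₀ a.ne_zero h01
  have hy : y = y' := mul_right_cancel₀ a.ne_zero h10
  subst hz hy
  exact ⟨rfl, Subtype.ext (mul_left_cancel (mul_right_cancel h))⟩

lemma lower_torus_weyl_ne {y z y' : F} {t t' : Torus F} :
    lowerUnip y * (t : Mp F) * upperUnip z ≠ lowerUnip y' * (t' : Mp F) * weyl F := by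
  intro h
  obtain ⟨a, ξ, h1, e⟩ := lower_torus_upper_eq y z t
  obtain ⟨a', ξ', h1', e'⟩ := lower_torus_upper_eq y' 0 t'
  rw [upperUnip_zero, mul_one] at e'
  rw [e, e'] at h
  have h2 := congrArg (fun g => (toSL g).1 0 0) h
  have h3 : (toSL (mk (sl _ _ _ _ h1') ξ' * weyl F)).1 0 0 = (a' : F) * 0 + a' * 0 * -1 := by
    rw [weyl, mk_sl_mul]; rfl
  have h4 : (toSL (mk (sl _ _ _ _ h1) ξ)).1 0 0 = (a : F) := rfl
  have h5 : (a : F) = (a' : F) * 0 + a' * 0 * -1 := h4.symm.trans (h2.trans h3)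
  exact a.ne_zero (by rw [h5]; ring)

/-- The function on the metaplectic cover which is left equivariant under `T̃ Ū*`, is supported
on the open cell, and restricts to the characteristic function of `𝒪` on the upper unipotent
elements. -/
def sphFun (g : Mp F) : E :=
  open Classical in
  if h : ∃ q : F × Torus F × F, q.2.2 ∈ ball F 0 ∧
    g = lowerUnip q.1 * (q.2.1 : Mp F) * upperUnip q.2.2 then (χ h.choose.2.1 : E) else 0

lemma sphFun_open (y z : F) (t : Torus F) : sphFun χ (lowerUnip y * (t : Mp F) * upperUnip z) =
    open Classical in if z ∈ ball F 0 then (χ t : E) else 0 := by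
  classical
  by_cases hz : z ∈ ball F 0
  · have h : ∃ q : F × Torus F × F, q.2.2 ∈ ball F 0 ∧ lowerUnip y * (t : Mp F) * upperUnip z =
        lowerUnip q.1 * (q.2.1 : Mp F) * upperUnip q.2.2 := ⟨(y, t, z), hz, rfl⟩
    rw [sphFun, dif_pos h, if_pos hz, ← (lower_torus_upper_inj h.choose_spec.2).2]
  · rw [sphFun, dif_neg, if_neg hz]
    rintro ⟨q, hq, e⟩
    exact hz ((lower_torus_upper_inj e).1 ▸ hq)

lemma sphFun_weyl (y : F) (t : Torus F) : sphFun χ (lowerUnip y * (t : Mp F) * weyl F) = 0 := by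
  rw [sphFun, dif_neg]
  rintro ⟨q, hq, e⟩
  exact lower_torus_weyl_ne e.symm

lemma sphFun_lower (y : F) (g : Mp F) : sphFun χ (lowerUnip y * g) = sphFun χ g := by
  obtain ⟨y', t, ⟨z, rfl⟩ | rfl⟩ := exists_eq_cell g
  · rw [← mul_assoc, ← mul_assoc, ← lowerUnip_add, sphFun_open, sphFun_open]
  · rw [← mul_assoc, ← mul_assoc, ← lowerUnip_add, sphFun_weyl, sphFun_weyl]

lemma exists_torus_mul_lower (t : Torus F) (y : F) :
    ∃ y', (t : Mp F) * lowerUnip y = lowerUnip y' * (t : Mp F) := by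
  obtain ⟨a, ζ, rfl⟩ := exists_eq_torT t
  exact ⟨_, tor_mul_lowerUnip a ζ y⟩

lemma sphFun_torus (t : Torus F) (g : Mp F) : sphFun χ ((t : Mp F) * g) = χ t * sphFun χ g := by
  obtain ⟨y, s, ⟨z, rfl⟩ | rfl⟩ := exists_eq_cell g
  · obtain ⟨y', e⟩ := exists_torus_mul_lower t y
    have e1 : (t : Mp F) * (lowerUnip y * (s : Mp F) * upperUnip z) =
        lowerUnip y' * ((t * s : Torus F) : Mp F) * upperUnip z := by
      rw [Subgroup.coe_mul, ← mul_assoc, ← mul_assoc, e, mul_assoc (lowerUnip _)]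
    rw [e1, sphFun_open, sphFun_open, map_mul, Units.val_mul]
    split_ifs <;> simp
  · obtain ⟨y', e⟩ := exists_torus_mul_lower t y
    have e1 : (t : Mp F) * (lowerUnip y * (s : Mp F) * weyl F) =
        lowerUnip y' * ((t * s : Torus F) : Mp F) * weyl F := by
      rw [Subgroup.coe_mul, ← mul_assoc, ← mul_assoc, e, mul_assoc (lowerUnip _)]
    rw [e1, sphFun_weyl, sphFun_weyl, mul_zero]

/-- Left equivariance reduces an identity between right translates of `sphFun` to the
representatives of the two cells. -/
lemma sphFun_mul_eq {h : Mp F} {c : E} (hu : ∀ z, sphFun χ (upperUnip z * h) = c * sphFun χ (upperUnip z))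
    (hw : sphFun χ (weyl F * h) = 0) (g : Mp F) : sphFun χ (g * h) = c * sphFun χ g := by
  obtain ⟨y, s, ⟨z, rfl⟩ | rfl⟩ := exists_eq_cell g
  · rw [mul_assoc, mul_assoc, mul_assoc, sphFun_lower, sphFun_lower, sphFun_torus, sphFun_torus, hu,
      mul_left_comm]
  · rw [sphFun_weyl, mul_zero, mul_assoc, mul_assoc, sphFun_lower, sphFun_torus, hw, mul_zero]

lemma sphFun_upper (z : F) : sphFun χ (upperUnip z) =
    open Classical in if z ∈ ball F 0 then (1 : E) else 0 := by
  have := sphFun_open χ 0 z 1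
  rwa [lowerUnip_zero, Subgroup.coe_one, one_mul, one_mul, map_one, Units.val_one] at this

lemma sphFun_weyl' : sphFun χ (weyl F) = 0 := by
  have := sphFun_weyl χ 0 1
  rwa [lowerUnip_zero, Subgroup.coe_one, one_mul, one_mul] at this

lemma sphFun_upper_torus (z : F) (a : Fˣ) (ζ : ℤˣ) : sphFun χ (upperUnip z * tor a ζ) =
    χ (torT a ζ) * sphFun χ (upperUnip (((a⁻¹ : Fˣ) : F) * ((a⁻¹ : Fˣ) : F) * z)) := by
  have e : upperUnip z * tor a ζ =
      (torT a ζ : Mp F) * upperUnip (((a⁻¹ : Fˣ) : F) * ((a⁻¹ : Fˣ) : F) * z) := by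
    change _ = tor a ζ * _
    rw [tor_mul_upperUnip]
    congr 2
    have := a.mul_inv
    linear_combination (-(a * (a⁻¹ : Fˣ) : F) * z - z) * this
  rw [e, sphFun_torus]

lemma sphFun_weyl_upper (z : F) : sphFun χ (weyl F * upperUnip z) = 0 := by
  rw [weyl_mul_upperUnip, sphFun_lower, sphFun_weyl']

lemma sphFun_weyl_torus (a : Fˣ) (ζ : ℤˣ) : sphFun χ (weyl F * tor a ζ) = 0 := by
  rw [weyl_mul_tor]
  exact (sphFun_torus χ (torT a⁻¹ ζ) _).trans (by rw [sphFun_weyl', mul_zero])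

lemma sphFun_mul_upper {b : F} (hb : b ∈ ball F 0) (g : Mp F) :
    sphFun χ (g * upperUnip b) = sphFun χ g := by
  rw [sphFun_mul_eq χ (c := 1) (fun z => ?_) (sphFun_weyl_upper χ b), one_mul]
  rw [← upperUnip_add, sphFun_upper, sphFun_upper, one_mul]
  congr 1
  exact propext (AddSubgroup.add_mem_cancel_right _ hb)

lemma sphFun_mul_tor {a : Fˣ} (ha : ord (a : F) = 0) (ζ : ℤˣ) (g : Mp F) :
    sphFun χ (g * tor a ζ) = χ (torT a ζ) * sphFun χ g := by
  refine sphFun_mul_eq χ (fun z => ?_) (sphFun_weyl_torus χ a ζ) g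
  rw [sphFun_upper_torus, sphFun_upper, sphFun_upper]
  congr 2
  rw [mul_assoc, mul_mem_ball_iff (Units.ne_zero _), mul_mem_ball_iff (Units.ne_zero _),
    Units.val_inv_eq_inv_val, ord_inv, ha]
  simp

lemma sphFun_weyl_lower {c : F} (hc : c ∈ ball F 1) : sphFun χ (weyl F * lowerUnip c) = 0 := by
  by_cases hc0 : c = 0
  · rw [hc0, lowerUnip_zero, mul_one, sphFun_weyl']
  · have e := upperUnip_eq (Units.mk0 c hc0)⁻¹
    rw [inv_inv, Units.val_mk0, mul_assoc, mul_assoc] at e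
    have h1 : sphFun χ (lowerUnip c * (hTilde (Units.mk0 c hc0)⁻¹ * (weyl F * lowerUnip c))) = 0 := by
      rw [← e, sphFun_upper, if_neg]
      rw [mem_ball_of_ne (Units.ne_zero _), Units.val_inv_eq_inv_val, ord_inv, Units.val_mk0]
      rw [mem_ball_of_ne hc0] at hc
      omega
    rw [sphFun_lower, hTilde_eq] at h1
    have h2 := (sphFun_torus χ (torT _ _) _).symm.trans h1
    exact (mul_eq_zero.1 h2).resolve_left (Units.ne_zero _)

/-- The product `u(z) ū(c)` in the open cell, for `1 + zc` congruent to `1`. The Hilbert symbols in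
the cocycle vanish since such elements are squares. -/
lemma upper_mul_lower {z c : F} {s : Fˣ} (hs : (s : F) = 1 + z * c) (h1 : res (s : F) = 1) :
    upperUnip z * lowerUnip c = lowerUnip (c / s) * tor s 1 * upperUnip (z / s) := by
  have hs0 := s.ne_zero
  rw [tor_eq]
  change mk (sl 1 z 0 1 _) 1 * mk (sl 1 0 c 1 _) 1 = mk (sl 1 0 (c / s) 1 _) 1 *
    mk (sl (s : F) 0 0 (s : F)⁻¹ _) 1 * mk (sl 1 (z / s) 0 1 _) 1
  rw [mk_sl_mul, mk_sl_mul, mk_sl_mul]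
  refine mk_sl_congr (by rw [hs]; ring) (by field_simp; ring) (by field_simp; ring)
    (by field_simp; rw [hs]; ring) ?_
  by_cases hc : c = 0
  · have hs1 : (s : F) = 1 := by rw [hs, hc]; ring
    simp [hc, hs1, xRow_zero, hilb_one_right]
  · have hcs : c / s ≠ 0 := div_ne_zero hc hs0
    simp only [mul_zero, zero_add, add_zero, one_mul, mul_one]
    have e3 : c / (s : F) * s = c := by field_simp
    rw [e3, xRow_ne hc, xRow_ne hc, xRow_ne hcs, xRow_ne hc, xRow_zero, xRow_zero,
      div_self hc, hilb_one_right, hilb_one_left, mul_one]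
    have e4 : c / (c / (s : F)) = s := by field_simp
    rw [e4, hilb_of_res_one_left (div_ne_zero hc (inv_ne_zero hs0)) hs0 h1]

lemma exists_torus_fixed {W : Type*} [AddCommGroup W] [Module E W]
    {τ : Representation E (Torus F) W} (hs : IsSmooth τ) (w : W) :
    ∃ n : ℕ, 0 < n ∧ ∀ a : Fˣ, (a : F) - 1 ∈ ball F n → τ (torT a 1) w = w := by
  obtain ⟨U, hU, hUe⟩ := isOpen_induced_iff.1 (hs w)
  have h1 : (1 : Mp F) ∈ U := by
    have : (1 : Torus F) ∈ Subtype.val ⁻¹' U := by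
      rw [hUe]; change τ 1 w = w; rw [map_one]; rfl
    exact this
  obtain ⟨n, hn, h⟩ := exists_isCong (isOpen_iff_mp.1 hU 1 h1)
  refine ⟨n, hn, fun a ha => ?_⟩
  have ha0 := (ord_pos_unique (ball_anti (show (1 : ℤ) ≤ n by exact_mod_cast hn) ha)).2.1
  have h2 : (torT a 1 : Torus F) ∈ Subtype.val ⁻¹' U := by
    have := h _ (isCong_hMat ha0 ha)
    change (1 : Mp F) * mk (hMat a) 1 ∈ U at this
    rwa [one_mul] at this
  rw [hUe] at h2
  exact h2

/-- A smooth character of the torus is trivial on the lifts of a congruence subgroup of the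
units. -/
lemma exists_conductor (hs : IsSmooth (charRep χ)) :
    ∃ n : ℕ, 0 < n ∧ ∀ a : Fˣ, (a : F) - 1 ∈ ball F n → χ (torT a 1) = 1 := by
  obtain ⟨n, hn, h⟩ := exists_torus_fixed hs 1
  refine ⟨n, hn, fun a ha => ?_⟩
  have h3 : (χ (torT a 1) : E) * 1 = 1 := h a ha
  exact Units.ext (by rw [← mul_one (χ (torT a 1) : E), h3, Units.val_one])

lemma sphFun_mul_lower {n : ℕ} (hn : 0 < n)
    (hχ : ∀ a : Fˣ, (a : F) - 1 ∈ ball F n → χ (torT a 1) = 1) {c : F} (hc : c ∈ ball F n)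
    (g : Mp F) : sphFun χ (g * lowerUnip c) = sphFun χ g := by
  have hc1 : c ∈ ball F 1 := ball_anti (by exact_mod_cast hn) hc
  rw [sphFun_mul_eq χ (c := 1) (fun z => ?_) (sphFun_weyl_lower χ hc1), one_mul]
  rw [one_mul]
  by_cases hz : z ∈ ball F 0
  · have h1 : z * c ∈ ball F n := mul_mem_ball_zero hz hc
    have h2 : (1 + z * c) - 1 ∈ ball F n := by rwa [add_sub_cancel_left]
    obtain ⟨h3, h4, h5⟩ := ord_pos_unique (ball_anti (show (1 : ℤ) ≤ n by exact_mod_cast hn) h2)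
    rw [upper_mul_lower (s := Units.mk0 _ h3) rfl h5]
    refine (sphFun_open χ _ _ (torT _ 1)).trans ?_
    have hzs : z / (Units.mk0 _ h3 : Fˣ) ∈ ball F 0 := by
      rw [div_eq_inv_mul, mul_mem_ball_iff (inv_ne_zero (Units.ne_zero _)), ord_inv, Units.val_mk0,
        h4]
      simpa using hz
    rw [if_pos hzs, hχ _ h2, sphFun_upper, if_pos hz, Units.val_one]
  · obtain ⟨hz0, hzo⟩ := not_mem_ball.1 hz
    have hz1 : ((Units.mk0 z hz0)⁻¹ : Fˣ).1 + c ∈ ball F 1 := by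
      refine (ball F 1).add_mem ?_ hc1
      rw [mem_ball_of_ne (Units.ne_zero _), Units.val_inv_eq_inv_val, ord_inv, Units.val_mk0]
      omega
    have e := upperUnip_eq (Units.mk0 z hz0)
    rw [Units.val_mk0] at e
    rw [sphFun_upper, if_neg hz, e, mul_assoc, ← lowerUnip_add, mul_assoc, mul_assoc, sphFun_lower,
      hTilde_eq]
    refine (sphFun_torus χ (torT _ _) _).trans ?_
    rw [sphFun_weyl_lower χ hz1, mul_zero]

variable {χ}

/-- The element of a principal series given by `sphFun`. -/
def sphVec (hs : IsSmooth (charRep χ)) : parIndSpace (charRep χ) :=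
  ⟨sphFun χ, fun t g => sphFun_torus χ t g, fun x g => sphFun_lower χ x g, by
    obtain ⟨ϖ⟩ : Nonempty (Uniformizer F) :=
      let ⟨x, hx⟩ := IsDiscreteValuationRing.exists_irreducible 𝒪[F]; ⟨⟨x, hx⟩⟩
    obtain ⟨n, hn, hχ⟩ := exists_conductor χ hs
    let S : Subgroup (Mp F) :=
      { carrier := {u | ∀ g, sphFun χ (g * u) = sphFun χ g}
        one_mem' := fun g => by rw [mul_one]
        mul_mem' := fun {a b} ha hb g => by rw [← mul_assoc, hb, ha]
        inv_mem' := fun {a} ha g => by rw [← ha (g * a⁻¹), inv_mul_cancel_right] }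
    refine ⟨⟨S, isOpen_of_generators ϖ S (n := n) (by exact_mod_cast hn)
      (fun x hx g => sphFun_mul_upper χ (ball_anti (by omega) hx) g)
      (fun x hx g => sphFun_mul_lower χ hn hχ hx g) fun a ha g => ?_⟩, fun u hu g => hu g⟩
    have ha0 := (ord_pos_unique (ball_anti (show (1 : ℤ) ≤ n by exact_mod_cast hn) ha)).2.1
    rw [sphFun_mul_tor χ ha0, hχ a ha, Units.val_one, one_mul]⟩

variable (hs : IsSmooth (charRep χ))

lemma sphFun_zpow (z : F) (k : ℤ) : sphFun χ (upperUnip z * hUnif ϖ ^ k) =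
    open Classical in if z ∈ ball F (2 * k) then (χ (hUnifT ϖ) : E) ^ k else 0 := by
  classical
  rw [upperUnip_mul_hUnif_zpow]
  have e : hUnif ϖ ^ k = ((hUnifT ϖ ^ k : Torus F) : Mp F) := by
    rw [Subgroup.coe_zpow]; rfl
  rw [e, sphFun_torus, sphFun_upper, zpow_mul_mem_ball, map_zpow, Units.val_zpow_eq_zpow_val,
    zero_sub, neg_neg, mul_ite, mul_one, mul_zero]

lemma sphFun_weyl_zpow (z : F) (k : ℤ) : sphFun χ (weyl F * (upperUnip z * hUnif ϖ ^ k)) = 0 := by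
  obtain ⟨ξ, e⟩ := hUnif_zpow_eq ϖ k
  rw [e, ← mul_assoc, weyl_mul_upperUnip, mul_assoc, sphFun_lower, sphFun_weyl_torus]

/-- The translate of the characteristic function of `𝒪` by `u(x) h̃(ϖ)` is `χ(h̃(ϖ))` times the
characteristic function of `-x + ϖ²𝒪`, and these cosets partition `𝒪`. -/
lemma isOrdinary_sphVec : IsOrdinary ϖ χ (parInd (charRep χ)) (sphVec hs) where
  upper x hx := Subtype.ext (funext fun g => sphFun_mul_upper χ hx g)
  units a ζ ha := Subtype.ext (funext fun g => sphFun_mul_tor χ ha ζ g)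
  hecke S hS := by
    have hev : ∀ g, (∑ x ∈ S, parInd (charRep χ) (upperUnip x * hUnif ϖ) (sphVec hs)).1 g =
        ∑ x ∈ S, sphFun χ (g * (upperUnip x * hUnif ϖ)) := fun g => by
      rw [Submodule.coe_sum, Finset.sum_apply]; rfl
    have h1 : ∀ z x : F, sphFun χ (upperUnip z * (upperUnip x * hUnif ϖ)) =
        open Classical in if z + x ∈ ball F 2 then (χ (hUnifT ϖ) : E) else 0 := fun z x => by
      have := sphFun_zpow ϖ (χ := χ) (z + x) 1
      rwa [zpow_one, zpow_one, mul_one, upperUnip_add, mul_assoc] at this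
    refine parInd_ext (fun z => ?_) ?_
    · rw [hev]
      simp only [h1]
      change _ = (χ (hUnifT ϖ) : E) * sphFun χ (upperUnip z)
      rw [sphFun_upper]
      by_cases hz : z ∈ ball F 0
      · obtain ⟨s, hsS, hz2, e⟩ := hS.sum_eq_single ((ball F 0).neg_mem hz)
          (φ := fun x => open Classical in if z + x ∈ ball F 2 then (χ (hUnifT ϖ) : E) else 0)
          fun s _ h => if_neg fun h' => h (by
            have := (ball F 2).neg_mem h'
            rwa [neg_add, ← sub_eq_add_neg] at this)
        rw [e, if_pos hz, if_pos, mul_one]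
        have := (ball F 2).neg_mem hz2
        rwa [neg_sub, sub_neg_eq_add, add_comm] at this
      · rw [if_neg hz, mul_zero]
        refine Finset.sum_eq_zero fun x hx => if_neg fun h => hz ?_
        have := (ball F 0).sub_mem (ball_anti (by omega) h) (hS.mem x hx)
        rwa [add_sub_cancel_right] at this
    · rw [hev]
      change _ = (χ (hUnifT ϖ) : E) * sphFun χ (weyl F)
      rw [sphFun_weyl', mul_zero]
      refine Finset.sum_eq_zero fun x _ => ?_
      have := sphFun_weyl_zpow ϖ (χ := χ) x 1
      rwa [zpow_one] at this

/-- The elements of a principal series which vanish at the Weyl element are spanned by the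
translates of `sphVec`. -/
lemma mem_ordSpan_of_weyl {f : parIndSpace (charRep χ)} (hf : f.1 (weyl F) = 0) :
    f ∈ ordSpan ϖ (parInd (charRep χ)) (sphVec hs) := by
  classical
  obtain ⟨N, hN0, hN⟩ := (isSmooth_parInd (τ := charRep χ)).exists_isCong ϖ f
  have hu : ∀ x ∈ ball F N, ∀ g, f.1 (g * upperUnip x) = f.1 g := fun x hx g =>
    congrFun (congrArg Subtype.val (hN _ (isCong_upperUnip hx))) g
  have hl : ∀ x ∈ ball F N, ∀ g, f.1 (g * lowerUnip x) = f.1 g := fun x hx g =>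
    congrFun (congrArg Subtype.val (hN _ (isCong_lowerUnip hx))) g
  obtain ⟨S, hS⟩ := exists_isReps ϖ (-N) (2 * N)
  -- for large `z`, the relation `upperUnip_eq` and smoothness relate `f (u(z))` to `f(w) = 0`
  have hsupp : ∀ z, z ∉ ball F (-N) → f.1 (upperUnip z) = 0 := by
    intro z hz
    obtain ⟨hz0, hzo⟩ := not_mem_ball.1 hz
    have e := upperUnip_eq (Units.mk0 z hz0)
    rw [Units.val_mk0] at e
    rw [e, hl, mul_assoc, parInd_lower, hTilde_eq, parInd_tor, hf, map_zero]
    rw [mem_ball_of_ne (Units.ne_zero _), Units.val_inv_eq_inv_val, ord_inv, Units.val_mk0]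
    omega
  have hc : (χ (hUnifT ϖ) : E) ^ (N : ℤ) ≠ 0 := zpow_ne_zero _ (Units.ne_zero _)
  have hfe : f = ∑ s ∈ S, (f.1 (upperUnip s) * ((χ (hUnifT ϖ) : E) ^ (N : ℤ))⁻¹) •
      parInd (charRep χ) (upperUnip (-s) * hUnif ϖ ^ (N : ℤ)) (sphVec hs) := by
    have hev : ∀ g, (∑ s ∈ S, (f.1 (upperUnip s) * ((χ (hUnifT ϖ) : E) ^ (N : ℤ))⁻¹) •
        parInd (charRep χ) (upperUnip (-s) * hUnif ϖ ^ (N : ℤ)) (sphVec hs)).1 g =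
        ∑ s ∈ S, (f.1 (upperUnip s) * ((χ (hUnifT ϖ) : E) ^ (N : ℤ))⁻¹) *
          sphFun χ (g * (upperUnip (-s) * hUnif ϖ ^ (N : ℤ))) := fun g => by
      rw [Submodule.coe_sum, Finset.sum_apply]; rfl
    refine parInd_ext (fun z => ?_) ?_
    · rw [hev]
      have h1 : ∀ s, f.1 (upperUnip s) * ((χ (hUnifT ϖ) : E) ^ (N : ℤ))⁻¹ *
          sphFun χ (upperUnip z * (upperUnip (-s) * hUnif ϖ ^ (N : ℤ))) =
          if z - s ∈ ball F (2 * N) then f.1 (upperUnip s) else 0 := fun s => by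
        rw [← mul_assoc (upperUnip z), ← upperUnip_add, sphFun_zpow, ← sub_eq_add_neg]
        split_ifs
        · rw [inv_mul_cancel_right₀ hc]
        · rw [mul_zero]
      simp only [h1]
      by_cases hz : z ∈ ball F (-N)
      · obtain ⟨s, hsS, hz2, e⟩ := hS.sum_eq_single hz
          (φ := fun s => if z - s ∈ ball F (2 * N) then f.1 (upperUnip s) else 0)
          fun s _ h => if_neg h
        rw [e, if_pos hz2]
        have e2 : upperUnip z = upperUnip s * upperUnip (z - s) := by
          rw [← upperUnip_add]; congr 1; ring
        rw [e2, hu _ (ball_anti (by omega) hz2)]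
      · rw [hsupp z hz]
        refine (Finset.sum_eq_zero fun s hsS => if_neg fun h => hz ?_).symm
        have := (ball F (-N)).add_mem (ball_anti (by omega) h) (hS.mem s hsS)
        rwa [sub_add_cancel] at this
    · rw [hev, hf]
      exact (Finset.sum_eq_zero fun s _ => by rw [sphFun_weyl_zpow, mul_zero]).symm
  rw [hfe]
  exact Submodule.sum_mem _ fun s _ => Submodule.smul_mem _ _ (mem_ordSpan _ _)

end PrincipalSeries

/-! ### Irreducibility and admissibility of the principal series -/

section PrincipalSeries

variable {F : Type*} [Field F] [ValuativeRel F] [TopologicalSpace F] [IsNonarchimedeanLocalField F]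
variable {E : Type*} [Field E] (ϖ : Uniformizer F) {χ : Torus F →* Eˣ}

lemma sphVec_weyl_weyl (hs : IsSmooth (charRep χ)) :
    (parInd (charRep χ) (weyl F) (sphVec hs)).1 (weyl F) ≠ 0 := by
  change sphFun χ (weyl F * weyl F) ≠ 0
  have e := sphFun_torus χ (torT (-1) 1) 1
  have h1 : sphFun χ (1 : Mp F) = 1 := by
    rw [← upperUnip_zero, sphFun_upper, if_pos (ball F 0).zero_mem]
  rw [weyl_mul_weyl]
  rw [mul_one, h1, mul_one] at e
  exact fun h => (χ (torT (-1) 1)).ne_zero (e.symm.trans h)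

/-- The ordinary vector generates its principal series: subtract a multiple of its Weyl translate to
obtain a function which vanishes at the Weyl element. -/
lemma ordSub_sphVec (hs : IsSmooth (charRep χ)) :
    ordSub ϖ (parInd (charRep χ)) (sphVec hs) = ⊤ := by
  refine Submodule.eq_top_iff'.2 fun f => ?_
  have hw := sphVec_weyl_weyl hs
  set ξ := parInd (charRep χ) (weyl F) (sphVec hs) with hξ
  have h1 : (f - (f.1 (weyl F) / ξ.1 (weyl F)) • ξ).1 (weyl F) = 0 := by
    change f.1 (weyl F) - f.1 (weyl F) / ξ.1 (weyl F) * ξ.1 (weyl F) = 0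
    rw [div_mul_cancel₀ _ hw, sub_self]
  have h2 := (ordSub ϖ (parInd (charRep χ)) (sphVec hs)).add_mem
    (ordSpan_le_ordSub (mem_ordSpan_of_weyl ϖ hs h1))
    (Submodule.smul_mem _ (f.1 (weyl F) / ξ.1 (weyl F))
      (Submodule.mem_sup_right (Submodule.mem_span_singleton_self ξ)))
  rwa [sub_add_cancel] at h2

lemma ordSub_le {V : Type*} [AddCommGroup V] [Module E V] {ρ : Representation E (Mp F) V} {v : V}
    {N : Submodule E V} (hN : ∀ g, ∀ v ∈ N, ρ g v ∈ N) (hv : v ∈ N) : ordSub ϖ ρ v ≤ N := by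
  refine sup_le (Submodule.span_le.2 ?_) (Submodule.span_le.2 ?_)
  · rintro _ ⟨q, rfl⟩; exact hN _ _ hv
  · rintro _ rfl; exact hN _ _ hv

/-- The principal series are irreducible: a stable subspace contains a nonzero element which
vanishes at the Weyl element, and by a `p`-group argument it contains a translate of `sphVec`. -/
lemma isIrreducible_parInd (p : ℕ) [Fact p.Prime] [CharP E p] [CharP 𝓀[F] p] (hp : p ≠ 2)
    (hs : IsSmooth (charRep χ)) (hg : IsGenuineTorus (charRep χ)) :
    (parInd (charRep χ)).IsIrreducible := by
  classical
  obtain ⟨ϖ⟩ : Nonempty (Uniformizer F) :=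
    let ⟨x, hx⟩ := IsDiscreteValuationRing.exists_irreducible 𝒪[F]; ⟨⟨x, hx⟩⟩
  have hw0 := sphVec_weyl_weyl hs
  refine isIrreducible_of_forall ⟨sphVec hs, fun h => hw0 (by rw [h, map_zero]; rfl)⟩ fun N hN hN0 => ?_
  obtain ⟨f0, hf0, hf0'⟩ := hN0
  have h2 : ringChar 𝓀[F] ≠ 2 := by rwa [ringChar.eq_iff.2 (inferInstance : CharP 𝓀[F] p)]
  have hE : (2 : E) ≠ 0 := by
    intro h
    have h3 : ((2 : ℕ) : E) = 0 := by exact_mod_cast h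
    rw [CharP.cast_eq_zero_iff E p] at h3
    exact hp ((Nat.prime_dvd_prime_iff_eq Fact.out Nat.prime_two).1 h3)
  -- the values at the Weyl element are invariant under right translation by `u(x)`, so it suffices
  -- that `f0` is not fixed by all of these elements
  obtain ⟨f, hf, hfne, hfw⟩ : ∃ f ∈ N, f ≠ 0 ∧ f.1 (weyl F) = 0 := by
    by_contra hcon
    push Not at hcon
    refine hf0' (eq_zero_of_upperUnip_fixed (isSmooth_parInd (τ := charRep χ))
      (isGenuine_parInd hg) ϖ h2 hE fun x => ?_)
    by_contra hx
    refine hcon _ (N.sub_mem (hN (upperUnip x) _ hf0) hf0) (sub_ne_zero.2 hx) ?_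
    change f0.1 (weyl F * upperUnip x) - f0.1 (weyl F) = 0
    rw [weyl_mul_upperUnip, parInd_lower, sub_self]
  obtain ⟨M, hM0, hM⟩ := (isSmooth_parInd (τ := charRep χ)).exists_isCong ϖ f
  have hu : ∀ x ∈ ball F M, parInd (charRep χ) (upperUnip x) f = f := fun x hx =>
    hM _ (isCong_upperUnip hx)
  have hl : ∀ x ∈ ball F M, ∀ g, f.1 (g * lowerUnip x) = f.1 g := fun x hx g =>
    congrFun (congrArg Subtype.val (hM _ (isCong_lowerUnip hx))) g
  have hsupp : ∀ z, z ∉ ball F (2 * (-M)) → f.1 (upperUnip z) = 0 := by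
    intro z hz
    obtain ⟨hz0, hzo⟩ := not_mem_ball.1 hz
    have e := upperUnip_eq (Units.mk0 z hz0)
    rw [Units.val_mk0] at e
    rw [e, hl, mul_assoc, parInd_lower, hTilde_eq, parInd_tor, hfw, map_zero]
    rw [mem_ball_of_ne (Units.ne_zero _), Units.val_inv_eq_inv_val, ord_inv, Units.val_mk0]
    omega
  -- the unipotent elements over the ball which supports `f` act through a finite `p`-group, as
  -- `p ^ (3 * M)` maps this ball into the one which fixes `f`
  let u : Multiplicative (ball F (2 * (-M))) →* Mp F :=
    { toFun := fun x => upperUnip (x.toAdd : F)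
      map_one' := upperUnip_zero
      map_mul' := fun x y => upperUnip_add _ _ }
  have hu_app : ∀ x : Multiplicative (ball F (2 * (-M))), u x = upperUnip (x.toAdd : F) :=
    fun _ => rfl
  have hfin : (Set.range fun g => (parInd (charRep χ)).comp u g f).Finite := by
    obtain ⟨S, hS⟩ := exists_isReps ϖ (2 * (-M)) M
    refine (S.finite_toSet.image fun s => parInd (charRep χ) (upperUnip s) f).subset ?_
    rintro _ ⟨x, rfl⟩
    obtain ⟨s, hsS, hxs⟩ := hS.exists_mem _ x.toAdd.2
    refine ⟨s, hsS, ?_⟩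
    change _ = parInd (charRep χ) (upperUnip _) f
    have e : (x.toAdd : F) = s + (x.toAdd - s) := by ring
    rw [e, upperUnip_add, rep_mul, hu _ hxs]
  have hpk : ∀ g, ∃ k : ℕ, ∀ h, (parInd (charRep χ)).comp u (g ^ p ^ k)
      ((parInd (charRep χ)).comp u h f) = (parInd (charRep χ)).comp u h f := by
    intro g
    have hpball : ∀ (k : ℕ) (m : ℤ) (x : F), x ∈ ball F m → ((p ^ k : ℕ) : F) * x ∈ ball F (m + k) := by
      have h1 : ((p : ℕ) : F) ∈ ball F 1 := by
        rw [mem_ball_one]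
        have h2 : ValuativeRel.valuation F (p : F) ≤ 1 := by
          have := ((p : 𝒪[F])).2
          exact_mod_cast this
        rw [← res_eq_zero h2, res_of_le h2]
        have : (⟨(p : F), h2⟩ : 𝒪[F]) = (p : 𝒪[F]) := Subtype.ext (by push_cast; rfl)
        rw [this, map_natCast, CharP.cast_eq_zero]
      intro k
      induction k with
      | zero => intro m x hx; simpa using hx
      | succ k ih =>
        intro m x hx
        have := mul_mem_ball h1 (ih m x hx)
        have e : ((p ^ (k + 1) : ℕ) : F) * x = (p : F) * (((p ^ k : ℕ) : F) * x) := by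
          push_cast; ring
        rw [e]
        exact ball_anti (by push_cast; omega) this
    refine ⟨3 * M, fun h => ?_⟩
    change parInd (charRep χ) (u (g ^ p ^ (3 * M))) (parInd (charRep χ) (u h) f) =
      parInd (charRep χ) (u h) f
    rw [← rep_mul, ← map_mul, mul_comm (g ^ p ^ (3 * M)) h, map_mul, rep_mul]
    congr 1
    rw [hu_app, toAdd_pow]
    refine hu _ ?_
    have := hpball (3 * M) _ _ g.toAdd.2
    rw [AddSubgroup.coe_nsmul, nsmul_eq_mul]
    exact ball_anti (by push_cast; omega) this
  obtain ⟨f1, hf1, hf1ne, hf1u⟩ := exists_fixed_vector p ((parInd (charRep χ)).comp u) hfne hfin hpk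
  have hf1N : f1 ∈ N := by
    refine (Submodule.span_le.2 ?_ : Submodule.span E _ ≤ N) hf1
    rintro _ ⟨x, rfl⟩
    exact hN _ _ hf
  -- the fixed vector is supported on `u(ϖ^{-2M} 𝒪)` and constant there
  have hspan : ∀ f2 ∈ Submodule.span E (Set.range fun g => (parInd (charRep χ)).comp u g f),
      f2.1 (weyl F) = 0 ∧ ∀ z, z ∉ ball F (2 * (-M)) → f2.1 (upperUnip z) = 0 := by
    intro f2 hf2
    induction hf2 using Submodule.span_induction with
    | mem x hx =>
      obtain ⟨y, rfl⟩ := hx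
      constructor
      · change f.1 (weyl F * upperUnip _) = 0
        rw [weyl_mul_upperUnip, parInd_lower, hfw]
      · intro z hz
        change f.1 (upperUnip z * upperUnip (y.toAdd : F)) = 0
        rw [← upperUnip_add]
        refine hsupp _ fun h => hz ?_
        have := (ball F (2 * (-M))).sub_mem h y.toAdd.2
        rwa [add_sub_cancel_right] at this
    | zero => exact ⟨rfl, fun _ _ => rfl⟩
    | add x y _ _ hx hy =>
      exact ⟨by change x.1 _ + y.1 _ = 0; rw [hx.1, hy.1, add_zero], fun z hz => by
        change x.1 _ + y.1 _ = 0; rw [hx.2 z hz, hy.2 z hz, add_zero]⟩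
    | smul c x _ hx =>
      exact ⟨by change c * x.1 _ = 0; rw [hx.1, mul_zero], fun z hz => by
        change c * x.1 _ = 0; rw [hx.2 z hz, mul_zero]⟩
  obtain ⟨h1w, h1s⟩ := hspan f1 hf1
  have h1c : ∀ z ∈ ball F (2 * (-M)), f1.1 (upperUnip z) = f1.1 1 := by
    intro z hz
    have := congrFun (congrArg Subtype.val (hf1u (Multiplicative.ofAdd ⟨z, hz⟩))) 1
    change f1.1 (1 * upperUnip z) = f1.1 1 at this
    rwa [one_mul] at this
  have hc : (χ (hUnifT ϖ) : E) ^ (-M : ℤ) ≠ 0 := zpow_ne_zero _ (Units.ne_zero _)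
  have hfe : f1 = (f1.1 1 * ((χ (hUnifT ϖ) : E) ^ (-M : ℤ))⁻¹) •
      parInd (charRep χ) (hUnif ϖ ^ (-M : ℤ)) (sphVec hs) := by
    refine parInd_ext (fun z => ?_) ?_
    · change _ = f1.1 1 * ((χ (hUnifT ϖ) : E) ^ (-M : ℤ))⁻¹ *
        sphFun χ (upperUnip z * hUnif ϖ ^ (-M : ℤ))
      rw [sphFun_zpow]
      split_ifs with hz
      · rw [inv_mul_cancel_right₀ hc, h1c z hz]
      · rw [mul_zero, h1s z hz]
    · change _ = f1.1 1 * ((χ (hUnifT ϖ) : E) ^ (-M : ℤ))⁻¹ *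
        sphFun χ (weyl F * hUnif ϖ ^ (-M : ℤ))
      have := sphFun_weyl_zpow ϖ (χ := χ) 0 (-M)
      rw [upperUnip_zero, one_mul] at this
      rw [this, h1w, mul_zero]
  have h11 : f1.1 1 ≠ 0 := fun h => hf1ne (by rw [hfe, h, zero_mul, zero_smul])
  obtain ⟨c, hc0, hfc⟩ : ∃ c : E, c ≠ 0 ∧
      f1 = c • parInd (charRep χ) (hUnif ϖ ^ (-M : ℤ)) (sphVec hs) :=
    ⟨_, mul_ne_zero h11 (inv_ne_zero hc), hfe⟩
  have hsph : sphVec hs ∈ N := by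
    have h3 := hN (hUnif ϖ ^ (M : ℤ)) _ (N.smul_mem c⁻¹ hf1N)
    rw [hfc, smul_smul, inv_mul_cancel₀ hc0, one_smul, ← rep_mul, ← zpow_add,
      add_neg_cancel, zpow_zero, map_one] at h3
    exact h3
  exact eq_top_iff.2 ((ordSub_sphVec ϖ hs).symm.le.trans (ordSub_le ϖ hN hsph))

/-- The principal series are admissible: an invariant of an open subgroup is determined by its
values at finitely many points. -/
lemma isAdmissible_parInd (χ : Torus F →* Eˣ) : IsAdmissible (parInd (charRep χ)) := by
  intro U
  obtain ⟨ϖ⟩ : Nonempty (Uniformizer F) :=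
    let ⟨x, hx⟩ := IsDiscreteValuationRing.exists_irreducible 𝒪[F]; ⟨⟨x, hx⟩⟩
  obtain ⟨n, hn, hU⟩ := (isOpen_subgroup_iff ϖ U.toSubgroup).1 U.isOpen
  obtain ⟨S, hS⟩ := exists_isReps ϖ 0 n
  -- the points `u(s)` and `w ū(s)`, for `s` in `𝒪` modulo a power of the maximal ideal, suffice
  let T : Representation.invariants ((parInd (charRep χ)).comp U.toSubgroup.subtype) →ₗ[E]
      (S → E) × (S → E) :=
    { toFun := fun f => (fun s => f.1.1 (upperUnip (s : F)), fun s => f.1.1 (weyl F * lowerUnip (s : F)))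
      map_add' := fun _ _ => rfl
      map_smul' := fun _ _ => rfl }
  refine FiniteDimensional.of_injective T ?_
  intro f f' hf
  have hinv : ∀ f : Representation.invariants ((parInd (charRep χ)).comp U.toSubgroup.subtype),
      ∀ k, IsCong n k → ∀ g, f.1.1 (g * mk k 1) = f.1.1 g := fun f k hk g =>
    congrFun (congrArg Subtype.val (f.2 ⟨_, hU k hk⟩)) g
  have h1 : ∀ z ∈ ball F 0, f.1.1 (upperUnip z) = f'.1.1 (upperUnip z) := by
    intro z hz
    obtain ⟨s, hs, h⟩ := hS.exists_mem z hz
    have e : z = s + (z - s) := by ring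
    rw [e, upperUnip_add]
    exact (hinv f _ (isCong_upperUnip h) _).trans ((congrFun (Prod.ext_iff.1 hf).1 ⟨s, hs⟩).trans
      (hinv f' _ (isCong_upperUnip h) _).symm)
  have h2 : ∀ z ∈ ball F 0, f.1.1 (weyl F * lowerUnip z) = f'.1.1 (weyl F * lowerUnip z) := by
    intro z hz
    obtain ⟨s, hs, h⟩ := hS.exists_mem z hz
    have e : z = s + (z - s) := by ring
    rw [e, lowerUnip_add, ← mul_assoc]
    exact (hinv f _ (isCong_lowerUnip h) _).trans ((congrFun (Prod.ext_iff.1 hf).2 ⟨s, hs⟩).trans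
      (hinv f' _ (isCong_lowerUnip h) _).symm)
  refine Subtype.ext (parInd_ext (fun z => ?_) ?_)
  · by_cases hz : z ∈ ball F 0
    · exact h1 z hz
    · obtain ⟨hz0, hzo⟩ := not_mem_ball.1 hz
      have e := upperUnip_eq (Units.mk0 z hz0)
      rw [Units.val_mk0] at e
      rw [e, mul_assoc, mul_assoc, parInd_lower, parInd_lower, hTilde_eq, parInd_tor, parInd_tor, h2]
      rw [mem_ball_of_ne (Units.ne_zero _), Units.val_inv_eq_inv_val, ord_inv, Units.val_mk0]
      omega
  · have := h2 0 (ball F 0).zero_mem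
    rwa [lowerUnip_zero, mul_one] at this

end PrincipalSeries

/-! ### Irreducible representations with an ordinary vector -/

section OrdinaryEmbedding

variable {F : Type*} [Field F] [ValuativeRel F] [TopologicalSpace F] [IsNonarchimedeanLocalField F]
variable {E : Type*} [Field E] {V : Type*} [AddCommGroup V] [Module E V]
variable {ϖ : Uniformizer F} {χ : Torus F →* Eˣ} {ρ : Representation E (Mp F) V} {v : V}

lemma isSmooth_prod {W : Type*} [AddCommGroup W] [Module E W] {ρ : Representation E (Mp F) V}
    {π : Representation E (Mp F) W} (ϖ : Uniformizer F) (hρ : IsSmooth ρ) (hπ : IsSmooth π) :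
    IsSmooth (ρ.prod π) := by
  refine isSmooth_of_isCong ϖ fun x => ?_
  obtain ⟨m, hm, h1⟩ := hρ.exists_isCong ϖ x.1
  obtain ⟨n, -, h2⟩ := hπ.exists_isCong ϖ x.2
  exact ⟨m + n, by omega, fun k hk => Prod.ext (h1 k (hk.mono (by omega)))
    (h2 k (hk.mono (by omega)))⟩

lemma IsOrdinary.prod {W : Type*} [AddCommGroup W] [Module E W] {π : Representation E (Mp F) W}
    {w : W} (h : IsOrdinary ϖ χ ρ v) (h' : IsOrdinary ϖ χ π w) :
    IsOrdinary ϖ χ (ρ.prod π) (v, w) where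
  upper x hx := Prod.ext (h.upper x hx) (h'.upper x hx)
  units a ζ ha := Prod.ext (h.units a ζ ha) (h'.units a ζ ha)
  hecke S hS := Prod.ext
    ((map_sum (LinearMap.fst E V W) _ _).trans (h.hecke S hS))
    ((map_sum (LinearMap.snd E V W) _ _).trans (h'.hecke S hS))

/-- Every element of `ordSpan` is a combination of translates of the ordinary vector at one level,
given by a finitely supported function on the quotient of `F` by a ball. -/
lemma IsOrdinary.exists_level (h : IsOrdinary ϖ χ ρ v) {w : V} (hw : w ∈ ordSpan ϖ ρ v) :
    ∃ (m : ℤ) (c : (F ⧸ ball F (2 * m)) →₀ E),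
      w = c.sum fun q a => a • ρ (upperUnip q.out * hUnif ϖ ^ m) v := by
  -- by refinement, all terms can be brought to one sufficiently high level
  have h1 : ∃ n : ℤ, ∀ m, n ≤ m → w ∈ Submodule.span E
      (Set.range fun y : F => ρ (upperUnip y * hUnif ϖ ^ m) v) := by
    induction hw using Submodule.span_induction with
    | mem x hx =>
      obtain ⟨⟨y, n⟩, rfl⟩ := hx
      refine ⟨n, fun m hm => ?_⟩
      obtain ⟨k, rfl⟩ : ∃ k : ℕ, m = n + k := ⟨(m - n).toNat, by omega⟩
      refine Submodule.span_mono ?_ (h.refine k y n)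
      rintro _ ⟨z, -, rfl⟩
      exact ⟨z, rfl⟩
    | zero => exact ⟨0, fun m _ => Submodule.zero_mem _⟩
    | add x y _ _ hx hy =>
      obtain ⟨a, ha⟩ := hx
      obtain ⟨b, hb⟩ := hy
      exact ⟨max a b, fun m hm => Submodule.add_mem _ (ha m (le_trans (le_max_left _ _) hm))
        (hb m (le_trans (le_max_right _ _) hm))⟩
    | smul c x _ hx =>
      obtain ⟨a, ha⟩ := hx
      exact ⟨a, fun m hm => Submodule.smul_mem _ _ (ha m hm)⟩
  obtain ⟨m, hm⟩ := h1
  refine ⟨m, ?_⟩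
  have h2 : w ∈ Submodule.span E (Set.range fun q : F ⧸ ball F (2 * m) =>
      ρ (upperUnip q.out * hUnif ϖ ^ m) v) := by
    refine Submodule.span_mono ?_ (hm m le_rfl)
    rintro _ ⟨y, rfl⟩
    refine ⟨QuotientAddGroup.mk y, ?_⟩
    change ρ (upperUnip _ * hUnif ϖ ^ m) v = ρ (upperUnip y * hUnif ϖ ^ m) v
    have h3 : -(QuotientAddGroup.mk y : F ⧸ ball F (2 * m)).out + y ∈ ball F (2 * m) :=
      QuotientAddGroup.eq.1 (Quotient.out_eq (QuotientAddGroup.mk y : F ⧸ ball F (2 * m)))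
    generalize (QuotientAddGroup.mk y : F ⧸ ball F (2 * m)).out = z at h3
    have e : y = z + (-z + y) := by ring
    have h4 : upperUnip y * hUnif ϖ ^ m = upperUnip z * hUnif ϖ ^ m *
        upperUnip (ϖ.val ^ (-(2 * m)) * (-z + y)) := by
      rw [mul_assoc, ← upperUnip_mul_hUnif_zpow, ← mul_assoc, ← upperUnip_add, ← e]
    rw [h4, rep_mul ρ (upperUnip z * hUnif ϖ ^ m), h.upper]
    rw [zpow_mul_mem_ball]
    exact ball_anti (by omega) h3
  obtain ⟨c, hc⟩ := Finsupp.mem_span_range_iff_exists_finsupp.1 h2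
  exact ⟨c, hc.symm⟩

/-- The space `ordSub` generated by `(sphVec, v)` in the product of a principal series and a
representation is the graph of a partial map. -/
lemma IsOrdinary.snd_eq_zero (hs : IsSmooth (charRep χ)) (h : IsOrdinary ϖ χ ρ v)
    {x : parIndSpace (charRep χ) × V}
    (hx : x ∈ ordSub ϖ ((parInd (charRep χ)).prod ρ) (sphVec hs, v)) (hx1 : x.1 = 0) : x.2 = 0 := by
  classical
  have hord := (isOrdinary_sphVec ϖ hs).prod h
  obtain ⟨a, ha, b, hb, rfl⟩ := Submodule.mem_sup.1 hx
  obtain ⟨c, rfl⟩ := Submodule.mem_span_singleton.1 hb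
  obtain ⟨m, d, rfl⟩ := hord.exists_level ha
  -- evaluation of the first component at a point of the group
  let ev : Mp F → (parIndSpace (charRep χ) × V →ₗ[E] E) := fun g =>
    { toFun := fun x => x.1.1 g
      map_add' := fun _ _ => rfl
      map_smul' := fun _ _ => rfl }
  have hev : ∀ g, ev g (d.sum fun q a => a • ((parInd (charRep χ)).prod ρ)
      (upperUnip q.out * hUnif ϖ ^ m) (sphVec hs, v)) =
      d.sum fun q a => a * sphFun χ (g * (upperUnip q.out * hUnif ϖ ^ m)) := fun g => by
    rw [map_finsuppSum]; rfl
  -- only the Weyl translate has a nonzero value at the Weyl element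
  have hc : c = 0 := by
    have h1 : ev (weyl F) (_ + _) = 0 := congrFun (congrArg Subtype.val hx1) (weyl F)
    rw [map_add, hev, map_smul] at h1
    simp only [sphFun_weyl_zpow, mul_zero, Finsupp.sum, Finset.sum_const_zero, zero_add] at h1
    exact (mul_eq_zero.1 h1).resolve_right (sphVec_weyl_weyl hs)
  subst hc
  rw [zero_smul, add_zero] at hx1 ⊢
  -- translates at one level by inequivalent points have disjoint supports on `u(F)`
  have hd : d = 0 := by
    ext q
    have h1 : ev (upperUnip (-q.out)) _ = 0 :=
      congrFun (congrArg Subtype.val hx1) (upperUnip (-q.out))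
    rw [hev, Finsupp.sum, Finset.sum_eq_single q] at h1
    · rw [← mul_assoc, ← upperUnip_add, neg_add_cancel, sphFun_zpow,
        if_pos (ball F _).zero_mem] at h1
      exact (mul_eq_zero.1 h1).resolve_right (zpow_ne_zero _ (Units.ne_zero _))
    · intro q' _ hq
      rw [← mul_assoc, ← upperUnip_add, sphFun_zpow, if_neg, mul_zero]
      intro hmem
      apply hq
      rw [← Quotient.out_eq q, ← Quotient.out_eq q']
      exact (QuotientAddGroup.eq.2 hmem).symm
    · intro hq
      rw [Finsupp.notMem_support_iff.1 hq, zero_mul]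
  rw [hd]; rfl

/-- An irreducible representation with an ordinary vector is a principal series. -/
lemma IsOrdinary.nonempty_equiv (hs : IsSmooth (charRep χ))
    (hχ : (parInd (charRep χ)).IsIrreducible) (hρ : IsSmooth ρ) (hirr : ρ.IsIrreducible)
    (h : IsOrdinary ϖ χ ρ v) (hv : v ≠ 0) :
    Nonempty (Representation.Equiv ρ (parInd (charRep χ))) := by
  set N := ordSub ϖ ((parInd (charRep χ)).prod ρ) (sphVec hs, v) with hN
  have hstab : ∀ g, ∀ x ∈ N, ((parInd (charRep χ)).prod ρ) g x ∈ N := fun g x hx =>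
    ((isOrdinary_sphVec ϖ hs).prod h).ordSub_stable (isSmooth_prod ϖ isSmooth_parInd hρ) g hx
  have hmem : (sphVec hs, v) ∈ N := by
    have := mem_ordSpan (ρ := (parInd (charRep χ)).prod ρ) (v := (sphVec hs, v)) (ϖ := ϖ) 0 0
    rw [upperUnip_zero, one_mul, zpow_zero, map_one] at this
    exact ordSpan_le_ordSub this
  -- the first projection identifies this stable subspace with the principal series, and the second
  -- one is then an intertwining map
  let P : N →ₗ[E] parIndSpace (charRep χ) := LinearMap.fst E _ _ ∘ₗ N.subtype
  have hinj : Function.Injective P := by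
    intro x y hxy
    have h1 : ((x - y : N) : parIndSpace (charRep χ) × V).1 = 0 := by
      change x.1.1 - y.1.1 = 0
      exact sub_eq_zero.2 hxy
    have h2 := h.snd_eq_zero hs (x - y).2 h1
    exact sub_eq_zero.1 (Subtype.ext (Prod.ext h1 h2))
  have hsurj : Function.Surjective P := by
    rw [← LinearMap.range_eq_top]
    refine eq_top_of_irreducible hχ _ ?_ (v := sphVec hs) ⟨⟨_, hmem⟩, rfl⟩ fun h0 => ?_
    · rintro g _ ⟨x, rfl⟩
      exact ⟨⟨_, hstab g x.1 x.2⟩, rfl⟩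
    · exact sphVec_weyl_weyl hs (by rw [h0, map_zero]; rfl)
  let e := LinearEquiv.ofBijective P ⟨hinj, hsurj⟩
  let T : parIndSpace (charRep χ) →ₗ[E] V := LinearMap.snd E _ _ ∘ₗ N.subtype ∘ₗ e.symm.toLinearMap
  have hT : ∀ x : N, T x.1.1 = x.1.2 := fun x => by
    have : e.symm x.1.1 = x := e.symm_apply_apply x
    change (e.symm x.1.1).1.2 = _
    rw [this]
  let T' : Representation.IntertwiningMap (parInd (charRep χ)) ρ :=
    ⟨T, fun g => LinearMap.ext fun f => by
      obtain ⟨x, rfl⟩ := hsurj f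
      have h1 := hT ⟨_, hstab g x.1 x.2⟩
      have h2 := hT x
      change T (parInd (charRep χ) g x.1.1) = ρ g (T x.1.1)
      rw [h2]
      exact h1⟩
  rcases Representation.IsIrreducible.bijective_or_eq_zero T' with hb | h0
  · exact ⟨(Representation.IntertwiningMap.ofBijective T' hb).symm⟩
  · exfalso
    apply hv
    have h1 := hT ⟨_, hmem⟩
    rw [← show T (sphVec hs) = v from h1]
    have h2 : T' (sphVec hs) = 0 := by rw [h0]; rfl
    exact h2

end OrdinaryEmbedding

/-! ### Frobenius reciprocity for Hecke modules -/

section HeckeFrobenius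

variable {E : Type*} [Field E] {G : Type*} [Group G] {H : Subgroup G} {V : Type*}
  [AddCommGroup V] [Module E V] {σ : Representation E H V} (φ : HeckeFunction σ)
variable {W : Type*} [AddCommGroup W] [Module E W] {ρ : Representation E G W}

variable (σ) in
/-- The element of a compact induction supported on `H` with value `v` at the identity. -/
def cIndOne : V →ₗ[E] cIndSpace σ where
  toFun v := ⟨fun g => open Classical in if h : g ∈ H then σ ⟨g, h⟩ v else 0, by
    classical
    refine ⟨fun h g => ?_, {1}, fun g hg => ⟨1, by simp, ?_⟩⟩
    · beta_reduce
      by_cases hg : g ∈ H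
      · have h1 : (h : G) * g ∈ H := H.mul_mem h.2 hg
        rw [dif_pos hg, dif_pos h1]
        have e : (⟨(h : G) * g, h1⟩ : H) = h * ⟨g, hg⟩ := rfl
        rw [e, rep_mul]
      · have h1 : (h : G) * g ∉ H := fun h' => hg ((H.mul_mem_cancel_left h.2).1 h')
        rw [dif_neg hg, dif_neg h1, map_zero]
    · by_contra h
      rw [inv_one, mul_one] at h
      exact hg (dif_neg h)⟩
  map_add' v v' := by
    classical
    refine Subtype.ext (funext fun g => ?_)
    change (if h : g ∈ H then σ ⟨g, h⟩ (v + v') else 0) =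
      (if h : g ∈ H then σ ⟨g, h⟩ v else 0) + (if h : g ∈ H then σ ⟨g, h⟩ v' else 0)
    split_ifs <;> simp
  map_smul' a v := by
    classical
    refine Subtype.ext (funext fun g => ?_)
    change (if h : g ∈ H then σ ⟨g, h⟩ (a • v) else 0) = a • (if h : g ∈ H then σ ⟨g, h⟩ v else 0)
    split_ifs <;> simp

lemma cIndOne_of_mem (v : V) {g : G} (h : g ∈ H) : (cIndOne σ v).1 g = σ ⟨g, h⟩ v := dif_pos h

lemma cIndOne_of_not_mem (v : V) {g : G} (h : g ∉ H) : (cIndOne σ v).1 g = 0 := dif_neg h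

lemma cInd_cIndOne (h : H) (v : V) : cInd σ h (cIndOne σ v) = cIndOne σ (σ h v) := by
  refine Subtype.ext (funext fun g => ?_)
  rw [cInd_apply]
  by_cases hg : g ∈ H
  · have h1 : g * h ∈ H := H.mul_mem hg h.2
    rw [cIndOne_of_mem v h1, cIndOne_of_mem _ hg, ← rep_mul]; rfl
  · have h1 : g * h ∉ H := fun h' => hg ((H.mul_mem_cancel_right h.2).1 h')
    rw [cIndOne_of_not_mem v h1, cIndOne_of_not_mem _ hg]

/-- An element of a compact induction is a sum of translates of elements supported on `H`. -/
lemma mem_of_cIndOne_mem (N : Submodule E (cIndSpace σ)) (hN : ∀ g, ∀ f ∈ N, cInd σ g f ∈ N)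
    (h1 : ∀ v, cIndOne σ v ∈ N) (f : cIndSpace σ) : f ∈ N := by
  classical
  obtain ⟨T, hT⟩ := f.2.2
  induction T using Finset.induction_on generalizing f with
  | empty =>
    have : f = 0 := Subtype.ext (funext fun g => by
      by_contra hg
      obtain ⟨s, hs, -⟩ := hT g hg
      simp at hs)
    rw [this]; exact N.zero_mem
  | insert t T ht ih =>
    have e : ∀ g, (cInd σ t⁻¹ (cIndOne σ (f.1 t))).1 g = if g * t⁻¹ ∈ H then f.1 g else 0 := by
      intro g
      rw [cInd_apply]
      split_ifs with h
      · rw [cIndOne_of_mem _ h, ← f.2.1]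
        change f.1 (g * t⁻¹ * t) = _
        rw [inv_mul_cancel_right]
      · rw [cIndOne_of_not_mem _ h]
    have h2 := ih (f - cInd σ t⁻¹ (cIndOne σ (f.1 t))) fun g hg => by
      have hg' : f.1 g - (cInd σ t⁻¹ (cIndOne σ (f.1 t))).1 g ≠ 0 := hg
      rw [e] at hg'
      by_cases h : g * t⁻¹ ∈ H
      · rw [if_pos h, sub_self] at hg'; exact absurd rfl hg'
      · rw [if_neg h, sub_zero] at hg'
        obtain ⟨s, hs, hs'⟩ := hT g hg'
        rcases Finset.mem_insert.1 hs with rfl | hs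
        · exact absurd hs' h
        · exact ⟨s, hs, hs'⟩
    have h3 := N.add_mem h2 (hN t⁻¹ _ (h1 (f.1 t)))
    rwa [sub_add_cancel] at h3

lemma op_cIndOne (v : V) (g : G) : (φ.op (cIndOne σ v)).1 g = φ.toFun g v := by
  classical
  change φ.conv _ g = _
  unfold HeckeFunction.conv
  rw [finsum_eq_single _ (Quotient.mk (QuotientGroup.rightRel H) 1), φ.term_eq,
    cIndOne_of_mem v H.one_mem]
  · have e : (⟨1, H.one_mem⟩ : H) = 1 := rfl
    rw [e, map_one, inv_one, mul_one]; rfl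
  · intro c hc
    have : c.out ∉ H := fun h => hc (by
      rw [← Quotient.out_eq c]
      exact Quotient.sound (QuotientGroup.rightRel_apply.2 (by rw [one_mul]; exact H.inv_mem h)))
    rw [cIndOne_of_not_mem v this, map_zero]

/-- The Hecke operator on elements supported on `H`, in terms of representatives of the support of
the Hecke function modulo `H`. -/
lemma op_cIndOne_eq_sum {I : Type*} (s : Finset I) (r : I → G)
    (h1 : ∀ g, φ.toFun g ≠ 0 → ∃ i ∈ s, g * (r i)⁻¹ ∈ H)
    (h2 : ∀ i ∈ s, ∀ j ∈ s, r i * (r j)⁻¹ ∈ H → i = j) (v : V) :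
    φ.op (cIndOne σ v) = ∑ i ∈ s, cInd σ (r i)⁻¹ (cIndOne σ (φ.toFun (r i) v)) := by
  refine Subtype.ext (funext fun g => ?_)
  rw [op_cIndOne, Submodule.coe_sum, Finset.sum_apply]
  by_cases hg : ∃ i ∈ s, g * (r i)⁻¹ ∈ H
  · obtain ⟨i, hi, h⟩ := hg
    rw [Finset.sum_eq_single i]
    · rw [cInd_apply, cIndOne_of_mem _ h, ← LinearMap.comp_apply, ← φ.left_equiv]
      change _ = φ.toFun (g * (r i)⁻¹ * r i) v
      rw [inv_mul_cancel_right]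
    · intro j hj hij
      rw [cInd_apply, cIndOne_of_not_mem]
      intro h'
      refine hij (h2 j hj i hi ?_)
      have := H.mul_mem (H.inv_mem h') h
      rwa [mul_inv_rev, inv_inv, mul_assoc, inv_mul_cancel_left] at this
    · intro h'; exact absurd hi h'
  · have h0 : φ.toFun g = 0 := by
      by_contra h; exact hg (h1 g h)
    rw [h0, LinearMap.zero_apply, Finset.sum_eq_zero]
    intro i hi
    rw [cInd_apply, cIndOne_of_not_mem]
    exact fun h => hg ⟨i, hi, h⟩

/-- The maps from the inducing representation which correspond under Frobenius reciprocity to the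
equivariant maps from the compact induction on which the Hecke operator acts by `a`. -/
def IsEigenMap (φ : HeckeFunction σ) (ρ : Representation E G W) (a : E) (Φ : V →ₗ[E] W) : Prop :=
  ∃ A : cIndSpace σ →ₗ[E] W, (∀ g f, A (cInd σ g f) = ρ g (A f)) ∧
    (∀ f, A (φ.op f) = a • A f) ∧ Φ = A ∘ₗ cIndOne σ

variable {φ} in
lemma IsEigenMap.map_rep {a : E} {Φ : V →ₗ[E] W} (hΦ : IsEigenMap φ ρ a Φ) (h : H) (v : V) :
    Φ (σ h v) = ρ h (Φ v) := by
  obtain ⟨A, hA, -, rfl⟩ := hΦ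
  change A (cIndOne σ (σ h v)) = ρ h (A (cIndOne σ v))
  rw [← cInd_cIndOne, hA]

variable {φ} in
/-- The eigenvalue equation, expressed through representatives of the support of the Hecke
function. -/
lemma IsEigenMap.sum_eq {a : E} {Φ : V →ₗ[E] W} (hΦ : IsEigenMap φ ρ a Φ) {I : Type*}
    (s : Finset I) (r : I → G) (h1 : ∀ g, φ.toFun g ≠ 0 → ∃ i ∈ s, g * (r i)⁻¹ ∈ H)
    (h2 : ∀ i ∈ s, ∀ j ∈ s, r i * (r j)⁻¹ ∈ H → i = j) (v : V) :
    ∑ i ∈ s, ρ (r i)⁻¹ (Φ (φ.toFun (r i) v)) = a • Φ v := by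
  obtain ⟨A, hA, hAop, rfl⟩ := hΦ
  have h3 := congrArg A (op_cIndOne_eq_sum φ s r h1 h2 v)
  rw [hAop, map_sum] at h3
  simp only [hA] at h3
  exact h3.symm

/-- Frobenius reciprocity for quotients of the cokernel of a Hecke operator. -/
lemma exists_isEigenMap (hW : ∃ w : W, w ≠ 0) {a : E} (h : IsQuotientOf ρ (φ.cokernel a)) :
    ∃ Φ : V →ₗ[E] W, Φ ≠ 0 ∧ IsEigenMap φ ρ a Φ := by
  obtain ⟨q, hq⟩ := h
  let A : cIndSpace σ →ₗ[E] W := q.toLinearMap ∘ₗ (φ.image a).mkQ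
  have hA : ∀ g f, A (cInd σ g f) = ρ g (A f) := fun g f =>
    Representation.IntertwiningMap.isIntertwining _ _ q g ((φ.image a).mkQ f)
  have hAop : ∀ f, A (φ.op f) = a • A f := fun f => by
    have h1 : (φ.image a).mkQ (φ.op f - a • f) = 0 :=
      (Submodule.Quotient.mk_eq_zero _).2 ⟨f, rfl⟩
    have h2 : A (φ.op f - a • f) = 0 := by
      change q.toLinearMap ((φ.image a).mkQ (φ.op f - a • f)) = 0
      rw [h1, map_zero]
    rwa [map_sub, map_smul, sub_eq_zero] at h2
  refine ⟨A ∘ₗ cIndOne σ, fun h0 => ?_, A, hA, hAop, rfl⟩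
  obtain ⟨w, hw⟩ := hW
  obtain ⟨x, rfl⟩ := hq w
  obtain ⟨f, rfl⟩ := (φ.image a).mkQ_surjective x
  refine hw ?_
  have : f ∈ LinearMap.ker A := mem_of_cIndOne_mem _ (fun g f hf => by
    rw [LinearMap.mem_ker] at hf ⊢
    rw [hA, hf, map_zero]) (fun v => LinearMap.congr_fun h0 v) f
  exact this

/-- The map from a compact induction attached to an equivariant map. -/
def cIndLift (ρ : Representation E G W) (Φ : V →ₗ[E] W) (f : cIndSpace σ) : W :=
  ∑ᶠ c : Quotient (QuotientGroup.rightRel H), ρ c.out⁻¹ (Φ (f.1 c.out))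

variable {Φ : V →ₗ[E] W} (hΦ : ∀ h v, Φ (σ h v) = ρ h (Φ v))

include hΦ in
/-- The summands of `cIndLift` are independent of the choice of representatives. -/
lemma cIndLift_term (f : cIndSpace σ) (x : G) :
    ρ (Quotient.mk (QuotientGroup.rightRel H) x).out⁻¹
      (Φ (f.1 (Quotient.mk (QuotientGroup.rightRel H) x).out)) = ρ x⁻¹ (Φ (f.1 x)) := by
  have h : QuotientGroup.rightRel H (Quotient.mk (QuotientGroup.rightRel H) x).out x :=
    Quotient.exact (Quotient.out_eq _)
  rw [QuotientGroup.rightRel_apply] at h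
  generalize (Quotient.mk (QuotientGroup.rightRel H) x).out = y at h ⊢
  obtain ⟨k, hk⟩ : ∃ k : H, (k : G) = x * y⁻¹ := ⟨⟨_, h⟩, rfl⟩
  have hx : x = k * y := by rw [hk]; group
  rw [hx, f.2.1, hΦ, ← rep_mul]
  congr 2
  group

omit hΦ in
lemma cIndLift_finite (f : cIndSpace σ) : (Function.support
    fun c : Quotient (QuotientGroup.rightRel H) => ρ c.out⁻¹ (Φ (f.1 c.out))).Finite := by
  obtain ⟨T, hT⟩ := f.2.2
  refine (T.finite_toSet.image (Quotient.mk (QuotientGroup.rightRel H))).subset fun c hc => ?_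
  have hf : f.1 c.out ≠ 0 := fun h0 => hc (by simp [h0])
  obtain ⟨s, hs, h⟩ := hT _ hf
  refine ⟨s, hs, ?_⟩
  rw [← Quotient.out_eq c]
  exact Quotient.sound (QuotientGroup.rightRel_apply.2 h)

include hΦ in
lemma cIndLift_cInd (x : G) (f : cIndSpace σ) :
    cIndLift ρ Φ (cInd σ x f) = ρ x (cIndLift ρ Φ f) := by
  unfold cIndLift
  rw [map_finsum _ (cIndLift_finite (ρ := ρ) (Φ := Φ) f)]
  let e : Quotient (QuotientGroup.rightRel H) ≃ Quotient (QuotientGroup.rightRel H) :=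
    Quotient.congr (Equiv.mulRight x⁻¹) fun a b => by
      rw [QuotientGroup.rightRel_apply, QuotientGroup.rightRel_apply]
      simp [mul_assoc]
  rw [← finsum_comp_equiv e]
  refine finsum_congr fun c => ?_
  obtain ⟨y, rfl⟩ := Quotient.exists_rep c
  have e1 : e (Quotient.mk (QuotientGroup.rightRel H) y) =
      Quotient.mk (QuotientGroup.rightRel H) (y * x⁻¹) := rfl
  rw [e1, cIndLift_term hΦ (cInd σ x f), cIndLift_term hΦ f, cInd_apply, ← rep_mul, mul_inv_rev,
    inv_inv, inv_mul_cancel_right]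

include hΦ in
lemma cIndLift_cIndOne (v : V) : cIndLift ρ Φ (cIndOne σ v) = Φ v := by
  unfold cIndLift
  rw [finsum_eq_single _ (Quotient.mk (QuotientGroup.rightRel H) 1), cIndLift_term hΦ,
    cIndOne_of_mem v H.one_mem]
  · have e : (⟨1, H.one_mem⟩ : H) = 1 := rfl
    rw [e, map_one, inv_one, map_one]; rfl
  · intro c hc
    have : c.out ∉ H := fun h => hc (by
      rw [← Quotient.out_eq c]
      exact Quotient.sound (QuotientGroup.rightRel_apply.2 (by rw [one_mul]; exact H.inv_mem h)))
    rw [cIndOne_of_not_mem v this, map_zero, map_zero]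

include hΦ in
/-- An irreducible representation which receives an equivariant map from the inducing
representation is a quotient of the cokernel of some translate of the Hecke operator, if all such
maps take their values in a finite-dimensional subspace. -/
lemma exists_isQuotientOf [IsAlgClosed E] [FiniteDimensional E V] (hirr : ρ.IsIrreducible)
    (W0 : Submodule E W) [FiniteDimensional E W0]
    (hW0 : ∀ Φ : V →ₗ[E] W, (∀ h v, Φ (σ h v) = ρ h (Φ v)) → ∀ v, Φ v ∈ W0) (h0 : Φ ≠ 0) :
    ∃ a, IsQuotientOf ρ (φ.cokernel a) := by
  -- the Hecke operator acts on the space `L` of equivariant maps, which is finite-dimensional by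
  -- Frobenius reciprocity; an eigenvector in `L` factors through the cokernel
  let L : Submodule E (cIndSpace σ →ₗ[E] W) :=
    { carrier := {A | ∀ g f, A (cInd σ g f) = ρ g (A f)}
      zero_mem' := fun g f => by simp
      add_mem' := fun {A B} hA hB g f => by simp [hA g f, hB g f]
      smul_mem' := fun c A hA g f => by simp [hA g f] }
  have hLW : ∀ A : L, ∀ v, A.1 (cIndOne σ v) ∈ W0 := fun A v =>
    hW0 (A.1 ∘ₗ cIndOne σ) (fun h v => by
      change A.1 (cIndOne σ (σ h v)) = ρ h (A.1 (cIndOne σ v))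
      rw [← cInd_cIndOne, A.2]) v
  let R : L →ₗ[E] (V →ₗ[E] W0) :=
    { toFun := fun A => (A.1 ∘ₗ cIndOne σ).codRestrict W0 (hLW A)
      map_add' := fun _ _ => rfl
      map_smul' := fun _ _ => rfl }
  have hR : Function.Injective R := by
    intro A B hAB
    refine Subtype.ext (LinearMap.ext fun f => ?_)
    have : f ∈ LinearMap.eqLocus A.1 B.1 := mem_of_cIndOne_mem _ (fun g f hf => by
      rw [LinearMap.mem_eqLocus] at hf ⊢
      rw [A.2, B.2, hf]) (fun v => congrArg Subtype.val (LinearMap.congr_fun hAB v)) f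
    exact this
  have hfin : FiniteDimensional E L := FiniteDimensional.of_injective R hR
  let A0 : L := ⟨
    { toFun := cIndLift ρ Φ
      map_add' := fun f f' => by
        unfold cIndLift
        rw [← finsum_add_distrib (cIndLift_finite (ρ := ρ) (Φ := Φ) f) (cIndLift_finite (ρ := ρ) (Φ := Φ) f')]
        exact finsum_congr fun c => by simp
      map_smul' := fun a f => by
        unfold cIndLift
        rw [RingHom.id_apply, smul_finsum]
        exact finsum_congr fun c => by simp }, fun g f => cIndLift_cInd hΦ g f⟩
  have hA0 : A0 ≠ 0 := by
    intro h
    refine h0 (LinearMap.ext fun v => ?_)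
    have h1 := LinearMap.congr_fun (congrArg Subtype.val h) (cIndOne σ v)
    rw [← cIndLift_cIndOne hΦ v]
    exact h1
  have hnt : Nontrivial L := ⟨⟨A0, 0, hA0⟩⟩
  let T : L →ₗ[E] L :=
    { toFun := fun A => ⟨A.1 ∘ₗ φ.op, fun g f => by
        change A.1 (φ.op (cInd σ g f)) = ρ g (A.1 (φ.op f))
        rw [φ.op_comm, A.2]⟩
      map_add' := fun _ _ => rfl
      map_smul' := fun _ _ => rfl }
  obtain ⟨a, ha⟩ := Module.End.exists_eigenvalue (K := E) (V := L) T
  obtain ⟨A, hA⟩ := ha.exists_hasEigenvector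
  have hAop : ∀ f, A.1 (φ.op f) = a • A.1 f := fun f =>
    LinearMap.congr_fun (congrArg Subtype.val hA.apply_eq_smul) f
  have hle : φ.image a ≤ LinearMap.ker A.1 := by
    rintro _ ⟨f, rfl⟩
    rw [LinearMap.mem_ker]
    change A.1 (φ.op f - a • f) = 0
    rw [map_sub, map_smul, hAop, sub_self]
  let q : Representation.IntertwiningMap (φ.cokernel a) ρ :=
    ⟨(φ.image a).liftQ A.1 hle, fun g => LinearMap.ext fun x => by
      obtain ⟨f, rfl⟩ := (φ.image a).mkQ_surjective x
      exact A.2 g f⟩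
  refine ⟨a, q, ?_⟩
  have hrange : LinearMap.range q.toLinearMap = ⊤ := by
    obtain ⟨f, hf⟩ : ∃ f, A.1 f ≠ 0 := by
      by_contra h
      push Not at h
      exact hA.2 (Subtype.ext (LinearMap.ext h))
    refine eq_top_of_irreducible hirr _ ?_ (v := A.1 f) ⟨(φ.image a).mkQ f, rfl⟩ hf
    rintro g _ ⟨x, rfl⟩
    exact ⟨φ.cokernel a g x, Representation.IntertwiningMap.isIntertwining _ _ q g x⟩
  exact LinearMap.range_eq_top.1 hrange

end HeckeFrobenius

/-! ### The maximal compact subgroup and its reduction map -/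

section Maximal

variable {F : Type*} [Field F] [ValuativeRel F] [TopologicalSpace F] [IsNonarchimedeanLocalField F]

lemma mem_Kt {x : Mp F} : x ∈ Kt F ↔ ∀ i j, (toSL x).1 i j ∈ ball F 0 := by
  constructor
  · intro h i j
    exact mem_ball_zero.2 (h.2 i j)
  · intro h
    refine ⟨?_, fun i j => mem_ball_zero.1 (h i j)⟩
    exact (toSL x).2

lemma reduction_apply (x : Kt F) (i j : Fin 2) :
    (reduction F x).1 i j = res ((toSL (x : Mp F)).1 i j) := rfl

lemma kSign_mk {k : SL(2, F)} {ζ : ℤˣ} (h : mk k ζ ∈ Kt F) :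
    kSign F ⟨mk k ζ, h⟩ = ζ * theta (k : GL (Fin 2) F) := rfl

lemma theta_of_isCong {k : SL(2, F)} (hk : IsCong 1 k) : theta (k : GL (Fin 2) F) = 1 := by
  obtain ⟨h1, h2, h3⟩ := ord_pos_unique hk.2.2.2
  unfold theta
  split_ifs with h
  · exact hilb_of_res_one h1 h3
  · rfl

lemma central_mem_Kt (ζ : ℤˣ) : mk (1 : SL(2, F)) ζ ∈ Kt F :=
  mem_Kt.2 (mem_Kt.1 (Kt F).one_mem)

lemma kSign_central (ζ : ℤˣ) : kSign F ⟨mk 1 ζ, central_mem_Kt ζ⟩ = ζ := by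
  rw [kSign_mk, theta_of_isCong, mul_one]
  have h : ∀ i j : Fin 2, (1 : SL(2, F)).1 i j = (1 : Matrix (Fin 2) (Fin 2) F) i j := fun i j => rfl
  refine ⟨?_, ?_, ?_, ?_⟩ <;> simp [h]

lemma reduction_central (ζ : ℤˣ) : reduction F ⟨mk 1 ζ, central_mem_Kt ζ⟩ = 1 := by
  rw [← map_one (reduction F)]
  ext i j
  rw [reduction_apply, reduction_apply]
  rfl

lemma res_sub {x y : F} (hx : x ∈ ball F 0) (hy : y ∈ ball F 0) :
    res (x - y) = res x - res y := by
  have h := res_add (mem_ball_zero.1 ((ball F 0).sub_mem hx hy)) (mem_ball_zero.1 hy)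
  rw [sub_add_cancel] at h
  rw [h, add_sub_cancel_right]

lemma res_eq_res_iff {x y : F} (hx : x ∈ ball F 0) (hy : y ∈ ball F 0) :
    res x = res y ↔ x - y ∈ ball F 1 := by
  rw [← sub_eq_zero, ← res_sub hx hy, mem_ball_one,
    res_eq_zero (mem_ball_zero.1 ((ball F 0).sub_mem hx hy))]

variable (F) in
/-- The kernel of the reduction map, embedded in the metaplectic cover by means of the splitting
over the maximal compact subgroup. -/
def congOne : Subgroup (Mp F) := ((reduction F).ker ⊓ (kSign F).ker).map (Kt F).subtype

lemma mem_congOne_iff {x : Mp F} :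
    x ∈ congOne F ↔ ∃ h : x ∈ Kt F, reduction F ⟨x, h⟩ = 1 ∧ kSign F ⟨x, h⟩ = 1 := by
  constructor
  · rintro ⟨k, hk, rfl⟩
    exact ⟨k.2, hk.1, hk.2⟩
  · rintro ⟨h, h1, h2⟩
    exact ⟨⟨x, h⟩, ⟨h1, h2⟩, rfl⟩

lemma mk_mem_congOne {k : SL(2, F)} (hk : IsCong 1 k) : mk k 1 ∈ congOne F := by
  obtain ⟨h1, h2, h3, h4⟩ := hk
  have h01 : ball F 1 ≤ ball F 0 := ball_anti (by norm_num)
  have e : ∀ x : F, x = x - 1 + 1 := fun x => by ring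
  have hK : mk k 1 ∈ Kt F := by
    rw [mem_Kt]
    intro i j
    rw [toSL_mk]
    fin_cases i <;> fin_cases j
    · change k.1 0 0 ∈ _
      rw [e (k.1 0 0)]; exact add_mem (h01 h1) one_mem_ball
    · exact h01 h2
    · exact h01 h3
    · change k.1 1 1 ∈ _
      rw [e (k.1 1 1)]; exact add_mem (h01 h4) one_mem_ball
  rw [mem_congOne_iff]
  refine ⟨hK, ?_, ?_⟩
  · ext i j
    rw [reduction_apply, toSL_mk]
    have hz : ∀ {x : F}, x ∈ ball F 1 → res x = 0 := fun hx => by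
      rw [mem_ball_one] at hx
      exact (res_eq_zero hx.le).2 hx
    fin_cases i <;> fin_cases j
    · exact (ord_pos_unique h1).2.2
    · exact hz h2
    · exact hz h3
    · exact (ord_pos_unique h4).2.2
  · rw [kSign_mk, theta_of_isCong ⟨h1, h2, h3, h4⟩, mul_one]

lemma exists_of_mem_congOne {x : Mp F} (hx : x ∈ congOne F) :
    IsCong 1 (toSL x) ∧ x = mk (toSL x) 1 := by
  obtain ⟨h, h1, h2⟩ := mem_congOne_iff.1 hx
  have hb := mem_Kt.1 h
  have hr : ∀ i j, res ((toSL x).1 i j) = (1 : Matrix (Fin 2) (Fin 2) 𝓀[F]) i j := fun i j => by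
    rw [← reduction_apply ⟨x, h⟩, h1]; rfl
  have hz : ∀ i j, i ≠ j → (toSL x).1 i j ∈ ball F 1 := fun i j hij => by
    have h3 := hr i j
    rw [Matrix.one_apply_ne hij, ← res_zero (F := F), res_eq_res_iff (hb i j) (zero_mem _)] at h3
    rwa [sub_zero] at h3
  have ho : ∀ i, (toSL x).1 i i - 1 ∈ ball F 1 := fun i => by
    have h3 := hr i i
    rwa [Matrix.one_apply_eq, ← res_one (F := F), res_eq_res_iff (hb i i) one_mem_ball] at h3
  have hc : IsCong 1 (toSL x) := ⟨ho 0, hz 0 1 (by decide), hz 1 0 (by decide), ho 1⟩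
  refine ⟨hc, mp_ext rfl ?_⟩
  change x.1.sgn * theta x.1.mat = 1 at h2
  rw [← toSL_coe, theta_of_isCong hc, mul_one] at h2
  exact h2

lemma isOpen_congOne (ϖ : Uniformizer F) : IsOpen (congOne F : Set (Mp F)) :=
  (isOpen_subgroup_iff ϖ _).2 ⟨1, one_pos, fun _ hk => mk_mem_congOne hk⟩

/-- The reduction map is surjective on the splitting of the maximal compact subgroup. -/
lemma exists_reduction_eq (g : SL(2, 𝓀[F])) :
    ∃ k : Kt F, reduction F k = g ∧ kSign F k = 1 := by
  obtain ⟨A, hA, ha⟩ := exists_res_eq (F := F) (g.1 0 0)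
  obtain ⟨B, hB, hb⟩ := exists_res_eq (F := F) (g.1 0 1)
  obtain ⟨C, hC, hc⟩ := exists_res_eq (F := F) (g.1 1 0)
  obtain ⟨D, hD, hd⟩ := exists_res_eq (F := F) (g.1 1 1)
  have hdet : g.1 0 0 * g.1 1 1 - g.1 0 1 * g.1 1 0 = 1 := by
    have := g.2
    rwa [Matrix.det_fin_two] at this
  have key : ∀ A B C D : F, A ∈ ball F 0 → B ∈ ball F 0 → C ∈ ball F 0 → D ∈ ball F 0 →
      A * D - B * C = 1 → res A = g.1 0 0 → res B = g.1 0 1 → res C = g.1 1 0 → res D = g.1 1 1 →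
      ∃ k : Kt F, reduction F k = g ∧ kSign F k = 1 := by
    intro A B C D hA hB hC hD h ha hb hc hd
    have hK : mk (sl A B C D h) (theta ((sl A B C D h : SL(2, F)) : GL (Fin 2) F)) ∈ Kt F := by
      rw [mem_Kt]
      intro i j
      rw [toSL_mk]
      fin_cases i <;> fin_cases j <;> assumption
    refine ⟨⟨_, hK⟩, ?_, ?_⟩
    · ext i j
      rw [reduction_apply, toSL_mk]
      fin_cases i <;> fin_cases j <;> assumption
    · rw [kSign_mk, int_units_sq]
  have hmul : ∀ {x y : F}, x ∈ ball F 0 → y ∈ ball F 0 → res (x * y) = res x * res y :=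
    fun hx hy => res_mul (mem_ball_zero.1 hx) (mem_ball_zero.1 hy)
  have hinv : ∀ {x : F}, ord x = 0 → x⁻¹ ∈ ball F 0 := fun hx =>
    Or.inr (by rw [ord_inv, hx, neg_zero])
  by_cases h0 : g.1 0 0 = 0
  · have hb0 : g.1 0 1 ≠ 0 := by
      intro h; rw [h0, h] at hdet; simp at hdet
    obtain ⟨hB0, hBo⟩ := unit_of_res_ne_zero hB (by rwa [hb])
    have hAD := (ball F 0).sub_mem (mul_mem_ball_zero hA hD) one_mem_ball
    have hC' : (A * D - 1) * B⁻¹ ∈ ball F 0 := mul_mem_ball_zero hAD (hinv hBo)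
    refine key A B ((A * D - 1) * B⁻¹) D hA hB hC' hD (by field_simp; ring) ha hb ?_ hd
    have h1 := hmul hB hC'
    have e : B * ((A * D - 1) * B⁻¹) = A * D - 1 := by field_simp
    rw [e, res_sub (mul_mem_ball_zero hA hD) one_mem_ball, hmul hA hD, ha, hb, hd, res_one] at h1
    refine mul_left_cancel₀ hb0 ?_
    rw [← h1]
    linear_combination hdet
  · obtain ⟨hA0, hAo⟩ := unit_of_res_ne_zero hA (by rwa [ha])
    have hBC := (ball F 0).add_mem one_mem_ball (mul_mem_ball_zero hB hC)
    have hD' : (1 + B * C) * A⁻¹ ∈ ball F 0 := mul_mem_ball_zero hBC (hinv hAo)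
    refine key A B C ((1 + B * C) * A⁻¹) hA hB hC hD' (by field_simp; ring) ha hb hc ?_
    have h1 := hmul hA hD'
    have e : A * ((1 + B * C) * A⁻¹) = 1 + B * C := by field_simp
    rw [e, res_add (by simp) (mem_ball_zero.1 (mul_mem_ball_zero hB hC)), hmul hB hC, ha, hb, hc,
      res_one] at h1
    refine mul_left_cancel₀ h0 ?_
    rw [← h1]
    linear_combination -hdet

lemma natCast_mem_ball_zero (n : ℕ) : (n : F) ∈ ball F 0 := by
  induction n with
  | zero => simp
  | succ n ih => rw [Nat.cast_succ]; exact add_mem ih one_mem_ball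

lemma prime_mem_ball_one (p : ℕ) [CharP 𝓀[F] p] : (p : F) ∈ ball F 1 := by
  have h : ∀ n : ℕ, res (n : F) = (n : 𝓀[F]) := fun n => by
    induction n with
    | zero => simp [res_zero]
    | succ n ih =>
      rw [Nat.cast_succ, Nat.cast_succ, res_add (mem_ball_zero.1 (natCast_mem_ball_zero n))
        (by simp), ih, res_one]
  have h2 := h p
  rw [CharP.cast_eq_zero 𝓀[F] p, ← res_zero (F := F),
    res_eq_res_iff (natCast_mem_ball_zero p) (zero_mem _), sub_zero] at h2
  exact h2

lemma matrix_mul_mem_ball {m n : ℤ} {A B : Matrix (Fin 2) (Fin 2) F}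
    (hA : ∀ i j, A i j ∈ ball F m) (hB : ∀ i j, B i j ∈ ball F n) (i j : Fin 2) :
    (A * B) i j ∈ ball F (m + n) := by
  rw [Matrix.mul_apply]
  exact sum_mem fun l _ => mul_mem_ball (hA i l) (hB l j)

lemma isCong_iff {n : ℤ} {k : SL(2, F)} :
    IsCong n k ↔ ∀ i j, (k.1 - 1 : Matrix (Fin 2) (Fin 2) F) i j ∈ ball F n := by
  have e01 : (k.1 - 1 : Matrix (Fin 2) (Fin 2) F) 0 1 = k.1 0 1 := by
    rw [Matrix.sub_apply, Matrix.one_apply_ne (by decide), sub_zero]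
  have e10 : (k.1 - 1 : Matrix (Fin 2) (Fin 2) F) 1 0 = k.1 1 0 := by
    rw [Matrix.sub_apply, Matrix.one_apply_ne (by decide), sub_zero]
  have e : ∀ i, (k.1 - 1 : Matrix (Fin 2) (Fin 2) F) i i = k.1 i i - 1 := fun i => by
    rw [Matrix.sub_apply, Matrix.one_apply_eq]
  constructor
  · rintro ⟨h1, h2, h3, h4⟩ i j
    fin_cases i <;> fin_cases j
    · change (k.1 - 1 : Matrix (Fin 2) (Fin 2) F) 0 0 ∈ _
      rwa [e]
    · change (k.1 - 1 : Matrix (Fin 2) (Fin 2) F) 0 1 ∈ _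
      rwa [e01]
    · change (k.1 - 1 : Matrix (Fin 2) (Fin 2) F) 1 0 ∈ _
      rwa [e10]
    · change (k.1 - 1 : Matrix (Fin 2) (Fin 2) F) 1 1 ∈ _
      rwa [e]
  · intro h
    exact ⟨e 0 ▸ h 0 0, e01 ▸ h 0 1, e10 ▸ h 1 0, e 1 ▸ h 1 1⟩

/-- Taking `p`-th powers maps a principal congruence subgroup to the next one. -/
lemma IsCong.pow_prime (p : ℕ) [CharP 𝓀[F] p] {m : ℤ} (hm : 1 ≤ m) {k : SL(2, F)}
    (hk : IsCong m k) : IsCong (m + 1) (k ^ p) := by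
  rw [isCong_iff] at hk ⊢
  obtain ⟨A, hA⟩ : ∃ A, A = (k.1 - 1 : Matrix (Fin 2) (Fin 2) F) := ⟨_, rfl⟩
  rw [← hA] at hk
  have hkA : k.1 = 1 + A := by rw [hA]; abel
  have key : ∀ i : ℕ, ∃ C : Matrix (Fin 2) (Fin 2) F, (∀ a b, C a b ∈ ball F (m + 1)) ∧
      (k ^ i).1 = 1 + i • A + C := by
    intro i
    induction i with
    | zero =>
      refine ⟨0, fun a b => zero_mem _, ?_⟩
      rw [pow_zero, zero_smul, add_zero, add_zero]; rfl
    | succ i ih =>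
      obtain ⟨C, hC, e⟩ := ih
      refine ⟨i • (A * A) + C + C * A, fun a b => ?_, ?_⟩
      · refine add_mem (add_mem ?_ (hC a b)) (ball_anti (by omega) (matrix_mul_mem_ball hC hk a b))
        rw [Matrix.smul_apply]
        exact nsmul_mem (ball_anti (by omega) (matrix_mul_mem_ball hk hk a b)) _
      · rw [pow_succ]
        change (k ^ i).1 * k.1 = _
        rw [e, hkA]
        simp only [add_mul, mul_add, mul_one, one_mul, smul_mul_assoc, add_smul, one_smul]
        abel
  obtain ⟨C, hC, e⟩ := key p
  intro i j
  rw [e]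
  have e2 : (1 + p • A + C - 1 : Matrix (Fin 2) (Fin 2) F) i j = (p : F) * A i j + C i j := by
    have : (1 + p • A + C - 1 : Matrix (Fin 2) (Fin 2) F) = p • A + C := by abel
    rw [this, Matrix.add_apply, Matrix.smul_apply, nsmul_eq_mul]
  rw [e2]
  refine add_mem ?_ (hC i j)
  rw [add_comm m]
  exact mul_mem_ball (prime_mem_ball_one p) (hk i j)

lemma toSL_pow (x : Mp F) (n : ℕ) : toSL (x ^ n) = toSL x ^ n := by
  induction n with
  | zero => rw [pow_zero, pow_zero]; rfl
  | succ n ih => rw [pow_succ, pow_succ, toSL_mul, ih]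

lemma isCong_pow_of_mem_congOne (p : ℕ) [CharP 𝓀[F] p] {x : Mp F} (hx : x ∈ congOne F) (j : ℕ) :
    IsCong (1 + j) (toSL (x ^ p ^ j)) := by
  induction j with
  | zero => simpa using (exists_of_mem_congOne hx).1
  | succ j ih =>
    rw [pow_succ p, pow_mul, toSL_pow]
    have := ih.pow_prime p (by omega)
    rwa [Nat.cast_succ, ← add_assoc]

end Maximal

/-! ### Existence of weights and of parameters -/

section WeightsExist

variable {F : Type*} [Field F] [ValuativeRel F] [TopologicalSpace F] [IsNonarchimedeanLocalField F]
variable {E : Type*} [Field E] {V : Type*} [AddCommGroup V] [Module E V]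
variable {ρ : Representation E (Mp F) V}

variable (ρ) in
/-- The vectors fixed by the kernel of the reduction map. -/
abbrev congInv : Submodule E V := Representation.invariants (ρ.comp (congOne F).subtype)

lemma mem_congInv {v : V} : v ∈ congInv ρ ↔ ∀ x ∈ congOne F, ρ x v = v :=
  ⟨fun h x hx => h ⟨x, hx⟩, fun h x => h x.1 x.2⟩

lemma IsAdmissible.finiteDimensional_congInv (h : IsAdmissible ρ) (ϖ : Uniformizer F) :
    FiniteDimensional E (congInv ρ) :=
  h ⟨congOne F, isOpen_congOne ϖ⟩

/-- The kernel of the reduction map is a pro-`p` group, so it fixes a nonzero vector. -/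
lemma IsSmooth.exists_mem_congInv (p : ℕ) [Fact p.Prime] [CharP E p] [CharP 𝓀[F] p]
    (hs : IsSmooth ρ) (ϖ : Uniformizer F) {v : V} (hv : v ≠ 0) : ∃ w ∈ congInv ρ, w ≠ 0 := by
  obtain ⟨n, hn0, hn⟩ := hs.exists_isCong ϖ v
  have hfix : ∀ x ∈ congOne F, IsCong n (toSL x) → ρ x v = v := fun x hx hc => by
    rw [(exists_of_mem_congOne hx).2]; exact hn _ hc
  obtain ⟨S, hS⟩ := exists_isReps ϖ 0 n
  have hrep : ∀ x : F, ∃ s : F, x ∈ ball F 0 → s ∈ S ∧ x - s ∈ ball F n := fun x => by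
    by_cases hx : x ∈ ball F 0
    · obtain ⟨s, hs, h⟩ := hS.exists_mem x hx
      exact ⟨s, fun _ => ⟨hs, h⟩⟩
    · exact ⟨0, fun h => absurd h hx⟩
  choose s hs using hrep
  have hK : ∀ g : congOne F, ∀ i j, (toSL (g : Mp F)).1 i j ∈ ball F 0 := fun g => by
    obtain ⟨h, -⟩ := mem_congOne_iff.1 g.2
    exact mem_Kt.1 h
  -- the translate of `v` by `g` depends only on the entries of `g` modulo a power of the maximal
  -- ideal
  let c : congOne F → Fin 2 → Fin 2 → S := fun g i j =>
    ⟨s ((toSL (g : Mp F)).1 i j), (hs _ (hK g i j)).1⟩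
  have hc : ∀ g h : congOne F, c g = c h → ρ (g : Mp F) v = ρ (h : Mp F) v := by
    intro g h hgh
    have h1 : ∀ i j, ((toSL (h : Mp F)).1 - (toSL (g : Mp F)).1 : Matrix (Fin 2) (Fin 2) F) i j ∈
        ball F n := fun i j => by
      have h2 : s ((toSL (g : Mp F)).1 i j) = s ((toSL (h : Mp F)).1 i j) :=
        congrArg Subtype.val (congrFun (congrFun hgh i) j)
      have h3 := (hs _ (hK g i j)).2
      have h4 := (hs _ (hK h i j)).2
      rw [← h2] at h4
      have := (ball F n).sub_mem h4 h3
      rwa [sub_sub_sub_cancel_right] at this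
    have h5 : ρ ((g⁻¹ * h : congOne F) : Mp F) v = v := by
      refine hfix _ (g⁻¹ * h).2 ?_
      rw [isCong_iff]
      intro i j
      have e1 : toSL (((g⁻¹ : congOne F) : Mp F) * (g : Mp F)) = 1 := by
        rw [← Subgroup.coe_mul, inv_mul_cancel]; rfl
      have e2 : ((toSL ((g⁻¹ * h : congOne F) : Mp F)).1 - 1 : Matrix (Fin 2) (Fin 2) F) =
          (toSL ((g⁻¹ : congOne F) : Mp F)).1 *
            ((toSL (h : Mp F)).1 - (toSL (g : Mp F)).1) := by
        rw [mul_sub]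
        have e3 : (toSL ((g⁻¹ : congOne F) : Mp F)).1 * (toSL (g : Mp F)).1 =
            (1 : Matrix (Fin 2) (Fin 2) F) := congrArg Subtype.val e1
        rw [e3]; rfl
      rw [e2, ← zero_add (n : ℤ)]
      exact matrix_mul_mem_ball (hK g⁻¹) h1 i j
    rw [Subgroup.coe_mul, Subgroup.coe_inv, rep_mul] at h5
    calc ρ (g : Mp F) v = ρ (g : Mp F) (ρ ((g : Mp F)⁻¹) (ρ (h : Mp F) v)) := by rw [h5]
      _ = ρ (h : Mp F) v := by rw [← rep_mul, ← rep_mul, mul_inv_cancel, one_mul]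
  have hfin : (Set.range fun g : congOne F => (ρ.comp (congOne F).subtype) g v).Finite := by
    classical
    refine (Set.finite_range (Function.extend c (fun g => ρ (g : Mp F) v) 0)).subset ?_
    rintro _ ⟨g, rfl⟩
    exact ⟨c g, Function.FactorsThrough.extend_apply (fun a b hab => hc a b hab) 0 g⟩
  obtain ⟨w, -, hw, hw'⟩ := exists_fixed_vector p (ρ.comp (congOne F).subtype) hv hfin fun g => by
    refine ⟨n, fun h => ?_⟩
    rw [← rep_mul]
    have e : g ^ p ^ n * h = h * (h⁻¹ * g * h) ^ p ^ n := by
      have := conj_pow (a := h⁻¹) (b := g) (i := p ^ n)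
      rw [inv_inv] at this
      rw [this]; group
    rw [e, rep_mul]
    congr 1
    exact hfix _ ((h⁻¹ * g * h) ^ p ^ n).2
      ((isCong_pow_of_mem_congOne p (h⁻¹ * g * h).2 n).mono (by omega))
  exact ⟨w, hw', hw⟩

lemma IsGenuine.congInv_stable (k : Kt F) {w : V} (hw : w ∈ congInv ρ) :
    ρ (k : Mp F) w ∈ congInv ρ := by
  rw [mem_congInv] at hw ⊢
  intro x hx
  have h1 : (k : Mp F)⁻¹ * x * k ∈ congOne F := by
    obtain ⟨y, ⟨hr, hk⟩, rfl⟩ := hx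
    have hr' : reduction F y = 1 := hr
    have hk' : kSign F y = 1 := hk
    refine ⟨k⁻¹ * y * k, ⟨?_, ?_⟩, by simp⟩
    · change reduction F (k⁻¹ * y * k) = 1
      rw [map_mul, map_mul, hr', mul_one, ← map_mul, inv_mul_cancel, map_one]
    · change kSign F (k⁻¹ * y * k) = 1
      rw [map_mul, map_mul, hk', mul_one, ← map_mul, inv_mul_cancel, map_one]
  calc ρ x (ρ (k : Mp F) w) = ρ (k : Mp F) (ρ ((k : Mp F)⁻¹ * x * k) w) := by
        rw [← rep_mul, ← rep_mul]; congr 2; group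
    _ = ρ (k : Mp F) w := by rw [hw _ h1]

/-- On the vectors fixed by the kernel of the reduction map, the action of the maximal compact
subgroup depends only on the reduction, up to the genuine sign. -/
lemma IsGenuine.kSign_smul_eq (hg : IsGenuine ρ) {w : V} (hw : w ∈ congInv ρ) {k k' : Kt F}
    (h : reduction F k = reduction F k') :
    ((kSign F k : ℤ) : E) • ρ (k : Mp F) w = ((kSign F k' : ℤ) : E) • ρ (k' : Mp F) w := by
  rw [mem_congInv] at hw
  let z : Kt F := k⁻¹ * k'
  let x : Kt F := z * ⟨mk 1 (kSign F z), central_mem_Kt _⟩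
  have hx : (x : Mp F) ∈ congOne F := by
    refine mem_congOne_iff.2 ⟨x.2, ?_, ?_⟩
    · change reduction F x = 1
      rw [map_mul, reduction_central, mul_one, map_mul, map_inv, h, inv_mul_cancel]
    · change kSign F x = 1
      rw [map_mul, kSign_central, int_units_sq]
  have h1 := hw _ hx
  change ρ ((z : Mp F) * mk 1 (kSign F z)) w = w at h1
  rw [rep_mul, hg.central, map_smul] at h1
  have h2 : ρ (k' : Mp F) w = ρ (k : Mp F) (ρ (z : Mp F) w) := by
    rw [← rep_mul]; congr 2
    change (k' : Mp F) = k * ((k : Mp F)⁻¹ * k')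
    group
  have h3 : kSign F k' = kSign F k * kSign F z := by rw [← map_mul]; congr 1; simp [z]
  rw [h2, h3, Units.val_mul, Int.cast_mul, mul_smul, ← map_smul (ρ (k : Mp F)) ((kSign F z : ℤ) : E), h1]

/-- Every smooth genuine representation with finite-dimensional invariants under the kernel of the
reduction map contains a weight of the maximal compact subgroup. -/
lemma exists_genWeight_map (p : ℕ) [Fact p.Prime] [CharP E p] [CharP 𝓀[F] p] [Fintype 𝓀[F]]
    [IsAlgClosed E] {f : ℕ} (hk : Fintype.card 𝓀[F] = p ^ f) (ι : 𝓀[F] →+* E)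
    (hs : IsSmooth ρ) (hg : IsGenuine ρ) (ha : IsAdmissible ρ) (ϖ : Uniformizer F)
    {v : V} (hv : v ≠ 0) :
    ∃ (r : Fin f → Fin p) (Φ : WtSpace E r →ₗ[E] V), Φ ≠ 0 ∧
      ∀ (h : Kt F) v, Φ (genWeight ι p r h v) = ρ h (Φ v) := by
  have hfin := ha.finiteDimensional_congInv ϖ
  obtain ⟨w, hw, hw0⟩ := hs.exists_mem_congInv p ϖ hv
  have hnt : Nontrivial (congInv ρ) := ⟨⟨⟨w, hw⟩, 0, fun h => hw0 (congrArg Subtype.val h)⟩⟩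
  choose s hs1 hs2 using exists_reduction_eq (F := F)
  have hind : ∀ (k : Kt F) (g : SL(2, 𝓀[F])), reduction F k = g → ∀ w ∈ congInv ρ,
      ((kSign F k : ℤ) : E) • ρ (k : Mp F) w = ρ (s g : Mp F) w := fun k g h w hw => by
    rw [hg.kSign_smul_eq hw (h.trans (hs1 g).symm), hs2]; simp
  -- after removing the genuine sign, the invariants are a representation of `SL₂` of the residue
  -- field
  let τ : Representation E SL(2, 𝓀[F]) (congInv ρ) :=
    { toFun := fun g => (ρ (s g : Mp F)).restrict fun w hw => IsGenuine.congInv_stable (s g) hw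
      map_one' := LinearMap.ext fun w => Subtype.ext (by
        change ρ (s 1 : Mp F) w.1 = w.1
        rw [← hind 1 1 (map_one _) w.1 w.2, map_one]; simp)
      map_mul' := fun g h => LinearMap.ext fun w => Subtype.ext (by
        change ρ (s (g * h) : Mp F) w.1 = ρ (s g : Mp F) (ρ (s h : Mp F) w.1)
        rw [← hind (s g * s h) (g * h) (by rw [map_mul, hs1, hs1]) w.1 w.2, map_mul, hs2, hs2,
          ← rep_mul]
        simp) }
  obtain ⟨r, Φ, hΦ0, hΦ⟩ := exists_weight_map p ι hk τ
  refine ⟨r, (congInv ρ).subtype ∘ₗ Φ, fun h0 => hΦ0 (LinearMap.ext fun v => Subtype.ext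
    (LinearMap.congr_fun h0 v)), fun h v => ?_⟩
  change (Φ (((kSign F h : ℤ) : E) • weight ι p r (reduction F h) v) : V) = ρ h (Φ v : V)
  have h1 : (Φ (weight ι p r (reduction F h) v) : V) = ρ (s (reduction F h) : Mp F) (Φ v : V) :=
    congrArg Subtype.val (hΦ (reduction F h) v)
  rw [map_smul, Submodule.coe_smul, h1, ← hind h _ rfl _ (Φ v).2, smul_smul, ← Int.cast_mul,
    ← Units.val_mul, int_units_sq]
  simp

/-- An equivariant map from a weight takes its values in the invariants of the kernel of the
reduction map. -/
lemma genWeight_map_mem (p : ℕ) [ExpChar E p] {f : ℕ} {ι : 𝓀[F] →+* E} {r : Fin f → Fin p}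
    {Φ : WtSpace E r →ₗ[E] V} (hΦ : ∀ (h : Kt F) v, Φ (genWeight ι p r h v) = ρ h (Φ v))
    (v : WtSpace E r) : Φ v ∈ congInv ρ := by
  rw [mem_congInv]
  intro x hx
  obtain ⟨h, h1, h2⟩ := mem_congOne_iff.1 hx
  have e : genWeight ι p r ⟨x, h⟩ v = v := by
    change ((kSign F ⟨x, h⟩ : ℤ) : E) • weight ι p r (reduction F ⟨x, h⟩) v = v
    rw [h1, h2, map_one]; simp
  have := hΦ ⟨x, h⟩ v
  rw [e] at this
  exact this.symm

/-- The equivariant maps from a weight take their values in one finite-dimensional space, so the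
Hecke operator has an eigenvector among them. -/
lemma exists_isParameter (p : ℕ) [Fact p.Prime] [CharP E p] [CharP 𝓀[F] p] [Fintype 𝓀[F]]
    [IsAlgClosed E] {f : ℕ} (hk : Fintype.card 𝓀[F] = p ^ f) (ι : 𝓀[F] →+* E)
    (hs : IsSmooth ρ) (hg : IsGenuine ρ) (hirr : ρ.IsIrreducible) (ha : IsAdmissible ρ)
    (ϖ : Uniformizer F) {v : V} (hv : v ≠ 0) :
    ∃ (r : Fin f → Fin p) (a : E), IsParameter ι p ϖ ρ r a := by
  have hfin := ha.finiteDimensional_congInv ϖ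
  obtain ⟨r, Φ, hΦ0, hΦ⟩ := exists_genWeight_map p hk ι hs hg ha ϖ hv
  obtain ⟨a, h⟩ := exists_isQuotientOf (heckeGen ι p r ϖ) hΦ hirr (congInv ρ)
    (fun Φ hΦ v => genWeight_map_mem p hΦ v) hΦ0
  exact ⟨r, a, h⟩

end WeightsExist

/-! ### Transport of Hecke modules along an automorphism -/

section TransportHecke

variable {E : Type*} [Field E] {G : Type*} [Group G] {H : Subgroup G} {V : Type*}
  [AddCommGroup V] [Module E V] {σ : Representation E H V} (φ : HeckeFunction σ)
variable {W : Type*} [AddCommGroup W] [Module E W] {ρ : Representation E G W} (c : G ≃* G)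

lemma transport_map (h : H) (h' : c (h : G) ∈ H.map c.toMonoidHom) :
    transport c σ ⟨c (h : G), h'⟩ = σ h := by
  rw [transport_apply]
  congr 1
  exact Subtype.ext (c.symm_apply_apply _)

/-- Equivariance for a transported representation is equivariance for the twisted action. -/
lemma equivariant_transport_iff {Φ : V →ₗ[E] W} :
    (∀ h v, Φ (transport c σ h v) = ρ h (Φ v)) ↔
      ∀ (h : H) v, Φ (σ h v) = (ρ.comp c.toMonoidHom) h (Φ v) := by
  constructor
  · intro hΦ h v
    have h1 : c (h : G) ∈ H.map c.toMonoidHom := ⟨h, h.2, rfl⟩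
    rw [← transport_map (σ := σ) c h h1, hΦ]
    rfl
  · rintro hΦ ⟨_, h, hh, rfl⟩ v
    have h2 := hΦ ⟨h, hh⟩ v
    rw [← transport_map (σ := σ) c ⟨h, hh⟩ ⟨h, hh, rfl⟩] at h2
    exact h2

variable (σ) in
/-- The transport of a compact induction along an automorphism. -/
def cIndTransport : cIndSpace σ →ₗ[E] cIndSpace (transport c σ) where
  toFun f := ⟨fun g => f.1 (c.symm g), fun h g => by
      beta_reduce
      rw [map_mul, transport_apply]
      exact f.2.1 ⟨c.symm h, _⟩ (c.symm g), by
      classical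
      obtain ⟨T, hT⟩ := f.2.2
      refine ⟨T.image c, fun g hg => ?_⟩
      obtain ⟨s, hs, h⟩ := hT _ hg
      exact ⟨c s, Finset.mem_image_of_mem _ hs, c.symm g * s⁻¹, h, by simp⟩⟩
  map_add' _ _ := rfl
  map_smul' _ _ := rfl

lemma cIndTransport_cInd (g : G) (f : cIndSpace σ) :
    cIndTransport σ c (cInd σ g f) = cInd (transport c σ) (c g) (cIndTransport σ c f) := by
  refine Subtype.ext (funext fun x => ?_)
  change f.1 (c.symm x * g) = f.1 (c.symm (x * c g))
  rw [map_mul, c.symm_apply_apply]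

lemma cIndTransport_cIndOne (v : V) :
    cIndTransport σ c (cIndOne σ v) = cIndOne (transport c σ) v := by
  refine Subtype.ext (funext fun x => ?_)
  change (cIndOne σ v).1 (c.symm x) = _
  by_cases hx : x ∈ H.map c.toMonoidHom
  · have hx' : c.symm x ∈ H := by
      obtain ⟨y, hy, rfl⟩ := hx
      simpa using hy
    rw [cIndOne_of_mem v hx, cIndOne_of_mem v hx', transport_apply]
  · have hx' : c.symm x ∉ H := fun h => hx ⟨_, h, c.apply_symm_apply x⟩
    rw [cIndOne_of_not_mem v hx, cIndOne_of_not_mem v hx']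

lemma cIndTransport_op (f : cIndSpace σ) :
    cIndTransport σ c (φ.op f) = (φ.transport c).op (cIndTransport σ c f) := by
  have key : cIndTransport σ c ∘ₗ φ.op = (φ.transport c).op ∘ₗ cIndTransport σ c := by
    refine LinearMap.ext fun f => ?_
    refine mem_of_cIndOne_mem (LinearMap.eqLocus (cIndTransport σ c ∘ₗ φ.op)
      ((φ.transport c).op ∘ₗ cIndTransport σ c)) (fun g f hf => ?_) (fun v => ?_) f
    · rw [LinearMap.mem_eqLocus] at hf ⊢
      change cIndTransport σ c (φ.op (cInd σ g f)) =
        (φ.transport c).op (cIndTransport σ c (cInd σ g f))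
      rw [φ.op_comm, cIndTransport_cInd, cIndTransport_cInd, HeckeFunction.op_comm]
      exact congrArg _ hf
    · rw [LinearMap.mem_eqLocus]
      change cIndTransport σ c (φ.op (cIndOne σ v)) =
        (φ.transport c).op (cIndTransport σ c (cIndOne σ v))
      rw [cIndTransport_cIndOne]
      refine Subtype.ext (funext fun x => ?_)
      rw [op_cIndOne]
      exact op_cIndOne φ v (c.symm x)
  exact LinearMap.congr_fun key f

/-- Parameters with respect to a conjugate of the maximal compact subgroup are parameters of the
twisted representation with respect to the subgroup itself. -/
lemma IsEigenMap.of_transport {a : E} {Φ : V →ₗ[E] W} (h : IsEigenMap (φ.transport c) ρ a Φ) :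
    IsEigenMap φ (ρ.comp c.toMonoidHom) a Φ := by
  obtain ⟨A, h1, h2, rfl⟩ := h
  refine ⟨A ∘ₗ cIndTransport σ c, fun g f => ?_, fun f => ?_, LinearMap.ext fun v => ?_⟩
  · change A (cIndTransport σ c (cInd σ g f)) = ρ (c g) (A (cIndTransport σ c f))
    rw [cIndTransport_cInd, h1]
  · change A (cIndTransport σ c (φ.op f)) = a • A (cIndTransport σ c f)
    rw [cIndTransport_op, h2]
  · exact congrArg A (cIndTransport_cIndOne c v).symm

end TransportHecke

/-! ### The Hecke operator on the highest weight vector -/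

section HeckeFormula

lemma doubleCoset_apply {E : Type*} [Field E] {G : Type*} [Group G] {H : Subgroup G} {V : Type*}
    [AddCommGroup V] [Module E V] {σ : Representation E H V} {t : G} {A : V →ₗ[E] V}
    (hA : ∀ k k' : H, (k : G) * t = t * k' → σ k ∘ₗ A = A ∘ₗ σ k')
    (hfin : FiniteMod H {g | ∃ k : H, g = t * k}) (k' : H) :
    (doubleCoset σ t A hA hfin).toFun (t * k') = A ∘ₗ σ k' := by
  have h := doubleCosetFun_apply hA 1 k'
  rw [map_one, Subgroup.coe_one, one_mul] at h
  exact h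

lemma doubleCoset_ne_zero {E : Type*} [Field E] {G : Type*} [Group G] {H : Subgroup G} {V : Type*}
    [AddCommGroup V] [Module E V] {σ : Representation E H V} {t : G} {A : V →ₗ[E] V}
    (hA : ∀ k k' : H, (k : G) * t = t * k' → σ k ∘ₗ A = A ∘ₗ σ k')
    (hfin : FiniteMod H {g | ∃ k : H, g = t * k}) {g : G}
    (hg : (doubleCoset σ t A hA hfin).toFun g ≠ 0) : ∃ k k' : H, g = k * t * k' := by
  by_contra h
  refine hg ?_
  change doubleCosetFun σ t A g = 0
  rw [doubleCosetFun, dif_neg]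
  rintro ⟨⟨k, k'⟩, e⟩
  exact h ⟨k, k', e⟩

variable {F : Type*} [Field F] [ValuativeRel F] [TopologicalSpace F] [IsNonarchimedeanLocalField F]

lemma toSL_inv (x : Mp F) : toSL x⁻¹ = (toSL x)⁻¹ := by
  rw [eq_inv_iff_mul_eq_one, ← toSL_mul, inv_mul_cancel]; rfl

lemma toSL_upperUnip (x : F) : toSL (upperUnip x) = sl 1 x 0 1 (by ring) := rfl

lemma toSL_lowerUnip (x : F) : toSL (lowerUnip x) = sl 1 0 x 1 (by ring) := rfl

lemma toSL_weyl : toSL (weyl F) = sl 0 1 (-1) 0 (by ring) := rfl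

lemma toSL_tor (a : Fˣ) (ζ : ℤˣ) : toSL (tor a ζ) = sl (a : F) 0 0 (a : F)⁻¹ (by simp) := rfl

lemma toSL_hUnif (ϖ : Uniformizer F) :
    toSL (hUnif ϖ) = sl ϖ.val 0 0 ϖ.val⁻¹ (by field_simp [ϖ.ne_zero]; ring) := rfl

lemma sl_mem_ball {a b c d : F} {h : a * d - b * c = 1} {n : ℤ} :
    (∀ i j, (sl a b c d h).1 i j ∈ ball F n) ↔
      a ∈ ball F n ∧ b ∈ ball F n ∧ c ∈ ball F n ∧ d ∈ ball F n := by
  constructor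
  · intro h
    exact ⟨h 0 0, h 0 1, h 1 0, h 1 1⟩
  · rintro ⟨h1, h2, h3, h4⟩ i j
    fin_cases i <;> fin_cases j <;> assumption

lemma upperUnip_mem_Kt {x : F} (hx : x ∈ ball F 0) : upperUnip x ∈ Kt F := by
  rw [mem_Kt, toSL_upperUnip, sl_mem_ball]
  exact ⟨one_mem_ball, hx, zero_mem _, one_mem_ball⟩

lemma lowerUnip_mem_Kt {x : F} (hx : x ∈ ball F 0) : lowerUnip x ∈ Kt F := by
  rw [mem_Kt, toSL_lowerUnip, sl_mem_ball]
  exact ⟨one_mem_ball, zero_mem _, hx, one_mem_ball⟩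

lemma weyl_mem_Kt : weyl F ∈ Kt F := by
  rw [mem_Kt, toSL_weyl, sl_mem_ball]
  exact ⟨zero_mem _, one_mem_ball, neg_mem one_mem_ball, zero_mem _⟩

lemma tor_mem_Kt {a : Fˣ} (ha : ord (a : F) = 0) (ζ : ℤˣ) : tor a ζ ∈ Kt F := by
  rw [mem_Kt, toSL_tor, sl_mem_ball]
  exact ⟨Or.inr ha.ge, zero_mem _, zero_mem _, Or.inr (by rw [ord_inv, ha, neg_zero])⟩

lemma kSign_upperUnip {x : F} (hx : upperUnip x ∈ Kt F) : kSign F ⟨upperUnip x, hx⟩ = 1 := by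
  change 1 * theta ((sl 1 x 0 1 _ : SL(2, F)) : GL (Fin 2) F) = 1
  rw [sl_coe, theta_gl_zero, one_mul]

lemma kSign_lowerUnip {x : F} (hx : lowerUnip x ∈ Kt F) : kSign F ⟨lowerUnip x, hx⟩ = 1 := by
  change 1 * theta ((sl 1 0 x 1 _ : SL(2, F)) : GL (Fin 2) F) = 1
  rw [sl_coe, one_mul]
  unfold theta
  split_ifs with h
  · rw [gl_val]
    exact hilb_one_right
  · rfl

lemma kSign_weyl : kSign F ⟨weyl F, weyl_mem_Kt⟩ = 1 := by
  change 1 * theta ((sl 0 1 (-1) 0 _ : SL(2, F)) : GL (Fin 2) F) = 1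
  rw [sl_coe, theta_gl_unit (by simp [Valuation.map_neg]), one_mul]

lemma kSign_tor {a : Fˣ} {ζ : ℤˣ} (h : tor a ζ ∈ Kt F) : kSign F ⟨tor a ζ, h⟩ = ζ := by
  change ζ * theta ((sl (a : F) 0 0 (a : F)⁻¹ (by simp) : SL(2, F)) : GL (Fin 2) F) = ζ
  rw [sl_coe, theta_gl_zero, mul_one]

/-- The maximal compact subgroup and its conjugate by `h̃(ϖ)` meet in the elements whose upper right
entry vanishes modulo `ϖ²`. -/
lemma conj_hUnif_mem_iff (ϖ : Uniformizer F) {m : Mp F} (hm : m ∈ Kt F) :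
    (hUnif ϖ)⁻¹ * m * hUnif ϖ ∈ Kt F ↔ (toSL m).1 0 1 ∈ ball F 2 := by
  obtain ⟨a, b, c, d, h, e⟩ := sl_eq (toSL m)
  have hϖ := ϖ.ne_zero
  have e2 : toSL ((hUnif ϖ)⁻¹ * m * hUnif ϖ) =
      sl a (ϖ.val ^ (-2 : ℤ) * b) (ϖ.val ^ (2 : ℤ) * c) d (by
        rw [zpow_neg]; field_simp; linear_combination h) := by
    rw [toSL_mul, toSL_mul, toSL_inv, e, toSL_hUnif, sl_inv, sl_mul, sl_mul]
    apply sl_congr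
    · field_simp; ring
    · rw [zpow_neg]
      have : ϖ.val ^ (2 : ℤ) = ϖ.val * ϖ.val := by rw [zpow_two]
      rw [this]
      field_simp; ring
    · rw [zpow_two]; ring
    · field_simp; ring
  rw [mem_Kt, e, sl_mem_ball] at hm
  obtain ⟨h1, h2, h3, h4⟩ := hm
  rw [mem_Kt, e2, sl_mem_ball, e]
  change _ ↔ b ∈ ball F 2
  rw [zpow_mul_mem_ball]
  constructor
  · rintro ⟨-, h, -⟩
    simpa using h
  · intro hb
    refine ⟨h1, by simpa using hb, ?_, h4⟩
    rw [zpow_mul_mem_ball]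
    exact ball_anti (by norm_num) h3

/-- Representatives of the double coset of the Hecke operator modulo the maximal compact
subgroup `K̃`. The summands correspond to the two kinds of points of the projective line over
`𝒪 / ϖ²`: those in the affine chart, indexed by `𝒪 / ϖ²`, and those reducing to the point at
infinity, indexed by `ϖ𝒪 / ϖ²`. -/
def heckeRep (ϖ : Uniformizer F) : F ⊕ F → Mp F
  | Sum.inl x => (hUnif ϖ)⁻¹ * upperUnip (-x)
  | Sum.inr y => (hUnif ϖ)⁻¹ * ((weyl F)⁻¹ * lowerUnip y)

variable {E : Type*} [Field E] {V : Type*} [AddCommGroup V] [Module E V]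
variable {ρ : Representation E (Mp F) V}
variable {ι : 𝓀[F] →+* E} {p : ℕ} [ExpChar E p] {f : ℕ} {r : Fin f → Fin p} {ϖ : Uniformizer F}

/-- The representatives exhaust the support of the Hecke function modulo `K̃`. -/
lemma heckeRep_cover {S S1 : Finset F} (hS : IsReps S 0 2) (hS1 : IsReps S1 1 2) (g : Mp F)
    (hg : (heckeGen ι p r ϖ).toFun g ≠ 0) : ∃ i ∈ S.disjSum S1, g * (heckeRep ϖ i)⁻¹ ∈ Kt F := by
  obtain ⟨k, k', rfl⟩ := doubleCoset_ne_zero _ _ hg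
  have hk' := mem_Kt.1 k'.2
  obtain ⟨a, b, c, d, h, e⟩ := sl_eq (toSL (k' : Mp F))
  rw [e, sl_mem_ball] at hk'
  obtain ⟨ha, hb, -, -⟩ := hk'
  have key : ∀ κ : Mp F, κ ∈ Kt F → (toSL ((k' : Mp F) * κ⁻¹)).1 0 1 ∈ ball F 2 →
      (k : Mp F) * (hTilde ϖ.unit)⁻¹ * k' * ((hUnif ϖ)⁻¹ * κ)⁻¹ ∈ Kt F := by
    intro κ hκ h1
    have h2 := (conj_hUnif_mem_iff ϖ ((Kt F).mul_mem k'.2 ((Kt F).inv_mem hκ))).2 h1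
    have e : (k : Mp F) * (hTilde ϖ.unit)⁻¹ * k' * ((hUnif ϖ)⁻¹ * κ)⁻¹ =
        k * ((hUnif ϖ)⁻¹ * (k' * κ⁻¹) * hUnif ϖ) := by
      rw [hUnif]; group
    rw [e]
    exact (Kt F).mul_mem k.2 h2
  by_cases ha1 : a ∈ ball F 1
  · have hb0 : b ≠ 0 ∧ ord b = 0 := by
      have hb1 : b ∉ ball F 1 := by
        intro hb1
        have hk'' := mem_Kt.1 k'.2
        rw [e, sl_mem_ball] at hk''
        obtain ⟨-, -, hc, hd⟩ := hk''
        have h1 : (1 : F) ∈ ball F 1 := by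
          rw [← h]
          refine (ball F 1).sub_mem ?_ ?_
          · rw [mul_comm]; exact mul_mem_ball_zero hd ha1
          · rw [mul_comm]; exact mul_mem_ball_zero hc hb1
        rw [mem_ball_of_ne one_ne_zero, ord_one] at h1
        omega
      obtain ⟨h0, h1⟩ := not_mem_ball.1 hb1
      rw [mem_ball_of_ne h0] at hb
      exact ⟨h0, by omega⟩
    have hbi : b⁻¹ ∈ ball F 0 := Or.inr (by rw [ord_inv, hb0.2, neg_zero])
    obtain ⟨y, hy, hy'⟩ := hS1.exists_mem (b⁻¹ * a) (mul_mem_ball_zero hbi ha1)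
    refine ⟨Sum.inr y, Finset.inr_mem_disjSum.2 hy, key _ ?_ ?_⟩
    · exact (Kt F).mul_mem ((Kt F).inv_mem weyl_mem_Kt)
        (lowerUnip_mem_Kt (ball_anti (by norm_num) (hS1.mem y hy)))
    · rw [mul_inv_rev, inv_inv, ← lowerUnip_neg, toSL_mul, toSL_mul, e, toSL_weyl, toSL_lowerUnip,
        sl_mul, sl_mul]
      change a * (1 * 1 + 0 * 0) + b * (-y * 1 + 1 * 0) ∈ _
      have e3 : a * (1 * 1 + 0 * 0) + b * (-y * 1 + 1 * 0) = b * (b⁻¹ * a - y) := by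
        field_simp [hb0.1]; ring
      rw [e3]
      exact mul_mem_ball_zero hb hy'
  · obtain ⟨ha0, hao⟩ := not_mem_ball.1 ha1
    have hao' : ord a = 0 := by
      rw [mem_ball_of_ne ha0] at ha
      omega
    have hai : a⁻¹ ∈ ball F 0 := Or.inr (by rw [ord_inv, hao', neg_zero])
    obtain ⟨x, hx, hx'⟩ := hS.exists_mem (-(a⁻¹ * b)) (neg_mem (mul_mem_ball_zero hai hb))
    refine ⟨Sum.inl x, Finset.inl_mem_disjSum.2 hx, key _ ?_ ?_⟩
    · exact upperUnip_mem_Kt (neg_mem (hS.mem x hx))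
    · rw [← upperUnip_neg, neg_neg, toSL_mul, e, toSL_upperUnip, sl_mul]
      change a * x + b * 1 ∈ _
      have e3 : a * x + b * 1 = -(a * (-(a⁻¹ * b) - x)) := by
        field_simp; ring
      rw [e3]
      exact neg_mem (mul_mem_ball_zero ha hx')

/-- The representatives are pairwise inequivalent modulo `K̃`. -/
lemma heckeRep_inj {S S1 : Finset F} (hS : IsReps S 0 2) (hS1 : IsReps S1 1 2) :
    ∀ i ∈ S.disjSum S1, ∀ j ∈ S.disjSum S1, heckeRep ϖ i * (heckeRep ϖ j)⁻¹ ∈ Kt F → i = j := by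
  have key : ∀ κ κ' : Mp F, κ ∈ Kt F → κ' ∈ Kt F →
      (hUnif ϖ)⁻¹ * κ * ((hUnif ϖ)⁻¹ * κ')⁻¹ ∈ Kt F → (toSL (κ * κ'⁻¹)).1 0 1 ∈ ball F 2 := by
    intro κ κ' hκ hκ' h
    rw [← conj_hUnif_mem_iff ϖ ((Kt F).mul_mem hκ ((Kt F).inv_mem hκ'))]
    have e : (hUnif ϖ)⁻¹ * κ * ((hUnif ϖ)⁻¹ * κ')⁻¹ =
        (hUnif ϖ)⁻¹ * (κ * κ'⁻¹) * hUnif ϖ := by group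
    rwa [← e]
  have hu : ∀ x ∈ S, upperUnip (-x) ∈ Kt F := fun x hx => upperUnip_mem_Kt (neg_mem (hS.mem x hx))
  have hl : ∀ y ∈ S1, (weyl F)⁻¹ * lowerUnip y ∈ Kt F := fun y hy =>
    (Kt F).mul_mem ((Kt F).inv_mem weyl_mem_Kt)
      (lowerUnip_mem_Kt (ball_anti (by norm_num) (hS1.mem y hy)))
  have hne : ∀ {x y : F}, x ∈ S → y ∈ S1 → 1 + y * x ∉ ball F 2 := by
    intro x y hx hy h
    have h1 : (1 : F) ∈ ball F 1 := by
      have e : (1 : F) = (1 + y * x) - x * y := by ring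
      rw [e]
      exact (ball F 1).sub_mem (ball_anti (by norm_num) h)
        (mul_mem_ball_zero (hS.mem x hx) (hS1.mem y hy))
    rw [mem_ball_of_ne one_ne_zero, ord_one] at h1
    omega
  rintro (x | y) hi (x' | y') hj h
  · have hx := Finset.inl_mem_disjSum.1 hi
    have hx' := Finset.inl_mem_disjSum.1 hj
    have h1 := key _ _ (hu x hx) (hu x' hx') h
    rw [← upperUnip_neg, neg_neg, ← upperUnip_add, toSL_upperUnip] at h1
    change -x + x' ∈ _ at h1
    rw [neg_add_eq_sub] at h1
    rw [hS.inj _ hx' _ hx h1]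
  · have hx := Finset.inl_mem_disjSum.1 hi
    have hy := Finset.inr_mem_disjSum.1 hj
    have h1 := key _ _ (hu x hx) (hl y' hy) h
    rw [mul_inv_rev, inv_inv, ← lowerUnip_neg, toSL_mul, toSL_mul, toSL_weyl, toSL_lowerUnip,
      toSL_upperUnip, sl_mul, sl_mul] at h1
    change 1 * (1 * 1 + 0 * 0) + -x * (-y' * 1 + 1 * 0) ∈ _ at h1
    have e : 1 * (1 * 1 + 0 * 0) + -x * (-y' * 1 + 1 * 0) = 1 + y' * x := by ring
    rw [e] at h1
    exact absurd h1 (hne hx hy)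
  · have hy := Finset.inr_mem_disjSum.1 hi
    have hx := Finset.inl_mem_disjSum.1 hj
    have h1 := key _ _ (hl y hy) (hu x' hx) h
    rw [← upperUnip_neg, neg_neg, toSL_mul, toSL_mul, toSL_inv, toSL_weyl, toSL_lowerUnip,
      toSL_upperUnip, sl_inv, sl_mul, sl_mul] at h1
    change (0 * 1 + -1 * y) * x' + (0 * 0 + -1 * 1) * 1 ∈ _ at h1
    have e : (0 * 1 + -1 * y) * x' + (0 * 0 + -1 * 1) * 1 = -(1 + y * x') := by ring
    rw [e, neg_mem_iff] at h1
    exact absurd h1 (hne hx hy)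
  · have hy := Finset.inr_mem_disjSum.1 hi
    have hy' := Finset.inr_mem_disjSum.1 hj
    have h1 := key _ _ (hl y hy) (hl y' hy') h
    have e1 : (weyl F)⁻¹ * lowerUnip y * ((weyl F)⁻¹ * lowerUnip y')⁻¹ =
        upperUnip (y' - y) := by
      have h2 := weyl_mul_upperUnip (F := F) (y' - y)
      have e2 : lowerUnip y * (lowerUnip y')⁻¹ = lowerUnip (-(y' - y)) := by
        rw [← lowerUnip_neg, ← lowerUnip_add]; congr 1; ring
      have e3 : (weyl F)⁻¹ * lowerUnip y * ((weyl F)⁻¹ * lowerUnip y')⁻¹ =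
          (weyl F)⁻¹ * (lowerUnip y * (lowerUnip y')⁻¹) * weyl F := by group
      rw [e3, e2, mul_assoc, ← h2, inv_mul_cancel_left]
    rw [e1, toSL_upperUnip] at h1
    change y' - y ∈ _ at h1
    rw [hS1.inj _ hy' _ hy h1]

lemma genWeight_of_kSign {k : Kt F} (hk : kSign F k = 1) (v : WtSpace E r) :
    genWeight ι p r k v = weight ι p r (reduction F k) v := by
  change ((kSign F k : ℤ) : E) • weight ι p r (reduction F k) v = _
  rw [hk]; simp

/-- The condition `∑ rᵢ pⁱ = 0` characterizes the trivial weight. -/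
lemma weight_topVec_of_total [Fact p.Prime] (hr : wtTotal r = 0) (g : SL(2, 𝓀[F])) :
    weight ι p r g (topVec (E := E) r) = topVec r := by
  have hr0 : ∀ i, (r i : ℕ) = 0 := fun i => by
    have h1 := (Finset.sum_eq_zero_iff.1 (show ∑ i, _ = 0 from hr)) i (Finset.mem_univ i)
    rcases Nat.mul_eq_zero.1 h1 with h | h
    · exact h
    · exact absurd h (pow_ne_zero _ (Fact.out : p.Prime).ne_zero)
  have hj : ∀ j : WtIndex r, j = fun _ => 0 := fun j => funext fun i => by
    ext
    have := (j i).2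
    have := hr0 i
    simp only [Fin.val_zero]
    omega
  rw [weight_topVec, Fintype.sum_eq_single (fun _ => 0) fun j h => absurd (hj j) h, wtMono_zero]
  simp [wtBinom, hr0]

/-- The eigenvalue equation for the highest weight vector. The second sum occurs only for the
trivial weight: otherwise the Weyl element moves the highest weight vector into the kernel of the
projection onto the highest weight line. -/
lemma IsEigenMap.topVec_eq [Fact p.Prime] {a : E} {Φ : WtSpace E r →ₗ[E] V}
    (h : IsEigenMap (heckeGen ι p r ϖ) ρ a Φ) {S S1 : Finset F} (hS : IsReps S 0 2)
    (hS1 : IsReps S1 1 2) :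
    ∑ x ∈ S, ρ (upperUnip x * hUnif ϖ) (Φ (topVec r)) + (if wtTotal r = 0 then
      ∑ y ∈ S1, ρ (lowerUnip (-y) * weyl F * hUnif ϖ) (Φ (topVec r)) else 0) =
        a • Φ (topVec r) := by
  rw [← h.sum_eq (S.disjSum S1) (heckeRep ϖ) (heckeRep_cover hS hS1) (heckeRep_inj hS hS1)
    (topVec r), Finset.sum_disjSum]
  congr 1
  · refine Finset.sum_congr rfl fun x hx => ?_
    have hK := upperUnip_mem_Kt (neg_mem (hS.mem x hx))
    have h1 : (heckeGen ι p r ϖ).toFun (heckeRep ϖ (Sum.inl x)) =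
        wtProj r ∘ₗ genWeight ι p r ⟨_, hK⟩ := doubleCoset_apply _ _ ⟨_, hK⟩
    have e : (heckeRep ϖ (Sum.inl x))⁻¹ = upperUnip x * hUnif ϖ := by
      change ((hUnif ϖ)⁻¹ * upperUnip (-x))⁻¹ = _
      rw [mul_inv_rev, inv_inv, ← upperUnip_neg, neg_neg]
    have h10 : (reduction F ⟨_, hK⟩).1 1 0 = 0 := by
      rw [reduction_apply, toSL_upperUnip]; exact res_zero
    have h00 : (reduction F ⟨_, hK⟩).1 0 0 = 1 := by
      rw [reduction_apply, toSL_upperUnip]; exact res_one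
    rw [h1, e, LinearMap.comp_apply, genWeight_of_kSign (kSign_upperUnip hK),
      weight_topVec_of_upper ι h10, h00, map_one, one_pow, one_smul, wtProj_topVec]
  · have h1 : ∀ y ∈ S1, ρ (heckeRep ϖ (Sum.inr y))⁻¹
        (Φ ((heckeGen ι p r ϖ).toFun (heckeRep ϖ (Sum.inr y)) (topVec r))) =
        if wtTotal r = 0 then ρ (lowerUnip (-y) * weyl F * hUnif ϖ) (Φ (topVec r)) else 0 := by
      intro y hy
      have hL := lowerUnip_mem_Kt (ball_anti (show (0 : ℤ) ≤ 1 by norm_num) (hS1.mem y hy))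
      let κ : Kt F := (⟨weyl F, weyl_mem_Kt⟩ : Kt F)⁻¹ * ⟨_, hL⟩
      have hκ : kSign F κ = 1 := by
        rw [map_mul, map_inv, kSign_weyl, kSign_lowerUnip, inv_one, one_mul]
      have h1 : (heckeGen ι p r ϖ).toFun (heckeRep ϖ (Sum.inr y)) =
          wtProj r ∘ₗ genWeight ι p r κ := doubleCoset_apply _ _ κ
      have e : (heckeRep ϖ (Sum.inr y))⁻¹ = lowerUnip (-y) * weyl F * hUnif ϖ := by
        change ((hUnif ϖ)⁻¹ * ((weyl F)⁻¹ * lowerUnip y))⁻¹ = _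
        rw [lowerUnip_neg]; group
      rw [h1, e, LinearMap.comp_apply, genWeight_of_kSign hκ]
      split_ifs with hr
      · rw [weight_topVec_of_total hr, wtProj_topVec]
      · rw [wtProj_weight_topVec ι hr, map_zero, map_zero]
        rw [reduction_apply]
        change res ((toSL ((weyl F)⁻¹ * lowerUnip y)).1 0 0) = 0
        rw [toSL_mul, toSL_inv, toSL_weyl, toSL_lowerUnip, sl_inv, sl_mul]
        change res (0 * 1 + -1 * y) = 0
        have e2 : 0 * 1 + -1 * y = -y := by ring
        have h3 := mem_ball_one.1 (neg_mem (hS1.mem y hy))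
        rw [e2, res_eq_zero h3.le]
        exact h3
    rw [Finset.sum_congr rfl h1]
    split_ifs
    · rfl
    · rw [Finset.sum_const_zero]

end HeckeFormula

/-! ### Tame genuine characters of the torus -/

section TorusCharacters

variable {F : Type*} [Field F] [ValuativeRel F] [TopologicalSpace F] [IsNonarchimedeanLocalField F]
variable {E : Type*} [Field E] {V : Type*} [AddCommGroup V] [Module E V]

lemma isOpen_torus_stab (ϖ : Uniformizer F) {τ : Representation E (Torus F) V} {v : V}
    (O : Subgroup (Mp F)) (hO : IsOpen (O : Set (Mp F)))
    (h : ∀ t : Torus F, (t : Mp F) ∈ O → τ t v = v) : IsOpen {t | τ t v = v} := by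
  obtain ⟨n, -, hn⟩ := (isOpen_subgroup_iff ϖ O).1 hO
  refine ⟨{x | ∃ t : Torus F, τ t v = v ∧ (t : Mp F)⁻¹ * x ∈ O}, ?_, ?_⟩
  · rw [isOpen_iff_mp]
    rintro x ⟨t, ht, hx⟩
    filter_upwards [eventually_isCong ϖ n] with k hk
    refine ⟨t, ht, ?_⟩
    rw [← mul_assoc]
    exact O.mul_mem hx (hn k hk)
  · ext t
    constructor
    · rintro ⟨s, hs, hx⟩
      have h1 := h (s⁻¹ * t) hx
      change τ t v = v
      have e : t = s * (s⁻¹ * t) := by group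
      rw [e, rep_mul, h1, hs]
    · intro ht
      refine ⟨t, ht, ?_⟩
      rw [inv_mul_cancel]
      exact O.one_mem

lemma isGenuineTorus_charRep {χ : Torus F →* Eˣ} (h : ∀ ζ, (χ (torT 1 ζ) : E) = ((ζ : ℤ) : E)) :
    IsGenuineTorus (charRep χ) := by
  intro t ζ h1 h2 v
  have e : (⟨mk t ζ, h1⟩ : Torus F) = torT 1 ζ * ⟨mk t 1, h2⟩ := by
    refine Subtype.ext ?_
    change mk t ζ = tor 1 ζ * mk t 1
    rw [tor_one, central_comm, mk_eq_mul_central]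
  rw [e, rep_mul]
  change (χ (torT 1 ζ) : E) • (charRep χ ⟨mk t 1, h2⟩ v : E) = _
  rw [h]

/-- The valuation of the upper left entry of an element of the torus. -/
def ordT : Torus F →* Multiplicative ℤ where
  toFun t := Multiplicative.ofAdd (ord ((toSL (t : Mp F)).1 0 0))
  map_one' := by
    change Multiplicative.ofAdd (ord (1 : F)) = 1
    rw [ord_one]; rfl
  map_mul' s t := by
    obtain ⟨a, ζ, rfl⟩ := exists_eq_torT s
    obtain ⟨b, ξ, rfl⟩ := exists_eq_torT t
    rw [torT_mul_torT, ← ofAdd_add]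
    change Multiplicative.ofAdd (ord ((a * b : Fˣ) : F)) =
      Multiplicative.ofAdd (ord (a : F) + ord (b : F))
    rw [Units.val_mul, ord_mul a.ne_zero b.ne_zero]

/-- The value on the units of the genuine character `(diag(u, u⁻¹), ζ) ↦ ζ ι(u mod ϖ)^R`. It is
multiplicative on elements of valuation `0`, where the Hilbert symbols in the cocycle vanish. -/
def tameVal (ι : 𝓀[F] →+* E) (R : ℕ) (t : Torus F) : E :=
  (((t : Mp F).1.sgn : ℤ) : E) * ι (res ((toSL (t : Mp F)).1 0 0)) ^ R

lemma tameVal_torT (ι : 𝓀[F] →+* E) (R : ℕ) (a : Fˣ) (ζ : ℤˣ) :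
    tameVal ι R (torT a ζ) = ((ζ : ℤ) : E) * ι (res (a : F)) ^ R := rfl

lemma tameVal_mul (ι : 𝓀[F] →+* E) (R : ℕ) {s t : Torus F} (hs : ordT s = 1) (ht : ordT t = 1) :
    tameVal ι R (s * t) = tameVal ι R s * tameVal ι R t := by
  obtain ⟨a, ζ, rfl⟩ := exists_eq_torT s
  obtain ⟨b, ξ, rfl⟩ := exists_eq_torT t
  have ha : ord (a : F) = 0 := congrArg Multiplicative.toAdd hs
  have hb : ord (b : F) = 0 := congrArg Multiplicative.toAdd ht
  rw [torT_mul_torT, tameVal_torT, tameVal_torT, tameVal_torT, hilb_units ha hb, mul_one,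
    Units.val_mul, Units.val_mul, Int.cast_mul,
    res_mul ((val_eq_one a.ne_zero).2 ha).le ((val_eq_one b.ne_zero).2 hb).le, map_mul, mul_pow]
  ring

/-- The unit part of an element of the torus. -/
def unitPart (ϖ : Uniformizer F) (t : Torus F) : Torus F :=
  t * hUnifT ϖ ^ (-(ordT t).toAdd)

lemma ordT_hUnifT (ϖ : Uniformizer F) : ordT (hUnifT ϖ) = Multiplicative.ofAdd 1 := by
  change Multiplicative.ofAdd (ord ϖ.val) = _
  rw [ord_uniformizer]

lemma ordT_unitPart (ϖ : Uniformizer F) (t : Torus F) : ordT (unitPart ϖ t) = 1 := by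
  rw [unitPart, map_mul, map_zpow, ordT_hUnifT, ← ofAdd_zsmul]
  apply Multiplicative.toAdd.injective
  simp

lemma unitPart_mul (ϖ : Uniformizer F) (s t : Torus F) :
    unitPart ϖ (s * t) = unitPart ϖ s * unitPart ϖ t := by
  rw [unitPart, unitPart, unitPart, map_mul, toAdd_mul, neg_add, zpow_add, mul_assoc s t,
    ← mul_assoc t, torus_comm t, mul_assoc, mul_assoc]

/-- The genuine character of the torus with prescribed value at `h̃(ϖ)` and prescribed tame
restriction to the units. -/
lemma exists_torus_char (ι : 𝓀[F] →+* E) (ϖ : Uniformizer F) (R : ℕ) {a : E} (ha : a ≠ 0) :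
    ∃ χ : Torus F →* Eˣ, (χ (hUnifT ϖ) : E) = a ∧ (∀ (u : Fˣ) (ζ : ℤˣ), ord (u : F) = 0 →
      (χ (torT u ζ) : E) = ((ζ : ℤ) : E) * ι (res (u : F)) ^ R) ∧ IsSmooth (charRep χ) ∧
      IsGenuineTorus (charRep χ) := by
  have hT1 : tameVal ι R (1 : Torus F) = 1 := by
    have e : (1 : Torus F) = torT 1 1 := Subtype.ext tor_one_one.symm
    rw [e, tameVal_torT]; simp [res_one]
  let χ' : Torus F →* E :=
    { toFun := fun t => a ^ (ordT t).toAdd * tameVal ι R (unitPart ϖ t)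
      map_one' := by
        have e : unitPart ϖ (1 : Torus F) = 1 := by
          rw [unitPart, map_one]; simp
        rw [e, map_one, hT1]; simp
      map_mul' := fun s t => by
        rw [unitPart_mul, tameVal_mul ι R (ordT_unitPart ϖ s) (ordT_unitPart ϖ t), map_mul,
          toAdd_mul, zpow_add₀ ha]
        ring }
  have hχ : ∀ t, (χ'.toHomUnits t : E) = a ^ (ordT t).toAdd * tameVal ι R (unitPart ϖ t) :=
    fun t => rfl
  have hunit : ∀ (u : Fˣ) (ζ : ℤˣ), ord (u : F) = 0 →
      (χ'.toHomUnits (torT u ζ) : E) = ((ζ : ℤ) : E) * ι (res (u : F)) ^ R := by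
    intro u ζ hu
    have e : ordT (torT u ζ) = 1 := by
      change Multiplicative.ofAdd (ord (u : F)) = 1
      rw [hu]; rfl
    rw [hχ, unitPart, e, ← tameVal_torT]
    simp
  refine ⟨χ'.toHomUnits, ?_, hunit, fun v => ?_, isGenuineTorus_charRep fun ζ => ?_⟩
  · have e : unitPart ϖ (hUnifT ϖ) = 1 := by
      rw [unitPart, ordT_hUnifT, toAdd_ofAdd, zpow_neg_one, mul_inv_cancel]
    rw [hχ, e, hT1, ordT_hUnifT]
    simp
  · refine isOpen_torus_stab ϖ (congOne F) (isOpen_congOne ϖ) fun t ht => ?_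
    obtain ⟨u, ζ, rfl⟩ := exists_eq_torT t
    obtain ⟨h1, h2⟩ := exists_of_mem_congOne ht
    have h3 : (u : F) - 1 ∈ ball F 1 := h1.1
    obtain ⟨-, h4, h5⟩ := ord_pos_unique h3
    have h6 : ζ = 1 := congrArg (fun x : Mp F => x.1.sgn) h2
    change (χ'.toHomUnits (torT u ζ) : E) • v = v
    rw [hunit u ζ h4, h5, h6]
    simp
  · rw [hunit 1 ζ (by rw [Units.val_one, ord_one]), Units.val_one, res_one]
    simp

end TorusCharacters

/-! ### The two sums of the Hecke operator -/

section OrdinaryVectors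

variable {F : Type*} [Field F] [ValuativeRel F] [TopologicalSpace F] [IsNonarchimedeanLocalField F]
variable {E : Type*} [Field E] {V : Type*} [AddCommGroup V] [Module E V]
variable {ρ : Representation E (Mp F) V} {v : V} {ϖ : Uniformizer F}

/-- The terms `u(x) h̃(ϖ) v` of the operator `U_p` depend on `x` modulo `ϖ²` only. -/
lemma heckeSum_congr (hv : ∀ x ∈ ball F 0, ρ (upperUnip x) v = v) {x y : F}
    (h : x - y ∈ ball F 2) : ρ (upperUnip x * hUnif ϖ) v = ρ (upperUnip y * hUnif ϖ) v := by
  have h1 := upperUnip_mul_hUnif_zpow ϖ 1 (x - y)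
  rw [zpow_one] at h1
  have e : upperUnip x * hUnif ϖ =
      upperUnip y * hUnif ϖ * upperUnip (ϖ.val ^ (-(2 * 1) : ℤ) * (x - y)) := by
    rw [mul_assoc, ← h1, ← mul_assoc, ← upperUnip_add]
    congr 2; ring
  rw [e, rep_mul, hv]
  rw [zpow_mul_mem_ball]
  simpa using h

lemma heckeSum_eq (hv : ∀ x ∈ ball F 0, ρ (upperUnip x) v = v) {S S' : Finset F}
    (hS : IsReps S 0 2) (hS' : IsReps S' 0 2) :
    ∑ x ∈ S, ρ (upperUnip x * hUnif ϖ) v = ∑ x ∈ S', ρ (upperUnip x * hUnif ϖ) v :=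
  hS.sum_eq hS' fun _ _ _ h => heckeSum_congr hv h

lemma heckeSum_add (hv : ∀ x ∈ ball F 0, ρ (upperUnip x) v = v) {S : Finset F}
    (hS : IsReps S 0 2) {t : F} (ht : t ∈ ball F 0) :
    ∑ x ∈ S, ρ (upperUnip (x + t) * hUnif ϖ) v = ∑ x ∈ S, ρ (upperUnip x * hUnif ϖ) v :=
  hS.sum_add (φ := fun x => ρ (upperUnip x * hUnif ϖ) v) (fun _ _ _ h => heckeSum_congr hv h) ht

lemma IsReps.mul_unit {S : Finset F} {m n : ℤ} (hS : IsReps S m n) [DecidableEq F] {u : F}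
    (hu0 : u ≠ 0) (hu : ord u = 0) : IsReps (S.image (u * ·)) m n := by
  have hui : ∀ {k : ℤ} {x : F}, u * x ∈ ball F k ↔ x ∈ ball F k := fun {k x} => by
    rw [mul_mem_ball_iff hu0, hu, sub_zero]
  refine ⟨fun s hs => ?_, fun z hz => ?_, fun s hs t ht hst => ?_⟩
  · obtain ⟨x, hx, rfl⟩ := Finset.mem_image.1 hs
    exact hui.2 (hS.mem x hx)
  · have e : z = u * (u⁻¹ * z) := by field_simp
    rw [e, hui] at hz
    obtain ⟨s, hs, h⟩ := hS.exists_mem _ hz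
    refine ⟨u * s, Finset.mem_image_of_mem _ hs, ?_⟩
    rw [e, ← mul_sub, hui]
    exact h
  · obtain ⟨x, hx, rfl⟩ := Finset.mem_image.1 hs
    obtain ⟨y, hy, rfl⟩ := Finset.mem_image.1 ht
    rw [← mul_sub, hui] at hst
    rw [hS.inj x hx y hy hst]

/-- The operator `U_p` commutes with the integral part of the torus: conjugation multiplies `x` by
the square of a unit, which permutes the representatives. -/
lemma heckeSum_tor (hv : ∀ x ∈ ball F 0, ρ (upperUnip x) v = v) {S : Finset F}
    (hS : IsReps S 0 2) {a : Fˣ} {ζ : ℤˣ} (ha : ord (a : F) = 0) {c : E}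
    (hc : ρ (tor a ζ) v = c • v) :
    ρ (tor a ζ) (∑ x ∈ S, ρ (upperUnip x * hUnif ϖ) v) =
      c • ∑ x ∈ S, ρ (upperUnip x * hUnif ϖ) v := by
  classical
  have haa : ((a : F) * a) ≠ 0 := mul_ne_zero a.ne_zero a.ne_zero
  have haao : ord ((a : F) * a) = 0 := by rw [ord_mul a.ne_zero a.ne_zero, ha, add_zero]
  have h1 := heckeSum_eq (ϖ := ϖ) hv (hS.mul_unit haa haao) hS
  rw [Finset.sum_image fun x _ y _ h => mul_left_cancel₀ haa h] at h1
  rw [map_sum]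
  conv_rhs => rw [← h1, Finset.smul_sum]
  refine Finset.sum_congr rfl fun x _ => ?_
  have e : tor a ζ * (upperUnip x * hUnif ϖ) = upperUnip (a * a * x) * hUnif ϖ * tor a ζ := by
    rw [← mul_assoc (tor a ζ), tor_mul_upperUnip, hUnif, hTilde_eq, mul_assoc (upperUnip _),
      tor_comm, ← mul_assoc (upperUnip _)]
  rw [← rep_mul, e, rep_mul, hc, map_smul]

/-- A vector on which the maximal compact subgroup acts through the genuine sign. -/
def IsSpherical (ρ : Representation E (Mp F) V) (v : V) : Prop :=
  ∀ k : Kt F, ρ (k : Mp F) v = ((kSign F k : ℤ) : E) • v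

lemma IsSpherical.upper (h : IsSpherical ρ v) {x : F} (hx : x ∈ ball F 0) :
    ρ (upperUnip x) v = v := by
  have := h ⟨_, upperUnip_mem_Kt hx⟩
  rw [kSign_upperUnip] at this
  simpa using this

lemma IsSpherical.weyl (h : IsSpherical ρ v) : ρ (weyl F) v = v := by
  have := h ⟨_, weyl_mem_Kt⟩
  rw [kSign_weyl] at this
  simpa using this

/-- For `y` in the maximal ideal, the quadratic character of the reduction of `y / ϖ`, extended by
zero. -/
def tameWeight (ϖ : Uniformizer F) (y : F) : ℤ :=
  open Classical in if y ∈ ball F 2 then 0 else (hilb (y / ϖ.val) ϖ.val : ℤˣ)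

lemma div_uniformizer_mem_ball {y : F} {n : ℤ} : y / ϖ.val ∈ ball F n ↔ y ∈ ball F (n + 1) := by
  have h := zpow_mul_mem_ball ϖ (k := -1) (n := n) (x := y)
  rw [zpow_neg_one, ← div_eq_inv_mul, sub_neg_eq_add] at h
  exact h

/-- The values of the quadratic character sum to zero. -/
lemma sum_tameWeight (h2 : ringChar 𝓀[F] ≠ 2) {S1 : Finset F} (hS1 : IsReps S1 1 2) :
    ∑ y ∈ S1, tameWeight ϖ y = 0 := by
  classical
  have := Fintype.ofFinite 𝓀[F]
  rw [← quadraticChar_sum_zero h2]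
  have hm : ∀ y ∈ S1, y / ϖ.val ∈ ball F 0 := fun y hy => div_uniformizer_mem_ball.2 (hS1.mem y hy)
  refine Finset.sum_bij (fun y _ => res (y / ϖ.val)) (fun _ _ => Finset.mem_univ _)
    (fun y hy z hz h => ?_) (fun x _ => ?_) (fun y hy => ?_)
  · rw [res_eq_res_iff (hm y hy) (hm z hz), ← sub_div, div_uniformizer_mem_ball] at h
    exact hS1.inj y hy z hz h
  · obtain ⟨a, ha, rfl⟩ := exists_res_eq (F := F) x
    have ha' : a * ϖ.val ∈ ball F 1 := by
      rw [mul_comm]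
      have := zpow_mul_mem_ball ϖ (k := 1) (n := 1) (x := a)
      rw [zpow_one] at this
      rw [this]; simpa using ha
    obtain ⟨s, hs, h⟩ := hS1.exists_mem _ ha'
    refine ⟨s, hs, ?_⟩
    rw [eq_comm, res_eq_res_iff ha (hm s hs)]
    have e : a - s / ϖ.val = (a * ϖ.val - s) / ϖ.val := by
      have := ϖ.ne_zero
      field_simp
    rw [e, div_uniformizer_mem_ball]
    exact h
  · unfold tameWeight
    split_ifs with h
    · have h1 : y / ϖ.val ∈ ball F 1 := div_uniformizer_mem_ball.2 h
      rw [mem_ball_one] at h1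
      rw [(res_eq_zero h1.le).2 h1, quadraticChar_zero]
    · have h1 : y / ϖ.val ∉ ball F 1 := fun h' => h (div_uniformizer_mem_ball.1 h')
      obtain ⟨h0, h3⟩ := not_mem_ball.1 h1
      have h4 := hm y hy
      rw [mem_ball_of_ne h0] at h4
      have h5 : ord (y / ϖ.val) = 0 := by omega
      rw [hilb_unit_uniformizer ϖ h0 h5, quadraticChar_apply, quadraticCharFun,
        if_neg (res_ne_zero h0 h5)]
      unfold rsign
      split_ifs <;> simp

/-- The factorization of `ū(-y) w h̃(ϖ)` used for `y` of valuation `1`, when the second factor is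
integral. -/
lemma lower_weyl_hUnif_eq {y : F} (hy : y ≠ 0) :
    lowerUnip (-y) * weyl F * hUnif ϖ = upperUnip (-y⁻¹) *
      mk (sl (-ϖ.val / y) 0 (-ϖ.val) (-(y / ϖ.val)) (by have := ϖ.ne_zero; field_simp; ring)) 1 := by
  have hϖ := ϖ.ne_zero
  have e : hUnif ϖ = mk (sl ϖ.val 0 0 ϖ.val⁻¹ (by field_simp; ring)) (hilb (-1) ϖ.val) := rfl
  have hn : (-1 : F) ≠ 0 := by simp
  rw [mul_assoc, e, lowerUnip, weyl, upperUnip, mk_sl_mul, mk_sl_mul, mk_sl_mul]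
  refine mk_sl_congr ?_ ?_ ?_ ?_ ?_
  · field_simp; ring
  · field_simp; ring
  · ring
  · field_simp; ring
  · have e1 : (-1 * ϖ.val + 0 * 0) = -ϖ.val := by ring
    have e2 : -y * (0 * ϖ.val + 1 * 0) + 1 * -ϖ.val = -ϖ.val := by ring
    have e3 : (0 * (-ϖ.val / y) + 1 * -ϖ.val) = -ϖ.val := by ring
    have hne : -ϖ.val ≠ 0 := neg_ne_zero.2 hϖ
    simp only [e1, e2, e3, xRow_zero, xRow_ne hne, xRow_ne hn, xRow_ne (neg_ne_zero.2 hy),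
      div_self hne, hilb_one_right]
    simp only [mul_one, one_mul]
    have e4 : -ϖ.val / -1 = ϖ.val := by ring
    have e5 : -ϖ.val / ϖ.val⁻¹ = -1 * (ϖ.val * ϖ.val) := by field_simp
    rw [e4, e5, hilb_mul_right hϖ hn (mul_ne_zero hϖ hϖ), hilb_mul_right hϖ hϖ hϖ, int_units_sq,
      mul_one, hilb_symm hn hϖ, int_units_sq]

/-- For a spherical vector, the second sum of the Hecke operator in terms of `h̃(ϖ)⁻¹` and upper
unipotent elements. The class of `y = 0` gives the first term. For `y` of valuation `1` the integral
factor in `lower_weyl_hUnif_eq` acts through the sign of the splitting, a quadratic character. -/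
lemma IsSpherical.exists_second_sum (h : IsSpherical ρ v) (hg : IsGenuine ρ) {S1 : Finset F}
    (hS1 : IsReps S1 1 2) : ∃ ζ ξ : ℤˣ,
    ∑ y ∈ S1, ρ (lowerUnip (-y) * Metaplectic.weyl F * hUnif ϖ) v = ((ζ : ℤ) : E) • ρ (hUnif ϖ)⁻¹ v +
      ((ξ : ℤ) : E) • ∑ y ∈ S1, (tameWeight ϖ y : E) • ρ (upperUnip (-y⁻¹)) v := by
  classical
  have hϖ := ϖ.ne_zero
  obtain ⟨ζ, hζ⟩ := weyl_mul_hUnif_zpow ϖ 1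
  rw [zpow_one, zpow_neg_one] at hζ
  refine ⟨ζ, hilb (-1) ϖ.val, ?_⟩
  have h1 : ∀ y ∈ S1, y ∈ ball F 2 → ρ (lowerUnip (-y) * Metaplectic.weyl F * hUnif ϖ) v =
      ((ζ : ℤ) : E) • ρ (hUnif ϖ)⁻¹ v := by
    intro y _ hy
    have h2 := upperUnip_mul_hUnif_zpow ϖ 1 y
    rw [zpow_one] at h2
    rw [← weyl_mul_upperUnip, mul_assoc, h2, ← mul_assoc, hζ, rep_mul, h.upper, rep_mul, rep_mul,
      h.weyl, hg.central]
    rw [zpow_mul_mem_ball]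
    simpa using hy
  have h3 : ∀ y ∈ S1, y ∉ ball F 2 → ρ (lowerUnip (-y) * Metaplectic.weyl F * hUnif ϖ) v =
      ((hilb (-1) ϖ.val : ℤ) : E) • (tameWeight ϖ y : E) • ρ (upperUnip (-y⁻¹)) v := by
    intro y hy hy2
    obtain ⟨hy0, hyo⟩ := not_mem_ball.1 hy2
    have hy1 := hS1.mem y hy
    rw [mem_ball_of_ne hy0] at hy1
    have hyo' : ord y = 1 := by omega
    have hu0 : y / ϖ.val ≠ 0 := div_ne_zero hy0 hϖ
    have huo : ord (y / ϖ.val) = 0 := by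
      rw [div_eq_mul_inv, ord_mul hy0 (inv_ne_zero hϖ), ord_inv, hyo', ord_uniformizer]; rfl
    have hui : ord (-ϖ.val / y) = 0 := by
      rw [div_eq_mul_inv, ord_mul (neg_ne_zero.2 hϖ) (inv_ne_zero hy0), ord_inv, ord_neg, hyo',
        ord_uniformizer]; rfl
    have hdet : -ϖ.val / y * -(y / ϖ.val) - 0 * (-ϖ.val) = 1 := by field_simp; ring
    have hK : mk (sl (-ϖ.val / y) 0 (-ϖ.val) (-(y / ϖ.val)) hdet) 1 ∈ Kt F := by
      rw [mem_Kt, toSL_mk, sl_mem_ball]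
      exact ⟨Or.inr hui.ge, zero_mem _, Or.inr (by rw [ord_neg, ord_uniformizer]; norm_num),
        Or.inr (by rw [ord_neg, huo])⟩
    have hS : kSign F ⟨_, hK⟩ = hilb (-1) ϖ.val * hilb (y / ϖ.val) ϖ.val := by
      have hn : (-1 : F) ≠ 0 := by simp
      rw [kSign_mk, one_mul, sl_coe, theta_gl_nonunit (neg_ne_zero.2 hϖ)
        (by rw [Valuation.map_neg]; exact ϖ.val_lt), neg_eq_neg_one_mul ϖ.val,
        hilb_mul_left hn hϖ (neg_ne_zero.2 hu0), hilb_units (by rw [ord_neg, ord_one])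
        (by rw [ord_neg, huo]), one_mul, neg_eq_neg_one_mul (y / ϖ.val), hilb_mul_right hϖ hn hu0,
        hilb_symm hn hϖ, hilb_symm hu0 hϖ]
    rw [lower_weyl_hUnif_eq hy0, rep_mul, h ⟨_, hK⟩, hS, map_smul, smul_smul, Units.val_mul,
      Int.cast_mul, tameWeight, if_neg hy2]
  have h4 : ∀ y ∈ S1, ρ (lowerUnip (-y) * Metaplectic.weyl F * hUnif ϖ) v =
      (if y ∈ ball F 2 then ((ζ : ℤ) : E) • ρ (hUnif ϖ)⁻¹ v else 0) +
        ((hilb (-1) ϖ.val : ℤ) : E) • (tameWeight ϖ y : E) • ρ (upperUnip (-y⁻¹)) v := by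
    intro y hy
    split_ifs with hy2
    · rw [h1 y hy hy2, tameWeight, if_pos hy2]; simp
    · rw [h3 y hy hy2, zero_add]
  rw [Finset.sum_congr rfl h4, Finset.sum_add_distrib, Finset.smul_sum]
  congr 1
  obtain ⟨s, -, hs, hsum⟩ := hS1.sum_eq_single
    (φ := fun y => if y ∈ ball F 2 then ((ζ : ℤ) : E) • ρ (hUnif ϖ)⁻¹ v else 0) (z := 0)
    (zero_mem _) fun s _ hs => by
      rw [zero_sub, neg_mem_iff] at hs
      exact if_neg hs
  rw [zero_sub, neg_mem_iff] at hs
  rw [hsum, if_pos hs]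

end OrdinaryVectors

/-! ### Nonzero Hecke eigenvalues -/

section NonzeroEigenvalues

variable {F : Type*} [Field F] [ValuativeRel F] [TopologicalSpace F] [IsNonarchimedeanLocalField F]
variable {E : Type*} [Field E] {V : Type*} [AddCommGroup V] [Module E V]
variable {ρ : Representation E (Mp F) V} {v : V} {ϖ : Uniformizer F}

/-- The number of elements of `𝒪` modulo a power of the maximal ideal vanishes in `E`: translation
by `1` permutes them and changes the sum of their residues by this number. -/
lemma IsReps.card_eq_zero (ι : 𝓀[F] →+* E) {S : Finset F} {n : ℤ} (hn : 1 ≤ n)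
    (hS : IsReps S 0 n) : (S.card : E) = 0 := by
  have hres : ∀ x ∈ ball F 0, ∀ y, x - y ∈ ball F n → ι (res x) = ι (res y) := by
    intro x hx y hxy
    have hy : y ∈ ball F 0 := by
      have := (ball F 0).sub_mem hx (ball_anti (by omega) hxy)
      rwa [sub_sub_cancel] at this
    rw [(res_eq_res_iff hx hy).2 (ball_anti hn hxy)]
  have h1 := hS.sum_add (φ := fun x => ι (res x)) hres one_mem_ball
  have h2 : ∀ x ∈ S, ι (res (x + 1)) = ι (res x) + 1 := fun x hx => by
    rw [res_add (mem_ball_zero.1 (hS.mem x hx)) (by simp), res_one, map_add, map_one]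
  rw [Finset.sum_congr rfl h2, Finset.sum_add_distrib] at h1
  simpa using h1

/-- The group `u(ϖ𝒪)` acts on a vector fixed by `u(ϖ²𝒪)` through a finite group of exponent `p`. -/
lemma exists_upper_fixed (p : ℕ) [Fact p.Prime] [CharP E p] [CharP 𝓀[F] p] (ϖ : Uniformizer F)
    (hv : ∀ x ∈ ball F 2, ρ (upperUnip x) v = v) (hv0 : v ≠ 0) :
    ∃ w ∈ Submodule.span E {w | ∃ x ∈ ball F 1, w = ρ (upperUnip x) v}, w ≠ 0 ∧
      ∀ x ∈ ball F 1, ρ (upperUnip x) w = w := by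
  obtain ⟨S, hS⟩ := exists_isReps ϖ 1 2
  let u : Multiplicative (ball F 1) →* Mp F :=
    { toFun := fun x => upperUnip (x.toAdd : F)
      map_one' := upperUnip_zero
      map_mul' := fun x y => upperUnip_add _ _ }
  have hfin : (Set.range fun g => (ρ.comp u) g v).Finite := by
    refine ((S.finite_toSet).image fun s => ρ (upperUnip s) v).subset ?_
    rintro _ ⟨g, rfl⟩
    obtain ⟨s, hs, h⟩ := hS.exists_mem _ g.toAdd.2
    refine ⟨s, hs, ?_⟩
    change ρ (upperUnip s) v = ρ (upperUnip (g.toAdd : F)) v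
    have e : (g.toAdd : F) = s + ((g.toAdd : F) - s) := by ring
    rw [e, upperUnip_add, rep_mul, hv _ h]
  obtain ⟨w, hw, hw0, hwu⟩ := exists_fixed_vector p (ρ.comp u) hv0 hfin fun g => by
    refine ⟨1, fun h => ?_⟩
    rw [← rep_mul]
    have e : g ^ p ^ 1 * h = h * g ^ p ^ 1 := mul_comm _ _
    rw [e, rep_mul]
    congr 1
    refine hv _ ?_
    rw [pow_one, toAdd_pow, AddSubgroup.coe_nsmul, nsmul_eq_mul]
    exact mul_mem_ball (prime_mem_ball_one p) g.toAdd.2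
  refine ⟨w, Submodule.span_mono ?_ hw, hw0, fun x hx => hwu (Multiplicative.ofAdd ⟨x, hx⟩)⟩
  rintro _ ⟨g, rfl⟩
  exact ⟨_, g.toAdd.2, rfl⟩

/-- An eigenvector of the torus element `h̃(ϖ)` fixed by the integral upper unipotent elements
is fixed by all upper unipotent elements. -/
lemma upperUnip_fixed_of_eigenvector (hv : ∀ x ∈ ball F 0, ρ (upperUnip x) v = v) {c : E}
    (hH : ρ (hUnif ϖ) v = c • v) (x : F) : ρ (upperUnip x) v = v := by
  have key : ∀ n : ℕ, ∀ x ∈ ball F (-(2 * n)), ρ (upperUnip x) v = v := by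
    intro n
    induction n with
    | zero => simpa using hv
    | succ n ih =>
      intro x hx
      have h1 := hUnif_zpow_mul_upperUnip ϖ 1 x
      rw [zpow_one] at h1
      have h2 : ρ (hUnif ϖ) (ρ (upperUnip x) v) = ρ (hUnif ϖ) v := by
        rw [← rep_mul, h1, rep_mul, hH, map_smul, ih]
        rw [zpow_mul_mem_ball]
        convert hx using 2
        push_cast; ring
      have h3 := congrArg (ρ (hUnif ϖ)⁻¹) h2
      rwa [← rep_mul, ← rep_mul, inv_mul_cancel, one_mul, ← rep_mul, inv_mul_cancel, map_one] at h3
  obtain ⟨n, hn⟩ := exists_mem_ball x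
  exact key n.natAbs x (ball_anti (by omega) hn)

lemma sq_mul_neg_inv_mem_ball {S1 : Finset F} (hS1 : IsReps S1 1 2) {y : F} (hy : y ∈ S1)
    (hy2 : y ∉ ball F 2) : ϖ.val ^ (2 : ℤ) * -y⁻¹ ∈ ball F 1 := by
  obtain ⟨hy0, hyo⟩ := not_mem_ball.1 hy2
  have hy1 := hS1.mem y hy
  rw [mem_ball_of_ne hy0] at hy1
  rw [zpow_mul_mem_ball]
  exact Or.inr (by rw [ord_neg, ord_inv]; omega)

/-- If a nonzero spherical vector `v` satisfies the eigenvalue equation of the Hecke operator of the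
trivial weight with nonzero eigenvalue, then the first sum `U_p v` is nonzero. Otherwise the
translate of the equation by `h̃(ϖ)` shows that `v` is an eigenvector of `h̃(ϖ)`, hence fixed by all
upper unipotent elements, which is impossible for a genuine representation. -/
lemma IsSpherical.heckeSum_ne_zero (p : ℕ) [Fact p.Prime] [CharP E p] [CharP 𝓀[F] p]
    (h : IsSpherical ρ v) (hs : IsSmooth ρ) (hg : IsGenuine ρ) (h2 : ringChar 𝓀[F] ≠ 2)
    (hE : (2 : E) ≠ 0) {a : E} (ha : a ≠ 0) (hv : v ≠ 0) {S S1 : Finset F}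
    (hS1 : IsReps S1 1 2)
    (heq : ∑ x ∈ S, ρ (upperUnip x * hUnif ϖ) v +
      ∑ y ∈ S1, ρ (lowerUnip (-y) * Metaplectic.weyl F * hUnif ϖ) v = a • v) :
    ∑ x ∈ S, ρ (upperUnip x * hUnif ϖ) v ≠ 0 := by
  intro h0
  obtain ⟨ζ, ξ, hsum⟩ := h.exists_second_sum (ϖ := ϖ) hg hS1
  rw [h0, zero_add, hsum] at heq
  have hκ : ∑ y ∈ S1, (tameWeight ϖ y : E) = 0 := by
    rw [← Int.cast_sum, sum_tameWeight h2 hS1, Int.cast_zero]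
  -- `D` kills the vectors fixed by `u(ϖ𝒪)`, since the values of the quadratic character sum to zero
  let D : V →ₗ[E] V := ∑ y ∈ S1, (tameWeight ϖ y : E) • ρ (upperUnip (ϖ.val ^ (2 : ℤ) * -y⁻¹))
  have hD : ∀ w, D w = ∑ y ∈ S1, (tameWeight ϖ y : E) • ρ (upperUnip (ϖ.val ^ (2 : ℤ) * -y⁻¹)) w :=
    fun w => by simp [D, LinearMap.sum_apply]
  have hDfix : ∀ w, (∀ x ∈ ball F 1, ρ (upperUnip x) w = w) → D w = 0 := by
    intro w hw
    rw [hD]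
    have h3 : ∀ y ∈ S1, (tameWeight ϖ y : E) • ρ (upperUnip (ϖ.val ^ (2 : ℤ) * -y⁻¹)) w =
        (tameWeight ϖ y : E) • w := by
      intro y hy
      by_cases hy2 : y ∈ ball F 2
      · rw [tameWeight, if_pos hy2]; simp
      · rw [hw _ (sq_mul_neg_inv_mem_ball hS1 hy hy2)]
    rw [Finset.sum_congr rfl h3, ← Finset.sum_smul, hκ, zero_smul]
  -- the eigenvalue equation translated by `h̃(ϖ)`
  have hDH : a • ρ (hUnif ϖ) v = ((ζ : ℤ) : E) • v + ((ξ : ℤ) : E) • D (ρ (hUnif ϖ) v) := by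
    rw [← map_smul, ← heq, map_add, map_smul, map_smul, map_sum, ← rep_mul, mul_inv_cancel,
      map_one, hD]
    congr 2
    refine Finset.sum_congr rfl fun y _ => ?_
    have h1 := hUnif_zpow_mul_upperUnip ϖ 1 (-y⁻¹)
    rw [zpow_one, mul_one] at h1
    rw [map_smul, ← rep_mul, ← rep_mul, h1]
  -- `Y` is an eigenvector of `D` with nonzero eigenvalue; if it were nonzero, the span of its
  -- translates would contain an eigenvector killed by `D`
  let Y : V := ρ (hUnif ϖ) v - (a⁻¹ * ((ζ : ℤ) : E)) • v
  have hDY : ((ξ : ℤ) : E) • D Y = a • Y := by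
    have h3 : D v = 0 := hDfix v fun x hx => h.upper (ball_anti (by norm_num) hx)
    simp only [Y]
    rw [map_sub, map_smul, h3, smul_zero, sub_zero, smul_sub, smul_smul, mul_inv_cancel_left₀ ha,
      hDH]
    abel
  have hY0 : Y = 0 := by
    by_contra hY0
    have hYu : ∀ x ∈ ball F 2, ρ (upperUnip x) Y = Y := by
      intro x hx
      simp only [Y]
      have h1 := upperUnip_mul_hUnif_zpow ϖ 1 x
      rw [zpow_one] at h1
      rw [map_sub, map_smul, h.upper (ball_anti (by norm_num) hx), ← rep_mul, h1, rep_mul, h.upper]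
      rw [zpow_mul_mem_ball]
      simpa using hx
    obtain ⟨z, hz, hz0, hzu⟩ := exists_upper_fixed p ϖ hYu hY0
    have h3 : ((ξ : ℤ) : E) • D z = a • z := by
      have hle : Submodule.span E {w | ∃ x ∈ ball F 1, w = ρ (upperUnip x) Y} ≤
          LinearMap.eqLocus (((ξ : ℤ) : E) • D) (a • LinearMap.id) := by
        rw [Submodule.span_le]
        rintro _ ⟨x, hx, rfl⟩
        change ((ξ : ℤ) : E) • D (ρ (upperUnip x) Y) = a • ρ (upperUnip x) Y
        have hcomm : D (ρ (upperUnip x) Y) = ρ (upperUnip x) (D Y) := by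
          rw [hD, hD, map_sum]
          refine Finset.sum_congr rfl fun y _ => ?_
          rw [map_smul, ← rep_mul, ← rep_mul, ← upperUnip_add, ← upperUnip_add, add_comm]
        rw [hcomm, ← map_smul, hDY, map_smul]
      exact hle hz
    rw [hDfix z hzu, smul_zero] at h3
    exact hz0 ((smul_eq_zero.1 h3.symm).resolve_left ha)
  have hH : ρ (hUnif ϖ) v = (a⁻¹ * ((ζ : ℤ) : E)) • v := sub_eq_zero.1 hY0
  exact hv (eq_zero_of_upperUnip_fixed hs hg ϖ h2 hE
    (upperUnip_fixed_of_eigenvector (fun x hx => h.upper hx) hH))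

/-- The image of a spherical eigenvector under the first sum `U_p` of the Hecke operator of the
trivial weight is an eigenvector of this sum: `U_p` kills both terms of the second sum, as `|𝒪/ϖ²|`
and the sum of the values of the quadratic character vanish. -/
lemma IsSpherical.heckeSum_heckeSum (ι : 𝓀[F] →+* E) (h : IsSpherical ρ v) (hg : IsGenuine ρ)
    (h2 : ringChar 𝓀[F] ≠ 2) {a : E} {S S1 : Finset F} (hS : IsReps S 0 2) (hS1 : IsReps S1 1 2)
    (heq : ∑ x ∈ S, ρ (upperUnip x * hUnif ϖ) v +
      ∑ y ∈ S1, ρ (lowerUnip (-y) * Metaplectic.weyl F * hUnif ϖ) v = a • v) :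
    ∑ x ∈ S, ρ (upperUnip x * hUnif ϖ) (∑ x ∈ S, ρ (upperUnip x * hUnif ϖ) v) =
      a • ∑ x ∈ S, ρ (upperUnip x * hUnif ϖ) v := by
  obtain ⟨ζ, ξ, hsum⟩ := h.exists_second_sum (ϖ := ϖ) hg hS1
  rw [hsum] at heq
  have hκ : ∑ y ∈ S1, (tameWeight ϖ y : E) = 0 := by
    rw [← Int.cast_sum, sum_tameWeight h2 hS1, Int.cast_zero]
  let T : V →ₗ[E] V := ∑ x ∈ S, ρ (upperUnip x * hUnif ϖ)
  have hT : ∀ w, ∑ x ∈ S, ρ (upperUnip x * hUnif ϖ) w = T w := fun w => by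
    simp [T, LinearMap.sum_apply]
  have hT1 : T (ρ (hUnif ϖ)⁻¹ v) = 0 := by
    have h3 : ∀ x ∈ S, ρ (upperUnip x * hUnif ϖ) (ρ (hUnif ϖ)⁻¹ v) = v := fun x hx => by
      rw [← rep_mul, mul_inv_cancel_right, h.upper (hS.mem x hx)]
    rw [← hT, Finset.sum_congr rfl h3, Finset.sum_const, ← Nat.cast_smul_eq_nsmul E,
      hS.card_eq_zero ι (by norm_num), zero_smul]
  have hT2 : ∀ y ∈ S1, (tameWeight ϖ y : E) • T (ρ (upperUnip (-y⁻¹)) v) =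
      (tameWeight ϖ y : E) • T v := by
    intro y hy
    by_cases hy2 : y ∈ ball F 2
    · rw [tameWeight, if_pos hy2]; simp
    · rw [← hT, ← hT, ← heckeSum_add (fun x hx => h.upper hx) hS
        (ball_anti (show (0 : ℤ) ≤ 1 by norm_num) (sq_mul_neg_inv_mem_ball (ϖ := ϖ) hS1 hy hy2))]
      congr 1
      refine Finset.sum_congr rfl fun x _ => ?_
      have h1 := hUnif_zpow_mul_upperUnip ϖ 1 (-y⁻¹)
      rw [zpow_one, mul_one] at h1
      rw [← rep_mul, mul_assoc, h1, ← mul_assoc, ← upperUnip_add]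
  rw [hT, hT] at *
  have h4 := congrArg T heq
  rw [map_add, map_add, map_smul, map_smul, map_smul, hT1, smul_zero, zero_add, map_sum] at h4
  simp only [map_smul] at h4
  rwa [Finset.sum_congr rfl hT2, ← Finset.sum_smul, hκ, zero_smul, smul_zero, add_zero] at h4

variable {ι : 𝓀[F] →+* E} {p : ℕ} [Fact p.Prime] [CharP E p] {f : ℕ} {r : Fin f → Fin p}

lemma genWeight_upper_topVec {x : F} (hx : x ∈ ball F 0) :
    genWeight ι p r ⟨_, upperUnip_mem_Kt hx⟩ (topVec r) = topVec r := by
  have h10 : (reduction F ⟨_, upperUnip_mem_Kt hx⟩).1 1 0 = 0 := by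
    rw [reduction_apply, toSL_upperUnip]; exact res_zero
  have h00 : (reduction F ⟨_, upperUnip_mem_Kt hx⟩).1 0 0 = 1 := by
    rw [reduction_apply, toSL_upperUnip]; exact res_one
  rw [genWeight_of_kSign (kSign_upperUnip _), weight_topVec_of_upper ι h10, h00, map_one, one_pow,
    one_smul]

lemma genWeight_tor_topVec {a : Fˣ} (ha : ord (a : F) = 0) (ζ : ℤˣ) :
    genWeight ι p r ⟨_, tor_mem_Kt ha ζ⟩ (topVec r) =
      (((ζ : ℤ) : E) * ι (res (a : F)) ^ wtTotal r) • topVec r := by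
  have h10 : (reduction F ⟨_, tor_mem_Kt ha ζ⟩).1 1 0 = 0 := by
    rw [reduction_apply, toSL_tor]; exact res_zero
  have h00 : (reduction F ⟨_, tor_mem_Kt ha ζ⟩).1 0 0 = res (a : F) := by
    rw [reduction_apply, toSL_tor]; rfl
  change ((kSign F ⟨_, tor_mem_Kt ha ζ⟩ : ℤ) : E) • weight ι p r _ _ = _
  rw [kSign_tor, weight_topVec_of_upper ι h10, h00, smul_smul]

lemma slLow_eq_reduction {a : F} (ha : a ∈ ball F 0) :
    slLow (res a) = reduction F ⟨_, lowerUnip_mem_Kt ha⟩ := by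
  ext i j
  rw [reduction_apply, toSL_lowerUnip]
  fin_cases i <;> fin_cases j
  · exact res_one.symm
  · exact res_zero.symm
  · rfl
  · exact res_one.symm

lemma map_weight_slLow {Φ : WtSpace E r →ₗ[E] V}
    (hΦ : ∀ (h : Kt F) v, Φ (genWeight ι p r h v) = ρ h (Φ v)) {a : F} (ha : a ∈ ball F 0)
    (v : WtSpace E r) : Φ (weight ι p r (slLow (res a)) v) = ρ (lowerUnip a) (Φ v) := by
  rw [slLow_eq_reduction ha, ← genWeight_of_kSign (kSign_lowerUnip _), hΦ]

/-- A nonzero equivariant map from a weight does not kill the highest weight vector. -/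
lemma map_topVec_ne_zero [Fintype 𝓀[F]] (hk : Fintype.card 𝓀[F] = p ^ f) {Φ : WtSpace E r →ₗ[E] V}
    (hΦ : ∀ (h : Kt F) v, Φ (genWeight ι p r h v) = ρ h (Φ v)) (h0 : Φ ≠ 0) :
    Φ (topVec r) ≠ 0 := by
  intro h
  have h1 := eq_top_of_topVec_mem ι hk (LinearMap.ker Φ) h fun x v hv => by
    obtain ⟨a, ha, rfl⟩ := exists_res_eq (F := F) x
    rw [LinearMap.mem_ker] at hv ⊢
    rw [map_weight_slLow hΦ ha, hv, map_zero]
  exact h0 (LinearMap.ker_eq_top.1 h1)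

/-- A nonzero Hecke eigenvalue produces an ordinary vector: the image `v` of the highest weight
vector, or `U_p v` for the trivial weight. -/
lemma IsEigenMap.exists_isOrdinary [CharP 𝓀[F] p] [Fintype 𝓀[F]] (hk : Fintype.card 𝓀[F] = p ^ f)
    (hp : p ≠ 2) (hs : IsSmooth ρ) (hg : IsGenuine ρ) {a : E} (ha : a ≠ 0)
    {Φ : WtSpace E r →ₗ[E] V} (h : IsEigenMap (heckeGen ι p r ϖ) ρ a Φ) (h0 : Φ ≠ 0) :
    ∃ (χ : Torus F →* Eˣ) (v : V), IsSmooth (charRep χ) ∧ IsGenuineTorus (charRep χ) ∧ v ≠ 0 ∧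
      IsOrdinary ϖ χ ρ v := by
  have h2 : ringChar 𝓀[F] ≠ 2 := by rwa [ringChar.eq 𝓀[F] p]
  have hE : (2 : E) ≠ 0 := by
    have := CharP.cast_eq_zero_iff E p 2
    intro h'
    have h3 := (Nat.prime_dvd_prime_iff_eq (Fact.out : p.Prime) Nat.prime_two).1
      (this.1 (by exact_mod_cast h'))
    exact hp h3
  obtain ⟨χ, hχH, hχu, hχs, hχg⟩ := exists_torus_char ι ϖ (wtTotal r) ha
  obtain ⟨S, hS⟩ := exists_isReps ϖ 0 2
  obtain ⟨S1, hS1⟩ := exists_isReps ϖ 1 2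
  have hv0 := map_topVec_ne_zero hk h.map_rep h0
  have hup : ∀ x ∈ ball F 0, ρ (upperUnip x) (Φ (topVec r)) = Φ (topVec r) := fun x hx => by
    have := h.map_rep ⟨_, upperUnip_mem_Kt hx⟩ (topVec r)
    rw [genWeight_upper_topVec hx] at this
    exact this.symm
  have htor : ∀ (a : Fˣ) ζ, ord (a : F) = 0 →
      ρ (tor a ζ) (Φ (topVec r)) = (χ (torT a ζ) : E) • Φ (topVec r) := fun a ζ ha => by
    have := h.map_rep ⟨_, tor_mem_Kt ha ζ⟩ (topVec r)
    rw [genWeight_tor_topVec ha, map_smul] at this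
    rw [hχu a ζ ha, this]
  by_cases hr : wtTotal r = 0
  · have hsph : IsSpherical ρ (Φ (topVec r)) := fun k => by
      rw [← h.map_rep]
      change Φ (((kSign F k : ℤ) : E) • weight ι p r (reduction F k) (topVec r)) = _
      rw [weight_topVec_of_total hr, map_smul]
    have heq := h.topVec_eq hS hS1
    rw [if_pos hr] at heq
    refine ⟨χ, ∑ x ∈ S, ρ (upperUnip x * hUnif ϖ) (Φ (topVec r)), hχs, hχg,
      hsph.heckeSum_ne_zero p hs hg h2 hE ha hv0 hS1 heq, ?_⟩
    have hup' : ∀ x ∈ ball F 0, ρ (upperUnip x) (∑ x ∈ S, ρ (upperUnip x * hUnif ϖ)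
        (Φ (topVec r))) = ∑ x ∈ S, ρ (upperUnip x * hUnif ϖ) (Φ (topVec r)) := fun x hx => by
      rw [map_sum]
      conv_rhs => rw [← heckeSum_add hup hS hx]
      refine Finset.sum_congr rfl fun y _ => ?_
      rw [← rep_mul, ← mul_assoc, ← upperUnip_add, add_comm]
    refine ⟨hup', fun u ζ hu => heckeSum_tor hup hS hu (htor u ζ hu), fun S' hS' => ?_⟩
    rw [heckeSum_eq hup' hS' hS, hχH]
    exact hsph.heckeSum_heckeSum ι hg h2 hS hS1 heq
  · refine ⟨χ, Φ (topVec r), hχs, hχg, hv0, hup, htor, fun S' hS' => ?_⟩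
    have heq := h.topVec_eq hS' hS1
    rw [if_neg hr, add_zero] at heq
    rw [heq, hχH]

/-- In a genuine principal series representation all Hecke eigenvalues are nonzero. The equation is
evaluated at the identity, or at the Weyl element for the trivial weight, where exactly one term
remains. -/
lemma IsEigenMap.ne_zero_of_parInd [CharP 𝓀[F] p] [Fintype 𝓀[F]]
    (hk : Fintype.card 𝓀[F] = p ^ f) (hp : p ≠ 2) {χ : Torus F →* Eˣ}
    (hg : IsGenuineTorus (charRep χ)) {a : E} {Φ : WtSpace E r →ₗ[E] parIndSpace (charRep χ)}
    (h : IsEigenMap (heckeGen ι p r ϖ) (parInd (charRep χ)) a Φ) (h0 : Φ ≠ 0) : a ≠ 0 := by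
  have h2 : ringChar 𝓀[F] ≠ 2 := by rwa [ringChar.eq 𝓀[F] p]
  obtain ⟨S, hS⟩ := exists_isReps ϖ 0 2
  obtain ⟨S1, hS1⟩ := exists_isReps ϖ 1 2
  have hgen := isGenuine_parInd hg
  let ev : parIndSpace (charRep χ) →ₗ[E] E :=
    { toFun := fun f => f.1 1
      map_add' := fun _ _ => rfl
      map_smul' := fun _ _ => rfl }
  -- by the Iwasawa decomposition, the functional `ψ` determines the map `Φ`
  let ψ : WtSpace E r →ₗ[E] E := ev ∘ₗ Φ
  have hψ : ∀ (x : 𝓀[F]) v, ψ (weight ι p r (slLow x) v) = ψ v := by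
    intro x v
    obtain ⟨a, ha, rfl⟩ := exists_res_eq (F := F) x
    change (Φ (weight ι p r (slLow (res a)) v)).1 1 = (Φ v).1 1
    rw [map_weight_slLow h.map_rep ha, parInd_apply, one_mul]
    have := parInd_lower (Φ v) a 1
    rwa [mul_one] at this
  have hK : ∀ (k : Kt F) v, (Φ v).1 (k : Mp F) = ψ (genWeight ι p r k v) := fun k v => by
    change _ = (Φ (genWeight ι p r k v)).1 1
    rw [h.map_rep, parInd_apply, one_mul]
  have hscal : ∀ (t : Torus F) (f : parIndSpace (charRep χ)) (g : Mp F),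
      f.1 (t * g) = (χ t : E) * f.1 g := fun t f g => parInd_torus f t g
  have hout : ∀ (f : parIndSpace (charRep χ)) (z : Fˣ), ∃ c : E, f.1 (upperUnip (z : F)) =
      c * f.1 (weyl F * lowerUnip ((z⁻¹ : Fˣ) : F)) := fun f z => by
    rw [upperUnip_eq, mul_assoc, mul_assoc, parInd_lower]
    have e : hTilde z = ((torT z (hilb (-1) (z : F)) : Torus F) : Mp F) := rfl
    rw [e, hscal]
    exact ⟨_, rfl⟩
  have hψ0 : ψ (topVec r) ≠ 0 := by
    intro h'
    have hψz := eq_zero_of_map_topVec ι hk ψ hψ h'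
    refine h0 (LinearMap.ext fun v => parInd_ext (fun z => ?_) ?_)
    · change (Φ v).1 (upperUnip z) = 0
      by_cases hz : z ∈ ball F 0
      · rw [hK ⟨_, upperUnip_mem_Kt hz⟩, hψz]; rfl
      · obtain ⟨hz0, hzo⟩ := not_mem_ball.1 hz
        obtain ⟨c, hc⟩ := hout (Φ v) (Units.mk0 z hz0)
        have hl : lowerUnip (((Units.mk0 z hz0)⁻¹ : Fˣ) : F) ∈ Kt F :=
          lowerUnip_mem_Kt (Or.inr (by
            rw [Units.val_inv_eq_inv_val, Units.val_mk0, ord_inv]; omega))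
        rw [Units.val_mk0] at hc
        have h6 := hK (⟨weyl F, weyl_mem_Kt⟩ * ⟨_, hl⟩) v
        rw [hψz, LinearMap.zero_apply] at h6
        exact hc.trans ((congrArg (c * ·) h6).trans (mul_zero c))
    · change (Φ v).1 (weyl F) = 0
      rw [hK ⟨_, weyl_mem_Kt⟩, hψz]; rfl
  have hf1 : (Φ (topVec r)).1 1 ≠ 0 := hψ0
  have heq := h.topVec_eq hS hS1
  by_cases hr : wtTotal r = 0
  · rw [if_pos hr] at heq
    have hsph : IsSpherical (parInd (charRep χ)) (Φ (topVec r)) := fun k => by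
      rw [← h.map_rep]
      change Φ (((kSign F k : ℤ) : E) • weight ι p r (reduction F k) (topVec r)) = _
      rw [weight_topVec_of_total hr, map_smul]
    obtain ⟨ζ, ξ, hsum⟩ := hsph.exists_second_sum (ϖ := ϖ) hgen hS1
    rw [hsum] at heq
    have hw : (Φ (topVec r)).1 (weyl F) = (Φ (topVec r)).1 1 := by
      have := congrArg (fun f : parIndSpace (charRep χ) => f.1 1) hsph.weyl
      simpa [parInd_apply] using this
    -- evaluate the eigenvalue equation at the Weyl element
    let ew : parIndSpace (charRep χ) →ₗ[E] E :=
      { toFun := fun f => f.1 (weyl F)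
        map_add' := fun _ _ => rfl
        map_smul' := fun _ _ => rfl }
    have hew : ∀ x f, ew (parInd (charRep χ) x f) = f.1 (weyl F * x) := fun x f => rfl
    have h3 := congrArg ew heq
    rw [map_add, map_add, map_smul, map_smul, map_smul, map_sum, map_sum] at h3
    have h4 : ∀ x ∈ S, ew (parInd (charRep χ) (upperUnip x * hUnif ϖ) (Φ (topVec r))) =
        ew (parInd (charRep χ) (hUnif ϖ) (Φ (topVec r))) := fun x _ => by
      rw [hew, hew, ← mul_assoc, weyl_mul_upperUnip, mul_assoc, parInd_lower]
    have h5 : ∀ y ∈ S1, ew ((tameWeight ϖ y : E) • parInd (charRep χ) (upperUnip (-y⁻¹))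
        (Φ (topVec r))) = (tameWeight ϖ y : E) • (Φ (topVec r)).1 (weyl F) := fun y _ => by
      rw [map_smul, hew, weyl_mul_upperUnip, parInd_lower]
    have hκ : ∑ y ∈ S1, (tameWeight ϖ y : E) = 0 := by
      rw [← Int.cast_sum, sum_tameWeight h2 hS1, Int.cast_zero]
    rw [Finset.sum_congr rfl h4, Finset.sum_congr rfl h5, ← Finset.sum_smul, hκ, zero_smul,
      smul_zero, add_zero, Finset.sum_const, ← Nat.cast_smul_eq_nsmul E,
      hS.card_eq_zero ι (by norm_num), zero_smul, zero_add, hew] at h3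
    obtain ⟨ζ', hζ'⟩ := weyl_mul_hUnif_zpow ϖ (-1)
    rw [zpow_neg_one, neg_neg, zpow_one] at hζ'
    have e1 : mk (1 : SL(2, F)) ζ' = ((torT 1 ζ' : Torus F) : Mp F) := (tor_one ζ').symm
    rw [hζ', mul_assoc, e1, hscal, ← coe_hUnifT, hscal, hw] at h3
    change ((ζ : ℤ) : E) * _ = a * (Φ (topVec r)).1 (weyl F) at h3
    rintro rfl
    rw [zero_mul] at h3
    have hζ : ((ζ : ℤ) : E) ≠ 0 := by
      rcases Int.units_eq_one_or ζ with h | h <;> simp [h]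
    exact mul_ne_zero hζ (mul_ne_zero (Units.ne_zero _) (mul_ne_zero (Units.ne_zero _) hf1)) h3
  · rw [if_neg hr, add_zero] at heq
    have h3 := congrArg ev heq
    rw [map_sum, map_smul] at h3
    have hev : ∀ x f, ev (parInd (charRep χ) x f) = f.1 x := fun x f => by
      change f.1 (1 * x) = _
      rw [one_mul]
    -- `Φ(v₊)` vanishes at the integral elements whose upper left entry is a nonunit, as they map the
    -- highest weight vector to a multiple of the lowest one, which `ψ` kills
    have hlast : ∀ k : Kt F, (reduction F k).1 0 0 = 0 → (Φ (topVec r)).1 (k : Mp F) = 0 := by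
      intro k hk0
      rw [hK]
      change ψ (((kSign F k : ℤ) : E) • weight ι p r (reduction F k) (topVec r)) = 0
      rw [weight_topVec_of_zero ι hk0, map_smul, map_smul, map_wtMono_eq_zero ι hk ψ hψ,
        smul_zero, smul_zero]
      intro hl
      refine hr ?_
      rw [wtTotal, Finset.sum_eq_zero]
      intro i _
      have := congrArg Fin.val (congrFun hl i)
      rw [Fin.val_last] at this
      rw [this]; simp
    have hU : ∀ x : F, ev (parInd (charRep χ) (upperUnip x * hUnif ϖ) (Φ (topVec r))) =
        (χ (hUnifT ϖ) : E) * (Φ (topVec r)).1 (upperUnip (ϖ.val ^ (-(2 * 1) : ℤ) * x)) := by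
      intro x
      have h1 := upperUnip_mul_hUnif_zpow ϖ 1 x
      rw [zpow_one] at h1
      rw [hev, h1, ← coe_hUnifT, hscal]
    -- only the class of `0` contributes to the value at the identity
    obtain ⟨s, -, hs0, hsum⟩ := hS.sum_eq_single
      (φ := fun x => ev (parInd (charRep χ) (upperUnip x * hUnif ϖ) (Φ (topVec r)))) (z := 0)
      (zero_mem _) fun s hs hs0 => by
        rw [zero_sub, neg_mem_iff] at hs0
        rw [hU]
        have hz : ϖ.val ^ (-(2 * 1) : ℤ) * s ∉ ball F 0 := by
          rw [zpow_mul_mem_ball]; simpa using hs0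
        obtain ⟨hz0, hzo⟩ := not_mem_ball.1 hz
        obtain ⟨c, hc⟩ := hout (Φ (topVec r)) (Units.mk0 _ hz0)
        have hz1 : (((Units.mk0 _ hz0)⁻¹ : Fˣ) : F) ∈ ball F 1 := Or.inr (by
          rw [Units.val_inv_eq_inv_val, Units.val_mk0, ord_inv]; omega)
        have hl := lowerUnip_mem_Kt (ball_anti (show (0 : ℤ) ≤ 1 by norm_num) hz1)
        rw [Units.val_mk0] at hc
        have h6 := hlast (⟨weyl F, weyl_mem_Kt⟩ * ⟨_, hl⟩) (by
          rw [reduction_apply]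
          change res ((toSL (weyl F * lowerUnip (((Units.mk0 _ hz0)⁻¹ : Fˣ) : F))).1 0 0) = 0
          rw [toSL_mul, toSL_weyl, toSL_lowerUnip, sl_mul]
          change res (0 * 1 + 1 * (((Units.mk0 _ hz0)⁻¹ : Fˣ) : F)) = 0
          rw [zero_mul, zero_add, one_mul]
          rw [mem_ball_one] at hz1
          exact (res_eq_zero hz1.le).2 hz1)
        have h7 : (Φ (topVec r)).1 (weyl F * lowerUnip (((Units.mk0 _ hz0)⁻¹ : Fˣ) : F)) = 0 := h6
        rw [hc, h7, mul_zero, mul_zero]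
    rw [zero_sub, neg_mem_iff] at hs0
    have hs1 : ϖ.val ^ (-(2 * 1) : ℤ) * s ∈ ball F 0 := by
      rw [zpow_mul_mem_ball]; simpa using hs0
    have hfs : (Φ (topVec r)).1 (upperUnip (ϖ.val ^ (-(2 * 1) : ℤ) * s)) = (Φ (topVec r)).1 1 := by
      rw [hK ⟨_, upperUnip_mem_Kt hs1⟩, genWeight_upper_topVec hs1]; rfl
    rw [hsum, hU, hfs] at h3
    change _ = a * (Φ (topVec r)).1 1 at h3
    rintro rfl
    rw [zero_mul] at h3
    exact mul_ne_zero (Units.ne_zero _) hf1 h3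

end NonzeroEigenvalues

/-! ### Automorphisms which preserve the Borel subgroup -/

section BorelAutomorphisms

variable {F : Type*} [Field F] [ValuativeRel F] [TopologicalSpace F] [IsNonarchimedeanLocalField F]

/-- The automorphisms of the metaplectic cover which are continuous, fix the center and preserve
the torus and the lower unipotent subgroup. Continuity is expressed through congruence
subgroups. -/
structure IsBorelAut (d : Mp F ≃* Mp F) : Prop where
  torus : ∀ x ∈ Torus F, d x ∈ Torus F
  lower : ∀ x, ∃ y, d (lowerUnip x) = lowerUnip y
  central : ∀ ζ, d (mk 1 ζ) = mk 1 ζ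
  cong : ∀ n : ℕ, ∃ m : ℕ, ∀ k : SL(2, F), IsCong m k → ∃ k', IsCong n k' ∧ d (mk k 1) = mk k' 1

variable {d : Mp F ≃* Mp F}

lemma IsBorelAut.continuous (h : IsBorelAut d) (ϖ : Uniformizer F) : Continuous d := by
  rw [continuous_def]
  intro U hU
  rw [isOpen_iff_mp] at hU ⊢
  intro x hx
  obtain ⟨n, -, hn⟩ := exists_isCong (hU _ hx)
  obtain ⟨m, hm⟩ := h.cong n
  filter_upwards [eventually_isCong ϖ m] with k hk
  obtain ⟨k', hk', e⟩ := hm k hk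
  change d (x * Metaplectic.mk k 1) ∈ U
  rw [map_mul, e]
  exact hn k' hk'

/-- The restriction of an automorphism to the torus. -/
def IsBorelAut.torusHom (h : IsBorelAut d) : Torus F →* Torus F where
  toFun t := ⟨d (t : Mp F), h.torus t t.2⟩
  map_one' := Subtype.ext (map_one d)
  map_mul' s t := Subtype.ext (map_mul d (s : Mp F) (t : Mp F))

variable {E : Type*} [Field E] {V : Type*} [AddCommGroup V] [Module E V]
variable {ρ : Representation E (Mp F) V}

lemma IsBorelAut.isSmooth (h : IsBorelAut d) (ϖ : Uniformizer F) (hρ : IsSmooth ρ) :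
    IsSmooth (ρ.comp d.toMonoidHom) :=
  fun v => (hρ v).preimage (h.continuous ϖ)

lemma IsBorelAut.isGenuine (h : IsBorelAut d) (hρ : IsGenuine ρ) :
    IsGenuine (ρ.comp d.toMonoidHom) := by
  refine isGenuine_of_central fun ζ v => ?_
  change ρ (d (Metaplectic.mk 1 ζ)) v = _
  rw [h.central, hρ.central]

lemma exists_ne_zero_of_irreducible {G : Type*} [Group G] {ρ : Representation E G V}
    (hρ : ρ.IsIrreducible) : ∃ v : V, v ≠ 0 := by
  have hnt : Nontrivial (Subrepresentation ρ) := hρ.toNontrivial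
  by_contra h
  push Not at h
  refine bot_ne_top (α := Subrepresentation ρ) ?_
  ext v
  rw [h v]
  exact ⟨fun _ => zero_mem _, fun _ => zero_mem _⟩

lemma isIrreducible_comp {G : Type*} [Group G] {ρ : Representation E G V} (d : G ≃* G)
    (hρ : ρ.IsIrreducible) : Representation.IsIrreducible (ρ.comp d.toMonoidHom) := by
  refine isIrreducible_of_forall (exists_ne_zero_of_irreducible hρ) fun N hN hN0 => ?_
  obtain ⟨v, hv, hv0⟩ := hN0
  refine eq_top_of_irreducible hρ N (fun g v hv => ?_) hv hv0
  have := hN (d.symm g) v hv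
  change ρ (d (d.symm g)) v ∈ N at this
  rwa [d.apply_symm_apply] at this

lemma IsBorelAut.isAdmissible (h : IsBorelAut d.symm) (ϖ : Uniformizer F) (hρ : IsAdmissible ρ) :
    IsAdmissible (ρ.comp d.toMonoidHom) := by
  intro U
  have := hρ (U.comap d.symm.toMonoidHom (h.continuous ϖ))
  refine Submodule.finiteDimensional_of_le (S₂ := Representation.invariants
    (ρ.comp (U.comap d.symm.toMonoidHom (h.continuous ϖ)).toSubgroup.subtype)) ?_
  intro v hv x
  have h1 := hv ⟨d.symm x.1, x.2⟩
  change ρ (d (d.symm x.1)) v = v at h1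
  rw [d.apply_symm_apply] at h1
  exact h1

/-- Composition with an automorphism as a map of parabolic inductions. -/
def IsBorelAut.parIndMap (h : IsBorelAut d) (ϖ : Uniformizer F) (χ : Torus F →* Eˣ) :
    parIndSpace (charRep χ) →ₗ[E] parIndSpace (charRep (χ.comp h.torusHom)) where
  toFun f := ⟨fun g => f.1 (d g), by
    obtain ⟨h1, h2, U, hU⟩ := f.2
    refine ⟨fun t g => ?_, fun x g => ?_, U.comap d.toMonoidHom (h.continuous ϖ),
      fun u hu g => ?_⟩
    · change f.1 (d (t * g)) = _
      rw [map_mul]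
      exact h1 (h.torusHom t) (d g)
    · obtain ⟨y, hy⟩ := h.lower x
      change f.1 (d (lowerUnip x * g)) = f.1 (d g)
      rw [map_mul, hy, h2]
    · change f.1 (d (g * u)) = f.1 (d g)
      rw [map_mul]
      exact hU _ hu _⟩
  map_add' _ _ := rfl
  map_smul' _ _ := rfl

lemma IsBorelAut.parIndMap_bijective (h : IsBorelAut d) (h' : IsBorelAut d.symm)
    (ϖ : Uniformizer F) (χ : Torus F →* Eˣ) : Function.Bijective (h.parIndMap ϖ χ) := by
  constructor
  · intro f f' hf
    refine Subtype.ext (funext fun g => ?_)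
    have := congrFun (congrArg Subtype.val hf) (d.symm g)
    change f.1 (d (d.symm g)) = f'.1 (d (d.symm g)) at this
    rwa [d.apply_symm_apply] at this
  · intro f
    have e : (χ.comp h.torusHom).comp h'.torusHom = χ := by
      ext t
      change (χ (h.torusHom (h'.torusHom t)) : E) = χ t
      congr 2
      exact Subtype.ext (d.apply_symm_apply t)
    have h1 : ∀ χ' : Torus F →* Eˣ, (χ.comp h.torusHom).comp h'.torusHom = χ' →
        (fun g => f.1 (d.symm g)) ∈ parIndSpace (charRep χ') := by
      rintro _ rfl
      exact (h'.parIndMap ϖ (χ.comp h.torusHom) f).2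
    refine ⟨⟨_, h1 χ e⟩, Subtype.ext (funext fun g => ?_)⟩
    change f.1 (d.symm (d g)) = f.1 g
    rw [d.symm_apply_apply]

lemma IsGenuineTorus.central {W : Type*} [AddCommGroup W] [Module E W]
    {τ : Representation E (Torus F) W} (h : IsGenuineTorus τ) (ζ : ℤˣ) (w : W) :
    τ (torT 1 ζ) w = ((ζ : ℤ) : E) • w := by
  have h1 := h 1 ζ (by rw [← tor_one]; exact tor_mem _ _) (by rw [← tor_one]; exact tor_mem _ _) w
  have e : ∀ (ζ : ℤˣ) (hm : Metaplectic.mk 1 ζ ∈ Torus F),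
      (⟨Metaplectic.mk 1 ζ, hm⟩ : Torus F) = torT 1 ζ :=
    fun ζ hm => Subtype.ext (tor_one ζ).symm
  have e1 : torT (1 : Fˣ) 1 = 1 := Subtype.ext tor_one_one
  rw [e, e, e1] at h1
  simpa using h1

lemma IsGenuineTorus.char_central {χ : Torus F →* Eˣ} (h : IsGenuineTorus (charRep χ)) (ζ : ℤˣ) :
    (χ (torT 1 ζ) : E) = ((ζ : ℤ) : E) := by
  simpa [charRep] using h.central ζ 1

/-- Principal series are stable under twisting by automorphisms which preserve the Borel
subgroup. -/
lemma IsBorelAut.isGenuinePrincipalSeries (h : IsBorelAut d) (h' : IsBorelAut d.symm)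
    (ϖ : Uniformizer F) (hρ : IsGenuinePrincipalSeries ρ) :
    IsGenuinePrincipalSeries (ρ.comp d.toMonoidHom) := by
  obtain ⟨χ, hs, hg, ⟨e⟩⟩ := hρ
  refine ⟨χ.comp h.torusHom, fun v => ?_, isGenuineTorus_charRep fun ζ => ?_, ⟨?_⟩⟩
  · have hc : Continuous h.torusHom :=
      ((h.continuous ϖ).comp continuous_subtype_val).subtype_mk _
    exact (hs v).preimage hc
  · have e1 : h.torusHom (torT 1 ζ) = torT 1 ζ := by
      refine Subtype.ext ?_
      change d (tor 1 ζ) = tor 1 ζ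
      rw [tor_one, h.central]
    rw [MonoidHom.comp_apply, e1, hg.char_central]
  · refine Representation.Equiv.mk (e.toLinearEquiv.trans
      (LinearEquiv.ofBijective _ (h.parIndMap_bijective h' ϖ χ))) fun g => ?_
    refine LinearMap.ext fun v => ?_
    refine Subtype.ext (funext fun x => ?_)
    change (e (ρ (d g) v)).1 (d x) = (e v).1 (d (x * g))
    have h1 : e (ρ (d g) v) = parInd (charRep χ) (d g) (e v) :=
      Representation.IntertwiningMap.isIntertwining _ _ e.toIntertwiningMap (d g) v
    rw [h1, parInd_apply, map_mul]

/-- Conjugation by `α̃` in coordinates. The sign is nontrivial only on upper triangular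
matrices. -/
lemma conjAlpha_mk (ϖ : Uniformizer F) {a b c e : F} (h : a * e - b * c = 1)
    (h' : a * e - b / ϖ.val * (ϖ.val * c) = 1) (ζ : ℤˣ) :
    conjAlpha ϖ (mk (sl a b c e h) ζ) = mk (sl a (b / ϖ.val) (ϖ.val * c) e h')
      (ζ * (open Classical in if c = 0 then hilb ϖ.val e else 1)) := by
  have hϖ := ϖ.ne_zero
  have hX : xRow c e ≠ 0 := by
    have := X_ne ((sl a b c e h : SL(2, F)) : GL (Fin 2) F)
    rwa [sl_coe, X_gl] at this
  -- both sides of `α̃ x = y α̃` lie over the matrix with rows `(a, b)` and `(ϖ c, ϖ e)`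
  have hmat : (alphaTilde ϖ).mat * gl a b c e h =
      gl a (b / ϖ.val) (ϖ.val * c) e h' * (alphaTilde ϖ).mat := by
    refine Units.ext ?_
    rw [Units.val_mul, Units.val_mul, gl_val, gl_val]
    change !![1, 0; 0, ϖ.val] * _ = _ * !![1, 0; 0, ϖ.val]
    rw [Matrix.mul_fin_two, Matrix.mul_fin_two]
    ext i j
    fin_cases i <;> fin_cases j <;> simp <;> field_simp
  have hXα : X (alphaTilde ϖ).mat = ϖ.val := by
    rw [X_eq_xRow]
    exact xRow_zero _
  have hXm : X ((alphaTilde ϖ).mat * gl a b c e h) = ϖ.val * xRow c e := by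
    rw [X_eq_xRow, Units.val_mul, gl_val, ← xRow_mul hϖ]
    change xRow ((!![1, 0; 0, ϖ.val] * !![a, b; c, e]) 1 0)
      ((!![1, 0; 0, ϖ.val] * !![a, b; c, e]) 1 1) = _
    rw [Matrix.mul_fin_two]
    simp
  have hdet : ((alphaTilde ϖ).mat : Matrix (Fin 2) (Fin 2) F).det = ϖ.val := by
    change (!![1, 0; 0, ϖ.val] : Matrix (Fin 2) (Fin 2) F).det = _
    rw [Matrix.det_fin_two_of]
    ring
  have h1 : cocycle (alphaTilde ϖ).mat (gl a b c e h) = 1 := by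
    rw [cocycle, hXm, hXα, hdet, X_gl, mul_div_cancel_left₀ _ hϖ, mul_div_cancel_right₀ _ hX,
      hilb_symm hϖ hX, int_units_sq]
  have h2 : cocycle (gl a (b / ϖ.val) (ϖ.val * c) e h') (alphaTilde ϖ).mat =
      open Classical in if c = 0 then hilb ϖ.val e else 1 := by
    rw [cocycle_gl, ← hmat, hXm, hXα, X_gl, mul_div_cancel_left₀ _ hϖ]
    split_ifs with hc
    · subst hc
      rw [mul_zero, xRow_zero] at *
      rw [mul_div_cancel_right₀ _ hX]
    · rw [xRow_ne hc, xRow_ne (mul_ne_zero hϖ hc), div_self (mul_ne_zero hϖ hc), hilb_one_left]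
  refine Subtype.ext ?_
  change alphaTilde ϖ * (mk (sl a b c e h) ζ).1 * (alphaTilde ϖ)⁻¹ = _
  rw [mul_inv_eq_iff_eq_mul, GLCover.mul_def, GLCover.mul_def]
  refine GLCover.ext ?_ ?_
  · change (alphaTilde ϖ).mat * ((sl a b c e h : SL(2, F)) : GL (Fin 2) F) =
      ((sl a (b / ϖ.val) (ϖ.val * c) e h' : SL(2, F)) : GL (Fin 2) F) * (alphaTilde ϖ).mat
    rw [sl_coe, sl_coe, hmat]
  · change 1 * ζ * cocycle (alphaTilde ϖ).mat ((sl a b c e h : SL(2, F)) : GL (Fin 2) F) =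
      (ζ * (open Classical in if c = 0 then hilb ϖ.val e else 1)) * 1 *
        cocycle ((sl a (b / ϖ.val) (ϖ.val * c) e h' : SL(2, F)) : GL (Fin 2) F) (alphaTilde ϖ).mat
    rw [sl_coe, sl_coe, h1, h2, mul_one, one_mul, mul_one, mul_assoc, int_units_sq, mul_one]

lemma conjAlpha_lowerUnip (ϖ : Uniformizer F) (x : F) :
    conjAlpha ϖ (lowerUnip x) = lowerUnip (ϖ.val * x) := by
  rw [lowerUnip, conjAlpha_mk ϖ _ (by ring), lowerUnip]
  refine mk_sl_congr rfl (zero_div _) rfl rfl ?_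
  rw [one_mul]
  split_ifs
  · exact hilb_one_right
  · rfl

lemma conjAlpha_central (ϖ : Uniformizer F) (ζ : ℤˣ) : conjAlpha ϖ (mk 1 ζ) = mk 1 ζ := by
  rw [← tor_one, tor_eq, conjAlpha_mk ϖ _ (by simp)]
  refine mk_sl_congr rfl (zero_div _) (mul_zero _) rfl ?_
  rw [if_pos rfl, Units.val_one, inv_one, hilb_one_right, mul_one]

/-- On congruence subgroups the sign is trivial, since elements congruent to `1` are squares. -/
lemma conjAlpha_of_isCong (ϖ : Uniformizer F) {k : SL(2, F)} (hk : IsCong 1 k)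
    (h' : k.1 0 0 * k.1 1 1 - k.1 0 1 / ϖ.val * (ϖ.val * k.1 1 0) = 1) :
    conjAlpha ϖ (mk k 1) =
      mk (sl (k.1 0 0) (k.1 0 1 / ϖ.val) (ϖ.val * k.1 1 0) (k.1 1 1) h') 1 := by
  obtain ⟨a, b, c, e, h, rfl⟩ := sl_eq k
  obtain ⟨h1, h2, h3⟩ := ord_pos_unique hk.2.2.2
  rw [conjAlpha_mk ϖ h h']
  refine mk_sl_congr rfl rfl rfl rfl ?_
  rw [one_mul]
  split_ifs
  · exact hilb_of_res_one h1 h3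
  · rfl

/-- Conjugation by `α̃` preserves the Borel subgroup, so twisting by it turns parameters for `K̃'`
into parameters for `K̃` and principal series into principal series. -/
lemma isBorelAut_conjAlpha (ϖ : Uniformizer F) : IsBorelAut (conjAlpha ϖ) := by
  have hϖ := ϖ.ne_zero
  refine ⟨fun x hx => ?_, fun x => ⟨_, conjAlpha_lowerUnip ϖ x⟩, conjAlpha_central ϖ, fun n => ?_⟩
  · obtain ⟨a, ζ, ht⟩ := exists_eq_torT ⟨x, hx⟩
    have e : x = tor a ζ := congrArg Subtype.val ht
    rw [e, tor_eq, conjAlpha_mk ϖ _ (by simp)]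
    exact ⟨zero_div _, mul_zero _⟩
  · refine ⟨n + 1, fun k hk => ?_⟩
    have h' : k.1 0 0 * k.1 1 1 - k.1 0 1 / ϖ.val * (ϖ.val * k.1 1 0) = 1 := by
      have := k.2
      rw [Matrix.det_fin_two] at this
      field_simp
      exact this
    refine ⟨_, ?_, conjAlpha_of_isCong ϖ (hk.mono (by push_cast; omega)) h'⟩
    obtain ⟨h1, h2, h3, h4⟩ := hk
    refine ⟨ball_anti (by push_cast; omega) h1, ?_, ?_, ball_anti (by push_cast; omega) h4⟩
    · change k.1 0 1 / ϖ.val ∈ _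
      rw [div_uniformizer_mem_ball]
      exact_mod_cast h2
    · change ϖ.val * k.1 1 0 ∈ _
      exact mul_mem_ball_zero (mem_ball_zero.2 ϖ.val_lt.le) (ball_anti (by push_cast; omega) h3)

lemma isBorelAut_conjAlpha_symm (ϖ : Uniformizer F) : IsBorelAut (conjAlpha ϖ).symm := by
  have hϖ := ϖ.ne_zero
  refine ⟨fun x hx => ?_, fun x => ⟨x / ϖ.val, ?_⟩, fun ζ => ?_, fun n => ?_⟩
  · obtain ⟨a, ζ, ht⟩ := exists_eq_torT ⟨x, hx⟩
    have e : x = tor a ζ := congrArg Subtype.val ht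
    have e2 : (conjAlpha ϖ).symm x = tor a (ζ * hilb ϖ.val ((a : F)⁻¹)) := by
      rw [MulEquiv.symm_apply_eq, e, tor_eq, tor_eq, conjAlpha_mk ϖ _ (by simp)]
      refine mk_sl_congr rfl (zero_div _).symm (mul_zero _).symm rfl ?_
      rw [if_pos rfl, mul_assoc, int_units_sq, mul_one]
    rw [e2]
    exact tor_mem _ _
  · rw [MulEquiv.symm_apply_eq, conjAlpha_lowerUnip]
    congr 1
    field_simp
  · rw [MulEquiv.symm_apply_eq, conjAlpha_central]
  · refine ⟨n + 2, fun k hk => ?_⟩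
    have h' : k.1 0 0 * k.1 1 1 - ϖ.val * k.1 0 1 * (k.1 1 0 / ϖ.val) = 1 := by
      have := k.2
      rw [Matrix.det_fin_two] at this
      field_simp
      exact this
    obtain ⟨h1, h2, h3, h4⟩ := hk
    have hc : IsCong (n + 1) (sl (k.1 0 0) (ϖ.val * k.1 0 1) (k.1 1 0 / ϖ.val) (k.1 1 1) h') := by
      refine ⟨ball_anti (by push_cast; omega) h1, ?_, ?_, ball_anti (by push_cast; omega) h4⟩
      · change ϖ.val * k.1 0 1 ∈ _
        exact mul_mem_ball_zero (mem_ball_zero.2 ϖ.val_lt.le) (ball_anti (by push_cast; omega) h2)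
      · change k.1 1 0 / ϖ.val ∈ _
        rw [div_uniformizer_mem_ball]
        exact ball_anti (by push_cast; omega) h3
    refine ⟨_, hc.mono (by omega), ?_⟩
    rw [MulEquiv.symm_apply_eq, conjAlpha_of_isCong ϖ (hc.mono (by omega))
      (by
        change k.1 0 0 * k.1 1 1 - ϖ.val * k.1 0 1 / ϖ.val * (ϖ.val * (k.1 1 0 / ϖ.val)) = 1
        have := k.2
        rw [Matrix.det_fin_two] at this
        field_simp
        exact this)]
    refine mp_ext ?_ rfl
    rw [toSL_mk, toSL_mk]
    ext i j
    fin_cases i <;> fin_cases j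
    · rfl
    · change k.1 0 1 = ϖ.val * k.1 0 1 / ϖ.val
      field_simp
    · change k.1 1 0 = ϖ.val * (k.1 1 0 / ϖ.val)
      field_simp
    · rfl

end BorelAutomorphisms

/-! ### Irreducible representations of the torus -/

section TorusIrreducibles

lemma exists_eigenvector_of_aeval {E W : Type*} [Field E] [IsAlgClosed E] [AddCommGroup W]
    [Module E W] (h : W →ₗ[E] W) {v : W} (hv : v ≠ 0) {P : Polynomial E} (hP : P ≠ 0)
    (hPv : Polynomial.aeval h P v = 0) : ∃ (μ : E) (w : W), w ≠ 0 ∧ h w = μ • w := by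
  induction hn : P.natDegree generalizing P with
  | zero =>
    rw [Polynomial.eq_C_of_natDegree_eq_zero hn, Polynomial.aeval_C] at hPv
    have hc : P.coeff 0 ≠ 0 := fun h0 => hP (by
      rw [Polynomial.eq_C_of_natDegree_eq_zero hn, h0, Polynomial.C_0])
    exact absurd ((smul_eq_zero.1 hPv).resolve_left hc) hv
  | succ n ih =>
    obtain ⟨μ, hμ⟩ := IsAlgClosed.exists_root P (by
      rw [Polynomial.degree_eq_natDegree hP, hn]
      exact_mod_cast n.succ_ne_zero)
    obtain ⟨Q, hQ⟩ := Polynomial.dvd_iff_isRoot.2 hμ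
    have hQ0 : Q ≠ 0 := by
      rintro rfl
      exact hP (by rw [hQ, mul_zero])
    by_cases hw : Polynomial.aeval h Q v = 0
    · refine ih hQ0 hw ?_
      rw [hQ, Polynomial.natDegree_mul (Polynomial.X_sub_C_ne_zero μ) hQ0,
        Polynomial.natDegree_X_sub_C] at hn
      omega
    · refine ⟨μ, _, hw, ?_⟩
      rw [hQ, map_mul, Module.End.mul_apply] at hPv
      simpa [sub_eq_zero] using hPv

variable {F : Type*} [Field F] [ValuativeRel F] [TopologicalSpace F] [IsNonarchimedeanLocalField F]
variable {E : Type*} [Field E] {W : Type*} [AddCommGroup W] [Module E W]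
variable {τ : Representation E (Torus F) W}

lemma torus_rep_comm (τ : Representation E (Torus F) W) (s t : Torus F) (w : W) :
    τ s (τ t w) = τ t (τ s w) := by
  rw [← rep_mul, ← rep_mul, torus_comm]

/-- The torus is commutative, so the eigenspaces of its elements are stable. -/
lemma torus_smul_of_eigenvector (hirr : τ.IsIrreducible) {s : Torus F} {μ : E} {w : W} (hw : w ≠ 0)
    (h : τ s w = μ • w) (v : W) : τ s v = μ • v := by
  have h1 := eq_top_of_irreducible hirr (LinearMap.ker (τ s - μ • LinearMap.id))
    (fun g v hv => by
      have hv' : τ s v = μ • v := by simpa [sub_eq_zero] using hv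
      have : τ s (τ g v) = μ • τ g v := by rw [torus_rep_comm, hv', map_smul]
      simpa [sub_eq_zero] using this) (v := w) (by simpa [sub_eq_zero] using h) hw
  have h2 : v ∈ LinearMap.ker (τ s - μ • LinearMap.id) := by rw [h1]; trivial
  simpa [sub_eq_zero] using h2

/-- Some positive power of a unit is congruent to `1` modulo a given power of the maximal
ideal. -/
lemma exists_pow_sub_one_mem_ball (ϖ : Uniformizer F) {u : F} (hu : u ≠ 0) (hu0 : ord u = 0)
    (n : ℕ) : ∃ m : ℕ, 0 < m ∧ u ^ m - 1 ∈ ball F n := by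
  obtain ⟨S, hS⟩ := exists_isReps ϖ 0 n
  have hmem : ∀ k : ℤ, u ^ k ∈ ball F 0 := fun k =>
    (mem_ball_of_ne (zpow_ne_zero k hu)).2 (by rw [ord_zpow, hu0, mul_zero])
  choose s hs hs' using fun k : ℕ => hS.exists_mem _ (hmem k)
  obtain ⟨i, j, hij, e⟩ := Finite.exists_ne_map_eq_of_infinite (fun k : ℕ => (⟨s k, hs k⟩ : S))
  have e' : s i = s j := congrArg Subtype.val e
  have key : ∀ i j : ℕ, i < j → s i = s j → ∃ m : ℕ, 0 < m ∧ u ^ m - 1 ∈ ball F n := by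
    intro i j hij e'
    refine ⟨j - i, by omega, ?_⟩
    have h1 := (ball F n).sub_mem (hs' j) (hs' i)
    rw [e', sub_sub_sub_cancel_right] at h1
    have h2 := mul_mem_ball_zero (hmem (-i)) h1
    have e2 : u ^ (-(i : ℤ)) * (u ^ (j : ℤ) - u ^ (i : ℤ)) = u ^ (j - i) - 1 := by
      rw [mul_sub, ← zpow_add₀ hu, ← zpow_add₀ hu, ← zpow_natCast u (j - i), Nat.cast_sub hij.le]
      congr 2
      · ring
      · rw [neg_add_cancel, zpow_zero]
    rwa [e2] at h2
  rcases lt_or_gt_of_ne hij with h | h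
  · exact key i j h e'
  · exact key j i h e'.symm

lemma torT_pow (a : Fˣ) (ζ : ℤˣ) (m : ℕ) : ∃ ξ, torT a ζ ^ m = torT (a ^ m) ξ := by
  induction m with
  | zero => exact ⟨1, by rw [pow_zero, pow_zero]; exact (Subtype.ext tor_one_one).symm⟩
  | succ m ih =>
    obtain ⟨ξ, h⟩ := ih
    rw [pow_succ, h, torT_mul_torT, pow_succ]
    exact ⟨_, rfl⟩

lemma IsGenuineTorus.torT_apply (hg : IsGenuineTorus τ) (a : Fˣ) (ζ : ℤˣ) (w : W) :
    τ (torT a ζ) w = ((ζ : ℤ) : E) • τ (torT a 1) w := by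
  rw [← hg.central, ← rep_mul, torT_mul_torT]
  simp [hilb_one_left]

/-- Some power of a unit fixes a given vector up to sign, so a polynomial in it kills the vector. -/
lemma exists_scalar_of_unit [IsAlgClosed E] (ϖ : Uniformizer F) (hs : IsSmooth τ)
    (hg : IsGenuineTorus τ) (hirr : τ.IsIrreducible) {v : W} (hv : v ≠ 0) (u : Fˣ) (ζ : ℤˣ)
    (hu : ord (u : F) = 0) : ∃ μ : E, ∀ w, τ (torT u ζ) w = μ • w := by
  obtain ⟨n, -, hn⟩ := exists_torus_fixed hs v
  obtain ⟨m, hm, hum⟩ := exists_pow_sub_one_mem_ball ϖ u.ne_zero hu n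
  obtain ⟨ξ, hξ⟩ := torT_pow u ζ m
  have h1 : ((τ (torT u ζ)) ^ m) v = ((ξ : ℤ) : E) • v := by
    rw [← map_pow, hξ, hg.torT_apply, hn _ (by rwa [Units.val_pow_eq_pow_val])]
  obtain ⟨μ, w, hw, h2⟩ := exists_eigenvector_of_aeval (τ (torT u ζ)) hv
    (Polynomial.X_pow_sub_C_ne_zero hm ((ξ : ℤ) : E)) (by
      rw [map_sub, Polynomial.aeval_X_pow, Polynomial.aeval_C, LinearMap.sub_apply, h1]
      exact sub_self _)
  exact ⟨μ, torus_smul_of_eigenvector hirr hw h2⟩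

/-- Modulo the units, which act by scalars, an irreducible representation of the torus is a cyclic
module over the Laurent polynomials in `h̃(ϖ)`. If `h̃(ϖ) ≠ 1` then writing a vector `v` as
`(h̃(ϖ) - 1) w` and `w` as a Laurent polynomial applied to `v` shows that a nonzero polynomial in
`h̃(ϖ)` kills `w`. -/
lemma exists_scalar_of_hUnifT [IsAlgClosed E] (ϖ : Uniformizer F) (hs : IsSmooth τ)
    (hg : IsGenuineTorus τ) (hirr : τ.IsIrreducible) {v : W} (hv : v ≠ 0) :
    ∃ μ : E, ∀ w, τ (hUnifT ϖ) w = μ • w := by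
  set h := τ (hUnifT ϖ) with hh
  by_cases hr : ∃ x ∈ LinearMap.range (h - LinearMap.id), x ≠ 0
  · obtain ⟨x, hx, hx0⟩ := hr
    have htop := eq_top_of_irreducible hirr (LinearMap.range (h - LinearMap.id))
      (by
        rintro g _ ⟨w, rfl⟩
        refine ⟨τ g w, ?_⟩
        change h (τ g w) - τ g w = τ g (h w - w)
        rw [map_sub, hh, torus_rep_comm]) hx hx0
    obtain ⟨w, hw⟩ : v ∈ LinearMap.range (h - LinearMap.id) := by rw [htop]; trivial
    have hw0 : w ≠ 0 := by
      rintro rfl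
      exact hv (by rw [← hw, map_zero])
    let M : Submodule E W :=
      { carrier := {w' | ∃ (k : ℕ) (Q : Polynomial E), (h ^ k) w' = Polynomial.aeval h Q v}
        zero_mem' := ⟨0, 0, by simp⟩
        add_mem' := by
          rintro w₁ w₂ ⟨k₁, Q₁, h₁⟩ ⟨k₂, Q₂, h₂⟩
          refine ⟨k₁ + k₂, Polynomial.X ^ k₂ * Q₁ + Polynomial.X ^ k₁ * Q₂, ?_⟩
          rw [map_add, map_add, map_mul, map_mul, LinearMap.add_apply, Module.End.mul_apply,
            Module.End.mul_apply, ← h₁, ← h₂, Polynomial.aeval_X_pow, Polynomial.aeval_X_pow,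
            ← Module.End.mul_apply, ← Module.End.mul_apply, ← pow_add, ← pow_add, add_comm k₂]
        smul_mem' := by
          rintro c w' ⟨k, Q, h'⟩
          exact ⟨k, c • Q, by rw [map_smul, map_smul, LinearMap.smul_apply, h']⟩ }
    have hM : M = ⊤ := by
      refine eq_top_of_irreducible hirr M ?_ (v := v) ⟨0, 1, by simp⟩ hv
      rintro t w' ⟨k, Q, hQ⟩
      obtain ⟨a, ζ, rfl⟩ := exists_eq_torT t
      obtain ⟨u, ξ, j, hu, e⟩ := exists_tor_eq_mul_zpow ϖ a ζ
      obtain ⟨c, hc⟩ := exists_scalar_of_unit ϖ hs hg hirr hv u ξ hu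
      have e' : torT a ζ = hUnifT ϖ ^ j * torT u ξ := Subtype.ext (by
        rw [Subgroup.coe_mul, Subgroup.coe_zpow]
        exact e)
      rw [e', rep_mul, hc, map_smul]
      refine M.smul_mem c ?_
      obtain ⟨i, hi⟩ : ∃ i : ℕ, (i : ℤ) = j.natAbs + j := ⟨(j.natAbs + j).toNat, by omega⟩
      refine ⟨k + j.natAbs, Polynomial.X ^ i * Q, ?_⟩
      rw [map_mul, Module.End.mul_apply, ← hQ, Polynomial.aeval_X_pow, hh, ← map_pow, ← map_pow,
        ← map_pow, ← rep_mul, ← rep_mul, ← zpow_natCast, ← zpow_natCast, ← zpow_natCast,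
        ← zpow_add, ← zpow_add, hi]
      congr 3
      push_cast
      ring
    obtain ⟨k, Q, hQ⟩ : w ∈ M := by rw [hM]; trivial
    obtain ⟨μ, w', hw', h2⟩ := exists_eigenvector_of_aeval h hw0
      -- this polynomial is nonzero, as its value at `1` is `1`
      (P := Polynomial.X ^ k - Q * (Polynomial.X - 1))
      (fun h0 => by
        have := congrArg (Polynomial.eval 1) h0
        simp at this)
      (by
        have hw1 : Polynomial.aeval h (Polynomial.X - 1 : Polynomial E) w = v := by
          rw [← hw]
          simp
        rw [map_sub, map_mul, LinearMap.sub_apply, Module.End.mul_apply, hw1,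
          Polynomial.aeval_X_pow, hQ, sub_self])
    exact ⟨μ, torus_smul_of_eigenvector hirr hw' h2⟩
  · push Not at hr
    refine ⟨1, fun w => ?_⟩
    have := hr _ ⟨w, rfl⟩
    rw [one_smul]
    exact sub_eq_zero.1 this

/-- The irreducible smooth genuine representations of the torus are characters. -/
lemma exists_char_equiv [IsAlgClosed E] (hs : IsSmooth τ) (hg : IsGenuineTorus τ)
    (hirr : τ.IsIrreducible) : ∃ (χ : Torus F →* Eˣ) (e : E ≃ₗ[E] W), IsSmooth (charRep χ) ∧
      IsGenuineTorus (charRep χ) ∧ ∀ t x, e (charRep χ t x) = τ t (e x) := by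
  obtain ⟨ϖ⟩ : Nonempty (Uniformizer F) :=
    let ⟨x, hx⟩ := IsDiscreteValuationRing.exists_irreducible 𝒪[F]; ⟨⟨x, hx⟩⟩
  obtain ⟨v, hv⟩ := exists_ne_zero_of_irreducible hirr
  let S : Subgroup (Torus F) :=
    { carrier := {t | ∃ μ : E, ∀ w, τ t w = μ • w}
      one_mem' := ⟨1, fun w => by rw [map_one, one_smul]; rfl⟩
      mul_mem' := by
        rintro s t ⟨c, hc⟩ ⟨d, hd⟩
        exact ⟨c * d, fun w => by rw [rep_mul, hd, hc, smul_smul]⟩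
      inv_mem' := by
        rintro t ⟨c, hc⟩
        have h1 : ∀ w, c • τ t⁻¹ w = w := fun w => by
          rw [← hc, ← rep_mul, mul_inv_cancel, map_one]; rfl
        have hc0 : c ≠ 0 := by
          rintro rfl
          exact hv (by rw [← h1 v, zero_smul])
        exact ⟨c⁻¹, fun w => by rw [eq_inv_smul_iff₀ hc0, h1]⟩ }
  have hscal : ∀ t, ∃ μ : E, ∀ w, τ t w = μ • w := by
    intro t
    obtain ⟨a, ζ, rfl⟩ := exists_eq_torT t
    obtain ⟨u, ξ, j, hu, e⟩ := exists_tor_eq_mul_zpow ϖ a ζ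
    have e' : torT a ζ = hUnifT ϖ ^ j * torT u ξ := Subtype.ext (by
      rw [Subgroup.coe_mul, Subgroup.coe_zpow]
      exact e)
    rw [e']
    exact S.mul_mem (S.zpow_mem (exists_scalar_of_hUnifT ϖ hs hg hirr hv) j)
      (exists_scalar_of_unit ϖ hs hg hirr hv u ξ hu)
  choose μ hμ using hscal
  have hinj : ∀ {a b : E}, a • v = b • v → a = b := fun h => smul_left_injective E hv h
  let χ' : Torus F →* E :=
    { toFun := μ
      map_one' := hinj (by rw [← hμ, map_one, one_smul]; rfl)
      map_mul' := fun s t => hinj (by rw [← hμ, rep_mul, hμ, hμ, smul_smul]) }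
  have hχ : ∀ t, (χ'.toHomUnits t : E) = μ t := fun t => rfl
  have hbij : Function.Bijective (LinearMap.toSpanSingleton E W v) := by
    refine ⟨smul_left_injective E hv, fun w => ?_⟩
    have h1 := eq_top_of_irreducible hirr (Submodule.span E {v}) (fun t w hw => by
      rw [hμ]
      exact Submodule.smul_mem _ _ hw) (Submodule.mem_span_singleton_self v) hv
    have h2 : w ∈ Submodule.span E {v} := by rw [h1]; trivial
    exact Submodule.mem_span_singleton.1 h2
  refine ⟨χ'.toHomUnits, LinearEquiv.ofBijective _ hbij, fun x => ?_, isGenuineTorus_charRep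
    fun ζ => ?_, fun t x => ?_⟩
  · by_cases hx : x = 0
    · subst hx
      simp
    · have e : {t | charRep χ'.toHomUnits t x = x} = {t | τ t v = v} := by
        ext t
        change μ t * x = x ↔ τ t v = v
        rw [hμ, mul_eq_right₀ hx]
        exact ⟨fun h => by rw [h, one_smul], fun h => hinj (by rw [h, one_smul])⟩
      rw [e]
      exact hs v
  · exact hinj (by rw [hχ, ← hμ, hg.central])
  · change (μ t • x) • v = τ t (x • v)
    rw [hμ, smul_smul, smul_eq_mul]

end TorusIrreducibles

/-! ### Subquotients of parabolic inductions -/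

section Functoriality

variable {F : Type*} [Field F] [ValuativeRel F] [TopologicalSpace F] [IsNonarchimedeanLocalField F]
variable {E : Type*} [Field E] {V W : Type*} [AddCommGroup V] [Module E V] [AddCommGroup W]
  [Module E W] {σ : Representation E (Torus F) V} {τ : Representation E (Torus F) W}

/-- Parabolic induction of an equivariant map. -/
def parIndHom (A : V →ₗ[E] W) (hA : ∀ t v, A (σ t v) = τ t (A v)) :
    parIndSpace σ →ₗ[E] parIndSpace τ where
  toFun f := ⟨fun g => A (f.1 g), by
    obtain ⟨h1, h2, U, hU⟩ := f.2
    exact ⟨fun t g => (congrArg A (h1 t g)).trans (hA t _), fun x g => congrArg A (h2 x g), U,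
      fun u hu g => congrArg A (hU u hu g)⟩⟩
  map_add' _ _ := Subtype.ext (funext fun _ => map_add A _ _)
  map_smul' _ _ := Subtype.ext (funext fun _ => map_smul A _ _)

lemma parIndHom_surjective (e : V ≃ₗ[E] W) (he : ∀ t v, e (σ t v) = τ t (e v)) :
    Function.Surjective (parIndHom e.toLinearMap he) := by
  have he' : ∀ t w, e.symm (τ t w) = σ t (e.symm w) := fun t w => by
    rw [LinearEquiv.symm_apply_eq, he, e.apply_symm_apply]
  refine fun f => ⟨parIndHom e.symm.toLinearMap he' f, Subtype.ext (funext fun g => ?_)⟩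
  exact e.apply_symm_apply _

/-- The irreducible subquotients of parabolic inductions of irreducible representations are principal
series, since these inductions are themselves irreducible principal series. -/
lemma isGenuinePrincipalSeries_of_isSubquotientOf {U : Type*} [AddCommGroup U] [Module E U]
    [IsAlgClosed E] (p : ℕ) [Fact p.Prime] [CharP E p] [CharP 𝓀[F] p] (hp : p ≠ 2)
    {ρ : Representation E (Mp F) U} (hirr : ρ.IsIrreducible) (hs : IsSmooth τ)
    (hg : IsGenuineTorus τ) (hτ : τ.IsIrreducible) (h : IsSubquotientOf ρ (parInd τ)) :
    IsGenuinePrincipalSeries ρ := by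
  obtain ⟨χ, e, hχs, hχg, he⟩ := exists_char_equiv hs hg hτ
  obtain ⟨N, q, hq⟩ := h
  set J := parIndHom e.toLinearMap he
  have hI := isIrreducible_parInd p hp hχs hχg
  obtain ⟨v, hv⟩ := exists_ne_zero_of_irreducible hirr
  obtain ⟨n, hn⟩ := hq v
  obtain ⟨f0, hf0⟩ := parIndHom_surjective e he n.1
  have hf00 : f0 ≠ 0 := by
    rintro rfl
    refine hv ?_
    have : n = 0 := Subtype.ext (by rw [← hf0, map_zero]; rfl)
    rw [← hn, this]
    exact map_zero q.toLinearMap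
  have htop := eq_top_of_irreducible hI (N.toSubmodule.comap J)
    (fun g f hf => N.apply_mem_toSubmodule g hf) (v := f0) (by
      change J f0 ∈ N.toSubmodule
      rw [hf0]; exact n.2) hf00
  have hJ : ∀ f, J f ∈ N.toSubmodule := fun f => by
    have : f ∈ N.toSubmodule.comap J := by rw [htop]; trivial
    exact this
  let A : Representation.IntertwiningMap (parInd (charRep χ)) ρ :=
    ⟨q.toLinearMap ∘ₗ J.codRestrict N.toSubmodule hJ, fun g => LinearMap.ext fun f =>
      Representation.IntertwiningMap.isIntertwining _ _ q g (J.codRestrict N.toSubmodule hJ f)⟩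
  have hA0 : A f0 = v := by
    rw [← hn]
    exact congrArg q (Subtype.ext hf0)
  have := hI
  have := hirr
  have hbij := (Representation.IsIrreducible.bijective_or_eq_zero A).resolve_right (fun h0 => by
    rw [h0] at hA0
    exact hv hA0.symm)
  refine ⟨χ, hχs, hχg, ⟨?_⟩⟩
  exact (Representation.Equiv.mk (LinearEquiv.ofBijective A.toLinearMap hbij)
    fun g => A.isIntertwining' g).symm

end Functoriality

/-! ### Parameters and principal series -/

section Classification

variable {F : Type*} [Field F] [ValuativeRel F] [TopologicalSpace F] [IsNonarchimedeanLocalField F]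
variable {E : Type*} [Field E] {V : Type*} [AddCommGroup V] [Module E V]
variable {ρ : Representation E (Mp F) V}

lemma isIrreducible_of_equiv {G : Type*} [Group G] {W : Type*} [AddCommGroup W] [Module E W]
    {ρ : Representation E G V} {π : Representation E G W} (e : V ≃ₗ[E] W)
    (he : ∀ g v, e (ρ g v) = π g (e v)) (h : π.IsIrreducible) : ρ.IsIrreducible := by
  obtain ⟨w, hw⟩ := exists_ne_zero_of_irreducible h
  refine isIrreducible_of_forall ⟨e.symm w, by simpa using hw⟩ fun N hN => ?_
  rintro ⟨v, hv, hv0⟩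
  have h1 := eq_top_of_irreducible h (N.map e.toLinearMap)
    (by
      rintro g _ ⟨x, hx, rfl⟩
      exact ⟨ρ g x, hN g x hx, he g x⟩) (v := e v) ⟨v, hv, rfl⟩ (by simpa using hv0)
  refine eq_top_iff.2 fun x _ => ?_
  obtain ⟨y, hy, hyx⟩ : e x ∈ N.map e.toLinearMap := by rw [h1]; trivial
  rwa [← e.injective hyx]

lemma equiv_apply {G W : Type*} [Group G] [AddCommGroup W] [Module E W]
    {ρ : Representation E G V} {π : Representation E G W} (e : Representation.Equiv ρ π) (g : G)
    (v : V) : e.toLinearEquiv (ρ g v) = π g (e.toLinearEquiv v) :=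
  Representation.IntertwiningMap.isIntertwining _ _ e.toIntertwiningMap g v

lemma IsGenuinePrincipalSeries.isSmooth (h : IsGenuinePrincipalSeries ρ) : IsSmooth ρ := by
  obtain ⟨χ, -, -, ⟨e⟩⟩ := h
  intro v
  have h1 := isSmooth_parInd (τ := charRep χ) (e.toLinearEquiv v)
  simp only [← equiv_apply, EmbeddingLike.apply_eq_iff_eq] at h1
  exact h1

lemma IsGenuinePrincipalSeries.isGenuine (h : IsGenuinePrincipalSeries ρ) : IsGenuine ρ := by
  obtain ⟨χ, -, hg, ⟨e⟩⟩ := h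
  refine isGenuine_of_central fun ζ v => e.toLinearEquiv.injective ?_
  rw [equiv_apply, (isGenuine_parInd hg).central, map_smul]

lemma IsGenuinePrincipalSeries.isIrreducible (p : ℕ) [Fact p.Prime] [CharP E p] [CharP 𝓀[F] p]
    (hp : p ≠ 2) (h : IsGenuinePrincipalSeries ρ) : ρ.IsIrreducible := by
  obtain ⟨χ, hs, hg, ⟨e⟩⟩ := h
  exact isIrreducible_of_equiv e.toLinearEquiv (equiv_apply e) (isIrreducible_parInd p hp hs hg)

lemma IsGenuinePrincipalSeries.isAdmissible (h : IsGenuinePrincipalSeries ρ) :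
    IsAdmissible ρ := by
  obtain ⟨χ, -, -, ⟨e⟩⟩ := h
  intro U
  have hU := isAdmissible_parInd χ U
  have hfin : FiniteDimensional E ((Representation.invariants
      (ρ.comp U.toSubgroup.subtype)).map e.toLinearEquiv.toLinearMap) := by
    refine Submodule.finiteDimensional_of_le (S₂ := Representation.invariants
      ((parInd (charRep χ)).comp U.toSubgroup.subtype)) ?_
    rintro _ ⟨v, hv, rfl⟩ u
    exact (equiv_apply e u v).symm.trans (congrArg e.toLinearEquiv (hv u))
  exact Module.Finite.equiv (e.toLinearEquiv.submoduleMap _).symm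

variable {ι : 𝓀[F] →+* E} {p : ℕ} [Fact p.Prime] [CharP E p] {f : ℕ} {r : Fin f → Fin p}
  {ϖ : Uniformizer F} {a : E}

/-- An irreducible representation with a nonzero Hecke eigenvalue is a principal series. -/
lemma IsEigenMap.isGenuinePrincipalSeries [CharP 𝓀[F] p] [Fintype 𝓀[F]]
    (hk : Fintype.card 𝓀[F] = p ^ f) (hp : p ≠ 2) (hs : IsSmooth ρ) (hg : IsGenuine ρ)
    (hirr : ρ.IsIrreducible) (ha : a ≠ 0) {Φ : WtSpace E r →ₗ[E] V}
    (h : IsEigenMap (heckeGen ι p r ϖ) ρ a Φ) (h0 : Φ ≠ 0) : IsGenuinePrincipalSeries ρ := by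
  obtain ⟨χ, v, hχs, hχg, hv, hord⟩ := h.exists_isOrdinary hk hp hs hg ha h0
  exact ⟨χ, hχs, hχg, hord.nonempty_equiv hχs (isIrreducible_parInd p hp hχs hχg) hs hirr hv⟩

lemma IsGenuinePrincipalSeries.ne_zero_of_isEigenMap [CharP 𝓀[F] p] [Fintype 𝓀[F]]
    (hk : Fintype.card 𝓀[F] = p ^ f) (hp : p ≠ 2) (hρ : IsGenuinePrincipalSeries ρ)
    {Φ : WtSpace E r →ₗ[E] V} (h : IsEigenMap (heckeGen ι p r ϖ) ρ a Φ) (h0 : Φ ≠ 0) :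
    a ≠ 0 := by
  obtain ⟨χ, -, hg, ⟨e⟩⟩ := hρ
  obtain ⟨A, h1, h2, rfl⟩ := h
  refine IsEigenMap.ne_zero_of_parInd hk hp hg (ι := ι) (r := r) (ϖ := ϖ)
    (Φ := e.toLinearEquiv.toLinearMap ∘ₗ (A ∘ₗ cIndOne _))
    ⟨e.toLinearEquiv.toLinearMap ∘ₗ A, fun g F => ?_, fun F => ?_, rfl⟩ fun h3 => h0 ?_
  · change e.toLinearEquiv (A _) = _
    rw [h1, equiv_apply]
    rfl
  · change e.toLinearEquiv (A _) = _
    rw [h2, map_smul]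
    rfl
  · refine LinearMap.ext fun v => e.toLinearEquiv.injective ?_
    rw [LinearMap.zero_apply, map_zero]
    exact LinearMap.congr_fun h3 v

lemma exists_isEigenMap_of_isParameter (hV : ∃ v : V, v ≠ 0) (h : IsParameter ι p ϖ ρ r a) :
    ∃ Φ : WtSpace E r →ₗ[E] V, Φ ≠ 0 ∧ IsEigenMap (heckeGen ι p r ϖ) ρ a Φ :=
  exists_isEigenMap _ hV h

lemma exists_isEigenMap_of_isParameterConj (hV : ∃ v : V, v ≠ 0)
    (h : IsParameterConj ι p ϖ ρ r a) : ∃ Φ : WtSpace E r →ₗ[E] V, Φ ≠ 0 ∧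
      IsEigenMap (heckeGen ι p r ϖ) (ρ.comp (conjAlpha ϖ).toMonoidHom) a Φ := by
  obtain ⟨Φ, h0, hΦ⟩ := exists_isEigenMap _ hV h
  exact ⟨Φ, h0, hΦ.of_transport _ _⟩

/-- The twist by conjugation by `α̃` contains a weight of `K̃`, so the representation has a parameter
with respect to `K̃'`. -/
lemma exists_isParameterConj [CharP 𝓀[F] p] [Fintype 𝓀[F]] [IsAlgClosed E]
    (hk : Fintype.card 𝓀[F] = p ^ f) (ι : 𝓀[F] →+* E) (ϖ : Uniformizer F)
    (hs : IsSmooth ρ) (hg : IsGenuine ρ) (hirr : ρ.IsIrreducible) (ha : IsAdmissible ρ)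
    {v : V} (hv : v ≠ 0) : ∃ (r : Fin f → Fin p) (a : E), IsParameterConj ι p ϖ ρ r a := by
  have h1 := isBorelAut_conjAlpha ϖ
  have h2 := isBorelAut_conjAlpha_symm ϖ
  have ha' := h2.isAdmissible ϖ ha
  have hfin := ha'.finiteDimensional_congInv ϖ
  obtain ⟨r, Φ, hΦ0, hΦ⟩ :=
    exists_genWeight_map p hk ι (h1.isSmooth ϖ hs) (h1.isGenuine hg) ha' ϖ hv
  obtain ⟨a, h⟩ := exists_isQuotientOf ((heckeGen ι p r ϖ).transport (conjAlpha ϖ))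
    ((equivariant_transport_iff (conjAlpha ϖ)).2 hΦ) hirr
    (congInv (ρ.comp (conjAlpha ϖ).toMonoidHom))
    (fun Φ hΦ v => genWeight_map_mem p ((equivariant_transport_iff (conjAlpha ϖ)).1 hΦ) v) hΦ0
  exact ⟨r, a, h⟩

lemma isGenuinePrincipalSeries_comp_conjAlpha_iff (ϖ : Uniformizer F) :
    IsGenuinePrincipalSeries (ρ.comp (conjAlpha ϖ).toMonoidHom) ↔ IsGenuinePrincipalSeries ρ := by
  have h1 := isBorelAut_conjAlpha ϖ
  have h2 := isBorelAut_conjAlpha_symm ϖ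
  refine ⟨fun h => ?_, h1.isGenuinePrincipalSeries h2 ϖ⟩
  have h3 := h2.isGenuinePrincipalSeries h1 ϖ h
  have e : (MonoidHom.comp (MonoidHom.comp ρ (conjAlpha ϖ).toMonoidHom)
      (conjAlpha ϖ).symm.toMonoidHom) = ρ := MonoidHom.ext fun g =>
    congrArg ρ ((conjAlpha ϖ).apply_symm_apply g)
  rwa [e] at h3

/-- A parameter of an irreducible representation is nonsupersingular exactly if the representation
is a principal series. -/
lemma ne_zero_iff_isGenuinePrincipalSeries [CharP 𝓀[F] p] [Fintype 𝓀[F]]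
    (hk : Fintype.card 𝓀[F] = p ^ f) (hp : p ≠ 2) (hs : IsSmooth ρ) (hg : IsGenuine ρ)
    (hirr : ρ.IsIrreducible) (h : IsParameter ι p ϖ ρ r a ∨ IsParameterConj ι p ϖ ρ r a) :
    a ≠ 0 ↔ IsGenuinePrincipalSeries ρ := by
  have hV := exists_ne_zero_of_irreducible hirr
  rcases h with h | h
  · obtain ⟨Φ, h0, hΦ⟩ := exists_isEigenMap_of_isParameter hV h
    exact ⟨fun ha => hΦ.isGenuinePrincipalSeries hk hp hs hg hirr ha h0,
      fun hρ => hρ.ne_zero_of_isEigenMap hk hp hΦ h0⟩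
  · obtain ⟨Φ, h0, hΦ⟩ := exists_isEigenMap_of_isParameterConj hV h
    have h1 := isBorelAut_conjAlpha ϖ
    rw [← isGenuinePrincipalSeries_comp_conjAlpha_iff ϖ]
    exact ⟨fun ha => hΦ.isGenuinePrincipalSeries hk hp (h1.isSmooth ϖ hs) (h1.isGenuine hg)
      (isIrreducible_comp _ hirr) ha h0, fun hρ => hρ.ne_zero_of_isEigenMap hk hp hΦ h0⟩

end Classification

end Metaplectic

end

theorem theorem5p10 {F : Type u} [Field F] [ValuativeRel F] [TopologicalSpace F]
    [IsNonarchimedeanLocalField F] [CharZero F] (p f : ℕ) [Fact p.Prime] (hp : p ≠ 2)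
    (hq : Nat.card 𝓀[F] = p ^ f) {E : Type e} [Field E] [IsAlgClosed E] [CharP E p]
    (ι : 𝓀[F] →+* E) (ϖ : Uniformizer F) :
    -- every smooth genuine irreducible admissible representation has parameters with respect to
    -- both maximal compact subgroups and lies in exactly one of the two classes
    (∀ (V : Type v) [AddCommGroup V] [Module E V] (ρ : Representation E (Mp F) V),
      IsSmooth ρ → IsGenuine ρ → ρ.IsIrreducible → IsAdmissible ρ →
        (∃ (r : Fin f → Fin p) (a : E), IsParameter ι p ϖ ρ r a) ∧
        (∃ (r : Fin f → Fin p) (a : E), IsParameterConj ι p ϖ ρ r a) ∧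
        Xor (OnlyNonsupersingular ι p ϖ f ρ) (OnlySupersingular ι p ϖ f ρ)) ∧
    -- the first class consists exactly of the genuine principal series representations
    (∀ (V : Type v) [AddCommGroup V] [Module E V] (ρ : Representation E (Mp F) V),
      (IsSmooth ρ ∧ IsGenuine ρ ∧ ρ.IsIrreducible ∧ IsAdmissible ρ ∧
        OnlyNonsupersingular ι p ϖ f ρ) ↔ IsGenuinePrincipalSeries ρ) ∧
    -- every representation in the second class is supercuspidal
    (∀ (V : Type v) [AddCommGroup V] [Module E V] (ρ : Representation E (Mp F) V),
      IsSmooth ρ → IsGenuine ρ → ρ.IsIrreducible → IsAdmissible ρ →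
        OnlySupersingular ι p ϖ f ρ → IsSupercuspidal.{u, e, v, w} ρ) := by
  have : CharP 𝓀[F] p := (RingHom.charP_iff ι ι.injective p).2 inferInstance
  have := Fintype.ofFinite 𝓀[F]
  have hk : Fintype.card 𝓀[F] = p ^ f := by rw [← Nat.card_eq_fintype_card, hq]
  have hexists : ∀ (V : Type v) [AddCommGroup V] [Module E V] (ρ : Representation E (Mp F) V),
      IsSmooth ρ → IsGenuine ρ → ρ.IsIrreducible → IsAdmissible ρ →
        (∃ (r : Fin f → Fin p) (a : E), IsParameter ι p ϖ ρ r a) ∧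
        (∃ (r : Fin f → Fin p) (a : E), IsParameterConj ι p ϖ ρ r a) := by
    intro V _ _ ρ hs hg hirr ha
    obtain ⟨v, hv⟩ := exists_ne_zero_of_irreducible hirr
    exact ⟨exists_isParameter p hk ι hs hg hirr ha ϖ hv,
      exists_isParameterConj hk ι ϖ hs hg hirr ha hv⟩
  -- since parameters exist, each class is decided by any one of them
  have hns : ∀ (V : Type v) [AddCommGroup V] [Module E V] (ρ : Representation E (Mp F) V),
      IsSmooth ρ → IsGenuine ρ → ρ.IsIrreducible → IsAdmissible ρ →
        (OnlyNonsupersingular ι p ϖ f ρ ↔ IsGenuinePrincipalSeries ρ) := by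
    intro V _ _ ρ hs hg hirr ha
    refine ⟨fun h => ?_, fun h r a hr =>
      (ne_zero_iff_isGenuinePrincipalSeries hk hp hs hg hirr hr).2 h⟩
    obtain ⟨⟨r, a, hr⟩, -⟩ := hexists V ρ hs hg hirr ha
    exact (ne_zero_iff_isGenuinePrincipalSeries hk hp hs hg hirr (.inl hr)).1 (h r a (.inl hr))
  have hss : ∀ (V : Type v) [AddCommGroup V] [Module E V] (ρ : Representation E (Mp F) V),
      IsSmooth ρ → IsGenuine ρ → ρ.IsIrreducible → IsAdmissible ρ →
        (OnlySupersingular ι p ϖ f ρ ↔ ¬ IsGenuinePrincipalSeries ρ) := by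
    intro V _ _ ρ hs hg hirr ha
    constructor
    · intro h hρ
      obtain ⟨⟨r, a, hr⟩, -⟩ := hexists V ρ hs hg hirr ha
      exact (ne_zero_iff_isGenuinePrincipalSeries hk hp hs hg hirr (.inl hr)).2 hρ
        (h r a (.inl hr))
    · intro h r a hr
      by_contra ha0
      exact h ((ne_zero_iff_isGenuinePrincipalSeries hk hp hs hg hirr hr).1 ha0)
  refine ⟨fun V _ _ ρ hs hg hirr ha => ?_, fun V _ _ ρ => ?_, fun V _ _ ρ hs hg hirr ha h => ?_⟩
  · obtain ⟨h1, h2⟩ := hexists V ρ hs hg hirr ha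
    refine ⟨h1, h2, ?_⟩
    rw [hns V ρ hs hg hirr ha, hss V ρ hs hg hirr ha]
    by_cases h : IsGenuinePrincipalSeries ρ
    · exact Or.inl ⟨h, not_not.2 h⟩
    · exact Or.inr ⟨h, h⟩
  · constructor
    · rintro ⟨hs, hg, hirr, ha, h⟩
      exact (hns V ρ hs hg hirr ha).1 h
    · intro h
      have hirr := h.isIrreducible p hp
      exact ⟨h.isSmooth, h.isGenuine, hirr, h.isAdmissible,
        (hns V ρ h.isSmooth h.isGenuine hirr h.isAdmissible).2 h⟩
  · refine ⟨hs, hg, hirr, ha, fun W _ _ τ hτs hτg hτ hsub => ?_⟩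
    exact (hss V ρ hs hg hirr ha).1 h
      (isGenuinePrincipalSeries_of_isSubquotientOf p hp hirr hτs hτg hτ hsub)
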